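/- **Setting.** Let $\|A\|=\max_j\sum_k|a_{jk}|$ for $A\in\mathbb C^{m\times m}$. A *pencil* $L$ is given by $Q_0,Q_1:[0,\infty)\to\mathbb C^{m\times m}$ and $h_0,h_1\in\mathbb C^{m\times m}$, through $$\ell_\rho(Y)=Y''+(\rho^2I+2i\rho Q_1(x)+Q_0(x))Y,\qquad U_\rho(Y)=Y'(0)+(i\rho h_1+h_0)Y(0),$$ where the entries of $Q_1$ are absolutely continuous on every $[0,T]$, $Q_0,Q_1,Q_1'\in L(0,\infty)$ and $\det(I\pm h_1)\neq0$. Put also $\ell^*_\rho(Z)=Z''+Z(\rho^2I+2i\rho Q_1+Q_0)$, $U^*_\rho(Z)=Z'(0)+Z(0)(i\rho h_1+h_0)$. Let $\varphi,\varphi^*$ be the solutions of $\ell_\rho(\varphi)=0$, $\varphi(0,\rho)=I$, $U_\rho(\varphi)=0$ and $\ell^*_\rho(\varphi^*)=0$, $\varphi^*(0,\rho)=I$, $U^*_\rho(\varphi^*)=0$, and let $$D(x,\rho,\theta)=\frac{\varphi^{*\prime}(x,\theta)\varphi(x,\rho)-\varphi^*(x,\theta)\varphi'(x,\rho)}{\rho-\theta},\qquad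 D^*(x,\rho,\theta)=D(x,\theta,\rho)$$ (extended by continuity to $\rho=\theta$). Let $\Pi_\pm=\{\pm\operatorname{Im}\rho>0\}$. The Weyl solution $\Phi(x,\rho)$ satisfies $\ell_\rho(\Phi)=0$, $U_\rho(\Phi)=I$, $\Phi(x,\rho)=O(e^{\pm i\rho x})$ as $x\to\infty$ for $\rho\in\Pi_\pm$; the Weyl matrix is $M(\rho)=\Phi(0,\rho)$, and $M_\pm(t)$, $t\in\mathbb R$, is the limit of $M(\rho)$ as $\rho\to t$, $\rho\in\Pi_\pm$. The singular set of $L$ consists of the nonreal $\rho$ for which there is no Weyl solution and the real $t$ at which $M_+(t)$ or $M_-(t)$ does not exist. Objects of a second pencil $\tilde L$ carry a tilde. **Main equations.** Let $R>0$ be such that the singular sets of $L$ and $\tilde L$ lie in $\{|\rho|<R\}$. Let $\gamma$ consist of the circle $|\rho|=R$, passed counterclockwise, and of two-sided cuts along the real rays $\{|t|\ge R\}$, the upper edges passed from right to left with $M_+-\tilde M_+$, the lower edges from left to right with $M_--\tilde M_-$. With $\hat M=M-\tilde M$, the main equations at $x$ are $$\tilde\varphi(x,\rho)=z(\rho)+\frac1{2\pi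 i}\int_\gamma z(\theta)\hat M(\theta)\tilde D(x,\rho,\theta)\,d\theta,\qquad \tilde\varphi^*(x,\rho)=z^*(\rho)+\frac1{2\pi i}\int_\gamma\tilde D^*(x,\rho,\theta)\hat M(\theta)z^*(\theta)\,d\theta,\qquad \rho\in\gamma,$$ for bounded continuous matrix functions $z$, $z^*$ on $\gamma$. **Models.** For $\delta\ge0$, $\tilde Q_1$ belongs to $\mathcal Q(\delta)$ if $\tilde Q_1=Q_1$ on $[0,\delta]$, $\|\tilde Q_1(x)\|\le\|Q_1(\delta)\|$ for $x>\delta$, and $\int_\delta^\infty\|\tilde Q_1(x)\|\,dx\le\|Q_1(\delta)\|$. A pencil $\tilde L$ is an *admissible model at $\delta$* if $\tilde Q_1\in\mathcal Q(\delta)$ and, for both signs and some $\rho^*>0$, $\int_{|\rho|>\rho^*}\|M_\pm(\rho)-\tilde M_\pm(\rho)\|^2\rho^4\,d\rho<\infty$. **Algorithm 2** (step-by-step reconstruction of $L$ from its Weyl matrix). Put $\delta_0=0$. In the $k$-th step, $Q_1$ being known on $[0,\delta_{k-1}]$, $\delta_{k-1}<\infty$, choose any admissible model $\tilde L$ at $\delta_{k-1}$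 and any $R$ as above, and let $\delta_k\in(\delta_{k-1},\infty]$ be the largest value such that both main equations are uniquely solvable for all $x\in(\delta_{k-1},\delta_k)$; their solutions give the coefficients of $L$ on this interval. If $\delta_k=\infty$, stop; otherwise pass to step $k+1$. **Theorem.** Algorithm 2 terminates after a finite number of steps. Precisely, let $L$ be a pencil. (a) For every $\delta\in[0,\infty)$, every admissible model $\tilde L$ at $\delta$ and every $R$ as above, there is a unique largest value in $(\delta,\infty]$ with the property required of $\delta_k$ (with $\delta_{k-1}=\delta$). (b) There are $s$ and a partition $0=x_0<x_1<\dots<x_s=\infty$, depending only on $L$, such that for all choices of models and radii, any run of $n$ steps of Algorithm 2 satisfies $n\le s$ and $\delta_k\ge x_k$ for $0\le k\le n$. -/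

import Mathlib

open Set Filter Topology MeasureTheory
open scoped Matrix.Norms.Operator

noncomputable section

/-! The scoped norm on matrices opened above is the maximal row sum
`‖A‖ = max_j ∑_k |a_{jk}|`. -/

/-- Coefficients of the pencil
`ℓ_ρ(Y) = Y'' + (ρ² I + 2 i ρ Q₁(x) + Q₀(x)) Y`, `x > 0`,
`U_ρ(Y) = Y'(0) + (i ρ h₁ + h₀) Y(0)`.
Only the values of `Q₀`, `Q₁` on the half-line `x ≥ 0` are used. -/
structure QuadraticPencil (m : ℕ) where
  Q₀ : ℝ → Matrix (Fin m) (Fin m) ℂ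
  Q₁ : ℝ → Matrix (Fin m) (Fin m) ℂ
  h₀ : Matrix (Fin m) (Fin m) ℂ
  h₁ : Matrix (Fin m) (Fin m) ℂ

namespace QuadraticPencil

variable {m : ℕ}

/-- The class of admissible pencils: entrywise, `Q₁` is absolutely continuous on every `[0, T]`,
the functions `Q₀`, `Q₁`, `Q₁'` are integrable on `(0, ∞)`, and `det (I ± h₁) ≠ 0`. -/
structure Admissible (L : QuadraticPencil m) : Prop where
  absolutelyContinuous : ∀ j k, ∀ T : ℝ, 0 < T →
    AbsolutelyContinuousOnInterval (fun x => L.Q₁ x j k) 0 T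
  integrable_Q₀ : ∀ j k, IntegrableOn (fun x => L.Q₀ x j k) (Ioi 0)
  integrable_Q₁ : ∀ j k, IntegrableOn (fun x => L.Q₁ x j k) (Ioi 0)
  integrable_deriv_Q₁ : ∀ j k, IntegrableOn (deriv fun x => L.Q₁ x j k) (Ioi 0)
  det_add_ne_zero : (1 + L.h₁).det ≠ 0
  det_sub_ne_zero : (1 - L.h₁).det ≠ 0

/-- `ρ² I + 2 i ρ Q₁(x) + Q₀(x)`. -/
def coeff (L : QuadraticPencil m) (ρ : ℂ) (x : ℝ) : Matrix (Fin m) (Fin m) ℂ :=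
  ρ ^ 2 • (1 : Matrix (Fin m) (Fin m) ℂ) + (2 * Complex.I * ρ) • L.Q₁ x + L.Q₀ x

/-- `i ρ h₁ + h₀`. -/
def bdry (L : QuadraticPencil m) (ρ : ℂ) : Matrix (Fin m) (Fin m) ℂ :=
  (Complex.I * ρ) • L.h₁ + L.h₀

/-- `Y` is a matrix solution of `ℓ_ρ(Y) = 0` on `[0, ∞)` with derivative `Y'`: the function `Y'`
is locally absolutely continuous, and the equation holds almost everywhere. -/
structure IsSolution (L : QuadraticPencil m) (ρ : ℂ)
    (Y Y' : ℝ → Matrix (Fin m) (Fin m) ℂ) : Prop where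
  hasDeriv : ∀ j k, ∀ x : ℝ, 0 ≤ x → HasDerivWithinAt (fun t => Y t j k) (Y' x j k) (Ici 0) x
  absolutelyContinuous : ∀ j k, ∀ T : ℝ, 0 < T →
    AbsolutelyContinuousOnInterval (fun x => Y' x j k) 0 T
  equation : ∀ j k, ∀ᵐ x ∂(volume.restrict (Ioi (0 : ℝ))),
    HasDerivAt (fun t => Y' t j k) (-(L.coeff ρ x * Y x) j k) x

/-- `Z` is a matrix solution, with derivative `Z'`, of the adjoint equation
`ℓ*_ρ(Z) = Z'' + Z (ρ² I + 2 i ρ Q₁(x) + Q₀(x)) = 0` on `[0, ∞)`. -/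
structure IsSolutionStar (L : QuadraticPencil m) (ρ : ℂ)
    (Z Z' : ℝ → Matrix (Fin m) (Fin m) ℂ) : Prop where
  hasDeriv : ∀ j k, ∀ x : ℝ, 0 ≤ x → HasDerivWithinAt (fun t => Z t j k) (Z' x j k) (Ici 0) x
  absolutelyContinuous : ∀ j k, ∀ T : ℝ, 0 < T →
    AbsolutelyContinuousOnInterval (fun x => Z' x j k) 0 T
  equation : ∀ j k, ∀ᵐ x ∂(volume.restrict (Ioi (0 : ℝ))),
    HasDerivAt (fun t => Z' t j k) (-(Z x * L.coeff ρ x) j k) x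

open Classical in
/-- The pair `(φ(·, ρ), φ'(·, ρ))`, where `ℓ_ρ(φ) = 0`, `φ(0, ρ) = I`, `U_ρ(φ) = 0`. On `[0, ∞)`
it is the unique solution of this Cauchy problem, which exists for every admissible pencil. -/
def phiPair (L : QuadraticPencil m) (ρ : ℂ) :
    (ℝ → Matrix (Fin m) (Fin m) ℂ) × (ℝ → Matrix (Fin m) (Fin m) ℂ) :=
  if h : ∃ p : (ℝ → Matrix (Fin m) (Fin m) ℂ) × (ℝ → Matrix (Fin m) (Fin m) ℂ),
      L.IsSolution ρ p.1 p.2 ∧ p.1 0 = 1 ∧ p.2 0 + L.bdry ρ * p.1 0 = 0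
  then h.choose else 0

open Classical in
/-- The pair `(φ*(·, ρ), φ*'(·, ρ))`, where `ℓ*_ρ(φ*) = 0`, `φ*(0, ρ) = I`, `U*_ρ(φ*) = 0` and
`U*_ρ(Z) = Z'(0) + Z(0) (i ρ h₁ + h₀)`. -/
def phiStarPair (L : QuadraticPencil m) (ρ : ℂ) :
    (ℝ → Matrix (Fin m) (Fin m) ℂ) × (ℝ → Matrix (Fin m) (Fin m) ℂ) :=
  if h : ∃ p : (ℝ → Matrix (Fin m) (Fin m) ℂ) × (ℝ → Matrix (Fin m) (Fin m) ℂ),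
      L.IsSolutionStar ρ p.1 p.2 ∧ p.1 0 = 1 ∧ p.2 0 + p.1 0 * L.bdry ρ = 0
  then h.choose else 0

/-- `φ(x, ρ)`. -/
def phi (L : QuadraticPencil m) (x : ℝ) (ρ : ℂ) : Matrix (Fin m) (Fin m) ℂ :=
  (L.phiPair ρ).1 x

/-- `φ*(x, ρ)`. -/
def phiStar (L : QuadraticPencil m) (x : ℝ) (ρ : ℂ) : Matrix (Fin m) (Fin m) ℂ :=
  (L.phiStarPair ρ).1 x

/-- `⟨φ*(x, θ), φ(x, ρ)⟩ = φ*'(x, θ) φ(x, ρ) - φ*(x, θ) φ'(x, ρ)`. -/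
def bracket (L : QuadraticPencil m) (x : ℝ) (ρ θ : ℂ) : Matrix (Fin m) (Fin m) ℂ :=
  (L.phiStarPair θ).2 x * (L.phiPair ρ).1 x - (L.phiStarPair θ).1 x * (L.phiPair ρ).2 x

open Classical in
/-- `D(x, ρ, θ) = ⟨φ*(x, θ), φ(x, ρ)⟩ / (ρ - θ)`, extended to `ρ = θ` by continuity, that is, by
`i h₁ + ∫₀ˣ φ*(s, θ) ((ρ + θ) I + 2 i Q₁(s)) φ(s, ρ) ds`. -/
def D (L : QuadraticPencil m) (x : ℝ) (ρ θ : ℂ) : Matrix (Fin m) (Fin m) ℂ :=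
  if ρ = θ then
    Complex.I • L.h₁ + Matrix.of fun j k => ∫ s in (0 : ℝ)..x, (L.phiStar s θ *
      ((ρ + θ) • (1 : Matrix (Fin m) (Fin m) ℂ) + (2 * Complex.I) • L.Q₁ s) * L.phi s ρ) j k
  else (ρ - θ)⁻¹ • L.bracket x ρ θ

/-- The kernel of the adjoint pencil,
`D*(x, ρ, θ) = ⟨φ*(x, ρ), φ(x, θ)⟩ / (θ - ρ)`. It is what `D` becomes under transposition:
if `Lᵀ` has the coefficients `Q_sᵀ`, `h_sᵀ`, then `D*` of `L` is the transpose of `D` of `Lᵀ`. -/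
def DStar (L : QuadraticPencil m) (x : ℝ) (ρ θ : ℂ) : Matrix (Fin m) (Fin m) ℂ :=
  L.D x θ ρ

/-- The open half-planes `Π₊` (for `σ = 1`) and `Π₋` (for `σ = -1`). -/
def halfPlane (σ : ℤˣ) : Set ℂ := {ρ : ℂ | 0 < ((σ : ℤ) : ℝ) * ρ.im}

/-- `Φ` is the Weyl solution at the nonreal point `ρ` (with derivative `Φ'`):
`ℓ_ρ(Φ) = 0`, `U_ρ(Φ) = I`, and `Φ(x) = O(exp(± i ρ x))` as `x → ∞` for `ρ ∈ Π_±`. -/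
structure IsWeylSolution (L : QuadraticPencil m) (ρ : ℂ)
    (Φ Φ' : ℝ → Matrix (Fin m) (Fin m) ℂ) : Prop where
  nonreal : ρ.im ≠ 0
  solution : L.IsSolution ρ Φ Φ'
  boundary : Φ' 0 + L.bdry ρ * Φ 0 = 1
  growth : ∀ σ : ℤˣ, ρ ∈ halfPlane σ →
    Φ =O[atTop] fun x : ℝ => Complex.exp (((σ : ℤ) : ℂ) * Complex.I * ρ * (x : ℂ))

/-- The Weyl solution exists at `ρ`. -/
def HasWeylSolution (L : QuadraticPencil m) (ρ : ℂ) : Prop :=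
  ∃ p : (ℝ → Matrix (Fin m) (Fin m) ℂ) × (ℝ → Matrix (Fin m) (Fin m) ℂ),
    L.IsWeylSolution ρ p.1 p.2

open Classical in
/-- The Weyl matrix `M(ρ) = Φ(0, ρ)` (with value `0` where there is no Weyl solution). -/
def weylMatrix (L : QuadraticPencil m) (ρ : ℂ) : Matrix (Fin m) (Fin m) ℂ :=
  if h : L.HasWeylSolution ρ then h.choose.1 0 else 0

/-- The boundary values `M_±(t) = lim M(ρ)`, `ρ → t`, `ρ ∈ Π_±`, at real points `t`. -/
def weylBoundary (L : QuadraticPencil m) (σ : ℤˣ) (t : ℝ) : Matrix (Fin m) (Fin m) ℂ :=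
  limUnder (𝓝[halfPlane σ] (t : ℂ)) L.weylMatrix

/-- The singularities of the Weyl matrix: the nonreal points at which there is no Weyl solution
(the poles of `M`), and the real points at which one of the limits `M_±` does not exist. -/
def singularSet (L : QuadraticPencil m) : Set ℂ :=
  {ρ : ℂ | ρ.im ≠ 0 ∧ ¬ L.HasWeylSolution ρ} ∪
    {ρ : ℂ | ∃ t : ℝ, (t : ℂ) = ρ ∧
      ∃ σ : ℤˣ, ¬ ∃ l, Tendsto L.weylMatrix (𝓝[halfPlane σ] (t : ℂ)) (𝓝 l)}

/-- The circle `|ρ| = R` encloses the origin and the singularities of both Weyl matrices. -/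
def Encloses (L Lt : QuadraticPencil m) (R : ℝ) : Prop :=
  0 < R ∧ L.singularSet ⊆ Metric.ball 0 R ∧ Lt.singularSet ⊆ Metric.ball 0 R

/-- The contour `γ = γ₋ ∪ γ₀ ∪ γ₊`, where `γ₀` is the circle `|ρ| = R` and `γ_±` are the parts
of the real axis outside of it. -/
def contour (R : ℝ) : Set ℂ :=
  Metric.sphere 0 R ∪ {ρ : ℂ | ρ.im = 0 ∧ R ≤ |ρ.re|}

/-- `∫_γ A(θ) (M(θ) - M̃(θ)) B(θ) dθ`, entry by entry. The circle is passed counterclockwise. The rays are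
two-sided cuts that carry the boundary values of `M - M̃` from `Π₊` on the upper edge, passed from
right to left, and those from `Π₋` on the lower edge, passed from left to right. -/
def contourIntegral (L Lt : QuadraticPencil m) (R : ℝ)
    (A B : ℂ → Matrix (Fin m) (Fin m) ℂ) : Matrix (Fin m) (Fin m) ℂ :=
  Matrix.of fun j k =>
    circleIntegral (fun θ : ℂ => (A θ * (L.weylMatrix θ - Lt.weylMatrix θ) * B θ) j k) 0 R +
      ∫ t in {t : ℝ | R < |t|}, (A (t : ℂ) *
        ((L.weylBoundary (-1) t - Lt.weylBoundary (-1) t) -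
          (L.weylBoundary 1 t - Lt.weylBoundary 1 t)) * B (t : ℂ)) j k

/-- `z` is bounded and continuous on the contour. -/
def BoundedContinuousOn (R : ℝ) (z : ℂ → Matrix (Fin m) (Fin m) ℂ) : Prop :=
  ContinuousOn z (contour R) ∧ ∃ C : ℝ, ∀ ρ ∈ contour R, ‖z ρ‖ ≤ C

/-- `z` solves the main equation at `x`:
`φ̃(x, ρ) = z(ρ) + (2 π i)⁻¹ ∫_γ z(θ) (M(θ) - M̃(θ)) D̃(x, ρ, θ) dθ` for `ρ ∈ γ`. -/
def SolvesMain (L Lt : QuadraticPencil m) (R x : ℝ) (z : ℂ → Matrix (Fin m) (Fin m) ℂ) : Prop :=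
  BoundedContinuousOn R z ∧ ∀ ρ ∈ contour R, Lt.phi x ρ =
    z ρ + (2 * (Real.pi : ℂ) * Complex.I)⁻¹ •
      contourIntegral L Lt R z (fun θ => Lt.D x ρ θ)

/-- `z` solves the main equation of the adjoint pencil at `x`:
`φ̃*(x, ρ) = z(ρ) + (2 π i)⁻¹ ∫_γ D̃*(x, ρ, θ) (M(θ) - M̃(θ)) z(θ) dθ` for `ρ ∈ γ`. -/
def SolvesMainStar (L Lt : QuadraticPencil m) (R x : ℝ)
    (z : ℂ → Matrix (Fin m) (Fin m) ℂ) : Prop :=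
  BoundedContinuousOn R z ∧ ∀ ρ ∈ contour R, Lt.phiStar x ρ =
    z ρ + (2 * (Real.pi : ℂ) * Complex.I)⁻¹ •
      contourIntegral L Lt R (fun θ => Lt.DStar x ρ θ) z

/-- Both main equations have exactly one solution at `x` (as functions on the contour). -/
def UniquelySolvable (L Lt : QuadraticPencil m) (R x : ℝ) : Prop :=
  ((∃ z, SolvesMain L Lt R x z) ∧
    ∀ z w, SolvesMain L Lt R x z → SolvesMain L Lt R x w → EqOn z w (contour R)) ∧
  ((∃ z, SolvesMainStar L Lt R x z) ∧
    ∀ z w, SolvesMainStar L Lt R x z → SolvesMainStar L Lt R x w → EqOn z w (contour R))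

/-- `∫_{|t| > r} ‖M_±(t) - M̃_±(t)‖² t⁴ dt < ∞` for some `r > 0`, for both signs. -/
def CloseWeylMatrices (L Lt : QuadraticPencil m) : Prop :=
  ∃ r : ℝ, 0 < r ∧ ∀ σ : ℤˣ,
    IntegrableOn (fun t : ℝ => ‖L.weylBoundary σ t - Lt.weylBoundary σ t‖ ^ 2 * t ^ 4)
      {t : ℝ | r < |t|}

/-- The coefficient `Q̃₁` of the model belongs to the class `𝒬(d)` of the pencil `L`. -/
structure ClassQ (L : QuadraticPencil m) (d : ℝ) (Qt : ℝ → Matrix (Fin m) (Fin m) ℂ) : Prop where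
  eq_on : ∀ x ∈ Icc 0 d, Qt x = L.Q₁ x
  norm_le : ∀ x ∈ Ioi d, ‖Qt x‖ ≤ ‖L.Q₁ d‖
  integral_le : ∫ x in Ioi d, ‖Qt x‖ ≤ ‖L.Q₁ d‖

/-- `Lt` may be chosen as the model pencil when the reconstruction has reached the point `d`. -/
structure IsModel (L : QuadraticPencil m) (d : ℝ) (Lt : QuadraticPencil m) : Prop where
  admissible : Lt.Admissible
  close : CloseWeylMatrices L Lt
  classQ : L.ClassQ d Lt.Q₁

/-- `e` is the largest element of `(d, ∞]` such that both main equations are uniquely solvable for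
all `x ∈ (d, e)`. -/
def IsNextPoint (L : QuadraticPencil m) (d : ℝ) (Lt : QuadraticPencil m) (R : ℝ)
    (e : EReal) : Prop :=
  IsGreatest {e : EReal | (d : EReal) < e ∧
    ∀ x : ℝ, (d : EReal) < (x : EReal) → (x : EReal) < e → UniquelySolvable L Lt R x} e

/-- One pass of the loop of the algorithm, from the point `d` to the point `e`, with the
model pencil `Lt` and the contour of radius `R`. -/
structure IsStep (L : QuadraticPencil m) (d : ℝ) (Lt : QuadraticPencil m) (R : ℝ)
    (e : EReal) : Prop where
  model : L.IsModel d Lt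
  encloses : Encloses L Lt R
  next : L.IsNextPoint d Lt R e

/-- `n` consecutive passes of the loop, with the points `δ 0 = 0, δ 1, …, δ n`, the model pencils
`Lt 0, …, Lt (n - 1)` and the contours of radii `R 0, …, R (n - 1)`. A further pass is made only
from a finite point `δ k`: the algorithm stops when `δ k = ∞`. -/
def IsRun (L : QuadraticPencil m) (n : ℕ) (δ : ℕ → EReal) (Lt : ℕ → QuadraticPencil m)
    (R : ℕ → ℝ) : Prop :=
  δ 0 = 0 ∧ ∀ k < n, ∃ d : ℝ, δ k = (d : EReal) ∧ L.IsStep d (Lt k) (R k) (δ (k + 1))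

end QuadraticPencil

end

/-!
Fix `x ≥ 0`. Write `φ`, `Φ = S + φ M` for the solutions of the pencil `L` at `x` and mark those of
the model by a tilde. The proof never passes through the coefficients: all that the main equation at
`x` depends on is collected in `WeylSystem.IsRegular`, namely that `φ`, `S` and their adjoints are
entire in `ρ`, that their Wronskians are constant, and that `φ` and `Φ` grow and decay like
`exp (|Im ρ| x)` and `exp (-|Im ρ| x) / |ρ|`. The last facts come from the Jost solutions
(`jost_asymptotics`), which are compared with the solutions of `Y' = ∓ Q₁ Y`.

**The factor `q`.** The combinations `φ Φ̃*' - Φ φ̃*'` and `Φ φ̃* - φ Φ̃*` are holomorphic off the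
cuts outside `|ρ| ≤ R`, and their jumps are `φ M̂ φ̃*'` and `φ M̂ φ̃*` up to sign. Adding the Cauchy
integrals of these jumps over `γ` makes them entire (`CutHolomorphic.exists_entire_extension`). The
Cauchy integrals are bounded only up to a negative power of `|Im ρ|`, but a form of Liouville's
theorem allows for that (`norm_le_of_norm_mul_im_le`), so the entire functions are a constant matrix
`q` and zero. Multiplied by `φ̃` and its derivative and combined, these identities say that `φ` solves
the main equation with `q φ̃` in place of `φ̃` (`WeylSystem.IsRegular.exists_factor`). Along the
imaginary axis the suitably normalised Weyl solutions have limits, given by the solutions of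
`Y' = ∓ Q₁ Y` (`tendsto_weylPhi`), and `2 q` is the sum over both signs of the ratio of the limits
for `L` and for the model.

**Solvability.** If `q` is invertible, `q⁻¹ φ` solves the main equation. Conversely the difference
of two solutions extends to an entire solution of the homogeneous equation, and the argument above,
applied to it and its companion, shows that it vanishes (`WeylSystem.IsRegular.mainOp_eq_zero`,
`WeylSystem.IsRegular.uniquelySolvable`). By Gronwall's inequality `q` is close to the identity when
the integral of `‖Q₁ - Q̃₁‖` over `[0, x]` is small, which gives `solvesMain_existsUnique`. The
adjoint equation is the main equation of the transposed pencils (`solvesMainStar_iff`).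

**Termination.** For a model at `δ` the coefficients `Q₁` and `Q̃₁` agree on `[0, δ]`, while beyond
`δ` they differ by at most `‖Q₁‖ + ‖Q₁(δ)‖`. Since `Q₁` is bounded and integrable, there is a step
`ε > 0`, independent of `δ` and of the model, such that the main equations are uniquely solvable on
`[δ, δ + ε]`. Since `Q₁` tends to zero and the integral of `‖Q̃₁‖` beyond `δ` is at most `‖Q₁(δ)‖`,
there is `T` such that for `δ ≥ T` they are uniquely solvable on `[δ, ∞)`
(`QuadraticPencil.exists_uniform_step`). The partition is `0, ε, …, N ε, ∞` with `N ε ≥ T`.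
-/

set_option linter.unusedSectionVars false

noncomputable section

/-! ### Indefinite integrals on the half-line -/

section Primitive

variable {E F H : Type*} [NormedAddCommGroup E] [NormedSpace ℝ E]
  [NormedAddCommGroup F] [NormedSpace ℝ F] [NormedAddCommGroup H] [NormedSpace ℝ H]

/-- On `[0, ∞)` the function `f` is an indefinite integral of the locally integrable function `g`;
equivalently, `f` is locally absolutely continuous and `f' = g` almost everywhere. -/
structure IsPrimitive (f g : ℝ → E) : Prop where
  intervalIntegrable : ∀ x, 0 ≤ x → IntervalIntegrable g volume 0 x
  eq_add : ∀ x, 0 ≤ x → f x = f 0 + ∫ t in (0 : ℝ)..x, g t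

/-- A function whose increments are dominated by those of two absolutely continuous functions is
absolutely continuous. -/
lemma AbsolutelyContinuousOnInterval.of_dist_le {X Y Z : Type*} [PseudoMetricSpace X]
    [PseudoMetricSpace Y] [PseudoMetricSpace Z] {f : ℝ → X} {g : ℝ → Y} {h : ℝ → Z} {a b : ℝ}
    (K : ℝ) (hf : AbsolutelyContinuousOnInterval f a b) (hg : AbsolutelyContinuousOnInterval g a b)
    (H : ∀ x ∈ uIcc a b, ∀ y ∈ uIcc a b, dist (h x) (h y) ≤ K * dist (f x) (f y) +
      K * dist (g x) (g y)) : AbsolutelyContinuousOnInterval h a b := by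
  unfold AbsolutelyContinuousOnInterval at hf hg ⊢
  apply squeeze_zero' ?_ ?_ (by simpa using (hf.const_mul K).add (hg.const_mul K))
  · exact Filter.Eventually.of_forall fun _ ↦ Finset.sum_nonneg fun i hi ↦ dist_nonneg
  rw [eventually_inf_principal]
  filter_upwards with (n, I) hnI
  simp only [Finset.mul_sum, ← Finset.sum_add_distrib]
  refine Finset.sum_le_sum fun i hi => ?_
  simp only [AbsolutelyContinuousOnInterval.disjWithin, mem_ofPred_eq] at hnI
  exact H _ (hnI.left i hi).1 _ (hnI.left i hi).2

lemma absolutelyContinuousOnInterval_integral {g : ℝ → E} {T : ℝ} (hT : 0 ≤ T)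
    (hg : IntervalIntegrable g volume 0 T) :
    AbsolutelyContinuousOnInterval (fun x => ∫ t in (0 : ℝ)..x, g t) 0 T := by
  have hG := hg.norm.absolutelyContinuousOnInterval_intervalIntegral (c := 0) (by simp)
  refine .of_dist_le 1 hG hG fun x hx y hy => ?_
  rw [uIcc_of_le hT] at hx hy
  have key : ∀ z ∈ Icc 0 T, IntervalIntegrable g volume 0 z := fun z hz =>
    hg.mono_set (by rw [uIcc_of_le hT, uIcc_of_le hz.1]; exact Icc_subset_Icc_right hz.2)
  rw [dist_eq_norm, dist_eq_norm,
    intervalIntegral.integral_interval_sub_left (key x hx) (key y hy),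
    intervalIntegral.integral_interval_sub_left (key x hx).norm (key y hy).norm]
  have h2 := intervalIntegral.norm_integral_le_abs_integral_norm (f := g) (a := y) (b := x)
    (μ := volume)
  rw [Real.norm_eq_abs]
  have := abs_nonneg (∫ t in y..x, ‖g t‖)
  linarith

namespace IsPrimitive

variable {f g f' g' : ℝ → E}

lemma const (c : E) : IsPrimitive (fun _ => c) (fun _ => (0 : E)) :=
  ⟨fun _ _ => by simp, fun _ _ => by simp⟩

lemma integral_eq (h : IsPrimitive f g) {x y : ℝ} (hx : 0 ≤ x) (hy : 0 ≤ y) :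
    ∫ t in x..y, g t = f y - f x := by
  rw [h.eq_add x hx, h.eq_add y hy, add_sub_add_left_eq_sub,
    intervalIntegral.integral_interval_sub_left (h.intervalIntegrable y hy)
      (h.intervalIntegrable x hx)]

lemma absolutelyContinuous (h : IsPrimitive f g) {T : ℝ} (hT : 0 ≤ T) :
    AbsolutelyContinuousOnInterval f 0 T := by
  have h1 := absolutelyContinuousOnInterval_integral hT (h.intervalIntegrable T hT)
  refine .of_dist_le (1 / 2) h1 h1 fun x hx y hy => ?_
  rw [uIcc_of_le hT] at hx hy
  rw [h.eq_add x hx.1, h.eq_add y hy.1, dist_add_left]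
  linarith

lemma continuousOn (h : IsPrimitive f g) : ContinuousOn f (Ici 0) := by
  intro x hx
  have hx0 : (0 : ℝ) ≤ x := hx
  have h1 := (h.absolutelyContinuous (T := x + 1) (by linarith)).continuousOn
  rw [uIcc_of_le (by linarith)] at h1
  refine (h1 x ⟨hx, by linarith⟩).mono_of_mem_nhdsWithin ?_
  have : Iio (x + 1) ∈ 𝓝 x := Iio_mem_nhds (by linarith)
  filter_upwards [self_mem_nhdsWithin, mem_nhdsWithin_of_mem_nhds this] with y hy1 hy2
  exact ⟨hy1, le_of_lt hy2⟩

lemma exists_bound (h : IsPrimitive f g) (T : ℝ) : ∃ C, 0 ≤ C ∧ ∀ x ∈ Icc 0 T, ‖f x‖ ≤ C := by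
  obtain ⟨C, hC⟩ := isCompact_Icc.exists_bound_of_continuousOn
    (h.continuousOn.mono (Icc_subset_Ici_self : Icc 0 T ⊆ Ici 0))
  exact ⟨max C 0, le_max_right _ _, fun x hx => (hC x hx).trans (le_max_left _ _)⟩

lemma locallyIntegrable (h : IsPrimitive f g) :
    LocallyIntegrable ((Ioi (0 : ℝ)).indicator g) volume := by
  intro x
  refine ⟨Ioo (x - 1) (|x| + 1), Ioo_mem_nhds (by linarith) (by linarith [le_abs_self x]), ?_⟩
  rw [integrableOn_indicator_iff measurableSet_Ioi]
  have := (h.intervalIntegrable (|x| + 1) (by positivity)).1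
  refine this.mono_set ?_
  rintro t ⟨h1, h2⟩
  exact ⟨h1, h2.2.le⟩

lemma ae_hasDerivAt [CompleteSpace E] (h : IsPrimitive f g) :
    ∀ᵐ x ∂(volume.restrict (Ioi (0 : ℝ))), HasDerivAt f (g x) x := by
  rw [ae_restrict_iff' measurableSet_Ioi]
  filter_upwards [_root_.LocallyIntegrable.ae_hasDerivAt_integral h.locallyIntegrable] with x hx hx0
  have hx0' : (0 : ℝ) < x := hx0
  have h1 := (hx 0).const_add (f 0)
  rw [indicator_of_mem hx0] at h1
  refine h1.congr_of_eventuallyEq ?_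
  filter_upwards [Ioi_mem_nhds hx0'] with y hy
  rw [h.eq_add y (le_of_lt hy)]
  congr 1
  refine intervalIntegral.integral_congr_ae ?_
  filter_upwards with t ht
  rw [uIoc_of_le (le_of_lt hy)] at ht
  rw [indicator_of_mem (show t ∈ Ioi (0 : ℝ) from ht.1)]

/-- The fundamental theorem of calculus for absolutely continuous functions with values in a
Banach space, in the form that is used to produce indefinite integrals. -/
lemma of_absolutelyContinuous [CompleteSpace E]
    (hf : ∀ T, 0 < T → AbsolutelyContinuousOnInterval f 0 T)
    (hg : ∀ x, 0 ≤ x → IntervalIntegrable g volume 0 x)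
    (h : ∀ᵐ x ∂(volume.restrict (Ioi (0 : ℝ))), HasDerivAt f (g x) x) : IsPrimitive f g := by
  refine ⟨hg, fun x hx => ?_⟩
  rcases hx.eq_or_lt with rfl | hx0
  · simp
  have hac := (hf x hx0).sub (absolutelyContinuousOnInterval_integral hx (hg x hx))
  obtain ⟨C, hC⟩ := hac.const_of_ae_hasDerivAt_zero (by
    rw [ae_restrict_iff' measurableSet_Ioi] at h
    have h0 : ∀ᵐ t : ℝ, t ≠ 0 := by simp [ae_iff, measure_singleton]
    filter_upwards [h, (hg x hx).ae_hasDerivAt_integral, h0] with t h1 h2 h3 ht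
    have ht' := ht
    rw [uIcc_of_le hx] at ht'
    have := (h1 (lt_of_le_of_ne ht'.1 h3.symm)).sub (h2 ht 0 (by simp))
    simpa using this)
  have h1 := hC 0 (by simp)
  have h2 := hC x (by simp)
  simp only [Pi.sub_apply, intervalIntegral.integral_same, sub_zero] at h1 h2
  rw [h1, ← h2]; abel

lemma add (h : IsPrimitive f g) (h' : IsPrimitive f' g') :
    IsPrimitive (fun x => f x + f' x) (fun x => g x + g' x) := by
  refine ⟨fun x hx => (h.1 x hx).add (h'.1 x hx), fun x hx => ?_⟩
  rw [h.2 x hx, h'.2 x hx, intervalIntegral.integral_add (h.1 x hx) (h'.1 x hx)]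
  abel

lemma congr {f₁ g₁ : ℝ → E} (h : IsPrimitive f g) (hf : ∀ x, 0 ≤ x → f₁ x = f x)
    (hg : ∀ x, 0 < x → g₁ x = g x) : IsPrimitive f₁ g₁ := by
  refine ⟨fun x hx => (h.1 x hx).congr ?_, fun x hx => ?_⟩
  · intro t ht
    rw [uIoc_of_le hx] at ht
    exact (hg t ht.1).symm
  · rw [hf x hx, hf 0 le_rfl, h.2 x hx]
    congr 1
    refine intervalIntegral.integral_congr_ae ?_
    filter_upwards with t ht
    rw [uIoc_of_le hx] at ht
    exact (hg t ht.1).symm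

lemma clm_comp [CompleteSpace F] [CompleteSpace E] (h : IsPrimitive f g) (A : E →L[ℝ] F) :
    IsPrimitive (fun x => A (f x)) (fun x => A (g x)) := by
  refine ⟨fun x hx => ⟨A.integrable_comp (h.1 x hx).1, A.integrable_comp (h.1 x hx).2⟩,
    fun x hx => ?_⟩
  rw [h.2 x hx, map_add, A.intervalIntegral_comp_comm (h.1 x hx)]

lemma neg [CompleteSpace E] (h : IsPrimitive f g) : IsPrimitive (fun x => -f x) (fun x => -g x) :=
  h.clm_comp (-ContinuousLinearMap.id ℝ E)

lemma sub [CompleteSpace E] (h : IsPrimitive f g) (h' : IsPrimitive f' g') :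
    IsPrimitive (fun x => f x - f' x) (fun x => g x - g' x) := by
  simpa only [sub_eq_add_neg] using h.add h'.neg

/-- The product rule. -/
lemma bilin [CompleteSpace E] [CompleteSpace F] [CompleteSpace H] {p q : ℝ → F}
    (B : E →L[ℝ] F →L[ℝ] H) (h : IsPrimitive f g) (h' : IsPrimitive p q) :
    IsPrimitive (fun x => B (f x) (p x)) (fun x => B (f x) (q x) + B (g x) (p x)) := by
  refine of_absolutelyContinuous (fun T hT => ?_) (fun T hT => ?_) ?_
  · obtain ⟨C, hC0, hC⟩ := h.exists_bound T
    obtain ⟨D, hD0, hD⟩ := h'.exists_bound T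
    refine .of_dist_le (‖B‖ * (C + D)) (h.absolutelyContinuous hT.le)
      (h'.absolutelyContinuous hT.le) fun x hx y hy => ?_
    rw [uIcc_of_le hT.le] at hx hy
    have e : B (f x) (p x) - B (f y) (p y) = B (f x - f y) (p x) + B (f y) (p x - p y) := by
      simp only [map_sub, sub_apply]; abel
    rw [dist_eq_norm, e, dist_eq_norm, dist_eq_norm]
    refine (norm_add_le _ _).trans (add_le_add ?_ ?_)
    · refine (B.le_opNorm₂ _ _).trans ?_
      have h1 : ‖p x‖ ≤ C + D := by linarith [hD x hx]
      calc ‖B‖ * ‖f x - f y‖ * ‖p x‖ ≤ ‖B‖ * ‖f x - f y‖ * (C + D) := by gcongr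
        _ = _ := by ring
    · refine (B.le_opNorm₂ _ _).trans ?_
      have h1 : ‖f y‖ ≤ C + D := by linarith [hC y hy]
      gcongr
  · obtain ⟨C, hC0, hC⟩ := h.exists_bound T
    obtain ⟨D, hD0, hD⟩ := h'.exists_bound T
    rw [intervalIntegrable_iff, uIoc_of_le hT]
    have hi1 := h.intervalIntegrable T hT
    have hi2 := h'.intervalIntegrable T hT
    rw [intervalIntegrable_iff, uIoc_of_le hT] at hi1 hi2
    have hs : Ioc 0 T ⊆ Ici (0 : ℝ) := fun t ht => ht.1.le
    refine Integrable.add ?_ ?_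
    · refine Integrable.mono' (hi2.norm.const_mul (‖B‖ * C)) ?_ ?_
      · exact B.aestronglyMeasurable_comp₂
          ((h.continuousOn.mono hs).aestronglyMeasurable measurableSet_Ioc) hi2.1
      · filter_upwards [ae_restrict_mem measurableSet_Ioc] with t ht
        refine (B.le_opNorm₂ _ _).trans ?_
        have := hC t ⟨ht.1.le, ht.2⟩
        gcongr
    · refine Integrable.mono' ((hi1.norm.const_mul ‖B‖).mul_const D) ?_ ?_
      · exact B.aestronglyMeasurable_comp₂ hi1.1
          ((h'.continuousOn.mono hs).aestronglyMeasurable measurableSet_Ioc)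
      · filter_upwards [ae_restrict_mem measurableSet_Ioc] with t ht
        refine (B.le_opNorm₂ _ _).trans ?_
        have := hD t ⟨ht.1.le, ht.2⟩
        gcongr
  · filter_upwards [h.ae_hasDerivAt, h'.ae_hasDerivAt] with x h1 h2
    exact B.hasDerivAt_of_bilinear (fun _ => h1) (fun _ => h2)

end IsPrimitive

namespace IsPrimitive

variable {𝔸 : Type*} [NormedRing 𝔸] [NormedAlgebra ℂ 𝔸] [CompleteSpace 𝔸]

lemma mul {f g f' g' : ℝ → 𝔸} (h : IsPrimitive f g) (h' : IsPrimitive f' g') :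
    IsPrimitive (fun x => f x * f' x) (fun x => f x * g' x + g x * f' x) :=
  h.bilin ((ContinuousLinearMap.mul ℂ 𝔸).bilinearRestrictScalars ℝ) h'

lemma const_mul {f g : ℝ → 𝔸} (c : 𝔸) (h : IsPrimitive f g) :
    IsPrimitive (fun x => c * f x) (fun x => c * g x) := by
  simpa using (const c).mul h

lemma mul_const {f g : ℝ → 𝔸} (h : IsPrimitive f g) (c : 𝔸) :
    IsPrimitive (fun x => f x * c) (fun x => g x * c) := by
  simpa using h.mul (const c)

lemma smul {s s' : ℝ → ℂ} {f g : ℝ → 𝔸} (hs : IsPrimitive s s') (h : IsPrimitive f g) :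
    IsPrimitive (fun x => s x • f x) (fun x => s x • g x + s' x • f x) :=
  hs.bilin ((ContinuousLinearMap.lsmul ℂ ℂ).bilinearRestrictScalars ℝ) h

lemma const_smul {f g : ℝ → 𝔸} (c : ℂ) (h : IsPrimitive f g) :
    IsPrimitive (fun x => c • f x) (fun x => c • g x) := by
  simpa using (const c).smul h

lemma of_hasDerivAt {f g : ℝ → E} [CompleteSpace E] (h : ∀ x, HasDerivAt f (g x) x)
    (hg : Continuous g) : IsPrimitive f g := by
  refine ⟨fun x _ => hg.intervalIntegrable _ _, fun x _ => ?_⟩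
  rw [intervalIntegral.integral_eq_sub_of_hasDerivAt (fun y _ => h y) (hg.intervalIntegrable _ _)]
  abel

lemma cexp (c : ℂ) : IsPrimitive (fun x : ℝ => Complex.exp (c * x))
    (fun x : ℝ => c * Complex.exp (c * x)) := by
  refine of_hasDerivAt (fun x => ?_) (by fun_prop)
  have h1 : HasDerivAt (fun x : ℝ => c * (x : ℂ)) c x := by
    simpa using (Complex.ofRealCLM.hasDerivAt (x := x)).const_mul c
  simpa [mul_comm] using h1.cexp

lemma pow_succ {G g : ℝ → ℝ} (h : IsPrimitive G g) (n : ℕ) :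
    IsPrimitive (fun x => G x ^ (n + 1)) (fun x => (n + 1) * (g x * G x ^ n)) := by
  induction n with
  | zero => simpa using h
  | succ n ih =>
    have := ih.bilin (ContinuousLinearMap.mul ℝ ℝ) h
    simp only [ContinuousLinearMap.mul_apply'] at this
    refine this.congr (fun x _ => by ring) (fun x _ => ?_)
    push_cast; ring

end IsPrimitive

end Primitive

section Tail

variable {E : Type*} [NormedAddCommGroup E] [NormedSpace ℝ E]

lemma integral_Ioi_eq_sub_intervalIntegral {h : ℝ → E} (hi : IntegrableOn h (Ioi 0)) {x : ℝ}
    (hx : 0 ≤ x) : ∫ t in Ioi x, h t = (∫ t in Ioi 0, h t) - ∫ t in (0 : ℝ)..x, h t := by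
  rw [intervalIntegral.integral_of_le hx, ← Ioc_union_Ioi_eq_Ioi hx,
    setIntegral_union Ioc_disjoint_Ioi_same measurableSet_Ioi
      (hi.mono_set Ioc_subset_Ioi_self) (hi.mono_set (Ioi_subset_Ioi hx))]
  abel

lemma MeasureTheory.IntegrableOn.intervalIntegrable_zero {h : ℝ → E}
    (hi : IntegrableOn h (Ioi 0)) (x : ℝ) (hx : 0 ≤ x) : IntervalIntegrable h volume 0 x := by
  rw [intervalIntegrable_iff, uIoc_of_le hx]
  exact hi.mono_set Ioc_subset_Ioi_self

lemma isPrimitive_integral_Ioi [CompleteSpace E] {h : ℝ → E} (hi : IntegrableOn h (Ioi 0)) :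
    IsPrimitive (fun x => ∫ t in Ioi x, h t) (fun x => -h x) := by
  refine ⟨fun x hx => (hi.intervalIntegrable_zero x hx).neg, fun x hx => ?_⟩
  rw [intervalIntegral.integral_neg, integral_Ioi_eq_sub_intervalIntegral hi hx]; abel

lemma tendsto_integral_Ioi_zero {h : ℝ → E} (hi : IntegrableOn h (Ioi 0)) :
    Tendsto (fun x => ∫ t in Ioi x, h t) atTop (𝓝 0) := by
  have h1 := intervalIntegral_tendsto_integral_Ioi 0 hi tendsto_id
  have h2 := h1.const_sub (∫ t in Ioi 0, h t)
  rw [sub_self] at h2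
  refine h2.congr' ?_
  filter_upwards [eventually_ge_atTop 0] with x hx
  rw [integral_Ioi_eq_sub_intervalIntegral hi hx]; rfl

end Tail

/-! ### Volterra integral equations -/

section Volterra

/-- The data of a linear Volterra equation `y(x) = f(x) + ∫_{S x} k(x, t) y(t) dt` on `I`:
`g` is a majorant of the kernel and `G(x)` is its integral over `S x`, which gives the factorial
bounds for the iterated kernels. The two instances are `S x = (0, x]` and `S x = (x, ∞)`. -/
structure VolterraMajorant (I : Set ℝ) (S : ℝ → Set ℝ) (g G : ℝ → ℝ) : Prop where
  measurableSet_base : MeasurableSet I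
  measurableSet : MeasurableSet {p : ℝ × ℝ | p.2 ∈ S p.1}
  subset : ∀ x ∈ I, S x ⊆ I
  nonneg : ∀ t, 0 ≤ g t
  nonneg' : ∀ x ∈ I, 0 ≤ G x
  integrable : ∀ x ∈ I, ∀ n : ℕ, IntegrableOn (fun t => g t * G t ^ n) (S x)
  integral : ∀ x ∈ I, ∀ n : ℕ, ∫ t in S x, g t * G t ^ n = G x ^ (n + 1) / (n + 1)

/-- The majorant on `S x = (0, x]`, for solutions with prescribed behaviour at zero. -/
lemma volterraMajorant_forward {g : ℝ → ℝ} {X : ℝ} (hg : ∀ t, 0 ≤ g t)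
    (hi : ∀ x, 0 ≤ x → IntervalIntegrable g volume 0 x) :
    VolterraMajorant (Icc 0 X) (fun x => Ioc 0 x) g (fun x => ∫ t in (0 : ℝ)..x, g t) := by
  have hP : IsPrimitive (fun x => ∫ t in (0 : ℝ)..x, g t) g := ⟨hi, fun x _ => by simp⟩
  refine ⟨measurableSet_Icc, ?_, fun x hx t ht => ⟨ht.1.le, ht.2.trans hx.2⟩, hg,
    fun x hx => intervalIntegral.integral_nonneg hx.1 fun t _ => hg t, fun x hx n => ?_,
    fun x hx n => ?_⟩
  · exact (measurableSet_lt measurable_const measurable_snd).inter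
      (measurableSet_le measurable_snd measurable_fst)
  · have h1 := ((hP.pow_succ n).1 x hx.1).1.const_mul ((n : ℝ) + 1)⁻¹
    refine h1.congr (Eventually.of_forall fun t => ?_)
    have : (n : ℝ) + 1 ≠ 0 := by positivity
    simp only
    field_simp
  · have h1 := (hP.pow_succ n).integral_eq le_rfl hx.1
    rw [intervalIntegral.integral_const_mul, intervalIntegral.integral_of_le hx.1] at h1
    have : (n : ℝ) + 1 ≠ 0 := by positivity
    rw [eq_div_iff this, mul_comm, h1]
    simp

/-- The majorant on `S x = (x, ∞)`, for solutions with prescribed behaviour at infinity. -/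
lemma volterraMajorant_backward {g : ℝ → ℝ} (hg : ∀ t, 0 ≤ g t)
    (hi : IntegrableOn g (Ioi 0)) :
    VolterraMajorant (Ici 0) (fun x => Ioi x) g (fun x => ∫ t in Ioi x, g t) := by
  have hP := isPrimitive_integral_Ioi hi
  have hG := tendsto_integral_Ioi_zero hi
  have hG0 : ∀ x, 0 ≤ ∫ t in Ioi x, g t := fun x => integral_nonneg hg
  have hanti : ∀ x, 0 ≤ x → ∀ t, x ≤ t → ∫ s in Ioi t, g s ≤ ∫ s in Ioi x, g s :=
    fun x hx t ht => setIntegral_mono_set (hi.mono_set (Ioi_subset_Ioi hx))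
      (Eventually.of_forall hg) (LE.le.eventuallyLE (Ioi_subset_Ioi ht))
  have hint : ∀ x ∈ Ici (0 : ℝ), ∀ n : ℕ,
      IntegrableOn (fun t => g t * (∫ s in Ioi t, g s) ^ n) (Ioi x) := by
    intro x hx n
    have hx0 : (0 : ℝ) ≤ x := hx
    refine Integrable.mul_bdd (c := (∫ s in Ioi x, g s) ^ n)
      (hi.mono_set (Ioi_subset_Ioi hx0)) ?_ ?_
    · have : ContinuousOn (fun t => ∫ s in Ioi t, g s) (Ioi x) :=
        hP.continuousOn.mono fun t ht => (hx0.trans (le_of_lt ht) : (0:ℝ) ≤ t)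
      exact (this.pow n).aestronglyMeasurable measurableSet_Ioi
    · filter_upwards [ae_restrict_mem measurableSet_Ioi] with t ht
      rw [norm_pow, Real.norm_of_nonneg (hG0 t)]
      exact pow_le_pow_left₀ (hG0 t) (hanti x hx0 t (le_of_lt ht)) n
  refine ⟨measurableSet_Ici, measurableSet_lt measurable_fst measurable_snd,
    fun x hx t ht => (le_trans hx (le_of_lt ht) : (0 : ℝ) ≤ t), hg, fun x _ => hG0 x, hint,
    fun x hx n => ?_⟩
  have hx0 : (0 : ℝ) ≤ x := hx
  have h1 := intervalIntegral_tendsto_integral_Ioi x (hint x hx n) tendsto_id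
  refine tendsto_nhds_unique h1 ?_
  have h2 : Tendsto (fun X => ((∫ t in Ioi x, g t) ^ (n + 1) - (∫ t in Ioi X, g t) ^ (n + 1)) /
      ((n : ℝ) + 1)) atTop (𝓝 ((∫ t in Ioi x, g t) ^ (n + 1) / (n + 1))) := by
    have := ((hG.pow (n + 1)).const_sub ((∫ t in Ioi x, g t) ^ (n + 1))).div_const ((n : ℝ) + 1)
    simpa using this
  refine h2.congr' ?_
  filter_upwards [eventually_ge_atTop x] with X hX
  have h3 := (hP.pow_succ n).integral_eq hx0 (hx0.trans hX)
  simp only [intervalIntegral.integral_const_mul, neg_mul, intervalIntegral.integral_neg] at h3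
  have : (n : ℝ) + 1 ≠ 0 := by positivity
  simp only [id]
  rw [div_eq_iff this]
  linarith

namespace VolterraMajorant

variable {I : Set ℝ} {S : ℝ → Set ℝ} {g G : ℝ → ℝ}

/-- The Gronwall inequality. -/
lemma gronwall (h : VolterraMajorant I S g G) {y : ℝ → ℝ} {C M : ℝ} (hC : 0 ≤ C)
    (hy : ∀ x ∈ I, 0 ≤ y x) (hM : ∀ x ∈ I, y x ≤ M)
    (hyC : ∀ x ∈ I, y x ≤ C + ∫ t in S x, g t * y t) {x : ℝ} (hx : x ∈ I) :
    y x ≤ C * Real.exp (G x) := by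
  have key : ∀ n : ℕ, ∀ x ∈ I, y x ≤ C * (∑ k ∈ Finset.range n, G x ^ k / k.factorial) +
      M * (G x ^ n / n.factorial) := by
    intro n
    induction n with
    | zero => intro x hx; simpa using hM x hx
    | succ n ih =>
      intro x hx
      have hSm : MeasurableSet (S x) := h.measurableSet.preimage measurable_prodMk_left
      have hint : ∀ k : ℕ, ∀ c : ℝ, IntegrableOn (fun t => c * (g t * G t ^ k)) (S x) :=
        fun k c => (h.integrable x hx k).const_mul c
      have e1 : ∀ t, g t * (C * (∑ k ∈ Finset.range n, G t ^ k / k.factorial) +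
          M * (G t ^ n / n.factorial)) =
          (∑ k ∈ Finset.range n, (C / k.factorial) * (g t * G t ^ k)) +
          (M / n.factorial) * (g t * G t ^ n) := by
        intro t
        rw [mul_add, Finset.mul_sum, Finset.mul_sum]
        congr 1
        · refine Finset.sum_congr rfl fun k _ => by ring
        · ring
      have h1 : ∫ t in S x, g t * y t ≤ ∫ t in S x, g t *
          (C * (∑ k ∈ Finset.range n, G t ^ k / k.factorial) + M * (G t ^ n / n.factorial)) := by
        refine integral_mono_of_nonneg ?_ ?_ ?_
        · filter_upwards [ae_restrict_mem hSm] with t ht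
          exact mul_nonneg (h.nonneg t) (hy t (h.subset x hx ht))
        · simp_rw [e1]
          exact (integrable_finsetSum _ fun k _ => hint k _).add (hint n _)
        · filter_upwards [ae_restrict_mem hSm] with t ht
          exact mul_le_mul_of_nonneg_left (ih t (h.subset x hx ht)) (h.nonneg t)
      refine (hyC x hx).trans ((add_le_add_right h1 C).trans (le_of_eq ?_))
      simp_rw [e1]
      rw [integral_add (integrable_finsetSum _ fun k _ => hint k _) (hint n _),
        integral_finsetSum _ fun k _ => hint k _]
      simp_rw [integral_const_mul, h.integral x hx]
      rw [Finset.sum_range_succ', mul_add, Finset.mul_sum]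
      simp only [pow_zero, Nat.factorial_zero, Nat.cast_one, div_one, mul_one]
      have e2 : ∀ k : ℕ, ∀ c : ℝ, c / k.factorial * (G x ^ (k + 1) / (k + 1)) =
          c * (G x ^ (k + 1) / (k + 1).factorial) := by
        intro k c
        rw [Nat.factorial_succ]; push_cast; field_simp
      simp_rw [e2]
      ring
  have hlim : Tendsto (fun n : ℕ => C * Real.exp (G x) + M * (G x ^ n / n.factorial)) atTop
      (𝓝 (C * Real.exp (G x) + M * 0)) :=
    ((FloorSemiring.tendsto_pow_div_factorial_atTop (G x)).const_mul M).const_add _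
  rw [mul_zero, add_zero] at hlim
  refine ge_of_tendsto' hlim fun n => (key n x hx).trans ?_
  have := Real.sum_le_exp_of_nonneg (h.nonneg' x hx) n
  gcongr

end VolterraMajorant

/-- A parametric integral depends holomorphically on the parameter if the integrand does and has an
integrable majorant. -/
lemma differentiableOn_integral_of_dominated {α E : Type*} [MeasurableSpace α]
    [NormedAddCommGroup E] [NormedSpace ℂ E] [CompleteSpace E] {μ : Measure α} {U : Set ℂ}
    (hU : IsOpen U) {F : ℂ → α → E} {b : α → ℝ}
    (hm : ∀ ρ ∈ U, AEStronglyMeasurable (F ρ) μ)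
    (hd : ∀ᵐ a ∂μ, DifferentiableOn ℂ (fun ρ => F ρ a) U)
    (hb : ∀ᵐ a ∂μ, ∀ ρ ∈ U, ‖F ρ a‖ ≤ b a) (hbi : Integrable b μ) :
    DifferentiableOn ℂ (fun ρ => ∫ a, F ρ a ∂μ) U := by
  intro ρ₀ hρ₀
  obtain ⟨r, hr, hrU⟩ := Metric.isOpen_iff.1 hU ρ₀ hρ₀
  have hr2 : 0 < r / 2 := by linarith
  have hr3 : 0 < r / 3 := by linarith
  have hball : Metric.ball ρ₀ (r / 2) ⊆ U :=
    (Metric.ball_subset_ball (by linarith)).trans hrU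
  have hsub : ∀ z ∈ Metric.ball ρ₀ (r / 2), Metric.closedBall z (r / 3) ⊆ U := fun z hz w hw =>
    hrU (by
      rw [Metric.mem_ball] at hz ⊢; rw [Metric.mem_closedBall] at hw
      linarith [dist_triangle w z ρ₀])
  have hda : ∀ᵐ a ∂μ, ∀ z ∈ Metric.ball ρ₀ (r / 2),
      HasDerivAt (fun ρ => F ρ a) (deriv (fun ρ => F ρ a) z) z := by
    filter_upwards [hd] with a ha z hz
    exact (ha.differentiableAt (hU.mem_nhds (hball hz))).hasDerivAt
  have hbd : ∀ᵐ a ∂μ, ∀ z ∈ Metric.ball ρ₀ (r / 2),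
      ‖deriv (fun ρ => F ρ a) z‖ ≤ b a / (r / 3) := by
    filter_upwards [hd, hb] with a ha hba z hz
    refine Complex.norm_deriv_le_of_forall_mem_sphere_norm_le hr3 ?_
      fun w hw => hba w (hsub z hz (Metric.sphere_subset_closedBall hw))
    refine DifferentiableOn.diffContOnCl ?_
    rw [closure_ball _ hr3.ne']
    exact ha.mono (hsub z hz)
  have hmeas : AEStronglyMeasurable (fun a => deriv (fun ρ => F ρ a) ρ₀) μ := by
    have hseq : Tendsto (fun n : ℕ => ((r / 2 / ((n : ℝ) + 2) : ℝ) : ℂ)) atTop (𝓝[≠] 0) := by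
      rw [tendsto_nhdsWithin_iff]
      constructor
      · have h1 : Tendsto (fun n : ℕ => r / 2 / ((n : ℝ) + 2)) atTop (𝓝 0) :=
          Tendsto.div_atTop tendsto_const_nhds
            (tendsto_atTop_add_const_right _ _ tendsto_natCast_atTop_atTop)
        exact_mod_cast (Complex.continuous_ofReal.tendsto 0).comp h1
      · filter_upwards with n
        have : 0 < r / 2 / ((n : ℝ) + 2) := by positivity
        simpa using ⟨hr.ne', (by positivity : (n : ℝ) + 2 ≠ 0) |> fun h => by exact_mod_cast h⟩
    refine aestronglyMeasurable_of_tendsto_ae atTop (f := fun (n : ℕ) a =>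
      ((r / 2 / ((n : ℝ) + 2) : ℝ) : ℂ)⁻¹ • (F (ρ₀ + ((r / 2 / ((n : ℝ) + 2) : ℝ) : ℂ)) a -
        F ρ₀ a)) (fun n => ?_) ?_
    · refine ((hm _ (hball ?_)).sub (hm _ hρ₀)).const_smul _
      have h0 : (0 : ℝ) < (n : ℝ) + 2 := by positivity
      rw [Metric.mem_ball, dist_eq_norm, add_sub_cancel_left, Complex.norm_real,
        Real.norm_of_nonneg (by positivity), div_lt_iff₀ h0]
      nlinarith
    · filter_upwards [hda] with a ha
      have h1 := (hasDerivAt_iff_tendsto_slope_zero.1 (ha ρ₀ (Metric.mem_ball_self hr2)))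
      exact h1.comp hseq
  have hFi : Integrable (F ρ₀) μ := hbi.mono' (hm ρ₀ hρ₀) (by
    filter_upwards [hb] with a ha using ha ρ₀ hρ₀)
  exact (hasDerivAt_integral_of_dominated_loc_of_deriv_le (μ := μ) (F := F)
    (F' := fun z a => deriv (fun ρ => F ρ a) z) (Metric.ball_mem_nhds ρ₀ hr2)
    (by filter_upwards [hU.mem_nhds hρ₀] with z hz using hm z hz) hFi hmeas hbd
    (hbi.div_const _) hda).2.differentiableAt.differentiableWithinAt

variable {𝔸 : Type*} [NormedRing 𝔸] [NormedAlgebra ℂ 𝔸] [CompleteSpace 𝔸]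

/-- The terms of the Neumann series of the Volterra equation
`y(x) = f(x) + ∫_{S x} k(x, t) y(t) dt`. -/
def volterraIter (S : ℝ → Set ℝ) (k : ℝ → ℝ → 𝔸) (f : ℝ → 𝔸) : ℕ → ℝ → 𝔸
  | 0 => f
  | n + 1 => fun x => ∫ t in S x, k x t * volterraIter S k f n t

/-- The solution of the Volterra equation `y(x) = f(x) + ∫_{S x} k(x, t) y(t) dt`, as the sum of
its Neumann series. -/
def volterraSol (S : ℝ → Set ℝ) (k : ℝ → ℝ → 𝔸) (f : ℝ → 𝔸) (x : ℝ) : 𝔸 :=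
  ∑' n, volterraIter S k f n x

/-- The hypotheses on the kernel `k` and the free term `f` under which the Neumann series is
controlled by the majorant `g`. -/
structure VolterraKernel (I : Set ℝ) (S : ℝ → Set ℝ) (g : ℝ → ℝ) (k : ℝ → ℝ → 𝔸) (f : ℝ → 𝔸)
    (C : ℝ) : Prop where
  meas : AEStronglyMeasurable (Function.uncurry k) ((volume.restrict I).prod (volume.restrict I))
  meas_slice : ∀ x ∈ I, AEStronglyMeasurable (k x) (volume.restrict I)
  meas_free : AEStronglyMeasurable f (volume.restrict I)
  bound : ∀ x ∈ I, ∀ t ∈ S x, ‖k x t‖ ≤ g t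
  bound_free : ∀ x ∈ I, ‖f x‖ ≤ C

namespace VolterraMajorant

variable {I : Set ℝ} {S : ℝ → Set ℝ} {g G : ℝ → ℝ}

lemma measurableSet_section (h : VolterraMajorant I S g G) (x : ℝ) : MeasurableSet (S x) :=
  h.measurableSet.preimage measurable_prodMk_left

variable {k : ℝ → ℝ → 𝔸} {f : ℝ → 𝔸} {C : ℝ}

lemma aestronglyMeasurable_iter (h : VolterraMajorant I S g G) (hk : VolterraKernel I S g k f C)
    (n : ℕ) : AEStronglyMeasurable (volterraIter S k f n) (volume.restrict I) := by
  induction n with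
  | zero => exact hk.meas_free
  | succ n ih =>
    have h1 : AEStronglyMeasurable ({p : ℝ × ℝ | p.2 ∈ S p.1}.indicator
        fun p => k p.1 p.2 * volterraIter S k f n p.2)
        ((volume.restrict I).prod (volume.restrict I)) :=
      (hk.meas.mul ih.comp_snd).indicator h.measurableSet
    refine h1.integral_prod_right'.congr ?_
    filter_upwards [ae_restrict_mem h.measurableSet_base] with x hx
    have e : ∀ t, {p : ℝ × ℝ | p.2 ∈ S p.1}.indicator
        (fun p => k p.1 p.2 * volterraIter S k f n p.2) (x, t) =
        (S x).indicator (fun t => k x t * volterraIter S k f n t) t := fun t => by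
      by_cases ht : t ∈ S x <;> simp [indicator, ht]
    simp_rw [e]
    rw [setIntegral_indicator (h.measurableSet_section x), inter_eq_right.2 (h.subset x hx)]
    rfl

lemma norm_iter_le (h : VolterraMajorant I S g G) (hk : VolterraKernel I S g k f C)
    (n : ℕ) : ∀ x ∈ I, ‖volterraIter S k f n x‖ ≤ C * (G x ^ n / n.factorial) := by
  induction n with
  | zero => intro x hx; simpa [volterraIter] using hk.bound_free x hx
  | succ n ih =>
    intro x hx
    have h1 : ‖∫ t in S x, k x t * volterraIter S k f n t‖ ≤
        ∫ t in S x, C / n.factorial * (g t * G t ^ n) := by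
      refine norm_integral_le_of_norm_le ((h.integrable x hx n).const_mul _) ?_
      filter_upwards [ae_restrict_mem (h.measurableSet_section x)] with t ht
      refine (norm_mul_le _ _).trans ?_
      calc ‖k x t‖ * ‖volterraIter S k f n t‖ ≤ g t * (C * (G t ^ n / n.factorial)) :=
            mul_le_mul (hk.bound x hx t ht) (ih t (h.subset x hx ht)) (norm_nonneg _) (h.nonneg t)
        _ = _ := by ring
    refine h1.trans (le_of_eq ?_)
    rw [integral_const_mul, h.integral x hx, Nat.factorial_succ]
    push_cast
    field_simp

lemma summable_iter (h : VolterraMajorant I S g G) (hk : VolterraKernel I S g k f C)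
    {x : ℝ} (hx : x ∈ I) : Summable fun n => ‖volterraIter S k f n x‖ :=
  .of_nonneg_of_le (fun _ => norm_nonneg _) (fun n => h.norm_iter_le hk n x hx)
    ((Real.summable_pow_div_factorial (G x)).mul_left C)

lemma aestronglyMeasurable_sol (h : VolterraMajorant I S g G) (hk : VolterraKernel I S g k f C) :
    AEStronglyMeasurable (volterraSol S k f) (volume.restrict I) := by
  refine aestronglyMeasurable_of_tendsto_ae atTop (f := fun (n : ℕ) x =>
    ∑ j ∈ Finset.range n, volterraIter S k f j x) (fun n => ?_) ?_
  · exact Finset.aestronglyMeasurable_fun_sum _ fun j _ => h.aestronglyMeasurable_iter hk j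
  · filter_upwards [ae_restrict_mem h.measurableSet_base] with x hx
    exact (h.summable_iter hk hx).of_norm.hasSum.tendsto_sum_nat

lemma norm_sol_le (h : VolterraMajorant I S g G) (hk : VolterraKernel I S g k f C)
    {x : ℝ} (hx : x ∈ I) : ‖volterraSol S k f x‖ ≤ C * Real.exp (G x) := by
  have h1 : HasSum (fun n : ℕ => C * (G x ^ n / n.factorial)) (C * Real.exp (G x)) := by
    rw [Real.exp_eq_exp_ℝ]
    exact (NormedSpace.expSeries_div_hasSum_exp (G x)).mul_left C
  exact tsum_of_norm_bounded h1 fun n => h.norm_iter_le hk n x hx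

lemma integrableOn_mul (h : VolterraMajorant I S g G) (hk : VolterraKernel I S g k f C)
    {x : ℝ} (hx : x ∈ I) {y : ℝ → 𝔸} (hy : AEStronglyMeasurable y (volume.restrict I)) {n : ℕ}
    {K : ℝ} (hyb : ∀ t ∈ S x, ‖y t‖ ≤ K * G t ^ n) :
    IntegrableOn (fun t => k x t * y t) (S x) := by
  refine Integrable.mono' ((h.integrable x hx n).const_mul K)
    (((hk.meas_slice x hx).mono_measure (Measure.restrict_mono (h.subset x hx) le_rfl)).mul
      (hy.mono_measure (Measure.restrict_mono (h.subset x hx) le_rfl))) ?_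
  filter_upwards [ae_restrict_mem (h.measurableSet_section x)] with t ht
  refine (norm_mul_le _ _).trans ?_
  calc ‖k x t‖ * ‖y t‖ ≤ g t * (K * G t ^ n) :=
        mul_le_mul (hk.bound x hx t ht) (hyb t ht) (norm_nonneg _) (h.nonneg t)
    _ = _ := by ring

/-- The sum of the Neumann series solves the Volterra equation. -/
lemma sol_eq (h : VolterraMajorant I S g G) (hk : VolterraKernel I S g k f C)
    {x : ℝ} (hx : x ∈ I) :
    volterraSol S k f x = f x + ∫ t in S x, k x t * volterraSol S k f t := by
  have hbn : ∀ n, ∀ t ∈ S x, ‖volterraIter S k f n t‖ ≤ C / n.factorial * G t ^ n :=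
    fun n t ht => (h.norm_iter_le hk n t (h.subset x hx ht)).trans (le_of_eq (by ring))
  have hint : ∀ n, IntegrableOn (fun t => k x t * volterraIter S k f n t) (S x) := fun n =>
    h.integrableOn_mul hk hx (h.aestronglyMeasurable_iter hk n) (hbn n)
  have hsum : Summable fun n => ∫ t in S x, ‖k x t * volterraIter S k f n t‖ := by
    refine .of_nonneg_of_le (fun _ => integral_nonneg fun _ => norm_nonneg _) (fun n => ?_)
      (((summable_nat_add_iff 1).2 (Real.summable_pow_div_factorial (G x))).mul_left C)
    have h1 : ∫ t in S x, ‖k x t * volterraIter S k f n t‖ ≤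
        ∫ t in S x, C / n.factorial * (g t * G t ^ n) := by
      refine integral_mono_ae (hint n).norm ((h.integrable x hx n).const_mul _) ?_
      filter_upwards [ae_restrict_mem (h.measurableSet_section x)] with t ht
      refine (norm_mul_le _ _).trans ?_
      calc ‖k x t‖ * ‖volterraIter S k f n t‖ ≤ g t * (C / n.factorial * G t ^ n) :=
            mul_le_mul (hk.bound x hx t ht) (hbn n t ht) (norm_nonneg _) (h.nonneg t)
        _ = _ := by ring
    refine h1.trans (le_of_eq ?_)
    rw [integral_const_mul, h.integral x hx, Nat.factorial_succ]
    push_cast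
    field_simp
  have h2 := hasSum_integral_of_summable_integral_norm hint hsum
  have h3 : ∫ t in S x, ∑' n, k x t * volterraIter S k f n t =
      ∫ t in S x, k x t * volterraSol S k f t := by
    refine setIntegral_congr_fun (h.measurableSet_section x) fun t ht => ?_
    exact (h.summable_iter hk (h.subset x hx ht)).of_norm.tsum_mul_left _
  rw [h3] at h2
  have h4 := (h.summable_iter hk hx).of_norm.tsum_eq_zero_add
  rw [volterraSol, h4]
  congr 1
  exact h2.tsum_eq

/-- Holomorphic dependence of the solution on a parameter. -/
lemma differentiableOn_sol (h : VolterraMajorant I S g G) {U : Set ℂ} (hU : IsOpen U)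
    {k : ℂ → ℝ → ℝ → 𝔸} {f : ℂ → ℝ → 𝔸} (hk : ∀ ρ ∈ U, VolterraKernel I S g (k ρ) (f ρ) C)
    (hkd : ∀ x ∈ I, ∀ t ∈ S x, DifferentiableOn ℂ (fun ρ => k ρ x t) U)
    (hfd : ∀ x ∈ I, DifferentiableOn ℂ (fun ρ => f ρ x) U) {x : ℝ} (hx : x ∈ I) :
    DifferentiableOn ℂ (fun ρ => volterraSol S (k ρ) (f ρ) x) U := by
  have hiter : ∀ n, ∀ x ∈ I, DifferentiableOn ℂ (fun ρ => volterraIter S (k ρ) (f ρ) n x) U := by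
    intro n
    induction n with
    | zero => exact hfd
    | succ n ih =>
      intro x hx
      refine differentiableOn_integral_of_dominated hU
        (b := fun t => C / n.factorial * (g t * G t ^ n)) (fun ρ hρ => ?_) ?_ ?_
        ((h.integrable x hx n).const_mul _)
      · exact ((hk ρ hρ).meas_slice x hx |>.mono_measure
          (Measure.restrict_mono (h.subset x hx) le_rfl)).mul
          ((h.aestronglyMeasurable_iter (hk ρ hρ) n).mono_measure
            (Measure.restrict_mono (h.subset x hx) le_rfl))
      · filter_upwards [ae_restrict_mem (h.measurableSet_section x)] with t ht
        exact (hkd x hx t ht).mul (ih t (h.subset x hx ht))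
      · filter_upwards [ae_restrict_mem (h.measurableSet_section x)] with t ht ρ hρ
        refine (norm_mul_le _ _).trans ?_
        calc ‖k ρ x t‖ * ‖volterraIter S (k ρ) (f ρ) n t‖
            ≤ g t * (C * (G t ^ n / n.factorial)) :=
              mul_le_mul ((hk ρ hρ).bound x hx t ht)
                (h.norm_iter_le (hk ρ hρ) n t (h.subset x hx ht)) (norm_nonneg _) (h.nonneg t)
          _ = _ := by ring
  exact Complex.differentiableOn_tsum_of_summable_norm
    ((Real.summable_pow_div_factorial (G x)).mul_left C) (fun n => hiter n x hx) hU
    fun n ρ hρ => h.norm_iter_le (hk ρ hρ) n x hx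

end VolterraMajorant

end Volterra

/-! ### The Cauchy problem for the second-order equation -/

section CauchyProblem

variable {𝔸 : Type*} [NormedRing 𝔸] [NormedAlgebra ℂ 𝔸] [CompleteSpace 𝔸]

/-- `Y`, with derivative `Y'`, is a solution of `Y'' + q Y = 0` on `[0, ∞)`. -/
structure IsSol (q Y Y' : ℝ → 𝔸) : Prop where
  prim : IsPrimitive Y Y'
  prim' : IsPrimitive Y' (fun x => -(q x * Y x))

/-- `Z`, with derivative `Z'`, is a solution of `Z'' + Z q = 0` on `[0, ∞)`. -/
structure IsSolStar (q Z Z' : ℝ → 𝔸) : Prop where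
  prim : IsPrimitive Z Z'
  prim' : IsPrimitive Z' (fun x => -(Z x * q x))

namespace IsSol

variable {q Y Y' W W' : ℝ → 𝔸}

lemma add (h : IsSol q Y Y') (h' : IsSol q W W') :
    IsSol q (fun x => Y x + W x) (fun x => Y' x + W' x) :=
  ⟨h.prim.add h'.prim, (h.prim'.add h'.prim').congr (fun _ _ => rfl) fun x _ => by
    rw [mul_add]; abel⟩

lemma mul_const (h : IsSol q Y Y') (c : 𝔸) :
    IsSol q (fun x => Y x * c) (fun x => Y' x * c) :=
  ⟨h.prim.mul_const c, (h.prim'.mul_const c).congr (fun _ _ => rfl) fun x _ => by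
    rw [neg_mul, mul_assoc]⟩

lemma sub (h : IsSol q Y Y') (h' : IsSol q W W') :
    IsSol q (fun x => Y x - W x) (fun x => Y' x - W' x) := by
  simpa [sub_eq_add_neg] using h.add (h'.mul_const (-1))

/-- The Wronskian `Z' Y - Z Y'` of a solution of the equation and a solution of the adjoint
equation is constant. -/
lemma wronskian_eq {Z Z' : ℝ → 𝔸} (h : IsSol q Y Y') (hZ : IsSolStar q Z Z') {x : ℝ}
    (hx : 0 ≤ x) : Z' x * Y x - Z x * Y' x = Z' 0 * Y 0 - Z 0 * Y' 0 := by
  have h1 := ((hZ.prim'.mul h.prim).sub (hZ.prim.mul h.prim')).congr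
    (g₁ := fun _ => (0 : 𝔸)) (fun _ _ => rfl) (fun x _ => by
      simp only [neg_mul, mul_neg, mul_assoc]; abel)
  have := h1.eq_add x hx
  simpa using this

/-- A solution with zero Cauchy data vanishes. -/
lemma eq_zero (h : IsSol q Y Y') (hq : ∀ x, 0 ≤ x → IntervalIntegrable q volume 0 x)
    (h0 : Y 0 = 0) (h0' : Y' 0 = 0) {x : ℝ} (hx : 0 ≤ x) : Y x = 0 ∧ Y' x = 0 := by
  have hmaj := volterraMajorant_forward (X := x) (g := fun t => 1 + ‖q t‖)
    (fun t => by positivity) (fun x hx => intervalIntegrable_const.add (hq x hx).norm)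
  obtain ⟨C, -, hC⟩ := h.prim.exists_bound x
  obtain ⟨D, -, hD⟩ := h.prim'.exists_bound x
  have hc : ContinuousOn (fun t => ‖Y t‖ + ‖Y' t‖) (Ici 0) :=
    h.prim.continuousOn.norm.add h.prim'.continuousOn.norm
  have key := hmaj.gronwall (y := fun t => ‖Y t‖ + ‖Y' t‖) (C := 0) (M := C + D) le_rfl
    (fun t _ => by positivity) (fun t ht => add_le_add (hC t ht) (hD t ht)) (fun t ht => ?_)
    (x := x) ⟨hx, le_rfl⟩
  · have h1 := norm_nonneg (Y x)
    have h2 := norm_nonneg (Y' x)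
    simp only [zero_mul] at key
    exact ⟨norm_eq_zero.1 (by linarith), norm_eq_zero.1 (by linarith)⟩
  · have hsub : Ioc 0 t ⊆ Ici (0 : ℝ) := fun s hs => hs.1.le
    have hi1 : IntegrableOn (fun s => (1 + ‖q s‖) * (‖Y s‖ + ‖Y' s‖)) (Ioc 0 t) := by
      refine Integrable.mul_bdd (c := C + D)
        ((intervalIntegrable_const.add (hq t ht.1).norm).1 : IntegrableOn _ _ _)
        ((hc.mono hsub).aestronglyMeasurable measurableSet_Ioc) ?_
      filter_upwards [ae_restrict_mem measurableSet_Ioc] with s hs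
      have hs' : s ∈ Icc 0 x := ⟨hs.1.le, hs.2.trans ht.2⟩
      rw [Real.norm_of_nonneg (by positivity)]
      exact add_le_add (hC s hs') (hD s hs')
    have e1 := h.prim.eq_add t ht.1
    have e2 := h.prim'.eq_add t ht.1
    rw [h0, zero_add, intervalIntegral.integral_of_le ht.1] at e1
    rw [h0', zero_add, intervalIntegral.integral_of_le ht.1] at e2
    have i1 : IntegrableOn Y' (Ioc 0 t) := (h.prim.intervalIntegrable t ht.1).1
    have i2 : IntegrableOn (fun x => -(q x * Y x)) (Ioc 0 t) :=
      (h.prim'.intervalIntegrable t ht.1).1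
    have b1 : ‖Y t‖ ≤ ∫ s in Ioc 0 t, ‖Y' s‖ := by
      rw [e1]; exact norm_integral_le_integral_norm _
    have b2 : ‖Y' t‖ ≤ ∫ s in Ioc 0 t, ‖-(q s * Y s)‖ := by
      rw [e2]; exact norm_integral_le_integral_norm _
    rw [zero_add]
    refine (add_le_add b1 b2).trans ?_
    rw [← integral_add i1.norm i2.norm]
    refine integral_mono (i1.norm.add i2.norm) hi1 fun s => ?_
    have := norm_mul_le (q s) (Y s)
    simp only [norm_neg]
    nlinarith [norm_nonneg (Y s), norm_nonneg (Y' s), norm_nonneg (q s),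
      mul_nonneg (norm_nonneg (q s)) (norm_nonneg (Y' s))]

lemma eqOn (h : IsSol q Y Y') (h' : IsSol q W W')
    (hq : ∀ x, 0 ≤ x → IntervalIntegrable q volume 0 x)
    (h0 : Y 0 = W 0) (h0' : Y' 0 = W' 0) {x : ℝ} (hx : 0 ≤ x) : Y x = W x ∧ Y' x = W' x := by
  have := (h.sub h').eq_zero hq (by simp [h0]) (by simp [h0']) hx
  exact ⟨sub_eq_zero.1 this.1, sub_eq_zero.1 this.2⟩

end IsSol

/-- `ρ² I + 2 i ρ Q₁(x) + Q₀(x)`. -/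
def pencilCoeff (Q₀ Q₁ : ℝ → 𝔸) (ρ : ℂ) (x : ℝ) : 𝔸 :=
  ρ ^ 2 • (1 : 𝔸) + (2 * Complex.I * ρ) • Q₁ x + Q₀ x

variable {Q₀ Q₁ : ℝ → 𝔸}

lemma intervalIntegrable_pencilCoeff (h₀ : ∀ x, 0 ≤ x → IntervalIntegrable Q₀ volume 0 x)
    (h₁ : ∀ x, 0 ≤ x → IntervalIntegrable Q₁ volume 0 x) (ρ : ℂ) (x : ℝ) (hx : 0 ≤ x) :
    IntervalIntegrable (pencilCoeff Q₀ Q₁ ρ) volume 0 x := by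
  have h1 : IntervalIntegrable (fun t => (2 * Complex.I * ρ) • Q₁ t) volume 0 x :=
    (h₁ x hx).smul (2 * Complex.I * ρ)
  exact (intervalIntegrable_const.add h1).add (h₀ x hx)

/-- The solution of `Y'' + (ρ² I + 2 i ρ Q₁ + Q₀) Y = 0` with `Y(0) = a`, `Y'(0) = b`. -/
def cauchySol (Q₀ Q₁ : ℝ → 𝔸) (a b : 𝔸) (ρ : ℂ) : ℝ → 𝔸 :=
  volterraSol (fun x => Ioc 0 x) (fun x t => ((t - x : ℝ) : ℂ) • pencilCoeff Q₀ Q₁ ρ t)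
    (fun x => a + (x : ℂ) • b)

/-- The derivative of `cauchySol`. -/
def cauchySolDeriv (Q₀ Q₁ : ℝ → 𝔸) (a b : 𝔸) (ρ : ℂ) (x : ℝ) : 𝔸 :=
  b - ∫ t in (0 : ℝ)..x, pencilCoeff Q₀ Q₁ ρ t * cauchySol Q₀ Q₁ a b ρ t

section

variable (h₀ : ∀ x, 0 ≤ x → IntervalIntegrable Q₀ volume 0 x)
  (h₁ : ∀ x, 0 ≤ x → IntervalIntegrable Q₁ volume 0 x) (a b : 𝔸)

include h₀ h₁

lemma cauchy_majorant (X K : ℝ) (hX : 0 ≤ X) (hK : 0 ≤ K) :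
    VolterraMajorant (Icc 0 X) (fun x => Ioc 0 x)
      (fun t => X * (K ^ 2 * ‖(1 : 𝔸)‖ + 2 * K * ‖Q₁ t‖ + ‖Q₀ t‖))
      (fun x => ∫ t in (0 : ℝ)..x, X * (K ^ 2 * ‖(1 : 𝔸)‖ + 2 * K * ‖Q₁ t‖ + ‖Q₀ t‖)) :=
  volterraMajorant_forward (fun t => by positivity) fun x hx =>
    ((intervalIntegrable_const.add ((h₁ x hx).norm.const_mul _)).add (h₀ x hx).norm).const_mul _

lemma norm_pencilCoeff_le {ρ : ℂ} {K : ℝ} (hρ : ‖ρ‖ ≤ K) (t : ℝ) :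
    ‖pencilCoeff Q₀ Q₁ ρ t‖ ≤ K ^ 2 * ‖(1 : 𝔸)‖ + 2 * K * ‖Q₁ t‖ + ‖Q₀ t‖ := by
  unfold pencilCoeff
  refine (norm_add₃_le).trans ?_
  rw [norm_smul, norm_smul, norm_pow]
  have : ‖2 * Complex.I * ρ‖ = 2 * ‖ρ‖ := by simp
  rw [this]
  gcongr

lemma cauchy_kernel (X K : ℝ) (hX : 0 ≤ X) (_ : 0 ≤ K) {ρ : ℂ} (hρ : ‖ρ‖ ≤ K) :
    VolterraKernel (Icc 0 X) (fun x => Ioc 0 x)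
      (fun t => X * (K ^ 2 * ‖(1 : 𝔸)‖ + 2 * K * ‖Q₁ t‖ + ‖Q₀ t‖))
      (fun x t => ((t - x : ℝ) : ℂ) • pencilCoeff Q₀ Q₁ ρ t)
      (fun x => a + (x : ℂ) • b) (‖a‖ + X * ‖b‖) := by
  have hqm : AEStronglyMeasurable (pencilCoeff Q₀ Q₁ ρ) (volume.restrict (Icc 0 X)) := by
    have := (intervalIntegrable_pencilCoeff h₀ h₁ ρ X hX).1
    rw [← integrableOn_Icc_iff_integrableOn_Ioc] at this
    exact this.1
  refine ⟨?_, fun x _ => ?_, ?_, fun x hx t ht => ?_, fun x hx => ?_⟩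
  · exact AEStronglyMeasurable.smul (f := fun p : ℝ × ℝ => ((p.2 - p.1 : ℝ) : ℂ))
      (by fun_prop) hqm.comp_snd
  · exact AEStronglyMeasurable.smul (f := fun t : ℝ => ((t - x : ℝ) : ℂ)) (by fun_prop) hqm
  · fun_prop
  · rw [norm_smul, Complex.norm_real, Real.norm_eq_abs]
    have h1 : |t - x| ≤ X := by rw [abs_le]; constructor <;> linarith [hx.1, hx.2, ht.1, ht.2]
    have := norm_pencilCoeff_le h₀ h₁ hρ t
    gcongr
  · refine (norm_add_le _ _).trans ?_
    rw [norm_smul, Complex.norm_real, Real.norm_of_nonneg hx.1]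
    gcongr
    exact hx.2

lemma isSol_cauchySol (ρ : ℂ) :
    IsSol (pencilCoeff Q₀ Q₁ ρ) (cauchySol Q₀ Q₁ a b ρ) (cauchySolDeriv Q₀ Q₁ a b ρ) := by
  set q := pencilCoeff Q₀ Q₁ ρ
  set Y := cauchySol Q₀ Q₁ a b ρ with hY
  have hw : ∀ x, 0 ≤ x → IntervalIntegrable (fun t => q t * Y t) volume 0 x := fun x hx => by
    have hmaj := cauchy_majorant h₀ h₁ x ‖ρ‖ hx (norm_nonneg _)
    have hk := cauchy_kernel h₀ h₁ a b x ‖ρ‖ hx (norm_nonneg _) le_rfl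
    have hqi := (intervalIntegrable_pencilCoeff h₀ h₁ ρ x hx).1
    rw [intervalIntegrable_iff, uIoc_of_le hx]
    set G := fun x' => ∫ t in (0 : ℝ)..x', x * (‖ρ‖ ^ 2 * ‖(1 : 𝔸)‖ + 2 * ‖ρ‖ * ‖Q₁ t‖ + ‖Q₀ t‖)
    have hGc : ContinuousOn (fun t => (‖a‖ + x * ‖b‖) * Real.exp (G t)) (Icc 0 x) := by
      refine continuousOn_const.mul (Real.continuous_exp.comp_continuousOn ?_)
      have hP : IsPrimitive G
        (fun t => x * (‖ρ‖ ^ 2 * ‖(1 : 𝔸)‖ + 2 * ‖ρ‖ * ‖Q₁ t‖ + ‖Q₀ t‖)) :=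
        ⟨fun x' hx' => ((intervalIntegrable_const.add ((h₁ x' hx').norm.const_mul _)).add
          (h₀ x' hx').norm).const_mul _, fun x _ => by simp [G]⟩
      exact hP.continuousOn.mono Icc_subset_Ici_self
    obtain ⟨B, hB⟩ := isCompact_Icc.exists_bound_of_continuousOn hGc
    refine Integrable.mono' (hqi.norm.mul_const B) (hqi.1.mul
      ((hmaj.aestronglyMeasurable_sol hk).mono_measure
        (Measure.restrict_mono Ioc_subset_Icc_self le_rfl))) ?_
    filter_upwards [ae_restrict_mem measurableSet_Ioc] with t ht
    have ht' : t ∈ Icc 0 x := ⟨ht.1.le, ht.2⟩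
    refine (norm_mul_le _ _).trans ?_
    have h1 := (hmaj.norm_sol_le hk ht').trans ((le_abs_self _).trans (hB t ht'))
    gcongr
    exact h1
  have hW : IsPrimitive (fun x => ∫ t in (0 : ℝ)..x, q t * Y t) (fun t => q t * Y t) :=
    ⟨hw, fun x _ => by simp⟩
  have hx : IsPrimitive (fun x : ℝ => (x : ℂ)) (fun _ => (1 : ℂ)) :=
    IsPrimitive.of_hasDerivAt (fun x => Complex.ofRealCLM.hasDerivAt) continuous_const
  have htw : ∀ x, 0 ≤ x → IntervalIntegrable (fun t : ℝ => (t : ℂ) • (q t * Y t)) volume 0 x :=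
    fun x hx => (hw x hx).continuousOn_smul (by fun_prop)
  have hW1 : IsPrimitive (fun x => ∫ t in (0 : ℝ)..x, (t : ℂ) • (q t * Y t))
      (fun t => (t : ℂ) • (q t * Y t)) := ⟨htw, fun x _ => by simp⟩
  constructor
  · have h1 := (((IsPrimitive.const a).add (hx.smul (IsPrimitive.const b))).add hW1).sub
      (hx.smul hW)
    refine h1.congr (fun x hx => ?_) (fun x hx => ?_)
    · have hmaj := cauchy_majorant h₀ h₁ x ‖ρ‖ hx (norm_nonneg _)
      have hk := cauchy_kernel h₀ h₁ a b x ‖ρ‖ hx (norm_nonneg _) le_rfl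
      have h2 := hmaj.sol_eq hk (x := x) ⟨hx, le_rfl⟩
      rw [hY, cauchySol, h2, add_sub_assoc]
      congr 1
      have hsm : IntervalIntegrable (fun t => (x : ℂ) • (q t * Y t)) volume 0 x :=
        (hw x hx).smul (x : ℂ)
      change _ = (∫ t in (0 : ℝ)..x, (t : ℂ) • (q t * Y t)) -
        (x : ℂ) • ∫ t in (0 : ℝ)..x, q t * Y t
      rw [← intervalIntegral.integral_smul, ← intervalIntegral.integral_sub (htw x hx) hsm,
        intervalIntegral.integral_of_le hx]
      refine integral_congr_ae (Eventually.of_forall fun t => ?_)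
      change ((t - x : ℝ) : ℂ) • q t * Y t = (t : ℂ) • (q t * Y t) - (x : ℂ) • (q t * Y t)
      rw [smul_mul_assoc, Complex.ofReal_sub, sub_smul]
    · simp only [cauchySolDeriv, smul_zero, one_smul, zero_add]
      abel
  · exact ((IsPrimitive.const b).sub hW).congr (fun _ _ => rfl) (fun x _ => by simp)

lemma cauchySol_zero (ρ : ℂ) : cauchySol Q₀ Q₁ a b ρ 0 = a := by
  have hmaj := cauchy_majorant h₀ h₁ 0 ‖ρ‖ le_rfl (norm_nonneg _)
  have hk := cauchy_kernel h₀ h₁ a b 0 ‖ρ‖ le_rfl (norm_nonneg _) le_rfl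
  have h2 := hmaj.sol_eq hk (x := 0) (by simp)
  rw [cauchySol, h2]
  simp

omit h₀ h₁ in
lemma cauchySolDeriv_zero (ρ : ℂ) : cauchySolDeriv Q₀ Q₁ a b ρ 0 = b := by
  simp [cauchySolDeriv]

lemma differentiable_cauchySol {x : ℝ} (hx : 0 ≤ x) :
    Differentiable ℂ (fun ρ => cauchySol Q₀ Q₁ a b ρ x) := by
  intro ρ₀
  have hK : 0 ≤ ‖ρ₀‖ + 1 := by positivity
  have hmaj := cauchy_majorant h₀ h₁ x (‖ρ₀‖ + 1) hx hK
  have hU : Metric.ball ρ₀ 1 ∈ 𝓝 ρ₀ := Metric.ball_mem_nhds _ one_pos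
  refine DifferentiableOn.differentiableAt (hmaj.differentiableOn_sol (C := ‖a‖ + x * ‖b‖)
    Metric.isOpen_ball (f := fun _ x => a + (x : ℂ) • b) (fun ρ hρ => ?_) (fun x _ t _ => ?_)
    (fun x _ => ?_) (x := x) ⟨hx, le_rfl⟩) hU
  · refine cauchy_kernel h₀ h₁ a b x _ hx hK ?_
    rw [Metric.mem_ball, dist_eq_norm] at hρ
    linarith [norm_le_norm_add_norm_sub' ρ ρ₀]
  · unfold pencilCoeff; fun_prop
  · fun_prop

lemma differentiable_cauchySolDeriv {x : ℝ} (hx : 0 ≤ x) :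
    Differentiable ℂ (fun ρ => cauchySolDeriv Q₀ Q₁ a b ρ x) := by
  intro ρ₀
  have hK : 0 ≤ ‖ρ₀‖ + 1 := by positivity
  have hmaj := cauchy_majorant h₀ h₁ x (‖ρ₀‖ + 1) hx hK
  have hU : Metric.ball ρ₀ 1 ∈ 𝓝 ρ₀ := Metric.ball_mem_nhds _ one_pos
  have hρK : ∀ ρ ∈ Metric.ball ρ₀ 1, ‖ρ‖ ≤ ‖ρ₀‖ + 1 := fun ρ hρ => by
    rw [Metric.mem_ball, dist_eq_norm] at hρ
    linarith [norm_le_norm_add_norm_sub' ρ ρ₀]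
  have hgi : IntegrableOn (fun t => (‖ρ₀‖ + 1) ^ 2 * ‖(1 : 𝔸)‖ + 2 * (‖ρ₀‖ + 1) * ‖Q₁ t‖ + ‖Q₀ t‖)
      (Ioc 0 x) :=
    ((intervalIntegrable_const.add ((h₁ x hx).norm.const_mul _)).add (h₀ x hx).norm).1
  set G := fun x' => ∫ t in (0 : ℝ)..x', x * ((‖ρ₀‖ + 1) ^ 2 * ‖(1 : 𝔸)‖ +
    2 * (‖ρ₀‖ + 1) * ‖Q₁ t‖ + ‖Q₀ t‖)
  have hGm : ∀ t ∈ Ioc 0 x, G t ≤ G x := fun t ht => by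
    refine intervalIntegral.integral_mono_interval le_rfl ht.1.le ht.2
      (Eventually.of_forall fun s => by positivity) ?_
    exact ((intervalIntegrable_const.add ((h₁ x hx).norm.const_mul _)).add
      (h₀ x hx).norm).const_mul _
  have key : DifferentiableOn ℂ (fun ρ => ∫ t in Ioc 0 x,
      pencilCoeff Q₀ Q₁ ρ t * cauchySol Q₀ Q₁ a b ρ t) (Metric.ball ρ₀ 1) := by
    refine differentiableOn_integral_of_dominated Metric.isOpen_ball
      (b := fun t => ((‖ρ₀‖ + 1) ^ 2 * ‖(1 : 𝔸)‖ + 2 * (‖ρ₀‖ + 1) * ‖Q₁ t‖ + ‖Q₀ t‖) *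
        ((‖a‖ + x * ‖b‖) * Real.exp (G x))) (fun ρ hρ => ?_) ?_ ?_ (hgi.mul_const _)
    · exact (((isSol_cauchySol h₀ h₁ a b ρ).prim'.neg.congr (fun _ _ => rfl)
        (g₁ := fun t => pencilCoeff Q₀ Q₁ ρ t * cauchySol Q₀ Q₁ a b ρ t)
        (fun _ _ => by simp)).intervalIntegrable x hx).1.1
    · filter_upwards [ae_restrict_mem measurableSet_Ioc] with t ht
      refine DifferentiableOn.mul ?_
        (differentiable_cauchySol h₀ h₁ a b ht.1.le).differentiableOn
      unfold pencilCoeff; fun_prop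
    · filter_upwards [ae_restrict_mem measurableSet_Ioc] with t ht ρ hρ
      have hk := cauchy_kernel h₀ h₁ a b x _ hx hK (hρK ρ hρ)
      have h1 := hmaj.norm_sol_le hk ⟨ht.1.le, ht.2⟩
      refine (norm_mul_le _ _).trans (mul_le_mul (norm_pencilCoeff_le h₀ h₁ (hρK ρ hρ) t)
        (h1.trans ?_) (norm_nonneg _) (by positivity))
      have := hGm t ht
      gcongr
  have := (key.differentiableAt hU).const_sub b
  refine this.congr_of_eventuallyEq (Eventually.of_forall fun ρ => ?_)
  simp only [cauchySolDeriv]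
  rw [intervalIntegral.integral_of_le hx]

end

/-! ### Splitting into exponentially growing and decaying parts -/

/-- The coefficient `Q₁ + Q₀ / (2 i ρ)` of the first-order system that is equivalent to the
second-order equation. -/
def pencilQ (Q₀ Q₁ : ℝ → 𝔸) (ρ : ℂ) (x : ℝ) : 𝔸 := Q₁ x + (2 * Complex.I * ρ)⁻¹ • Q₀ x

lemma pencilCoeff_eq {ρ : ℂ} (hρ : ρ ≠ 0) (x : ℝ) :
    pencilCoeff Q₀ Q₁ ρ x = ρ ^ 2 • (1 : 𝔸) + (2 * Complex.I * ρ) • pencilQ Q₀ Q₁ ρ x := by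
  have : 2 * Complex.I * ρ ≠ 0 := by simp [hρ]
  rw [pencilCoeff, pencilQ, smul_add, smul_smul, mul_inv_cancel₀ this, one_smul, add_assoc]

/-- With `u = (Y + Y' / (i ρ)) / 2` one has `u' = i ρ u - Q Y`, `Q = Q₁ + Q₀ / (2 i ρ)`; the
companion `v = (Y - Y' / (i ρ)) / 2` is `u` for `(-ρ, -Q₁)`. -/
lemma IsSol.exp_smul_split {ρ : ℂ} (hρ : ρ ≠ 0) {Y Y' : ℝ → 𝔸}
    (h : IsSol (pencilCoeff Q₀ Q₁ ρ) Y Y') :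
    IsPrimitive (fun x : ℝ => Complex.exp (-(Complex.I * ρ) * x) •
        ((2 : ℂ)⁻¹ • (Y x + (Complex.I * ρ)⁻¹ • Y' x)))
      (fun x : ℝ => -(Complex.exp (-(Complex.I * ρ) * x) • (pencilQ Q₀ Q₁ ρ x * Y x))) := by
  have hI : Complex.I * ρ ≠ 0 := mul_ne_zero Complex.I_ne_zero hρ
  refine ((IsPrimitive.cexp (-(Complex.I * ρ))).smul ((h.prim.add
    (h.prim'.const_smul (Complex.I * ρ)⁻¹)).const_smul (2 : ℂ)⁻¹)).congr (fun _ _ => rfl)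
    (fun x _ => ?_)
  rw [mul_comm (-(Complex.I * ρ)) (Complex.exp _), mul_smul, ← smul_add, ← smul_neg]
  congr 1
  rw [pencilCoeff_eq hρ]
  simp only [add_mul, smul_mul_assoc, one_mul, smul_add, smul_neg, smul_smul]
  have e1 : -(Complex.I * ρ) * (2⁻¹ * (Complex.I * ρ)⁻¹) = -(2 : ℂ)⁻¹ := by field_simp
  have e2 : (2 : ℂ)⁻¹ * ((Complex.I * ρ)⁻¹ * ρ ^ 2) = -(Complex.I * ρ) * 2⁻¹ := by
    field_simp
    rw [Complex.I_sq]; ring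
  have e3 : (2 : ℂ)⁻¹ * ((Complex.I * ρ)⁻¹ * (2 * Complex.I * ρ)) = 1 := by field_simp
  rw [e1, e2, e3]
  simp only [neg_smul, one_smul, neg_mul]
  abel

lemma pencilCoeff_neg (ρ : ℂ) (x : ℝ) :
    pencilCoeff Q₀ (fun x => -Q₁ x) (-ρ) x = pencilCoeff Q₀ Q₁ ρ x := by
  simp [pencilCoeff]

lemma pencilQ_neg (ρ : ℂ) (x : ℝ) :
    pencilQ Q₀ (fun x => -Q₁ x) (-ρ) x = -pencilQ Q₀ Q₁ ρ x := by
  simp only [pencilQ, mul_neg, inv_neg, neg_smul]; abel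

lemma norm_pencilQ_le' {ρ : ℂ} {r : ℝ} (hr : 0 < r) (hρ : r ≤ ‖ρ‖) (x : ℝ) :
    ‖pencilQ Q₀ Q₁ ρ x‖ ≤ ‖Q₁ x‖ + (2 * r)⁻¹ * ‖Q₀ x‖ := by
  refine (norm_add_le _ _).trans ?_
  rw [norm_smul, norm_inv]
  have : ‖2 * Complex.I * ρ‖ = 2 * ‖ρ‖ := by simp
  rw [this]
  gcongr

lemma norm_pencilQ_le {ρ : ℂ} (hρ : 1 ≤ ‖ρ‖) (x : ℝ) :
    ‖pencilQ Q₀ Q₁ ρ x‖ ≤ ‖Q₁ x‖ + ‖Q₀ x‖ := by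
  refine (norm_pencilQ_le' one_pos hρ x).trans ?_
  nlinarith [norm_nonneg (Q₀ x)]

lemma norm_exp_I_mul (ρ : ℂ) (x : ℝ) :
    ‖Complex.exp (-(Complex.I * ρ) * x)‖ = Real.exp (ρ.im * x) := by
  rw [Complex.norm_exp]; simp

/-- Solutions grow at most like `exp (|Im ρ| x)`, uniformly for `|ρ| ≥ 1`. -/
lemma IsSol.growth (h₀ : ∀ x, 0 ≤ x → IntervalIntegrable Q₀ volume 0 x)
    (h₁ : ∀ x, 0 ≤ x → IntervalIntegrable Q₁ volume 0 x) {x : ℝ} (hx : 0 ≤ x) :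
    ∃ C, 0 ≤ C ∧ ∀ ρ : ℂ, 1 ≤ ‖ρ‖ → ∀ Y Y' : ℝ → 𝔸, IsSol (pencilCoeff Q₀ Q₁ ρ) Y Y' →
      ‖Y x‖ ≤ C * (‖Y 0‖ + ‖Y' 0‖ / ‖ρ‖) * Real.exp (|ρ.im| * x) ∧
      ‖Y' x‖ ≤ C * (‖Y 0‖ + ‖Y' 0‖ / ‖ρ‖) * ‖ρ‖ * Real.exp (|ρ.im| * x) := by
  have hgi : ∀ x, 0 ≤ x → IntervalIntegrable (fun t => 2 * (‖Q₁ t‖ + ‖Q₀ t‖)) volume 0 x :=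
    fun x hx => ((h₁ x hx).norm.add (h₀ x hx).norm).const_mul _
  have hmaj := volterraMajorant_forward (X := x) (g := fun t => 2 * (‖Q₁ t‖ + ‖Q₀ t‖))
    (fun t => by positivity) hgi
  refine ⟨Real.exp (∫ t in (0 : ℝ)..x, 2 * (‖Q₁ t‖ + ‖Q₀ t‖)), (Real.exp_pos _).le,
    fun ρ hρ Y Y' hY => ?_⟩
  have hρ0 : ρ ≠ 0 := by rintro rfl; simp at hρ; linarith
  have hρn : 0 < ‖ρ‖ := by linarith
  have hY2 : IsSol (pencilCoeff Q₀ (fun x => -Q₁ x) (-ρ)) Y Y' := by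
    have : pencilCoeff Q₀ (fun x => -Q₁ x) (-ρ) = pencilCoeff Q₀ Q₁ ρ :=
      funext fun x => pencilCoeff_neg ρ x
    rwa [this]
  set u : ℝ → 𝔸 := fun x => (2 : ℂ)⁻¹ • (Y x + (Complex.I * ρ)⁻¹ • Y' x)
  set v : ℝ → 𝔸 := fun x => (2 : ℂ)⁻¹ • (Y x + (Complex.I * -ρ)⁻¹ • Y' x)
  have hYuv : ∀ t, Y t = u t + v t := fun t => by
    simp only [u, v, mul_neg, inv_neg, neg_smul, ← smul_add]
    rw [show Y t + (Complex.I * ρ)⁻¹ • Y' t + (Y t + -((Complex.I * ρ)⁻¹ • Y' t)) =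
      (2 : ℂ) • Y t by rw [two_smul]; abel, smul_smul]
    norm_num
  have hY'uv : ∀ t, Y' t = (Complex.I * ρ) • (u t - v t) := fun t => by
    simp only [u, v, mul_neg, inv_neg, neg_smul, ← smul_sub]
    rw [show Y t + (Complex.I * ρ)⁻¹ • Y' t - (Y t + -((Complex.I * ρ)⁻¹ • Y' t)) =
      (2 : ℂ) • (Complex.I * ρ)⁻¹ • Y' t by rw [two_smul]; abel, smul_smul, smul_smul, smul_smul]
    have : Complex.I * ρ * 2⁻¹ * 2 * (Complex.I * ρ)⁻¹ = 1 := by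
      have := Complex.I_ne_zero
      field_simp
    rw [this, one_smul]
  have hcY : ContinuousOn Y (Ici 0) := hY.prim.continuousOn
  have hcY' : ContinuousOn Y' (Ici 0) := hY.prim'.continuousOn
  have hcu : ContinuousOn u (Ici 0) := (hcY.add (hcY'.const_smul _)).const_smul _
  have hcv : ContinuousOn v (Ici 0) := (hcY.add (hcY'.const_smul _)).const_smul _
  set y : ℝ → ℝ := fun t => Real.exp (-(|ρ.im| * t)) * (‖u t‖ + ‖v t‖) with hy
  have hcy : ContinuousOn y (Ici 0) :=
    (Continuous.continuousOn (by fun_prop)).mul (hcu.norm.add hcv.norm)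
  obtain ⟨M, hM⟩ := isCompact_Icc.exists_bound_of_continuousOn
    (hcy.mono (Icc_subset_Ici_self : Icc 0 x ⊆ Ici 0))
  have hy0 : ∀ t, 0 ≤ y t := fun t => by positivity
  -- the same estimate serves `u` (for `(ρ, Q₁)`) and `v` (for `(-ρ, -Q₁)`)
  have hpart : ∀ (τ : ℂ) (Qτ : ℝ → 𝔸) (w : ℝ → 𝔸), |τ.im| = |ρ.im| →
      (∀ t, ‖Qτ t‖ ≤ ‖Q₁ t‖ + ‖Q₀ t‖) →
      IsPrimitive (fun x : ℝ => Complex.exp (-(Complex.I * τ) * x) • w x)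
        (fun x : ℝ => -(Complex.exp (-(Complex.I * τ) * x) • (Qτ x * Y x))) →
      ∀ t ∈ Icc 0 x, Real.exp (-(|ρ.im| * t)) * ‖w t‖ ≤ ‖w 0‖ +
        ∫ s in Ioc 0 t, (‖Q₁ s‖ + ‖Q₀ s‖) * y s := by
    intro τ Qτ w hτ hQτ hw t ht
    have e1 := hw.eq_add t ht.1
    simp only [Complex.ofReal_zero, mul_zero, Complex.exp_zero, one_smul] at e1
    have e2 : w t = Complex.exp (Complex.I * τ * t) • (w 0 + ∫ s in (0 : ℝ)..t,
        -(Complex.exp (-(Complex.I * τ) * s) • (Qτ s * Y s))) := by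
      rw [← e1, smul_smul, ← Complex.exp_add]
      simp
    rw [e2, norm_smul]
    have hn : ‖Complex.exp (Complex.I * τ * t)‖ = Real.exp (-τ.im * t) := by
      rw [Complex.norm_exp]; simp
    rw [hn, ← mul_assoc, ← Real.exp_add]
    have hyint : IntegrableOn (fun s => (‖Q₁ s‖ + ‖Q₀ s‖) * y s) (Ioc 0 t) := by
      refine Integrable.mul_bdd (c := M) ((h₁ t ht.1).norm.add (h₀ t ht.1).norm).1
        ((hcy.mono fun s hs => hs.1.le).aestronglyMeasurable measurableSet_Ioc) ?_
      filter_upwards [ae_restrict_mem measurableSet_Ioc] with s hs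
      exact hM s ⟨hs.1.le, hs.2.trans ht.2⟩
    set β := Real.exp (-(|ρ.im| * t) + -τ.im * t) with hβ
    have hβ1 : β ≤ 1 := by
      rw [hβ, Real.exp_le_one_iff, ← hτ]
      nlinarith [neg_abs_le τ.im, ht.1]
    have hβ0 : 0 ≤ β := (Real.exp_pos _).le
    have hint : β * ‖∫ s in (0 : ℝ)..t, -(Complex.exp (-(Complex.I * τ) * s) • (Qτ s * Y s))‖ ≤
        ∫ s in Ioc 0 t, (‖Q₁ s‖ + ‖Q₀ s‖) * y s := by
      rw [intervalIntegral.integral_of_le ht.1, ← Real.norm_of_nonneg hβ0]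
      have : ‖β‖ * ‖∫ s in Ioc 0 t, -(Complex.exp (-(Complex.I * τ) * s) • (Qτ s * Y s))‖ =
          ‖∫ s in Ioc 0 t, β • -(Complex.exp (-(Complex.I * τ) * s) • (Qτ s * Y s))‖ := by
        rw [integral_smul, norm_smul]
      rw [this]
      refine norm_integral_le_of_norm_le hyint ?_
      filter_upwards [ae_restrict_mem measurableSet_Ioc] with s hs
      rw [norm_smul, norm_neg, norm_smul, norm_exp_I_mul, Real.norm_of_nonneg hβ0, hβ,
        ← mul_assoc, ← Real.exp_add]
      have hexp : Real.exp (-(|ρ.im| * t) + -τ.im * t + τ.im * s) ≤ Real.exp (-(|ρ.im| * s)) := by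
        rw [Real.exp_le_exp, ← hτ]
        nlinarith [neg_abs_le τ.im, hs.2]
      calc _ ≤ Real.exp (-(|ρ.im| * s)) * ((‖Q₁ s‖ + ‖Q₀ s‖) * (‖u s‖ + ‖v s‖)) := by
            refine mul_le_mul hexp ((norm_mul_le _ _).trans (mul_le_mul (hQτ s) ?_
              (norm_nonneg _) (by positivity))) (norm_nonneg _) (Real.exp_pos _).le
            rw [hYuv]; exact norm_add_le _ _
        _ = _ := by rw [hy]; ring
    calc β * ‖w 0 + ∫ s in (0 : ℝ)..t, -(Complex.exp (-(Complex.I * τ) * s) • (Qτ s * Y s))‖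
        ≤ β * (‖w 0‖ + ‖∫ s in (0 : ℝ)..t,
          -(Complex.exp (-(Complex.I * τ) * s) • (Qτ s * Y s))‖) := by
          gcongr; exact norm_add_le _ _
      _ ≤ 1 * ‖w 0‖ + β * ‖∫ s in (0 : ℝ)..t,
          -(Complex.exp (-(Complex.I * τ) * s) • (Qτ s * Y s))‖ := by
          rw [mul_add]; gcongr
      _ ≤ _ := by rw [one_mul]; gcongr
  have hu := hpart ρ (pencilQ Q₀ Q₁ ρ) u rfl (fun t => norm_pencilQ_le hρ t)
    (hY.exp_smul_split hρ0)
  have hv := hpart (-ρ) (pencilQ Q₀ (fun x => -Q₁ x) (-ρ)) v (by simp)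
    (fun t => by rw [pencilQ_neg, norm_neg]; exact norm_pencilQ_le hρ t)
    (hY2.exp_smul_split (neg_ne_zero.2 hρ0))
  have key := hmaj.gronwall (y := y) (C := ‖u 0‖ + ‖v 0‖) (M := M) (by positivity)
    (fun t _ => hy0 t) (fun t ht => (le_abs_self _).trans (hM t ht)) (fun t ht => ?_)
    (x := x) ⟨hx, le_rfl⟩
  · have hw0 : ∀ τ : ℂ, ‖τ‖ = ‖ρ‖ → ‖(2 : ℂ)⁻¹ • (Y 0 + (Complex.I * τ)⁻¹ • Y' 0)‖ ≤
        (‖Y 0‖ + ‖Y' 0‖ / ‖ρ‖) / 2 := by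
      intro τ hτ
      rw [norm_smul]
      have : ‖Y 0 + (Complex.I * τ)⁻¹ • Y' 0‖ ≤ ‖Y 0‖ + ‖Y' 0‖ / ‖ρ‖ := by
        refine (norm_add_le _ _).trans ?_
        rw [norm_smul, norm_inv, norm_mul, Complex.norm_I, one_mul, hτ, div_eq_inv_mul]
      simp only [norm_inv, Complex.norm_ofNat]
      linarith
    have h1 := hw0 ρ rfl
    have h2 := hw0 (-ρ) (norm_neg ρ)
    have h3 : ‖u x‖ + ‖v x‖ ≤ Real.exp (∫ t in (0 : ℝ)..x, 2 * (‖Q₁ t‖ + ‖Q₀ t‖)) *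
        (‖Y 0‖ + ‖Y' 0‖ / ‖ρ‖) * Real.exp (|ρ.im| * x) := by
      have e : ‖u x‖ + ‖v x‖ = y x * Real.exp (|ρ.im| * x) := by
        rw [hy]; simp only
        rw [mul_right_comm, ← Real.exp_add]; simp
      rw [e]
      gcongr
      refine key.trans ?_
      rw [mul_comm]
      change ‖u 0‖ ≤ _ at h1
      change ‖v 0‖ ≤ _ at h2
      exact mul_le_mul_of_nonneg_left (by linarith) (Real.exp_pos _).le
    refine ⟨?_, ?_⟩
    · rw [hYuv x]; exact (norm_add_le _ _).trans h3
    · rw [hY'uv x, norm_smul, norm_mul, Complex.norm_I, one_mul]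
      calc ‖ρ‖ * ‖u x - v x‖ ≤ ‖ρ‖ * (‖u x‖ + ‖v x‖) := by gcongr; exact norm_sub_le _ _
        _ ≤ _ := mul_le_mul_of_nonneg_left h3 (norm_nonneg ρ)
        _ = _ := by ring
  · have h1 := hu t ht
    have h2 := hv t ht
    have e : ∫ s in Ioc 0 t, 2 * (‖Q₁ s‖ + ‖Q₀ s‖) * y s =
        2 * ∫ s in Ioc 0 t, (‖Q₁ s‖ + ‖Q₀ s‖) * y s := by
      rw [← integral_const_mul]; simp only [mul_assoc]
    rw [e]
    have : y t = Real.exp (-(|ρ.im| * t)) * ‖u t‖ + Real.exp (-(|ρ.im| * t)) * ‖v t‖ := by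
      rw [hy]; ring
    rw [this]
    linarith

end CauchyProblem

/-! ### Jost solutions -/

section Tail

variable {E : Type*} [NormedAddCommGroup E] [NormedSpace ℝ E]

lemma integral_norm_Ioi_le {h : ℝ → E} (hi : IntegrableOn h (Ioi 0)) {x : ℝ} (hx : 0 ≤ x) :
    ∫ t in Ioi x, ‖h t‖ ≤ ∫ t in Ioi 0, ‖h t‖ :=
  setIntegral_mono_set hi.norm (Eventually.of_forall fun _ => norm_nonneg _)
    (LE.le.eventuallyLE (Ioi_subset_Ioi hx))

/-- A function with an integrable derivative on the half-line is bounded. -/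
lemma IsPrimitive.norm_le_of_integrableOn {f g : ℝ → E} (h : IsPrimitive f g)
    (hg : IntegrableOn g (Ioi 0)) {x : ℝ} (hx : 0 ≤ x) :
    ‖f x‖ ≤ ‖f 0‖ + ∫ t in Ioi 0, ‖g t‖ := by
  rw [h.eq_add x hx]
  refine (norm_add_le _ _).trans ?_
  gcongr
  rw [intervalIntegral.integral_of_le hx]
  exact (norm_integral_le_integral_norm _).trans (setIntegral_mono_set hg.norm
    (Eventually.of_forall fun _ => norm_nonneg _) (LE.le.eventuallyLE Ioc_subset_Ioi_self))

/-- A function is an antiderivative of a continuous one if and only if it has that derivative. -/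
lemma isPrimitive_iff_hasDerivWithinAt {E : Type*} [NormedAddCommGroup E] [NormedSpace ℝ E]
    [CompleteSpace E] {f g : ℝ → E} (hg : ContinuousOn g (Ici 0)) :
    IsPrimitive f g ↔ ∀ x, 0 ≤ x → HasDerivWithinAt f (g x) (Ici 0) x := by
  have hgi : ∀ x, 0 ≤ x → IntervalIntegrable g volume 0 x := fun x hx =>
    (hg.mono (by rw [uIcc_of_le hx]; exact Icc_subset_Ici_self)).intervalIntegrable
  constructor
  · intro h x hx
    have hc : Continuous fun t => g (max t 0) :=
      hg.comp_continuous (by fun_prop) fun t => mem_Ici.2 (le_max_right t 0)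
    have h1 := ((hc.integral_hasStrictDerivAt 0 x).hasDerivAt.const_add (f 0)).hasDerivWithinAt
      (s := Ici 0)
    rw [max_eq_left hx] at h1
    have key : ∀ y ∈ Ici (0 : ℝ), f y = f 0 + ∫ t in (0 : ℝ)..y, g (max t 0) := fun y hy => by
      rw [h.eq_add y hy]
      congr 1
      refine intervalIntegral.integral_congr fun t ht => ?_
      rw [uIcc_of_le hy] at ht
      simp only [max_eq_left ht.1]
    exact h1.congr key (key x hx)
  · intro h
    refine ⟨hgi, fun x hx => ?_⟩
    rw [intervalIntegral.integral_eq_sub_of_hasDeriv_right (f := f) ?_ ?_ (hgi x hx)]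
    · abel
    · intro y hy
      rw [uIcc_of_le hx] at hy
      exact (h y hy.1).continuousWithinAt.mono (by rw [uIcc_of_le hx]; exact Icc_subset_Ici_self)
    · intro y hy
      rw [min_eq_left hx, max_eq_right hx] at hy
      exact (h y hy.1.le).mono (Ioi_subset_Ici hy.1.le)

end Tail

section Jost

variable {𝔸 : Type*} [NormedRing 𝔸] [NormedAlgebra ℂ 𝔸] [CompleteSpace 𝔸]

lemma norm_exp_two_I_mul (ρ : ℂ) (s : ℝ) :
    ‖Complex.exp (2 * Complex.I * ρ * s)‖ = Real.exp (-(2 * ρ.im * s)) := by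
  rw [Complex.norm_exp]; simp

lemma norm_exp_two_I_mul_le {ρ : ℂ} (hρ : 0 < ρ.im) {s : ℝ} (hs : 0 ≤ s) :
    ‖Complex.exp (2 * Complex.I * ρ * s)‖ ≤ 1 := by
  rw [norm_exp_two_I_mul, Real.exp_le_one_iff]
  have : 0 ≤ 2 * ρ.im * s := by positivity
  linarith

lemma integrableOn_exp_smul {ρ : ℂ} (hρ : 0 < ρ.im) {h : ℝ → 𝔸} (hi : IntegrableOn h (Ioi 0))
    {x : ℝ} (hx : 0 ≤ x) :
    IntegrableOn (fun t : ℝ => Complex.exp (2 * Complex.I * ρ * ((t - x : ℝ) : ℂ)) • h t)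
      (Ioi x) := by
  have hix := hi.mono_set (Ioi_subset_Ioi hx)
  refine Integrable.mono' hix.norm (AEStronglyMeasurable.smul
    (Continuous.aestronglyMeasurable (by fun_prop)) hix.1) ?_
  filter_upwards [ae_restrict_mem measurableSet_Ioi] with t ht
  rw [norm_smul]
  exact mul_le_of_le_one_left (norm_nonneg _)
    (norm_exp_two_I_mul_le hρ (sub_nonneg.2 (le_of_lt ht)))

lemma norm_integral_exp_smul_le {ρ : ℂ} (hρ : 0 < ρ.im) {h : ℝ → 𝔸} (hi : IntegrableOn h (Ioi 0))
    {x : ℝ} (hx : 0 ≤ x) :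
    ‖∫ t in Ioi x, Complex.exp (2 * Complex.I * ρ * ((t - x : ℝ) : ℂ)) • h t‖ ≤
      ∫ t in Ioi x, ‖h t‖ := by
  refine norm_integral_le_of_norm_le (hi.mono_set (Ioi_subset_Ioi hx)).norm ?_
  filter_upwards [ae_restrict_mem measurableSet_Ioi] with t ht
  rw [norm_smul]
  exact mul_le_of_le_one_left (norm_nonneg _)
    (norm_exp_two_I_mul_le hρ (sub_nonneg.2 (le_of_lt ht)))

lemma exp_smul_integral_Ioi (ρ : ℂ) (h : ℝ → 𝔸) (x : ℝ) :
    ∫ t in Ioi x, Complex.exp (2 * Complex.I * ρ * ((t - x : ℝ) : ℂ)) • h t =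
      Complex.exp (-(2 * Complex.I * ρ) * x) •
        ∫ t in Ioi x, Complex.exp (2 * Complex.I * ρ * t) • h t := by
  rw [← integral_smul]
  refine integral_congr_ae (Eventually.of_forall fun t => ?_)
  simp only
  rw [smul_smul, ← Complex.exp_add]
  congr 2
  push_cast; ring

lemma integrableOn_exp_smul' {ρ : ℂ} (hρ : 0 < ρ.im) {h : ℝ → 𝔸} (hi : IntegrableOn h (Ioi 0)) :
    IntegrableOn (fun t : ℝ => Complex.exp (2 * Complex.I * ρ * t) • h t) (Ioi 0) := by
  simpa using integrableOn_exp_smul hρ hi le_rfl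

/-- An oscillating integral of a function with an integrable derivative is `O(1 / ρ)`, uniformly
in the half-plane: integration by parts. -/
lemma norm_oscillating_integral_le {ρ : ℂ} (hρ : 0 < ρ.im) {h h' : ℝ → 𝔸} (hp : IsPrimitive h h')
    (hi : IntegrableOn h (Ioi 0)) (hi' : IntegrableOn h' (Ioi 0)) {x : ℝ} (hx : 0 ≤ x) :
    ‖∫ t in Ioi x, Complex.exp (2 * Complex.I * ρ * ((t - x : ℝ) : ℂ)) • h t‖ ≤
      (‖h 0‖ + 2 * ∫ t in Ioi 0, ‖h' t‖) / ‖ρ‖ := by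
  have hρ0 : ρ ≠ 0 := by rintro rfl; simp at hρ
  have hρn : 0 < ‖ρ‖ := norm_pos_iff.2 hρ0
  set c := 2 * Complex.I * ρ with hc
  have hF := (IsPrimitive.cexp c).smul hp
  have j1 := integrableOn_exp_smul' hρ hi
  have j2 := integrableOn_exp_smul' hρ hi'
  have hlim : Tendsto (fun X : ℝ => Complex.exp (c * X) • h X) atTop (𝓝 0) := by
    rw [tendsto_zero_iff_norm_tendsto_zero]
    have h1 : Tendsto (fun X : ℝ => Real.exp (-(2 * ρ.im * X)) *
        (‖h 0‖ + ∫ t in Ioi 0, ‖h' t‖)) atTop (𝓝 (0 * (‖h 0‖ + ∫ t in Ioi 0, ‖h' t‖))) :=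
      ((Real.tendsto_exp_neg_atTop_nhds_zero.comp
        (tendsto_id.const_mul_atTop (by positivity))).mul_const _)
    rw [zero_mul] at h1
    refine squeeze_zero' (Eventually.of_forall fun _ => norm_nonneg _) ?_ h1
    filter_upwards [eventually_ge_atTop 0] with X hX
    rw [norm_smul, norm_exp_two_I_mul]
    gcongr
    exact hp.norm_le_of_integrableOn hi' hX
  have hsum : IntegrableOn (fun t : ℝ => Complex.exp (c * t) • h' t +
      (c * Complex.exp (c * t)) • h t) (Ioi 0) := by
    refine j2.add ((j1.smul c).congr (Eventually.of_forall fun t => ?_))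
    simp only [Pi.smul_apply, smul_smul]; rfl
  have key : ∫ t in Ioi x, (Complex.exp (c * t) • h' t + (c * Complex.exp (c * t)) • h t) =
      -(Complex.exp (c * x) • h x) := by
    have h1 := intervalIntegral_tendsto_integral_Ioi x (hsum.mono_set (Ioi_subset_Ioi hx))
      tendsto_id
    refine tendsto_nhds_unique h1 ?_
    have h2 := hlim.sub_const (Complex.exp (c * x) • h x)
    rw [zero_sub] at h2
    refine h2.congr' ?_
    filter_upwards [eventually_ge_atTop x] with X hX
    exact (hF.integral_eq hx (hx.trans hX)).symm
  have j1x := j1.mono_set (Ioi_subset_Ioi hx)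
  have j2x := j2.mono_set (Ioi_subset_Ioi hx)
  have e : ∫ t in Ioi x, (Complex.exp (c * t) • h' t + (c * Complex.exp (c * t)) • h t) =
      (∫ t in Ioi x, Complex.exp (c * t) • h' t) + c • ∫ t in Ioi x, Complex.exp (c * t) • h t := by
    have j1c : IntegrableOn (fun t : ℝ => c • Complex.exp (c * t) • h t) (Ioi x) := j1x.smul c
    rw [← integral_smul, ← integral_add j2x j1c]
    refine integral_congr_ae (Eventually.of_forall fun t => ?_)
    simp only [smul_smul]
    rfl
  have e2 : c • ∫ t in Ioi x, Complex.exp (c * ((t - x : ℝ) : ℂ)) • h t =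
      -h x - ∫ t in Ioi x, Complex.exp (c * ((t - x : ℝ) : ℂ)) • h' t := by
    rw [hc, exp_smul_integral_Ioi, exp_smul_integral_Ioi, ← hc, smul_comm,
      eq_sub_of_add_eq' (e.symm.trans key), smul_sub, smul_neg, smul_smul, ← Complex.exp_add]
    simp
  have h3 : ‖c‖ = 2 * ‖ρ‖ := by simp [hc]
  have h4 : ‖c‖ * ‖∫ t in Ioi x, Complex.exp (c * ((t - x : ℝ) : ℂ)) • h t‖ ≤
      ‖h 0‖ + 2 * ∫ t in Ioi 0, ‖h' t‖ := by
    rw [← norm_smul, e2]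
    refine (norm_sub_le _ _).trans ?_
    rw [norm_neg]
    have h5 := hp.norm_le_of_integrableOn hi' hx
    have h6 := (norm_integral_exp_smul_le hρ hi' hx).trans (integral_norm_Ioi_le hi' hx)
    linarith
  rw [le_div_iff₀ hρn]
  rw [h3] at h4
  nlinarith [norm_nonneg (∫ t in Ioi x, Complex.exp (c * ((t - x : ℝ) : ℂ)) • h t)]

/-- The coefficients of a pencil on the half-line: `Q₀`, `Q₁` and `Q₁'` are integrable. -/
structure IntegrableCoeff (Q₀ Q₁ dQ₁ : ℝ → 𝔸) : Prop where
  int₀ : IntegrableOn Q₀ (Ioi 0)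
  int₁ : IntegrableOn Q₁ (Ioi 0)
  intd : IntegrableOn dQ₁ (Ioi 0)
  prim : IsPrimitive Q₁ dQ₁

/-- The function `exp (-i ρ x) e(x, ρ)`, where `e(x, ρ) ~ exp (i ρ x)` is the Jost solution in the
upper half-plane. It solves `y(x) = 1 + ∫ₓ^∞ (1 - exp (2 i ρ (t - x))) Q(t) y(t) dt`. -/
def jostY (Q₀ Q₁ : ℝ → 𝔸) (ρ : ℂ) : ℝ → 𝔸 :=
  volterraSol (fun x => Ioi x) (fun x t =>
    (1 - Complex.exp (2 * Complex.I * ρ * ((t - x : ℝ) : ℂ))) • pencilQ Q₀ Q₁ ρ t) (fun _ => 1)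

/-- The part of `jostY` that does not oscillate. -/
def jostU (Q₀ Q₁ : ℝ → 𝔸) (ρ : ℂ) (x : ℝ) : 𝔸 :=
  1 + ∫ t in Ioi x, pencilQ Q₀ Q₁ ρ t * jostY Q₀ Q₁ ρ t

/-- The oscillating part of `jostY`. -/
def jostV (Q₀ Q₁ : ℝ → 𝔸) (ρ : ℂ) (x : ℝ) : 𝔸 :=
  -∫ t in Ioi x, Complex.exp (2 * Complex.I * ρ * ((t - x : ℝ) : ℂ)) •
    (pencilQ Q₀ Q₁ ρ t * jostY Q₀ Q₁ ρ t)

/-- The Jost solution `e(x, ρ) ~ exp (i ρ x)`, `x → ∞`, for `Im ρ > 0`. -/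
def jost (Q₀ Q₁ : ℝ → 𝔸) (ρ : ℂ) (x : ℝ) : 𝔸 :=
  Complex.exp (Complex.I * ρ * x) • jostY Q₀ Q₁ ρ x

/-- The derivative of the Jost solution. -/
def jostDeriv (Q₀ Q₁ : ℝ → 𝔸) (ρ : ℂ) (x : ℝ) : 𝔸 :=
  (Complex.I * ρ * Complex.exp (Complex.I * ρ * x)) • (jostU Q₀ Q₁ ρ x - jostV Q₀ Q₁ ρ x)

namespace IntegrableCoeff

variable {Q₀ Q₁ dQ₁ : ℝ → 𝔸} (hQ : IntegrableCoeff Q₀ Q₁ dQ₁)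

include hQ

lemma integrableOn_pencilQ (ρ : ℂ) : IntegrableOn (pencilQ Q₀ Q₁ ρ) (Ioi 0) :=
  hQ.int₁.add (hQ.int₀.smul (2 * Complex.I * ρ)⁻¹)

lemma intervalIntegrable_zero (x : ℝ) (hx : 0 ≤ x) : IntervalIntegrable Q₀ volume 0 x :=
  hQ.int₀.intervalIntegrable_zero x hx

lemma intervalIntegrable_one (x : ℝ) (hx : 0 ≤ x) : IntervalIntegrable Q₁ volume 0 x :=
  hQ.int₁.intervalIntegrable_zero x hx

lemma intervalIntegrable_coeff (ρ : ℂ) (x : ℝ) (hx : 0 ≤ x) :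
    IntervalIntegrable (pencilCoeff Q₀ Q₁ ρ) volume 0 x :=
  intervalIntegrable_pencilCoeff hQ.intervalIntegrable_zero hQ.intervalIntegrable_one ρ x hx

/-- A function that is almost everywhere twice differentiable and satisfies the equation is a
solution. -/
lemma isSol_of_ae {ρ : ℂ} {Y Y' : ℝ → 𝔸}
    (hY : ∀ x, 0 ≤ x → HasDerivWithinAt Y (Y' x) (Ici 0) x)
    (hac : ∀ T, 0 < T → AbsolutelyContinuousOnInterval Y' 0 T)
    (he : ∀ᵐ x ∂(volume.restrict (Ioi (0 : ℝ))),
      HasDerivAt Y' (-(pencilCoeff Q₀ Q₁ ρ x * Y x)) x) :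
    IsSol (pencilCoeff Q₀ Q₁ ρ) Y Y' := by
  have hYc : ContinuousOn Y (Ici 0) := fun x hx => (hY x hx).continuousWithinAt
  have h' : IsPrimitive Y' (fun x => -(pencilCoeff Q₀ Q₁ ρ x * Y x)) :=
    .of_absolutelyContinuous hac (fun x hx => ((hQ.intervalIntegrable_coeff ρ x hx).mul_continuousOn
      (hYc.mono (by rw [uIcc_of_le hx]; exact Icc_subset_Ici_self))).neg) he
  exact ⟨(isPrimitive_iff_hasDerivWithinAt h'.continuousOn).2 hY, h'⟩

lemma integrableOn_majorant (r : ℝ) :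
    IntegrableOn (fun t => 2 * (‖Q₁ t‖ + (2 * r)⁻¹ * ‖Q₀ t‖)) (Ioi 0) :=
  (hQ.int₁.norm.add (hQ.int₀.norm.const_mul _)).const_mul 2

lemma jost_majorant {r : ℝ} (hr : 0 < r) :
    VolterraMajorant (Ici 0) (fun x => Ioi x) (fun t => 2 * (‖Q₁ t‖ + (2 * r)⁻¹ * ‖Q₀ t‖))
      (fun x => ∫ t in Ioi x, 2 * (‖Q₁ t‖ + (2 * r)⁻¹ * ‖Q₀ t‖)) :=
  volterraMajorant_backward (fun t => by positivity) (hQ.integrableOn_majorant r)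

lemma jost_kernel {r : ℝ} (hr : 0 < r) {ρ : ℂ} (hρ : 0 < ρ.im) (hρr : r ≤ ‖ρ‖) :
    VolterraKernel (Ici 0) (fun x => Ioi x) (fun t => 2 * (‖Q₁ t‖ + (2 * r)⁻¹ * ‖Q₀ t‖))
      (fun x t => (1 - Complex.exp (2 * Complex.I * ρ * ((t - x : ℝ) : ℂ))) • pencilQ Q₀ Q₁ ρ t)
      (fun _ => 1) ‖(1 : 𝔸)‖ := by
  have hqm : AEStronglyMeasurable (pencilQ Q₀ Q₁ ρ) (volume.restrict (Ici 0)) := by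
    have := hQ.integrableOn_pencilQ ρ
    rw [← integrableOn_Ici_iff_integrableOn_Ioi] at this
    exact this.1
  refine ⟨?_, fun x _ => ?_, aestronglyMeasurable_const, fun x hx t ht => ?_, fun x hx => le_rfl⟩
  · exact AEStronglyMeasurable.smul (f := fun p : ℝ × ℝ =>
      (1 - Complex.exp (2 * Complex.I * ρ * ((p.2 - p.1 : ℝ) : ℂ))))
      (Continuous.aestronglyMeasurable (by fun_prop)) hqm.comp_snd
  · exact AEStronglyMeasurable.smul (f := fun t : ℝ =>
      (1 - Complex.exp (2 * Complex.I * ρ * ((t - x : ℝ) : ℂ))))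
      (Continuous.aestronglyMeasurable (by fun_prop)) hqm
  · rw [norm_smul]
    refine mul_le_mul ?_ (norm_pencilQ_le' hr hρr t) (norm_nonneg _) (by norm_num)
    refine (norm_sub_le _ _).trans ?_
    have := norm_exp_two_I_mul_le hρ (sub_nonneg.2 (le_of_lt ht) : 0 ≤ t - x)
    rw [norm_one]
    linarith

lemma norm_jostY_le {r : ℝ} (hr : 0 < r) {ρ : ℂ} (hρ : 0 < ρ.im) (hρr : r ≤ ‖ρ‖) {x : ℝ}
    (hx : 0 ≤ x) : ‖jostY Q₀ Q₁ ρ x‖ ≤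
      ‖(1 : 𝔸)‖ * Real.exp (∫ t in Ioi 0, 2 * (‖Q₁ t‖ + (2 * r)⁻¹ * ‖Q₀ t‖)) := by
  refine ((hQ.jost_majorant hr).norm_sol_le (hQ.jost_kernel hr hρ hρr) hx).trans ?_
  exact mul_le_mul_of_nonneg_left (Real.exp_le_exp.2 (setIntegral_mono_set
    (hQ.integrableOn_majorant r) (Eventually.of_forall fun t => by positivity)
    (LE.le.eventuallyLE (Ioi_subset_Ioi hx)))) (norm_nonneg _)

lemma integrableOn_mul_jostY {ρ : ℂ} (hρ : 0 < ρ.im) {h : ℝ → 𝔸} (hh : IntegrableOn h (Ioi 0)) :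
    IntegrableOn (fun t => h t * jostY Q₀ Q₁ ρ t) (Ioi 0) := by
  have hρ0 : ρ ≠ 0 := by rintro rfl; simp at hρ
  have hr := norm_pos_iff.2 hρ0
  have hm : AEStronglyMeasurable (jostY Q₀ Q₁ ρ) (volume.restrict (Ioi 0)) :=
    ((hQ.jost_majorant hr).aestronglyMeasurable_sol (hQ.jost_kernel hr hρ le_rfl)).mono_measure
      (Measure.restrict_mono Ioi_subset_Ici_self le_rfl)
  refine Integrable.mono' (hh.norm.mul_const (‖(1 : 𝔸)‖ *
    Real.exp (∫ t in Ioi 0, 2 * (‖Q₁ t‖ + (2 * ‖ρ‖)⁻¹ * ‖Q₀ t‖)))) (hh.1.mul hm) ?_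
  filter_upwards [ae_restrict_mem measurableSet_Ioi] with t ht
  exact (norm_mul_le _ _).trans (mul_le_mul_of_nonneg_left
    (hQ.norm_jostY_le hr hρ le_rfl (le_of_lt ht)) (norm_nonneg _))

lemma integrableOn_jost {ρ : ℂ} (hρ : 0 < ρ.im) :
    IntegrableOn (fun t => pencilQ Q₀ Q₁ ρ t * jostY Q₀ Q₁ ρ t) (Ioi 0) :=
  hQ.integrableOn_mul_jostY hρ (hQ.integrableOn_pencilQ ρ)

lemma jostY_eq {ρ : ℂ} (hρ : 0 < ρ.im) {x : ℝ} (hx : 0 ≤ x) :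
    jostY Q₀ Q₁ ρ x = jostU Q₀ Q₁ ρ x + jostV Q₀ Q₁ ρ x := by
  have hρ0 : ρ ≠ 0 := by rintro rfl; simp at hρ
  have hr := norm_pos_iff.2 hρ0
  have h1 := (hQ.jost_majorant hr).sol_eq (hQ.jost_kernel hr hρ le_rfl) (x := x) hx
  have hi := hQ.integrableOn_jost hρ
  change jostY Q₀ Q₁ ρ x = 1 + ∫ t in Ioi x, ((1 - Complex.exp (2 * Complex.I * ρ *
    ((t - x : ℝ) : ℂ))) • pencilQ Q₀ Q₁ ρ t) * jostY Q₀ Q₁ ρ t at h1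
  rw [h1, jostU, jostV, add_assoc, ← sub_eq_add_neg, ← integral_sub
    (hi.mono_set (Ioi_subset_Ioi hx)) (integrableOn_exp_smul hρ hi hx)]
  congr 1
  refine integral_congr_ae (Eventually.of_forall fun t => ?_)
  simp only
  rw [smul_mul_assoc, sub_smul, one_smul]

lemma isPrimitive_jostU {ρ : ℂ} (hρ : 0 < ρ.im) : IsPrimitive (jostU Q₀ Q₁ ρ)
    (fun x => -(pencilQ Q₀ Q₁ ρ x * jostY Q₀ Q₁ ρ x)) :=
  ((IsPrimitive.const (1 : 𝔸)).add (isPrimitive_integral_Ioi (hQ.integrableOn_jost hρ))).congr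
    (fun _ _ => rfl) (fun _ _ => by simp)

lemma isPrimitive_jostV {ρ : ℂ} (hρ : 0 < ρ.im) : IsPrimitive (jostV Q₀ Q₁ ρ)
    (fun x => pencilQ Q₀ Q₁ ρ x * jostY Q₀ Q₁ ρ x - (2 * Complex.I * ρ) • jostV Q₀ Q₁ ρ x) := by
  have h1 := ((IsPrimitive.cexp (-(2 * Complex.I * ρ))).smul
    (isPrimitive_integral_Ioi (integrableOn_exp_smul' hρ (hQ.integrableOn_jost hρ)))).neg
  refine h1.congr (fun x _ => ?_) (fun x _ => ?_)
  · rw [jostV, exp_smul_integral_Ioi]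
  · rw [jostV, exp_smul_integral_Ioi]
    simp only [smul_neg, smul_smul, ← Complex.exp_add, neg_add, neg_neg, neg_mul, neg_smul,
      neg_add_cancel, Complex.exp_zero, one_smul, sub_neg_eq_add]

lemma isSol_jost {ρ : ℂ} (hρ : 0 < ρ.im) :
    IsSol (pencilCoeff Q₀ Q₁ ρ) (jost Q₀ Q₁ ρ) (jostDeriv Q₀ Q₁ ρ) := by
  have hρ0 : ρ ≠ 0 := by rintro rfl; simp at hρ
  have hU := hQ.isPrimitive_jostU hρ
  have hV := hQ.isPrimitive_jostV hρ
  have hE := IsPrimitive.cexp (Complex.I * ρ)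
  refine ⟨(hE.smul (hU.add hV)).congr (fun x hx => ?_) (fun x hx => ?_),
    ((hE.smul (hU.sub hV)).const_smul (Complex.I * ρ)).congr (fun x hx => ?_) (fun x hx => ?_)⟩
  · rw [jost, hQ.jostY_eq hρ hx]
  · rw [jostDeriv]
    module
  · rw [jostDeriv, smul_smul]
  · rw [jost, pencilCoeff_eq hρ0]
    have hy := hQ.jostY_eq hρ hx.le
    generalize jostY Q₀ Q₁ ρ x = y at hy ⊢
    generalize hw : pencilQ Q₀ Q₁ ρ x * y = w
    have hI : Complex.I ^ 2 = -1 := Complex.I_sq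
    rw [mul_smul_comm, add_mul, smul_mul_assoc, smul_mul_assoc, one_mul, hw, hy]
    linear_combination (norm := module) hI •
      (-(ρ ^ 2 * Complex.exp (Complex.I * ρ * x)) • (jostU Q₀ Q₁ ρ x + jostV Q₀ Q₁ ρ x))

lemma tendsto_jostU {ρ : ℂ} (hρ : 0 < ρ.im) : Tendsto (jostU Q₀ Q₁ ρ) atTop (𝓝 1) := by
  have := (tendsto_integral_Ioi_zero (hQ.integrableOn_jost hρ)).const_add (1 : 𝔸)
  rw [add_zero] at this
  exact this

lemma tendsto_jostV {ρ : ℂ} (hρ : 0 < ρ.im) : Tendsto (jostV Q₀ Q₁ ρ) atTop (𝓝 0) := by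
  have hi := hQ.integrableOn_jost hρ
  refine squeeze_zero_norm' ?_ (tendsto_integral_Ioi_zero hi.norm)
  filter_upwards [eventually_ge_atTop 0] with x hx
  rw [jostV, norm_neg]
  exact norm_integral_exp_smul_le hρ hi hx

lemma tendsto_jostY {ρ : ℂ} (hρ : 0 < ρ.im) : Tendsto (jostY Q₀ Q₁ ρ) atTop (𝓝 1) := by
  have := (hQ.tendsto_jostU hρ).add (hQ.tendsto_jostV hρ)
  rw [add_zero] at this
  refine this.congr' ?_
  filter_upwards [eventually_ge_atTop 0] with x hx
  rw [hQ.jostY_eq hρ hx]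

lemma norm_jostU_le {r : ℝ} (hr : 0 < r) {ρ : ℂ} (hρ : 0 < ρ.im) (hρr : r ≤ ‖ρ‖) {x : ℝ}
    (hx : 0 ≤ x) {Y : ℝ} (hY : ∀ t, 0 ≤ t → ‖jostY Q₀ Q₁ ρ t‖ ≤ Y) :
    ‖jostU Q₀ Q₁ ρ x‖ ≤ ‖(1 : 𝔸)‖ + (∫ t in Ioi 0, (‖Q₁ t‖ + (2 * r)⁻¹ * ‖Q₀ t‖)) * Y := by
  refine (norm_add_le _ _).trans ?_
  gcongr
  have hi := hQ.integrableOn_jost hρ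
  refine (norm_integral_le_integral_norm _).trans ((integral_norm_Ioi_le hi hx).trans ?_)
  rw [← integral_mul_const]
  refine setIntegral_mono_on hi.norm ((hQ.int₁.norm.add (hQ.int₀.norm.const_mul _)).mul_const _)
    measurableSet_Ioi fun t ht => ?_
  exact (norm_mul_le _ _).trans (mul_le_mul (norm_pencilQ_le' hr hρr t) (hY t (le_of_lt ht))
    (norm_nonneg _) (by positivity))

lemma norm_jostV_le {r : ℝ} (hr : 0 < r) {ρ : ℂ} (hρ : 0 < ρ.im) (hρr : r ≤ ‖ρ‖) {x : ℝ}
    (hx : 0 ≤ x) {Y : ℝ} (hY : ∀ t, 0 ≤ t → ‖jostY Q₀ Q₁ ρ t‖ ≤ Y) :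
    ‖jostV Q₀ Q₁ ρ x‖ ≤ (∫ t in Ioi 0, (‖Q₁ t‖ + (2 * r)⁻¹ * ‖Q₀ t‖)) * Y := by
  have hi := hQ.integrableOn_jost hρ
  rw [jostV, norm_neg]
  refine (norm_integral_exp_smul_le hρ hi hx).trans ((integral_norm_Ioi_le hi hx).trans ?_)
  rw [← integral_mul_const]
  refine setIntegral_mono_on hi.norm ((hQ.int₁.norm.add (hQ.int₀.norm.const_mul _)).mul_const _)
    measurableSet_Ioi fun t ht => ?_
  exact (norm_mul_le _ _).trans (mul_le_mul (norm_pencilQ_le' hr hρr t) (hY t (le_of_lt ht))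
    (norm_nonneg _) (by positivity))

lemma limit_kernel : VolterraKernel (Ici 0) (fun x => Ioi x) (fun t => ‖Q₁ t‖)
    (fun _ t => Q₁ t) (fun _ => 1) ‖(1 : 𝔸)‖ := by
  have hqm : AEStronglyMeasurable Q₁ (volume.restrict (Ici 0)) := by
    have := hQ.int₁
    rw [← integrableOn_Ici_iff_integrableOn_Ioi] at this
    exact this.1
  exact ⟨hqm.comp_snd, fun x _ => hqm, aestronglyMeasurable_const, fun _ _ _ _ => le_rfl,
    fun x hx => le_rfl⟩

end IntegrableCoeff

/-- The leading coefficient `c(x)` of `exp (-i ρ x) e(x, ρ)` as `ρ → ∞` in the upper half-plane: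
`c' = -Q₁ c`, `c(∞) = 1`. -/
def jostLimit (Q₁ : ℝ → 𝔸) : ℝ → 𝔸 :=
  volterraSol (fun x => Ioi x) (fun _ t => Q₁ t) (fun _ => 1)

lemma integral_add_add {α E : Type*} [MeasurableSpace α] {μ : Measure α} [NormedAddCommGroup E]
    [NormedSpace ℝ E] {f g h : α → E} (hf : Integrable f μ) (hg : Integrable g μ)
    (hh : Integrable h μ) :
    ∫ a, (f a + (g a + h a)) ∂μ = (∫ a, f a ∂μ) + ((∫ a, g a ∂μ) + ∫ a, h a ∂μ) := by
  rw [← integral_add hg hh]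
  exact integral_add hf (hg.add hh)

lemma IntegrableOn.mul_of_bound {h f : ℝ → 𝔸} (hh : IntegrableOn h (Ioi 0)) {C : ℝ}
    (hf : AEStronglyMeasurable f (volume.restrict (Ioi 0))) (hC : ∀ x, 0 ≤ x → ‖f x‖ ≤ C) :
    IntegrableOn (fun t => h t * f t) (Ioi 0) := by
  refine Integrable.mono' (hh.norm.mul_const C) (hh.1.mul hf) ?_
  filter_upwards [ae_restrict_mem measurableSet_Ioi] with t ht
  exact (norm_mul_le _ _).trans (mul_le_mul_of_nonneg_left (hC t (le_of_lt ht)) (norm_nonneg _))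

lemma ContinuousOn.aestronglyMeasurable_Ioi {E : Type*} [NormedAddCommGroup E] {f : ℝ → E}
    (hf : ContinuousOn f (Ici 0)) : AEStronglyMeasurable f (volume.restrict (Ioi 0)) :=
  (hf.mono Ioi_subset_Ici_self).aestronglyMeasurable measurableSet_Ioi

namespace IntegrableCoeff

variable {Q₀ Q₁ dQ₁ : ℝ → 𝔸} (hQ : IntegrableCoeff Q₀ Q₁ dQ₁)

include hQ

lemma limit_majorant : VolterraMajorant (Ici 0) (fun x => Ioi x) (fun t => ‖Q₁ t‖)
      (fun x => ∫ t in Ioi x, ‖Q₁ t‖) :=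
  volterraMajorant_backward (fun _ => norm_nonneg _) hQ.int₁.norm

lemma norm_jostLimit_le {x : ℝ} (hx : 0 ≤ x) :
    ‖jostLimit Q₁ x‖ ≤ ‖(1 : 𝔸)‖ * Real.exp (∫ t in Ioi 0, ‖Q₁ t‖) :=
  (hQ.limit_majorant.norm_sol_le hQ.limit_kernel hx).trans
    (mul_le_mul_of_nonneg_left (Real.exp_le_exp.2 (integral_norm_Ioi_le hQ.int₁ hx))
      (norm_nonneg _))

lemma integrableOn_mul_jostLimit : IntegrableOn (fun t => Q₁ t * jostLimit Q₁ t) (Ioi 0) :=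
  IntegrableOn.mul_of_bound hQ.int₁
    ((hQ.limit_majorant.aestronglyMeasurable_sol hQ.limit_kernel).mono_measure
      (Measure.restrict_mono Ioi_subset_Ici_self le_rfl)) fun _ hx => hQ.norm_jostLimit_le hx

lemma jostLimit_eq {x : ℝ} (hx : 0 ≤ x) :
    jostLimit Q₁ x = 1 + ∫ t in Ioi x, Q₁ t * jostLimit Q₁ t :=
  hQ.limit_majorant.sol_eq hQ.limit_kernel hx

lemma isPrimitive_jostLimit :
    IsPrimitive (jostLimit Q₁) (fun x => -(Q₁ x * jostLimit Q₁ x)) :=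
  ((IsPrimitive.const (1 : 𝔸)).add (isPrimitive_integral_Ioi hQ.integrableOn_mul_jostLimit)).congr
    (fun _ hx => hQ.jostLimit_eq hx) (fun _ _ => by simp)

lemma tendsto_jostLimit : Tendsto (jostLimit Q₁) atTop (𝓝 1) := by
  have := (tendsto_integral_Ioi_zero hQ.integrableOn_mul_jostLimit).const_add (1 : 𝔸)
  rw [add_zero] at this
  refine this.congr' ?_
  filter_upwards [eventually_ge_atTop 0] with x hx
  rw [hQ.jostLimit_eq hx]

/-- Uniform asymptotics of the Jost solution as `ρ → ∞` in the upper half-plane, where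
`exp (-i ρ x) e(x, ρ) = u + v` with `u`, `v` the functions `jostU`, `jostV`: the oscillating part
`v` is `O(1 / ρ)` by partial integration, and `u` is close to its limit `c(x)`. -/
lemma jost_asymptotics : ∃ C, 0 ≤ C ∧ ∀ ρ : ℂ, 0 < ρ.im → 1 ≤ ‖ρ‖ → ∀ x : ℝ, 0 ≤ x →
    ‖jostU Q₀ Q₁ ρ x‖ ≤ C ∧ ‖jostV Q₀ Q₁ ρ x‖ ≤ C / ‖ρ‖ ∧
      ‖jostU Q₀ Q₁ ρ x - jostLimit Q₁ x‖ ≤ C / ‖ρ‖ := by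
  set Y := ‖(1 : 𝔸)‖ * Real.exp (∫ t in Ioi 0, 2 * (‖Q₁ t‖ + (2 * 1)⁻¹ * ‖Q₀ t‖)) with hYdef
  set A := ∫ t in Ioi 0, (‖Q₁ t‖ + (2 * 1)⁻¹ * ‖Q₀ t‖) with hAdef
  have hY0 : 0 ≤ Y := by positivity
  have hA0 : 0 ≤ A := setIntegral_nonneg measurableSet_Ioi fun t _ => by positivity
  set N := ‖(1 : 𝔸)‖ + A * Y with hN
  have hN0 : 0 ≤ N := by positivity
  set q := ‖Q₁ 0‖ + ∫ t in Ioi 0, ‖dQ₁ t‖ with hq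
  have hq0 : 0 ≤ q := add_nonneg (norm_nonneg _) (integral_nonneg fun t => norm_nonneg _)
  have hqb : ∀ x, 0 ≤ x → ‖Q₁ x‖ ≤ q := fun x hx => hQ.prim.norm_le_of_integrableOn hQ.intd hx
  set D := ∫ t in Ioi 0, ‖dQ₁ t‖ with hD
  have hD0 : 0 ≤ D := integral_nonneg fun t => norm_nonneg _
  set B := ∫ t in Ioi 0, ‖Q₀ t‖ with hB
  have hB0 : 0 ≤ B := integral_nonneg fun t => norm_nonneg _
  set q1 := ∫ t in Ioi 0, ‖Q₁ t‖ with hq1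
  have hq10 : 0 ≤ q1 := integral_nonneg fun t => norm_nonneg _
  set K := q * N + 2 * (q * (A * Y) + D * N) + B * Y with hK
  have hK0 : 0 ≤ K := by positivity
  set K2 := q1 * (K * Real.exp q1) + B * Y with hK2
  have hK20 : 0 ≤ K2 := by positivity
  refine ⟨N + K * Real.exp q1 + K2 * Real.exp q1, by positivity, fun ρ hρ hρ1 x hx => ?_⟩
  have hρn : 0 < ‖ρ‖ := one_pos.trans_le hρ1
  have hinv : ‖(2 * Complex.I * ρ)⁻¹‖ ≤ 1 / ‖ρ‖ := by
    rw [norm_inv, one_div]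
    have : ‖2 * Complex.I * ρ‖ = 2 * ‖ρ‖ := by simp
    rw [this]
    exact inv_anti₀ hρn (by linarith)
  have hy : ∀ t, 0 ≤ t → ‖jostY Q₀ Q₁ ρ t‖ ≤ Y := fun t ht => hQ.norm_jostY_le one_pos hρ hρ1 ht
  have hu : ∀ t, 0 ≤ t → ‖jostU Q₀ Q₁ ρ t‖ ≤ N := fun t ht =>
    hQ.norm_jostU_le one_pos hρ hρ1 ht hy
  have hv : ∀ t, 0 ≤ t → ‖jostV Q₀ Q₁ ρ t‖ ≤ A * Y := fun t ht =>
    hQ.norm_jostV_le one_pos hρ hρ1 ht hy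
  have hUp := hQ.isPrimitive_jostU hρ
  have hVp := hQ.isPrimitive_jostV hρ
  have hcp := hQ.isPrimitive_jostLimit
  have mU := hUp.continuousOn.aestronglyMeasurable_Ioi
  have mV := hVp.continuousOn.aestronglyMeasurable_Ioi
  have mQ := hQ.prim.continuousOn.aestronglyMeasurable_Ioi
  have iU : IntegrableOn (fun t => Q₁ t * jostU Q₀ Q₁ ρ t) (Ioi 0) :=
    IntegrableOn.mul_of_bound hQ.int₁ mU hu
  have iV : IntegrableOn (fun t => Q₁ t * jostV Q₀ Q₁ ρ t) (Ioi 0) :=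
    IntegrableOn.mul_of_bound hQ.int₁ mV hv
  have i0 : IntegrableOn (fun t => (2 * Complex.I * ρ)⁻¹ • (Q₀ t * jostY Q₀ Q₁ ρ t)) (Ioi 0) :=
    (hQ.integrableOn_mul_jostY hρ hQ.int₀).smul (2 * Complex.I * ρ)⁻¹
  have hsplit : ∀ t, 0 ≤ t → pencilQ Q₀ Q₁ ρ t * jostY Q₀ Q₁ ρ t =
      Q₁ t * jostU Q₀ Q₁ ρ t + (Q₁ t * jostV Q₀ Q₁ ρ t +
        (2 * Complex.I * ρ)⁻¹ • (Q₀ t * jostY Q₀ Q₁ ρ t)) := fun t ht => by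
    rw [pencilQ, add_mul, smul_mul_assoc]
    nth_rw 1 [hQ.jostY_eq hρ ht]
    rw [mul_add, add_assoc]
  have iQy := hQ.integrableOn_jost hρ
  have hQy : ∫ t in Ioi 0, ‖pencilQ Q₀ Q₁ ρ t * jostY Q₀ Q₁ ρ t‖ ≤ A * Y := by
    rw [← integral_mul_const]
    refine setIntegral_mono_on iQy.norm ((hQ.int₁.norm.add (hQ.int₀.norm.const_mul _)).mul_const _)
      measurableSet_Ioi fun t ht => ?_
    exact (norm_mul_le _ _).trans (mul_le_mul (norm_pencilQ_le' one_pos hρ1 t) (hy t (le_of_lt ht))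
      (norm_nonneg _) (by positivity))
  have hQ0y : ∀ x, 0 ≤ x → ∫ t in Ioi x, ‖(2 * Complex.I * ρ)⁻¹ • (Q₀ t * jostY Q₀ Q₁ ρ t)‖ ≤
      B * Y / ‖ρ‖ := fun x hx => by
    refine (integral_norm_Ioi_le i0 hx).trans ?_
    rw [div_eq_mul_one_div, ← integral_mul_const, ← integral_mul_const]
    refine setIntegral_mono_on i0.norm ((hQ.int₀.norm.mul_const _).mul_const _)
      measurableSet_Ioi fun t ht => ?_
    rw [norm_smul, mul_comm]
    refine mul_le_mul ((norm_mul_le _ _).trans (mul_le_mul_of_nonneg_left (hy t (le_of_lt ht))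
      (norm_nonneg _))) hinv (norm_nonneg _) (by positivity)
  -- in the integral equation for `v` the term with `Q₁ u` oscillates, the term with `Q₁ v` is left
  -- to the Gronwall inequality, and the term with `Q₀` carries the factor `1 / ρ`
  have hV : ∀ x, 0 ≤ x → ‖jostV Q₀ Q₁ ρ x‖ ≤ K * Real.exp q1 / ‖ρ‖ := by
    have hp := hQ.prim.mul hUp
    have i1 : IntegrableOn (fun t => Q₁ t * -(pencilQ Q₀ Q₁ ρ t * jostY Q₀ Q₁ ρ t)) (Ioi 0) := by
      refine Integrable.mono' (iQy.norm.const_mul q) (mQ.mul iQy.1.neg) ?_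
      filter_upwards [ae_restrict_mem measurableSet_Ioi] with t ht
      refine (norm_mul_le _ _).trans ?_
      rw [norm_neg]
      exact mul_le_mul_of_nonneg_right (hqb t (le_of_lt ht)) (norm_nonneg _)
    have i2 : IntegrableOn (fun t => dQ₁ t * jostU Q₀ Q₁ ρ t) (Ioi 0) :=
      IntegrableOn.mul_of_bound hQ.intd mU hu
    have hder : ∫ t in Ioi 0, ‖Q₁ t * -(pencilQ Q₀ Q₁ ρ t * jostY Q₀ Q₁ ρ t) +
        dQ₁ t * jostU Q₀ Q₁ ρ t‖ ≤ q * (A * Y) + D * N := by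
      have h1 : ∫ t in Ioi 0, ‖Q₁ t * -(pencilQ Q₀ Q₁ ρ t * jostY Q₀ Q₁ ρ t) +
          dQ₁ t * jostU Q₀ Q₁ ρ t‖ ≤
          ∫ t in Ioi 0, (q * ‖pencilQ Q₀ Q₁ ρ t * jostY Q₀ Q₁ ρ t‖ + ‖dQ₁ t‖ * N) := by
        refine setIntegral_mono_on (i1.add i2).norm ((iQy.norm.const_mul q).add
          (hQ.intd.norm.mul_const N)) measurableSet_Ioi fun t ht => ?_
        refine (norm_add_le _ _).trans (add_le_add ?_ ?_)
        · refine (norm_mul_le _ _).trans ?_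
          rw [norm_neg]
          exact mul_le_mul_of_nonneg_right (hqb t (le_of_lt ht)) (norm_nonneg _)
        · exact (norm_mul_le _ _).trans (mul_le_mul_of_nonneg_left (hu t (le_of_lt ht))
            (norm_nonneg _))
      rw [integral_add (iQy.norm.const_mul q) (hQ.intd.norm.mul_const N), integral_const_mul,
        integral_mul_const] at h1
      refine h1.trans (add_le_add (mul_le_mul_of_nonneg_left hQy hq0) le_rfl)
    have hosc : ∀ x, 0 ≤ x → ‖∫ t in Ioi x, Complex.exp (2 * Complex.I * ρ * ((t - x : ℝ) : ℂ)) •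
        (Q₁ t * jostU Q₀ Q₁ ρ t)‖ ≤ (q * N + 2 * (q * (A * Y) + D * N)) / ‖ρ‖ := fun x hx => by
      refine (norm_oscillating_integral_le hρ hp iU (i1.add i2) hx).trans ?_
      gcongr
      exact (norm_mul_le _ _).trans (mul_le_mul (hqb 0 le_rfl) (hu 0 le_rfl) (norm_nonneg _) hq0)
    have hstep : ∀ x ∈ Ici (0 : ℝ), ‖jostV Q₀ Q₁ ρ x‖ ≤ K / ‖ρ‖ +
        ∫ t in Ioi x, ‖Q₁ t‖ * ‖jostV Q₀ Q₁ ρ t‖ := fun x hx => by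
      have hx0 : 0 ≤ x := hx
      have e : jostV Q₀ Q₁ ρ x =
          -((∫ t in Ioi x, Complex.exp (2 * Complex.I * ρ * ((t - x : ℝ) : ℂ)) •
            (Q₁ t * jostU Q₀ Q₁ ρ t)) +
          ((∫ t in Ioi x, Complex.exp (2 * Complex.I * ρ * ((t - x : ℝ) : ℂ)) •
            (Q₁ t * jostV Q₀ Q₁ ρ t)) +
          ∫ t in Ioi x, Complex.exp (2 * Complex.I * ρ * ((t - x : ℝ) : ℂ)) •
            ((2 * Complex.I * ρ)⁻¹ • (Q₀ t * jostY Q₀ Q₁ ρ t)))) := by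
        rw [← integral_add_add (integrableOn_exp_smul hρ iU hx) (integrableOn_exp_smul hρ iV hx)
            (integrableOn_exp_smul hρ i0 hx), jostV]
        congr 1
        refine setIntegral_congr_fun measurableSet_Ioi fun t ht => ?_
        rw [hsplit t (hx0.trans (le_of_lt ht)), smul_add, smul_add]
      rw [e, norm_neg]
      refine (norm_add_le _ _).trans ((add_le_add (hosc x hx) (norm_add_le _ _)).trans ?_)
      have h2 := (norm_integral_exp_smul_le hρ i0 hx).trans (hQ0y x hx)
      have h3 : ‖∫ t in Ioi x, Complex.exp (2 * Complex.I * ρ * ((t - x : ℝ) : ℂ)) •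
            (Q₁ t * jostV Q₀ Q₁ ρ t)‖ ≤ ∫ t in Ioi x, ‖Q₁ t‖ * ‖jostV Q₀ Q₁ ρ t‖ := by
        refine (norm_integral_exp_smul_le hρ iV hx).trans ?_
        have hsub : Ioi x ⊆ Ioi 0 := Ioi_subset_Ioi hx
        refine setIntegral_mono_on (IntegrableOn.mono_set iV.norm hsub) ?_ measurableSet_Ioi
          fun t ht => norm_mul_le _ _
        refine Integrable.mono' (IntegrableOn.mono_set (hQ.int₁.norm.mul_const (A * Y)) hsub)
          ((hQ.int₁.norm.1.mul mV.norm).mono_measure (Measure.restrict_mono hsub le_rfl)) ?_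
        filter_upwards [ae_restrict_mem measurableSet_Ioi] with t ht
        rw [norm_mul, norm_norm, norm_norm]
        exact mul_le_mul_of_nonneg_left (hv t (hx0.trans (le_of_lt ht))) (norm_nonneg _)
      have : K / ‖ρ‖ = (q * N + 2 * (q * (A * Y) + D * N)) / ‖ρ‖ + B * Y / ‖ρ‖ := by
        rw [hK, add_div]
      linarith
    intro x hx
    have h1 := hQ.limit_majorant.gronwall (C := K / ‖ρ‖) (M := A * Y) (by positivity)
      (y := fun x => ‖jostV Q₀ Q₁ ρ x‖) (fun x _ => norm_nonneg _) (fun x hx => hv x hx) hstep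
      (x := x) hx
    refine h1.trans ?_
    rw [mul_div_right_comm]
    exact mul_le_mul_of_nonneg_left (Real.exp_le_exp.2 (integral_norm_Ioi_le hQ.int₁ hx))
      (by positivity)
  -- `u` solves the integral equation of `c` up to terms with `v` and `Q₀ / ρ`
  have hUc : ∀ x, 0 ≤ x → ‖jostU Q₀ Q₁ ρ x - jostLimit Q₁ x‖ ≤ K2 * Real.exp q1 / ‖ρ‖ := by
    set N2 := N + ‖(1 : 𝔸)‖ * Real.exp q1
    have hb : ∀ x, 0 ≤ x → ‖jostU Q₀ Q₁ ρ x - jostLimit Q₁ x‖ ≤ N2 := fun x hx =>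
      (norm_sub_le _ _).trans (add_le_add (hu x hx) (hQ.norm_jostLimit_le hx))
    have mW := (hUp.sub hcp).continuousOn.aestronglyMeasurable_Ioi
    have iW : IntegrableOn (fun t => Q₁ t * (jostU Q₀ Q₁ ρ t - jostLimit Q₁ t)) (Ioi 0) :=
      IntegrableOn.mul_of_bound hQ.int₁ mW hb
    have ic := hQ.integrableOn_mul_jostLimit
    have hstep : ∀ x ∈ Ici (0 : ℝ), ‖jostU Q₀ Q₁ ρ x - jostLimit Q₁ x‖ ≤ K2 / ‖ρ‖ +
        ∫ t in Ioi x, ‖Q₁ t‖ * ‖jostU Q₀ Q₁ ρ t - jostLimit Q₁ t‖ := fun x hx => by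
      have hx0 : 0 ≤ x := hx
      have hsub : Ioi x ⊆ Ioi 0 := Ioi_subset_Ioi hx
      have e : jostU Q₀ Q₁ ρ x - jostLimit Q₁ x =
          (∫ t in Ioi x, Q₁ t * (jostU Q₀ Q₁ ρ t - jostLimit Q₁ t)) +
          ((∫ t in Ioi x, Q₁ t * jostV Q₀ Q₁ ρ t) +
          ∫ t in Ioi x, (2 * Complex.I * ρ)⁻¹ • (Q₀ t * jostY Q₀ Q₁ ρ t)) := by
        rw [← integral_add_add (iW.mono_set hsub) (iV.mono_set hsub) (i0.mono_set hsub), jostU,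
          hQ.jostLimit_eq hx, add_sub_add_left_eq_sub,
          ← integral_sub (iQy.mono_set hsub) (ic.mono_set hsub)]
        refine setIntegral_congr_fun measurableSet_Ioi fun t ht => ?_
        rw [hsplit t (hx0.trans (le_of_lt ht)), mul_sub]
        abel
      rw [e]
      refine (norm_add_le _ _).trans ((add_le_add_right (norm_add_le _ _) _).trans ?_)
      have h2 := (norm_integral_le_integral_norm _).trans (hQ0y x hx)
      have h3 : ‖∫ t in Ioi x, Q₁ t * jostV Q₀ Q₁ ρ t‖ ≤ q1 * (K * Real.exp q1) / ‖ρ‖ := by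
        refine (norm_integral_le_integral_norm _).trans ((integral_norm_Ioi_le iV hx).trans ?_)
        rw [mul_div_assoc, ← integral_mul_const]
        exact setIntegral_mono_on iV.norm (hQ.int₁.norm.mul_const _) measurableSet_Ioi
          fun t ht => (norm_mul_le _ _).trans (mul_le_mul_of_nonneg_left (hV t (le_of_lt ht))
            (norm_nonneg _))
      have h4 : ‖∫ t in Ioi x, Q₁ t * (jostU Q₀ Q₁ ρ t - jostLimit Q₁ t)‖ ≤
          ∫ t in Ioi x, ‖Q₁ t‖ * ‖jostU Q₀ Q₁ ρ t - jostLimit Q₁ t‖ := by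
        refine (norm_integral_le_integral_norm _).trans ?_
        refine setIntegral_mono_on (IntegrableOn.mono_set iW.norm hsub) ?_ measurableSet_Ioi
          fun t ht => norm_mul_le _ _
        refine Integrable.mono' (IntegrableOn.mono_set (hQ.int₁.norm.mul_const N2) hsub)
          ((hQ.int₁.norm.1.mul mW.norm).mono_measure (Measure.restrict_mono hsub le_rfl)) ?_
        filter_upwards [ae_restrict_mem measurableSet_Ioi] with t ht
        rw [norm_mul, norm_norm, norm_norm]
        exact mul_le_mul_of_nonneg_left (hb t (hx0.trans (le_of_lt ht))) (norm_nonneg _)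
      have : K2 / ‖ρ‖ = q1 * (K * Real.exp q1) / ‖ρ‖ + B * Y / ‖ρ‖ := by rw [hK2, add_div]
      linarith
    intro x hx
    have h1 := hQ.limit_majorant.gronwall (C := K2 / ‖ρ‖) (M := N2) (by positivity)
      (y := fun x => ‖jostU Q₀ Q₁ ρ x - jostLimit Q₁ x‖) (fun x _ => norm_nonneg _)
      (fun x hx => hb x hx) hstep (x := x) hx
    refine h1.trans ?_
    rw [mul_div_right_comm]
    exact mul_le_mul_of_nonneg_left (Real.exp_le_exp.2 (integral_norm_Ioi_le hQ.int₁ hx))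
      (by positivity)
  have p1 : 0 ≤ K * Real.exp q1 := by positivity
  have p2 : 0 ≤ K2 * Real.exp q1 := by positivity
  refine ⟨(hu x hx).trans (by linarith), (hV x hx).trans ?_, (hUc x hx).trans ?_⟩ <;> gcongr <;>
    linarith

lemma differentiableOn_jostY {x : ℝ} (hx : 0 ≤ x) :
    DifferentiableOn ℂ (fun ρ => jostY Q₀ Q₁ ρ x) {ρ | 0 < ρ.im} := by
  intro ρ₀ hρ₀
  have hr : 0 < ρ₀.im / 2 := half_pos hρ₀
  have hU : IsOpen {ρ : ℂ | ρ₀.im / 2 < ρ.im} := isOpen_lt continuous_const Complex.continuous_im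
  have hUρ : {ρ : ℂ | ρ₀.im / 2 < ρ.im} ∈ 𝓝 ρ₀ :=
    hU.mem_nhds (show ρ₀.im / 2 < ρ₀.im from half_lt_self hρ₀)
  have hle : ∀ ρ ∈ {ρ : ℂ | ρ₀.im / 2 < ρ.im}, ρ₀.im / 2 ≤ ‖ρ‖ := fun ρ hρ =>
    (le_of_lt hρ).trans ((le_abs_self _).trans (Complex.abs_im_le_norm ρ))
  refine (DifferentiableOn.differentiableAt ((hQ.jost_majorant hr).differentiableOn_sol
    (C := ‖(1 : 𝔸)‖) hU
    (fun ρ hρ => hQ.jost_kernel hr (hr.trans hρ) (hle ρ hρ)) (fun x hx t ht => ?_)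
    (fun x hx => differentiableOn_const _) (x := x) hx) hUρ).differentiableWithinAt
  have he : DifferentiableOn ℂ (fun ρ : ℂ => 1 - Complex.exp (2 * Complex.I * ρ *
      ((t - x : ℝ) : ℂ))) {ρ : ℂ | ρ₀.im / 2 < ρ.im} := by fun_prop
  refine he.smul ?_
  unfold pencilQ
  refine (differentiableOn_const _).add (DifferentiableOn.smul_const (DifferentiableOn.inv
    (by fun_prop) fun ρ hρ => ?_) _)
  have := norm_pos_iff.1 (hr.trans_le (hle ρ hρ))
  simp [this]

lemma differentiableOn_jost_zero :
    DifferentiableOn ℂ (fun ρ => jost Q₀ Q₁ ρ 0) {ρ | 0 < ρ.im} := by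
  simpa [jost] using hQ.differentiableOn_jostY le_rfl

lemma differentiableOn_jostDeriv_zero :
    DifferentiableOn ℂ (fun ρ => jostDeriv Q₀ Q₁ ρ 0) {ρ | 0 < ρ.im} := by
  intro ρ₀ hρ₀
  have hr : 0 < ρ₀.im / 2 := half_pos hρ₀
  have hU : IsOpen {ρ : ℂ | ρ₀.im / 2 < ρ.im} := isOpen_lt continuous_const Complex.continuous_im
  have hUρ : {ρ : ℂ | ρ₀.im / 2 < ρ.im} ∈ 𝓝 ρ₀ :=
    hU.mem_nhds (show ρ₀.im / 2 < ρ₀.im from half_lt_self hρ₀)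
  have hle : ∀ ρ ∈ {ρ : ℂ | ρ₀.im / 2 < ρ.im}, ρ₀.im / 2 ≤ ‖ρ‖ := fun ρ hρ =>
    (le_of_lt hρ).trans ((le_abs_self _).trans (Complex.abs_im_le_norm ρ))
  have hsub : {ρ : ℂ | ρ₀.im / 2 < ρ.im} ⊆ {ρ | 0 < ρ.im} := fun ρ hρ => hr.trans hρ
  set Y := ‖(1 : 𝔸)‖ * Real.exp (∫ t in Ioi 0, 2 * (‖Q₁ t‖ + (2 * (ρ₀.im / 2))⁻¹ * ‖Q₀ t‖))
  have hd : ∀ t, 0 ≤ t → DifferentiableOn ℂ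
      (fun ρ => pencilQ Q₀ Q₁ ρ t * jostY Q₀ Q₁ ρ t) {ρ : ℂ | ρ₀.im / 2 < ρ.im} := fun t ht => by
    refine DifferentiableOn.mul ?_ ((hQ.differentiableOn_jostY ht).mono hsub)
    unfold pencilQ
    refine (differentiableOn_const _).add (DifferentiableOn.smul_const (DifferentiableOn.inv
      (by fun_prop) fun ρ hρ => ?_) _)
    have := norm_pos_iff.1 (hr.trans_le (hle ρ hρ))
    simp [this]
  have hb : ∀ t, 0 ≤ t → ∀ ρ ∈ {ρ : ℂ | ρ₀.im / 2 < ρ.im},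
      ‖pencilQ Q₀ Q₁ ρ t * jostY Q₀ Q₁ ρ t‖ ≤
        (‖Q₁ t‖ + (2 * (ρ₀.im / 2))⁻¹ * ‖Q₀ t‖) * Y := fun t ht ρ hρ =>
    (norm_mul_le _ _).trans (mul_le_mul (norm_pencilQ_le' hr (hle ρ hρ) t)
      (hQ.norm_jostY_le hr (hsub hρ) (hle ρ hρ) ht) (norm_nonneg _) (by positivity))
  have hbi : IntegrableOn (fun t => (‖Q₁ t‖ + (2 * (ρ₀.im / 2))⁻¹ * ‖Q₀ t‖) * Y) (Ioi 0) :=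
    (hQ.int₁.norm.add (hQ.int₀.norm.const_mul _)).mul_const _
  have h1 : DifferentiableOn ℂ (fun ρ => ∫ t in Ioi 0, pencilQ Q₀ Q₁ ρ t * jostY Q₀ Q₁ ρ t)
      {ρ : ℂ | ρ₀.im / 2 < ρ.im} := by
    refine differentiableOn_integral_of_dominated hU
      (fun ρ hρ => (hQ.integrableOn_jost (hsub hρ)).1) ?_ ?_ hbi
    · filter_upwards [ae_restrict_mem measurableSet_Ioi] with t ht using hd t (le_of_lt ht)
    · filter_upwards [ae_restrict_mem measurableSet_Ioi] with t ht using hb t (le_of_lt ht)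
  have h2 : DifferentiableOn ℂ (fun ρ => ∫ t in Ioi (0 : ℝ),
      Complex.exp (2 * Complex.I * ρ * t) • (pencilQ Q₀ Q₁ ρ t * jostY Q₀ Q₁ ρ t))
      {ρ : ℂ | ρ₀.im / 2 < ρ.im} := by
    refine differentiableOn_integral_of_dominated hU
      (fun ρ hρ => (integrableOn_exp_smul' (hsub hρ) (hQ.integrableOn_jost (hsub hρ))).1) ?_ ?_ hbi
    · filter_upwards [ae_restrict_mem measurableSet_Ioi] with t ht
      have he : DifferentiableOn ℂ (fun ρ : ℂ => Complex.exp (2 * Complex.I * ρ * t))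
        {ρ : ℂ | ρ₀.im / 2 < ρ.im} := by fun_prop
      exact he.smul (hd t (le_of_lt ht))
    · filter_upwards [ae_restrict_mem measurableSet_Ioi] with t ht ρ hρ
      rw [norm_smul]
      exact (mul_le_of_le_one_left (norm_nonneg _)
        (norm_exp_two_I_mul_le (hsub hρ) (le_of_lt ht))).trans (hb t (le_of_lt ht) ρ hρ)
  have h3 : DifferentiableOn ℂ (fun ρ => jostDeriv Q₀ Q₁ ρ 0) {ρ : ℂ | ρ₀.im / 2 < ρ.im} := by
    unfold jostDeriv jostU jostV
    have he : DifferentiableOn ℂ (fun ρ : ℂ => Complex.I * ρ * Complex.exp (Complex.I * ρ *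
        ((0 : ℝ) : ℂ))) {ρ : ℂ | ρ₀.im / 2 < ρ.im} := by fun_prop
    refine he.smul (((differentiableOn_const _).add h1).sub ?_)
    refine h2.neg.congr fun ρ hρ => ?_
    simp
  exact (h3.differentiableAt hUρ).differentiableWithinAt

end IntegrableCoeff

end Jost

/-! ### Matrix pencils -/

section Entries

variable {m : ℕ}

/-- The entry of a matrix, as a continuous linear functional. -/
def entryCLM (j k : Fin m) : Matrix (Fin m) (Fin m) ℂ →L[ℝ] ℂ :=
  LinearMap.toContinuousLinearMap (Matrix.entryLinearMap ℝ ℂ j k)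

/-- The matrix unit at a given place, as a continuous linear map of the coefficient. -/
def singleCLM (j k : Fin m) : ℂ →L[ℝ] Matrix (Fin m) (Fin m) ℂ :=
  LinearMap.toContinuousLinearMap (Matrix.singleLinearMap ℝ j k)

/-- Transposition, as a continuous linear map. -/
def transposeCLM (m : ℕ) : Matrix (Fin m) (Fin m) ℂ →L[ℂ] Matrix (Fin m) (Fin m) ℂ :=
  LinearMap.toContinuousLinearMap (Matrix.transposeLinearEquiv (Fin m) (Fin m) ℂ ℂ).toLinearMap

@[simp] lemma transposeCLM_apply (A : Matrix (Fin m) (Fin m) ℂ) :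
    transposeCLM m A = A.transpose := rfl

lemma sum_singleCLM (A : Matrix (Fin m) (Fin m) ℂ) : ∑ j, ∑ k, singleCLM j k (A j k) = A :=
  (Matrix.matrix_eq_sum_single A).symm

lemma norm_entry_le (A : Matrix (Fin m) (Fin m) ℂ) (j k : Fin m) : ‖A j k‖ ≤ ‖A‖ := by
  rw [Matrix.linfty_opNorm_def]
  have h1 : ‖A j k‖₊ ≤ ∑ k, ‖A j k‖₊ :=
    Finset.single_le_sum (f := fun k => ‖A j k‖₊) (fun _ _ => zero_le) (Finset.mem_univ k)
  exact_mod_cast h1.trans (Finset.le_sup (f := fun i => ∑ k, ‖A i k‖₊) (Finset.mem_univ j))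

lemma norm_matrix_le {A : Matrix (Fin m) (Fin m) ℂ} {C : ℝ} (hC : 0 ≤ C)
    (h : ∀ j, ∑ k, ‖A j k‖ ≤ C) : ‖A‖ ≤ C := by
  lift C to NNReal using hC
  rw [Matrix.linfty_opNorm_def]
  refine NNReal.coe_le_coe.2 (Finset.sup_le fun j _ => ?_)
  have := h j
  rw [← NNReal.coe_le_coe]
  push_cast
  exact this

lemma norm_transpose_le (A : Matrix (Fin m) (Fin m) ℂ) : ‖A.transpose‖ ≤ m * ‖A‖ := by
  refine norm_matrix_le (by positivity) fun j => ?_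
  refine (Finset.sum_le_sum fun k _ => norm_entry_le A k j).trans ?_
  simp

lemma integrable_of_sum_clm {ι α E F : Type*} [MeasurableSpace α] {μ : Measure α}
    [NormedAddCommGroup E] [NormedSpace ℝ E] [NormedAddCommGroup F] [NormedSpace ℝ F] (s : Finset ι)
    (σ : ι → F →L[ℝ] E) {f : α → E} {g : ι → α → F} (hfg : ∀ a, ∑ i ∈ s, σ i (g i a) = f a)
    (h : ∀ i ∈ s, Integrable (g i) μ) : Integrable f μ := by
  refine (integrable_finsetSum s fun i hi => (σ i).integrable_comp (h i hi)).congr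
    (Eventually.of_forall hfg)

lemma absolutelyContinuousOnInterval_of_sum_clm {ι E F : Type*} [NormedAddCommGroup E]
    [NormedSpace ℝ E] [NormedAddCommGroup F] [NormedSpace ℝ F] (s : Finset ι)
    (σ : ι → F →L[ℝ] E) {f : ℝ → E} {g : ι → ℝ → F} {a b : ℝ}
    (hfg : ∀ a, ∑ i ∈ s, σ i (g i a) = f a)
    (h : ∀ i ∈ s, AbsolutelyContinuousOnInterval (g i) a b) :
    AbsolutelyContinuousOnInterval f a b := by
  have : f = fun a => ∑ i ∈ s, σ i (g i a) := funext fun a => (hfg a).symm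
  rw [this]
  clear hfg this
  classical
  induction s using Finset.induction_on with
  | empty =>
    simp only [Finset.sum_empty]
    exact (LipschitzWith.const (0 : E)).lipschitzOnWith.absolutelyContinuousOnInterval
  | insert i s hi ih =>
    simp only [Finset.sum_insert hi]
    have h1 := h i (Finset.mem_insert_self _ _)
    have h2 : AbsolutelyContinuousOnInterval (fun t => σ i (g i t)) a b :=
      .of_dist_le (‖σ i‖ / 2) h1 h1 fun x _ y _ => by
        rw [dist_eq_norm, dist_eq_norm, ← map_sub]
        linarith [(σ i).le_opNorm (g i x - g i y)]
    exact h2.add (ih fun j hj => h j (Finset.mem_insert_of_mem hj))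

lemma sum_prod_singleCLM (A : Matrix (Fin m) (Fin m) ℂ) :
    ∑ p : Fin m × Fin m, singleCLM p.1 p.2 (A p.1 p.2) = A := by
  rw [Fintype.sum_prod_type]
  exact sum_singleCLM A

lemma isPrimitive_sum {ι E : Type*} [NormedAddCommGroup E] [NormedSpace ℝ E] (s : Finset ι)
    {f g : ι → ℝ → E} (h : ∀ i ∈ s, IsPrimitive (f i) (g i)) :
    IsPrimitive (fun x => ∑ i ∈ s, f i x) (fun x => ∑ i ∈ s, g i x) := by
  classical
  induction s using Finset.induction_on with
  | empty => simpa using IsPrimitive.const (0 : E)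
  | insert i s hi ih =>
    simp only [Finset.sum_insert hi]
    exact (h i (Finset.mem_insert_self _ _)).add (ih fun j hj => h j (Finset.mem_insert_of_mem hj))

lemma isPrimitive_matrix_iff {F G : ℝ → Matrix (Fin m) (Fin m) ℂ} :
    IsPrimitive F G ↔ ∀ j k, IsPrimitive (fun x => F x j k) (fun x => G x j k) := by
  refine ⟨fun h j k => h.clm_comp (entryCLM j k), fun h => ?_⟩
  have := isPrimitive_sum Finset.univ fun j _ => isPrimitive_sum Finset.univ fun k _ =>
      (h j k).clm_comp (singleCLM j k)
  exact this.congr (fun x _ => (sum_singleCLM _).symm) fun x _ => (sum_singleCLM _).symm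

lemma isPrimitive_of_absolutelyContinuous {f : ℝ → ℂ}
    (hf : ∀ T, 0 < T → AbsolutelyContinuousOnInterval f 0 T)
    (hd : IntegrableOn (deriv f) (Ioi 0)) : IsPrimitive f (deriv f) := by
  refine .of_absolutelyContinuous hf (fun x hx => hd.intervalIntegrable_zero x hx) ?_
  rw [ae_restrict_iff' measurableSet_Ioi]
  have h1 : ∀ n : ℕ, ∀ᵐ x : ℝ, x ∈ uIcc 0 ((n : ℝ) + 1) → DifferentiableAt ℝ f x := fun n =>
    (hf (n + 1) (by positivity)).boundedVariationOn.ae_differentiableAt_of_mem_uIcc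
  filter_upwards [ae_all_iff.2 h1] with x hx hx0
  obtain ⟨n, hn⟩ := exists_nat_ge x
  refine (hx n ?_).hasDerivAt
  rw [uIcc_of_le (by positivity)]
  exact ⟨le_of_lt hx0, hn.trans (by linarith)⟩

end Entries

namespace QuadraticPencil

variable {m : ℕ} {L : QuadraticPencil m}

/-- The derivative of `Q₁`, entry by entry. -/
def dQ₁ (L : QuadraticPencil m) (x : ℝ) : Matrix (Fin m) (Fin m) ℂ :=
  Matrix.of fun j k => deriv (fun t => L.Q₁ t j k) x

lemma Admissible.coeffs (hL : L.Admissible) : IntegrableCoeff L.Q₀ L.Q₁ L.dQ₁ :=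
  ⟨integrable_of_sum_clm Finset.univ (fun p : Fin m × Fin m => singleCLM p.1 p.2)
      (fun _ => sum_prod_singleCLM _) fun p _ => hL.integrable_Q₀ p.1 p.2,
    integrable_of_sum_clm Finset.univ (fun p : Fin m × Fin m => singleCLM p.1 p.2)
      (fun _ => sum_prod_singleCLM _) fun p _ => hL.integrable_Q₁ p.1 p.2,
    integrable_of_sum_clm Finset.univ (fun p : Fin m × Fin m => singleCLM p.1 p.2)
      (fun _ => sum_prod_singleCLM _) fun p _ => hL.integrable_deriv_Q₁ p.1 p.2,
    isPrimitive_matrix_iff.2 fun j k =>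
      isPrimitive_of_absolutelyContinuous (hL.absolutelyContinuous j k) (hL.integrable_deriv_Q₁ j k)⟩

lemma hasDerivWithinAt_matrix {F : ℝ → Matrix (Fin m) (Fin m) ℂ}
    {G : Matrix (Fin m) (Fin m) ℂ} {x : ℝ} {s : Set ℝ}
    (h : ∀ j k, HasDerivWithinAt (fun t => F t j k) (G j k) s x) : HasDerivWithinAt F G s x := by
  have : HasDerivWithinAt (fun t => ∑ j, ∑ k, singleCLM j k (F t j k))
      (∑ j, ∑ k, singleCLM j k (G j k)) s x :=
    HasDerivWithinAt.fun_sum fun j _ => HasDerivWithinAt.fun_sum fun k _ =>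
      (singleCLM j k).hasFDerivAt.comp_hasDerivWithinAt x (h j k)
  simpa only [sum_singleCLM] using this

lemma absolutelyContinuousOnInterval_matrix {F : ℝ → Matrix (Fin m) (Fin m) ℂ} {a b : ℝ}
    (h : ∀ j k, AbsolutelyContinuousOnInterval (fun t => F t j k) a b) :
    AbsolutelyContinuousOnInterval F a b :=
  absolutelyContinuousOnInterval_of_sum_clm Finset.univ
    (fun p : Fin m × Fin m => singleCLM p.1 p.2) (fun _ => sum_prod_singleCLM _)
    fun p _ => h p.1 p.2

lemma Admissible.isSolution_iff (hL : L.Admissible) {ρ : ℂ}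
    {Y Y' : ℝ → Matrix (Fin m) (Fin m) ℂ} : L.IsSolution ρ Y Y' ↔ IsSol (L.coeff ρ) Y Y' := by
  constructor
  · intro h
    refine hL.coeffs.isSol_of_ae (fun x hx => hasDerivWithinAt_matrix fun j k =>
      h.hasDeriv j k x hx) (fun T hT => absolutelyContinuousOnInterval_matrix fun j k =>
        h.absolutelyContinuous j k T hT) ?_
    filter_upwards [ae_all_iff.2 fun j => ae_all_iff.2 fun k => h.equation j k] with x hx
    exact (hasDerivWithinAt_matrix fun j k => (hx j k).hasDerivWithinAt).hasDerivAt univ_mem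
  · intro h
    have h1 := (isPrimitive_iff_hasDerivWithinAt h.prim'.continuousOn).1 h.prim
    refine ⟨fun j k x hx => (entryCLM j k).hasFDerivAt.comp_hasDerivWithinAt x (h1 x hx),
      fun j k T hT => (isPrimitive_matrix_iff.1 h.prim' j k).absolutelyContinuous hT.le,
      fun j k => (isPrimitive_matrix_iff.1 h.prim' j k).ae_hasDerivAt⟩

/-! ### The transposed and the reflected pencil -/

/-- The pencil with transposed coefficients; its solutions are the transposes of the solutions of
the adjoint equation. -/
def transpose (L : QuadraticPencil m) : QuadraticPencil m :=
  ⟨fun x => (L.Q₀ x).transpose, fun x => (L.Q₁ x).transpose, L.h₀.transpose, L.h₁.transpose⟩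

/-- The pencil obtained by the substitution `ρ ↦ -ρ`. -/
def reflect (L : QuadraticPencil m) : QuadraticPencil m :=
  ⟨L.Q₀, fun x => -L.Q₁ x, L.h₀, -L.h₁⟩

@[simp] lemma transpose_transpose (L : QuadraticPencil m) : L.transpose.transpose = L := rfl

lemma reflect_transpose (L : QuadraticPencil m) : L.reflect.transpose = L.transpose.reflect := rfl

lemma transpose_coeff (L : QuadraticPencil m) (ρ : ℂ) (x : ℝ) :
    L.transpose.coeff ρ x = (L.coeff ρ x).transpose := by
  simp [coeff, transpose]

lemma transpose_bdry (L : QuadraticPencil m) (ρ : ℂ) :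
    L.transpose.bdry ρ = (L.bdry ρ).transpose := by
  simp [bdry, transpose]

lemma reflect_coeff (L : QuadraticPencil m) (ρ : ℂ) (x : ℝ) :
    L.reflect.coeff ρ x = L.coeff (-ρ) x := by
  simp [coeff, reflect]

lemma reflect_bdry (L : QuadraticPencil m) (ρ : ℂ) : L.reflect.bdry ρ = L.bdry (-ρ) := by
  simp [bdry, reflect]

lemma Admissible.transpose (hL : L.Admissible) : L.transpose.Admissible :=
  ⟨fun j k => hL.absolutelyContinuous k j, fun j k => hL.integrable_Q₀ k j,
    fun j k => hL.integrable_Q₁ k j, fun j k => hL.integrable_deriv_Q₁ k j, by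
      have := hL.det_add_ne_zero
      rw [← Matrix.det_transpose] at this
      simpa [QuadraticPencil.transpose] using this, by
      have := hL.det_sub_ne_zero
      rw [← Matrix.det_transpose] at this
      simpa [QuadraticPencil.transpose] using this⟩

lemma Admissible.reflect (hL : L.Admissible) : L.reflect.Admissible := by
  refine ⟨fun j k T hT => ?_, hL.integrable_Q₀, fun j k => (hL.integrable_Q₁ j k).neg,
    fun j k => ?_, ?_, ?_⟩
  · exact (hL.absolutelyContinuous j k T hT).neg
  · have : (deriv fun x => L.reflect.Q₁ x j k) = fun x => -deriv (fun x => L.Q₁ x j k) x := by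
      funext x
      exact deriv.fun_neg
    rw [this]
    exact (hL.integrable_deriv_Q₁ j k).neg
  · simpa [QuadraticPencil.reflect, ← sub_eq_add_neg] using hL.det_sub_ne_zero
  · simpa [QuadraticPencil.reflect] using hL.det_add_ne_zero

lemma isSolution_reflect_iff {ρ : ℂ} {Y Y' : ℝ → Matrix (Fin m) (Fin m) ℂ} :
    L.reflect.IsSolution ρ Y Y' ↔ L.IsSolution (-ρ) Y Y' := by
  constructor <;> rintro ⟨h1, h2, h3⟩ <;> refine ⟨h1, h2, ?_⟩ <;>
    simpa only [reflect_coeff, neg_neg] using h3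

lemma isSolutionStar_iff {ρ : ℂ} {Z Z' : ℝ → Matrix (Fin m) (Fin m) ℂ} :
    L.IsSolutionStar ρ Z Z' ↔
      L.transpose.IsSolution ρ (fun x => (Z x).transpose) (fun x => (Z' x).transpose) := by
  constructor <;> rintro ⟨h1, h2, h3⟩ <;> refine ⟨fun j k => h1 k j, fun j k => h2 k j, ?_⟩
  · intro j k
    simpa only [transpose_coeff, ← Matrix.transpose_mul, ← Matrix.transpose_neg,
      Matrix.transpose_apply] using h3 k j
  · intro j k
    simpa only [transpose_coeff, ← Matrix.transpose_mul, ← Matrix.transpose_neg,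
      Matrix.transpose_apply] using h3 k j

lemma _root_.IsSol.transpose {ρ : ℂ} {Y Y' : ℝ → Matrix (Fin m) (Fin m) ℂ}
    (h : IsSol (L.transpose.coeff ρ) Y Y') :
    IsSolStar (L.coeff ρ) (fun x => (Y x).transpose) (fun x => (Y' x).transpose) := by
  refine ⟨h.prim.clm_comp ((transposeCLM m).restrictScalars ℝ),
    (h.prim'.clm_comp ((transposeCLM m).restrictScalars ℝ)).congr (fun _ _ => rfl) fun x _ => ?_⟩
  change -((Y x).transpose * L.coeff ρ x) = (-(L.transpose.coeff ρ x * Y x)).transpose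
  rw [Matrix.transpose_neg, Matrix.transpose_mul, transpose_coeff, Matrix.transpose_transpose]

/-! ### The solutions `φ` and `S` -/

/-- The solution `S` with `S(0) = 0`, `S'(0) = 1`. -/
def sine (L : QuadraticPencil m) (x : ℝ) (ρ : ℂ) : Matrix (Fin m) (Fin m) ℂ :=
  cauchySol L.Q₀ L.Q₁ 0 1 ρ x

/-- The derivative of `S`. -/
def sineDeriv (L : QuadraticPencil m) (x : ℝ) (ρ : ℂ) : Matrix (Fin m) (Fin m) ℂ :=
  cauchySolDeriv L.Q₀ L.Q₁ 0 1 ρ x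

/-- The derivative of `φ`. -/
def phiDeriv (L : QuadraticPencil m) (x : ℝ) (ρ : ℂ) : Matrix (Fin m) (Fin m) ℂ :=
  (L.phiPair ρ).2 x

/-- The derivative of `φ*`. -/
def phiStarDeriv (L : QuadraticPencil m) (x : ℝ) (ρ : ℂ) : Matrix (Fin m) (Fin m) ℂ :=
  (L.phiStarPair ρ).2 x

lemma differentiable_bdry (L : QuadraticPencil m) : Differentiable ℂ L.bdry := by
  unfold bdry
  fun_prop

namespace Admissible

variable (hL : L.Admissible)

include hL

lemma isSol_sine (ρ : ℂ) :
    IsSol (L.coeff ρ) (fun x => L.sine x ρ) (fun x => L.sineDeriv x ρ) :=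
  isSol_cauchySol hL.coeffs.intervalIntegrable_zero hL.coeffs.intervalIntegrable_one 0 1 ρ

lemma sine_zero (ρ : ℂ) : L.sine 0 ρ = 0 :=
  cauchySol_zero hL.coeffs.intervalIntegrable_zero hL.coeffs.intervalIntegrable_one 0 1 ρ

lemma sineDeriv_zero (ρ : ℂ) : L.sineDeriv 0 ρ = 1 :=
  cauchySolDeriv_zero 0 1 ρ

lemma phiPair_spec (ρ : ℂ) : L.IsSolution ρ (L.phiPair ρ).1 (L.phiPair ρ).2 ∧
    (L.phiPair ρ).1 0 = 1 ∧ (L.phiPair ρ).2 0 + L.bdry ρ * (L.phiPair ρ).1 0 = 0 := by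
  have h : ∃ p : (ℝ → Matrix (Fin m) (Fin m) ℂ) × (ℝ → Matrix (Fin m) (Fin m) ℂ),
      L.IsSolution ρ p.1 p.2 ∧ p.1 0 = 1 ∧ p.2 0 + L.bdry ρ * p.1 0 = 0 := by
    refine ⟨(cauchySol L.Q₀ L.Q₁ 1 (-L.bdry ρ) ρ, cauchySolDeriv L.Q₀ L.Q₁ 1 (-L.bdry ρ) ρ),
      hL.isSolution_iff.2 (isSol_cauchySol hL.coeffs.intervalIntegrable_zero
        hL.coeffs.intervalIntegrable_one _ _ ρ),
      cauchySol_zero hL.coeffs.intervalIntegrable_zero hL.coeffs.intervalIntegrable_one _ _ ρ, ?_⟩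
    simp [cauchySol_zero hL.coeffs.intervalIntegrable_zero hL.coeffs.intervalIntegrable_one,
      cauchySolDeriv_zero]
  rw [phiPair, dif_pos h]
  exact h.choose_spec

lemma isSol_phi (ρ : ℂ) : IsSol (L.coeff ρ) (fun x => L.phi x ρ) (fun x => L.phiDeriv x ρ) :=
  hL.isSolution_iff.1 (hL.phiPair_spec ρ).1

lemma phi_zero (ρ : ℂ) : L.phi 0 ρ = 1 := (hL.phiPair_spec ρ).2.1

lemma phiDeriv_zero (ρ : ℂ) : L.phiDeriv 0 ρ = -L.bdry ρ := by
  have h := (hL.phiPair_spec ρ).2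
  rw [h.1, mul_one] at h
  exact eq_neg_of_add_eq_zero_left h.2

lemma eqOn_of_initial {ρ : ℂ} {Y Y' W W' : ℝ → Matrix (Fin m) (Fin m) ℂ}
    (h : IsSol (L.coeff ρ) Y Y') (h' : IsSol (L.coeff ρ) W W') (h0 : Y 0 = W 0)
    (h0' : Y' 0 = W' 0) {x : ℝ} (hx : 0 ≤ x) : Y x = W x ∧ Y' x = W' x :=
  h.eqOn h' (hL.coeffs.intervalIntegrable_coeff ρ) h0 h0' hx

/-- `φ` in terms of two entire solutions with constant initial data. -/
lemma phi_eq {x : ℝ} (hx : 0 ≤ x) (ρ : ℂ) :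
    L.phi x ρ = cauchySol L.Q₀ L.Q₁ 1 0 ρ x - L.sine x ρ * L.bdry ρ ∧
    L.phiDeriv x ρ = cauchySolDeriv L.Q₀ L.Q₁ 1 0 ρ x - L.sineDeriv x ρ * L.bdry ρ := by
  refine hL.eqOn_of_initial (hL.isSol_phi ρ) ((isSol_cauchySol hL.coeffs.intervalIntegrable_zero
    hL.coeffs.intervalIntegrable_one 1 0 ρ).sub ((hL.isSol_sine ρ).mul_const (L.bdry ρ))) ?_ ?_ hx
  · simp [hL.phi_zero, hL.sine_zero,
      cauchySol_zero hL.coeffs.intervalIntegrable_zero hL.coeffs.intervalIntegrable_one]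
  · simp [hL.phiDeriv_zero, hL.sineDeriv_zero, cauchySolDeriv_zero]

lemma differentiable_sine {x : ℝ} (hx : 0 ≤ x) : Differentiable ℂ (L.sine x) :=
  differentiable_cauchySol hL.coeffs.intervalIntegrable_zero hL.coeffs.intervalIntegrable_one 0 1 hx

lemma differentiable_sineDeriv {x : ℝ} (hx : 0 ≤ x) : Differentiable ℂ (L.sineDeriv x) :=
  differentiable_cauchySolDeriv hL.coeffs.intervalIntegrable_zero
    hL.coeffs.intervalIntegrable_one 0 1 hx

lemma differentiable_phi {x : ℝ} (hx : 0 ≤ x) : Differentiable ℂ (L.phi x) := by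
  have : L.phi x = fun ρ => cauchySol L.Q₀ L.Q₁ 1 0 ρ x - L.sine x ρ * L.bdry ρ :=
    funext fun ρ => (hL.phi_eq hx ρ).1
  rw [this]
  exact (differentiable_cauchySol hL.coeffs.intervalIntegrable_zero
    hL.coeffs.intervalIntegrable_one 1 0 hx).sub
    ((hL.differentiable_sine hx).mul (differentiable_bdry L))

lemma differentiable_phiDeriv {x : ℝ} (hx : 0 ≤ x) : Differentiable ℂ (L.phiDeriv x) := by
  have : L.phiDeriv x = fun ρ => cauchySolDeriv L.Q₀ L.Q₁ 1 0 ρ x - L.sineDeriv x ρ * L.bdry ρ :=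
    funext fun ρ => (hL.phi_eq hx ρ).2
  rw [this]
  exact (differentiable_cauchySolDeriv hL.coeffs.intervalIntegrable_zero
    hL.coeffs.intervalIntegrable_one 1 0 hx).sub
    ((hL.differentiable_sineDeriv hx).mul (differentiable_bdry L))

/-- `φ*` is the transpose of the solution `φ` of the transposed pencil. -/
lemma phiStar_eq {x : ℝ} (hx : 0 ≤ x) (ρ : ℂ) :
    L.phiStar x ρ = (L.transpose.phi x ρ).transpose ∧
    L.phiStarDeriv x ρ = (L.transpose.phiDeriv x ρ).transpose := by
  have hT := hL.transpose
  have h : ∃ p : (ℝ → Matrix (Fin m) (Fin m) ℂ) × (ℝ → Matrix (Fin m) (Fin m) ℂ),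
      L.IsSolutionStar ρ p.1 p.2 ∧ p.1 0 = 1 ∧ p.2 0 + p.1 0 * L.bdry ρ = 0 := by
    refine ⟨(fun x => (L.transpose.phi x ρ).transpose,
      fun x => (L.transpose.phiDeriv x ρ).transpose), isSolutionStar_iff.2 ?_, ?_, ?_⟩
    · exact hT.isSolution_iff.2 (hT.isSol_phi ρ)
    · simp [hT.phi_zero]
    · simp [hT.phi_zero, hT.phiDeriv_zero, transpose_bdry]
  have hs : L.IsSolutionStar ρ (L.phiStarPair ρ).1 (L.phiStarPair ρ).2 ∧
      (L.phiStarPair ρ).1 0 = 1 ∧ (L.phiStarPair ρ).2 0 + (L.phiStarPair ρ).1 0 * L.bdry ρ = 0 := by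
    rw [phiStarPair, dif_pos h]
    exact h.choose_spec
  have h1 := hT.eqOn_of_initial (hT.isSolution_iff.1 (isSolutionStar_iff.1 hs.1))
    (hT.isSol_phi ρ) (by rw [hs.2.1, hT.phi_zero, Matrix.transpose_one]) (by
      have h2 := hs.2.2
      rw [hs.2.1, one_mul] at h2
      rw [hT.phiDeriv_zero, eq_neg_of_add_eq_zero_left h2, transpose_bdry, Matrix.transpose_neg]) hx
  constructor
  · rw [← h1.1]; rfl
  · rw [← h1.2]; rfl

lemma transpose_phiStar {x : ℝ} (hx : 0 ≤ x) (ρ : ℂ) :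
    L.transpose.phiStar x ρ = (L.phi x ρ).transpose ∧
    L.transpose.phiStarDeriv x ρ = (L.phiDeriv x ρ).transpose :=
  hL.transpose.phiStar_eq hx ρ

lemma reflect_phi {x : ℝ} (hx : 0 ≤ x) (ρ : ℂ) :
    L.reflect.phi x ρ = L.phi x (-ρ) ∧ L.reflect.phiDeriv x ρ = L.phiDeriv x (-ρ) := by
  have hR := hL.reflect
  refine hR.eqOn_of_initial (hR.isSol_phi ρ) (W := fun x => L.phi x (-ρ))
    (W' := fun x => L.phiDeriv x (-ρ)) ?_ ?_ ?_ hx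
  · rw [funext (reflect_coeff L ρ)]
    exact hL.isSol_phi (-ρ)
  · rw [hR.phi_zero, hL.phi_zero]
  · rw [hR.phiDeriv_zero, hL.phiDeriv_zero, reflect_bdry]

lemma reflect_sine {x : ℝ} (hx : 0 ≤ x) (ρ : ℂ) :
    L.reflect.sine x ρ = L.sine x (-ρ) ∧ L.reflect.sineDeriv x ρ = L.sineDeriv x (-ρ) := by
  have hR := hL.reflect
  refine hR.eqOn_of_initial (hR.isSol_sine ρ) (W := fun x => L.sine x (-ρ))
    (W' := fun x => L.sineDeriv x (-ρ)) ?_ ?_ ?_ hx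
  · rw [funext (reflect_coeff L ρ)]
    exact hL.isSol_sine (-ρ)
  · rw [hR.sine_zero, hL.sine_zero]
  · rw [hR.sineDeriv_zero, hL.sineDeriv_zero]

lemma isSolStar_phiStar (ρ : ℂ) : IsSolStar (L.coeff ρ) (fun x => (L.transpose.phi x ρ).transpose)
    (fun x => (L.transpose.phiDeriv x ρ).transpose) :=
  (hL.transpose.isSol_phi ρ).transpose

lemma isSolStar_sineStar (ρ : ℂ) :
    IsSolStar (L.coeff ρ) (fun x => (L.transpose.sine x ρ).transpose)
      (fun x => (L.transpose.sineDeriv x ρ).transpose) :=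
  (hL.transpose.isSol_sine ρ).transpose

/-- Bounds for `φ` and its derivative, uniform for large `ρ`. -/
lemma norm_phi_le {x : ℝ} (hx : 0 ≤ x) : ∃ C, 0 ≤ C ∧ ∀ ρ : ℂ, 1 ≤ ‖ρ‖ →
    ‖L.phi x ρ‖ ≤ C * Real.exp (|ρ.im| * x) ∧
    ‖L.phiDeriv x ρ‖ ≤ C * ‖ρ‖ * Real.exp (|ρ.im| * x) := by
  obtain ⟨C, hC0, hC⟩ := IsSol.growth hL.coeffs.intervalIntegrable_zero
    hL.coeffs.intervalIntegrable_one hx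
  refine ⟨C * (‖(1 : Matrix (Fin m) (Fin m) ℂ)‖ + (‖L.h₁‖ + ‖L.h₀‖)), by positivity,
    fun ρ hρ => ?_⟩
  have hρ0 : 0 < ‖ρ‖ := one_pos.trans_le hρ
  obtain ⟨h1, h2⟩ := hC ρ hρ _ _ (hL.isSol_phi ρ)
  have h3 : ‖L.phi 0 ρ‖ + ‖L.phiDeriv 0 ρ‖ / ‖ρ‖ ≤
      ‖(1 : Matrix (Fin m) (Fin m) ℂ)‖ + (‖L.h₁‖ + ‖L.h₀‖) := by
    rw [hL.phi_zero, hL.phiDeriv_zero, norm_neg]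
    gcongr
    rw [div_le_iff₀ hρ0, bdry]
    refine (norm_add_le _ _).trans ?_
    rw [norm_smul, norm_mul, Complex.norm_I, one_mul]
    nlinarith [norm_nonneg L.h₀]
  constructor
  · refine h1.trans ?_
    gcongr
  · refine h2.trans ?_
    gcongr

end Admissible

end QuadraticPencil

/-! ### The Weyl matrix -/

section Decay

variable {𝔸 : Type*} [NormedRing 𝔸] [NormedAlgebra ℂ 𝔸] [CompleteSpace 𝔸]

lemma tendsto_exp_neg_mul_atTop {c : ℝ} (hc : 0 < c) :
    Tendsto (fun x : ℝ => Real.exp (-(c * x))) atTop (𝓝 0) :=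
  Real.tendsto_exp_neg_atTop_nhds_zero.comp (tendsto_id.const_mul_atTop hc)

lemma norm_exp_I_mul' (ρ : ℂ) (x : ℝ) :
    ‖Complex.exp (Complex.I * ρ * x)‖ = Real.exp (-(ρ.im * x)) := by
  rw [Complex.norm_exp]; simp

/-- A decaying solution has a bounded derivative. -/
lemma IsSol.exists_deriv_bound {Q₀ Q₁ dQ₁ : ℝ → 𝔸} (hQ : IntegrableCoeff Q₀ Q₁ dQ₁) {ρ : ℂ}
    (hρ : 0 < ρ.im) {Y Y' : ℝ → 𝔸} (h : IsSol (pencilCoeff Q₀ Q₁ ρ) Y Y')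
    (hO : Y =O[atTop] fun x : ℝ => Complex.exp (Complex.I * ρ * x)) :
    Tendsto Y atTop (𝓝 0) ∧ ∃ C, ∀ x, 0 ≤ x → ‖Y' x‖ ≤ C := by
  obtain ⟨C, hC⟩ := hO.bound
  obtain ⟨X, hX⟩ := eventually_atTop.1 hC
  have hdec : ∀ x, X ≤ x → ‖Y x‖ ≤ C * Real.exp (-(ρ.im * x)) := fun x hx => by
    rw [← norm_exp_I_mul']; exact hX x hx
  have htend : Tendsto Y atTop (𝓝 0) := by
    have h1 := (tendsto_exp_neg_mul_atTop hρ).const_mul C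
    rw [mul_zero] at h1
    refine squeeze_zero_norm' ?_ h1
    filter_upwards [eventually_ge_atTop X] with x hx using hdec x hx
  refine ⟨htend, ?_⟩
  obtain ⟨K, hK0, hK⟩ := h.prim.exists_bound (max X 0)
  have hbd : ∀ x, 0 ≤ x → ‖Y x‖ ≤ K + |C| := fun x hx => by
    rcases le_total x (max X 0) with h1 | h1
    · exact (hK x ⟨hx, h1⟩).trans (by linarith [abs_nonneg C])
    · refine (hdec x ((le_max_left _ _).trans h1)).trans ?_
      have h2 : Real.exp (-(ρ.im * x)) ≤ 1 := Real.exp_le_one_iff.2 (by nlinarith)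
      nlinarith [le_abs_self C, abs_nonneg C, Real.exp_pos (-(ρ.im * x))]
  have hm := h.prim.continuousOn.aestronglyMeasurable_Ioi
  have hYi : IntegrableOn Y (Ioi 0) := by
    rw [← Ioc_union_Ioi_eq_Ioi (le_max_right X 0)]
    refine IntegrableOn.union ?_ ?_
    · exact ((h.prim.continuousOn.mono Icc_subset_Ici_self).integrableOn_Icc).mono_set
        Ioc_subset_Icc_self
    · refine Integrable.mono' (((exp_neg_integrableOn_Ioi (max X 0) hρ)).const_mul C)
        (hm.mono_measure (Measure.restrict_mono (Ioi_subset_Ioi (le_max_right _ _)) le_rfl)) ?_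
      filter_upwards [ae_restrict_mem measurableSet_Ioi] with x hx
      have := hdec x ((le_max_left _ _).trans (le_of_lt hx))
      rwa [neg_mul]
  have hi : IntegrableOn (fun x => -(pencilCoeff Q₀ Q₁ ρ x * Y x)) (Ioi 0) := by
    have h1 := (hYi.smul (ρ ^ 2)).add (((IntegrableOn.mul_of_bound hQ.int₁ hm hbd).smul
      (2 * Complex.I * ρ)).add (IntegrableOn.mul_of_bound hQ.int₀ hm hbd))
    refine h1.neg.congr (Eventually.of_forall fun x => ?_)
    simp only [Pi.neg_apply, Pi.add_apply, Pi.smul_apply, pencilCoeff, add_mul, smul_mul_assoc,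
      one_mul, add_assoc]
  exact ⟨_, fun x hx => h.prim'.norm_le_of_integrableOn hi hx⟩

/-- The Wronskian of a decaying and a bounded solution vanishes. -/
lemma IsSol.wronskian_eq_zero {q Y Y' Z Z' : ℝ → 𝔸} (h : IsSol q Y Y') (hZ : IsSolStar q Z Z')
    (h1 : Tendsto Z atTop (𝓝 0)) (h1' : Tendsto Z' atTop (𝓝 0)) {C : ℝ}
    (h2 : ∀ᶠ x in atTop, ‖Y x‖ ≤ C) (h2' : ∀ᶠ x in atTop, ‖Y' x‖ ≤ C) :
    Z' 0 * Y 0 - Z 0 * Y' 0 = 0 := by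
  have e1 : Tendsto (fun x => Z' x * Y x) atTop (𝓝 0) :=
    h1'.zero_mul_isBoundedUnder_le (isBoundedUnder_of_eventually_le h2)
  have e2 : Tendsto (fun x => Z x * Y' x) atTop (𝓝 0) :=
    h1.zero_mul_isBoundedUnder_le (isBoundedUnder_of_eventually_le h2')
  have e3 := e1.sub e2
  rw [sub_zero] at e3
  refine tendsto_nhds_unique (tendsto_const_nhds.congr' ?_) e3
  filter_upwards [eventually_ge_atTop 0] with x hx
  exact (h.wronskian_eq hZ hx).symm

namespace IntegrableCoeff

variable {Q₀ Q₁ dQ₁ : ℝ → 𝔸} (hQ : IntegrableCoeff Q₀ Q₁ dQ₁)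

include hQ

lemma tendsto_jost {ρ : ℂ} (hρ : 0 < ρ.im) : Tendsto (jost Q₀ Q₁ ρ) atTop (𝓝 0) := by
  have h1 : Tendsto (fun x : ℝ => Complex.exp (Complex.I * ρ * x)) atTop (𝓝 0) := by
    rw [tendsto_zero_iff_norm_tendsto_zero]
    simp only [norm_exp_I_mul']
    exact tendsto_exp_neg_mul_atTop hρ
  have := h1.smul (hQ.tendsto_jostY hρ)
  rwa [zero_smul] at this

lemma tendsto_jostDeriv {ρ : ℂ} (hρ : 0 < ρ.im) : Tendsto (jostDeriv Q₀ Q₁ ρ) atTop (𝓝 0) := by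
  have h1 : Tendsto (fun x : ℝ => Complex.I * ρ * Complex.exp (Complex.I * ρ * x)) atTop (𝓝 0) := by
    rw [tendsto_zero_iff_norm_tendsto_zero]
    simp only [norm_mul, norm_exp_I_mul']
    have := (tendsto_exp_neg_mul_atTop hρ).const_mul (‖Complex.I‖ * ‖ρ‖)
    rwa [mul_zero] at this
  have := h1.smul ((hQ.tendsto_jostU hρ).sub (hQ.tendsto_jostV hρ))
  rwa [zero_smul] at this

lemma jost_isBigO {ρ : ℂ} (hρ : 0 < ρ.im) (c : 𝔸) : (fun x => jost Q₀ Q₁ ρ x * c) =O[atTop]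
    fun x : ℝ => Complex.exp (Complex.I * ρ * x) := by
  obtain ⟨C, hC⟩ := (hQ.tendsto_jostY hρ).norm.isBoundedUnder_le
  refine Asymptotics.IsBigO.of_bound (C * ‖c‖) ?_
  filter_upwards [eventually_map.1 hC] with x hx
  refine (norm_mul_le _ _).trans ?_
  rw [jost, norm_smul, mul_assoc, mul_comm]
  gcongr

end IntegrableCoeff

end Decay

namespace QuadraticPencil

variable {m : ℕ} {L : QuadraticPencil m}

/-- The value `U_ρ(e)` of the boundary form on the Jost solution. -/
def jostBdry (L : QuadraticPencil m) (ρ : ℂ) : Matrix (Fin m) (Fin m) ℂ :=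
  jostDeriv L.Q₀ L.Q₁ ρ 0 + L.bdry ρ * jost L.Q₀ L.Q₁ ρ 0

lemma isUnit_of_mul_eq_zero {A : Matrix (Fin m) (Fin m) ℂ} (h : ∀ v, A * v = 0 → v = 0) :
    IsUnit A := by
  have h1 : Function.Injective (LinearMap.mulLeft ℂ A) := by
    rw [← LinearMap.ker_eq_bot, LinearMap.ker_eq_bot']
    exact fun v hv => h v hv
  obtain ⟨B, hB⟩ := LinearMap.injective_iff_surjective.1 h1 1
  exact IsUnit.of_mul_eq_one B hB

namespace IsWeylSolution

variable {ρ : ℂ} {Φ Φ' : ℝ → Matrix (Fin m) (Fin m) ℂ}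

lemma isBigO (h : L.IsWeylSolution ρ Φ Φ') (hρ : 0 < ρ.im) :
    Φ =O[atTop] fun x : ℝ => Complex.exp (Complex.I * ρ * x) := by
  simpa using h.growth 1 (by simpa [halfPlane] using hρ)

/-- The Wronskian of the Weyl solution and the Jost solution of the adjoint equation vanishes. -/
lemma transpose_mul_jostBdry (hL : L.Admissible) (h : L.IsWeylSolution ρ Φ Φ') (hρ : 0 < ρ.im) :
    (Φ 0).transpose * L.transpose.jostBdry ρ =
      jost L.transpose.Q₀ L.transpose.Q₁ ρ 0 := by
  have hT := hL.transpose.coeffs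
  have hS := hL.isSolution_iff.1 h.solution
  obtain ⟨h0, C, hC⟩ := hS.exists_deriv_bound hL.coeffs hρ (h.isBigO hρ)
  have hJ := (IsSol.transpose (L := L) (hT.isSol_jost hρ))
  have t1 : Tendsto (fun x => (jost L.transpose.Q₀ L.transpose.Q₁ ρ x).transpose) atTop (𝓝 0) :=
    (((transposeCLM m).continuous.tendsto 0).comp (hT.tendsto_jost hρ)).mono_right
      (by rw [map_zero])
  have t2 : Tendsto (fun x => (jostDeriv L.transpose.Q₀ L.transpose.Q₁ ρ x).transpose) atTop
      (𝓝 0) :=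
    (((transposeCLM m).continuous.tendsto 0).comp (hT.tendsto_jostDeriv hρ)).mono_right
      (by rw [map_zero])
  have hw := hS.wronskian_eq_zero hJ t1 t2 (C := max C 1)
    (by filter_upwards [h0.norm.eventually_le_const
          (by simp : ‖(0 : Matrix (Fin m) (Fin m) ℂ)‖ < 1)] with x hx using
          hx.trans (le_max_right _ _))
    (by filter_upwards [eventually_ge_atTop 0] with x hx using
          (hC x hx).trans (le_max_left _ _))
  rw [eq_sub_of_add_eq h.boundary] at hw
  have hw' := congrArg Matrix.transpose hw
  simp only [Matrix.transpose_sub, Matrix.transpose_mul, Matrix.transpose_transpose,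
    Matrix.transpose_zero, Matrix.transpose_one] at hw'
  rw [jostBdry, transpose_bdry, mul_add, ← mul_assoc]
  rw [sub_mul, one_mul] at hw'
  rw [← sub_eq_zero, ← hw']
  abel

end IsWeylSolution

namespace Admissible

variable (hL : L.Admissible)

include hL

lemma isUnit_transpose_jostBdry {ρ : ℂ} (hρ : 0 < ρ.im) (h : L.HasWeylSolution ρ) :
    IsUnit (L.transpose.jostBdry ρ) := by
  obtain ⟨⟨Φ, Φ'⟩, h⟩ := h
  have hT := hL.transpose.coeffs
  refine isUnit_of_mul_eq_zero fun v hv => ?_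
  have h1 := h.transpose_mul_jostBdry hL hρ
  have h2 : jost L.transpose.Q₀ L.transpose.Q₁ ρ 0 * v = 0 := by
    rw [← h1, mul_assoc, hv, mul_zero]
  have h3 : jostDeriv L.transpose.Q₀ L.transpose.Q₁ ρ 0 * v = 0 := by
    rw [jostBdry, add_mul, mul_assoc, h2, mul_zero, add_zero] at hv
    exact hv
  -- A solution `e v` with zero initial data vanishes, while `exp (-i ρ x) e v → v`.
  have h4 : ∀ x, 0 ≤ x → jostY L.transpose.Q₀ L.transpose.Q₁ ρ x * v = 0 := fun x hx => by
    have h5 := (((hT.isSol_jost hρ).mul_const v).eq_zero (hT.intervalIntegrable_coeff ρ) h2 h3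
      hx).1
    rw [jost, smul_mul_assoc] at h5
    exact (smul_eq_zero.1 h5).resolve_left (Complex.exp_ne_zero _)
  have h6 := (hT.tendsto_jostY hρ).mul_const v
  rw [one_mul] at h6
  refine (tendsto_nhds_unique (tendsto_const_nhds.congr' ?_) h6).symm
  filter_upwards [eventually_ge_atTop 0] with x hx
  exact (h4 x hx).symm

lemma isWeylSolution_jost {ρ : ℂ} (hρ : 0 < ρ.im) (h : IsUnit (L.jostBdry ρ)) :
    L.IsWeylSolution ρ (fun x => jost L.Q₀ L.Q₁ ρ x * Ring.inverse (L.jostBdry ρ))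
      (fun x => jostDeriv L.Q₀ L.Q₁ ρ x * Ring.inverse (L.jostBdry ρ)) := by
  refine ⟨hρ.ne', hL.isSolution_iff.2 ((hL.coeffs.isSol_jost hρ).mul_const _), ?_, ?_⟩
  · rw [← mul_assoc, ← add_mul]
    exact Ring.mul_inverse_cancel _ h
  · intro σ hσ
    have : σ = 1 := by
      rcases Int.units_eq_one_or σ with h | rfl
      · exact h
      · simp [halfPlane] at hσ
        linarith
    subst this
    simpa using hL.coeffs.jost_isBigO hρ (Ring.inverse (L.jostBdry ρ))

/-- In the upper half-plane, the Weyl solution exists at `ρ` if and only if `U_ρ(e)` is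
invertible. -/
lemma hasWeylSolution_iff {ρ : ℂ} (hρ : 0 < ρ.im) :
    L.HasWeylSolution ρ ↔ IsUnit (L.jostBdry ρ) := by
  refine ⟨fun h => ?_, fun h => ⟨(_, _), hL.isWeylSolution_jost hρ h⟩⟩
  have h1 := hL.transpose.isWeylSolution_jost hρ (hL.isUnit_transpose_jostBdry hρ h)
  exact hL.transpose.isUnit_transpose_jostBdry hρ ⟨(_, _), h1⟩

lemma hasWeylSolution_transpose_of_im_pos {ρ : ℂ} (hρ : 0 < ρ.im) (h : L.HasWeylSolution ρ) :
    L.transpose.HasWeylSolution ρ :=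
  (hL.transpose.hasWeylSolution_iff hρ).2 (hL.isUnit_transpose_jostBdry hρ h)

lemma weylSolution_zero_eq {ρ : ℂ} (hρ : 0 < ρ.im) {Φ Φ' : ℝ → Matrix (Fin m) (Fin m) ℂ}
    (h : L.IsWeylSolution ρ Φ Φ') :
    Φ 0 = jost L.Q₀ L.Q₁ ρ 0 * Ring.inverse (L.jostBdry ρ) := by
  have hu := hL.isUnit_transpose_jostBdry hρ ⟨(_, _), h⟩
  have h1 := h.transpose_mul_jostBdry hL hρ
  have hu' := (hL.hasWeylSolution_iff hρ).1 ⟨(_, _), h⟩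
  have h2 := (hL.isWeylSolution_jost hρ hu').transpose_mul_jostBdry hL hρ
  exact Matrix.transpose_injective (hu.mul_right_cancel (h1.trans h2.symm))

lemma weylMatrix_eq {ρ : ℂ} (hρ : 0 < ρ.im) (h : L.HasWeylSolution ρ) :
    L.weylMatrix ρ = jost L.Q₀ L.Q₁ ρ 0 * Ring.inverse (L.jostBdry ρ) := by
  rw [weylMatrix, dif_pos h]
  exact hL.weylSolution_zero_eq hρ h.choose_spec

lemma weylMatrix_transpose_of_im_pos {ρ : ℂ} (hρ : 0 < ρ.im) (h : L.HasWeylSolution ρ) :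
    L.transpose.weylMatrix ρ = (L.weylMatrix ρ).transpose := by
  have hT := hL.hasWeylSolution_transpose_of_im_pos hρ h
  have hu := (hL.hasWeylSolution_iff hρ).1 h
  have h1 := (hT.choose_spec).transpose_mul_jostBdry hL.transpose hρ
  rw [transpose_transpose] at h1
  rw [hL.weylMatrix_eq hρ h, ← h1, Ring.mul_inverse_cancel_right _ _ hu, Matrix.transpose_transpose,
    weylMatrix, dif_pos hT]

end Admissible

lemma mem_halfPlane_neg {σ : ℤˣ} {ρ : ℂ} : -ρ ∈ halfPlane σ ↔ ρ ∈ halfPlane (-σ) := by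
  simp [halfPlane]

lemma isWeylSolution_reflect_iff {ρ : ℂ} {Φ Φ' : ℝ → Matrix (Fin m) (Fin m) ℂ} :
    L.reflect.IsWeylSolution ρ Φ Φ' ↔ L.IsWeylSolution (-ρ) Φ Φ' := by
  have hg : (∀ σ : ℤˣ, ρ ∈ halfPlane σ →
      Φ =O[atTop] fun x : ℝ => Complex.exp (((σ : ℤ) : ℂ) * Complex.I * ρ * (x : ℂ))) ↔
      (∀ σ : ℤˣ, -ρ ∈ halfPlane σ →
      Φ =O[atTop] fun x : ℝ => Complex.exp (((σ : ℤ) : ℂ) * Complex.I * -ρ * (x : ℂ))) := by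
    constructor
    · intro h σ hσ
      simpa using h (-σ) (mem_halfPlane_neg.1 hσ)
    · intro h σ hσ
      simpa using h (-σ) (by rw [mem_halfPlane_neg, neg_neg]; exact hσ)
  constructor
  · rintro ⟨h1, h2, h3, h4⟩
    exact ⟨by simpa using h1, isSolution_reflect_iff.1 h2, by rw [← reflect_bdry]; exact h3,
      hg.1 h4⟩
  · rintro ⟨h1, h2, h3, h4⟩
    exact ⟨by simpa using h1, isSolution_reflect_iff.2 h2, by rw [reflect_bdry]; exact h3,
      hg.2 h4⟩

lemma hasWeylSolution_reflect (L : QuadraticPencil m) (ρ : ℂ) :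
    L.reflect.HasWeylSolution ρ ↔ L.HasWeylSolution (-ρ) := by
  simp only [HasWeylSolution, isWeylSolution_reflect_iff]

lemma weylMatrix_reflect (L : QuadraticPencil m) (ρ : ℂ) :
    L.reflect.weylMatrix ρ = L.weylMatrix (-ρ) := by
  have key : (fun p : (ℝ → Matrix (Fin m) (Fin m) ℂ) × (ℝ → Matrix (Fin m) (Fin m) ℂ) =>
      L.reflect.IsWeylSolution ρ p.1 p.2) = fun p => L.IsWeylSolution (-ρ) p.1 p.2 :=
    funext fun p => propext isWeylSolution_reflect_iff
  unfold weylMatrix HasWeylSolution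
  rw [key]

lemma not_hasWeylSolution_of_im_eq_zero {ρ : ℂ} (h : ρ.im = 0) : ¬ L.HasWeylSolution ρ :=
  fun ⟨_, hp⟩ => hp.nonreal h

lemma Admissible.hasWeylSolution_transpose (hL : L.Admissible) (ρ : ℂ)
    (h : L.HasWeylSolution ρ) : L.transpose.HasWeylSolution ρ := by
  rcases lt_trichotomy ρ.im 0 with h0 | h0 | h0
  · have h1 : L.reflect.HasWeylSolution (-ρ) := by rwa [hasWeylSolution_reflect, neg_neg]
    have := hL.reflect.hasWeylSolution_transpose_of_im_pos (ρ := -ρ) (by simpa using h0) h1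
    rwa [reflect_transpose, hasWeylSolution_reflect, neg_neg] at this
  · exact absurd h (not_hasWeylSolution_of_im_eq_zero h0)
  · exact hL.hasWeylSolution_transpose_of_im_pos h0 h

lemma Admissible.hasWeylSolution_transpose_iff (hL : L.Admissible) (ρ : ℂ) :
    L.transpose.HasWeylSolution ρ ↔ L.HasWeylSolution ρ :=
  ⟨fun h => hL.transpose.hasWeylSolution_transpose ρ h, hL.hasWeylSolution_transpose ρ⟩

/-- The Weyl matrix of the transposed pencil is the transposed Weyl matrix. -/
lemma Admissible.weylMatrix_transpose (hL : L.Admissible) (ρ : ℂ) :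
    L.transpose.weylMatrix ρ = (L.weylMatrix ρ).transpose := by
  by_cases h : L.HasWeylSolution ρ
  · rcases lt_trichotomy ρ.im 0 with h0 | h0 | h0
    · have h1 : L.reflect.HasWeylSolution (-ρ) := by rwa [hasWeylSolution_reflect, neg_neg]
      have := hL.reflect.weylMatrix_transpose_of_im_pos (ρ := -ρ) (by simpa using h0) h1
      rwa [reflect_transpose, weylMatrix_reflect, weylMatrix_reflect, neg_neg] at this
    · exact absurd h (not_hasWeylSolution_of_im_eq_zero h0)
    · exact hL.weylMatrix_transpose_of_im_pos h0 h
  · have h' := (hL.hasWeylSolution_transpose_iff ρ).not.2 h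
    rw [weylMatrix, dif_neg h', weylMatrix, dif_neg h, Matrix.transpose_zero]

/-- The Weyl solution. -/
def weylPhi (L : QuadraticPencil m) (x : ℝ) (ρ : ℂ) : Matrix (Fin m) (Fin m) ℂ :=
  L.sine x ρ + L.phi x ρ * L.weylMatrix ρ

/-- The derivative of the Weyl solution. -/
def weylPhiDeriv (L : QuadraticPencil m) (x : ℝ) (ρ : ℂ) : Matrix (Fin m) (Fin m) ℂ :=
  L.sineDeriv x ρ + L.phiDeriv x ρ * L.weylMatrix ρ

namespace Admissible

variable (hL : L.Admissible)

include hL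

lemma weylPhi_eq {ρ : ℂ} (hρ : 0 < ρ.im) (h : L.HasWeylSolution ρ) {x : ℝ} (hx : 0 ≤ x) :
    L.weylPhi x ρ = jost L.Q₀ L.Q₁ ρ x * Ring.inverse (L.jostBdry ρ) ∧
    L.weylPhiDeriv x ρ = jostDeriv L.Q₀ L.Q₁ ρ x * Ring.inverse (L.jostBdry ρ) := by
  refine hL.eqOn_of_initial ((hL.isSol_sine ρ).add ((hL.isSol_phi ρ).mul_const (L.weylMatrix ρ)))
    ((hL.coeffs.isSol_jost hρ).mul_const _) ?_ ?_ hx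
  · rw [hL.sine_zero, hL.phi_zero, zero_add, one_mul, hL.weylMatrix_eq hρ h]
  · have hb := (hL.isWeylSolution_jost hρ ((hL.hasWeylSolution_iff hρ).1 h)).boundary
    rw [hL.sineDeriv_zero, hL.phiDeriv_zero, ← hb, ← hL.weylMatrix_eq hρ h]
    noncomm_ring

lemma reflect_weylPhi {x : ℝ} (hx : 0 ≤ x) (ρ : ℂ) :
    L.reflect.weylPhi x ρ = L.weylPhi x (-ρ) ∧
    L.reflect.weylPhiDeriv x ρ = L.weylPhiDeriv x (-ρ) := by
  simp only [weylPhi, weylPhiDeriv, hL.reflect_phi hx, hL.reflect_sine hx, weylMatrix_reflect,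
    and_self]

end Admissible

end QuadraticPencil

/-! ### Asymptotics of the Weyl solution -/

/-- The filter of points of the upper half-plane that tend to infinity. -/
def upperInfinity : Filter ℂ := comap norm atTop ⊓ 𝓟 {ρ : ℂ | 0 < ρ.im}

lemma eventually_upperInfinity {p : ℂ → Prop} :
    (∀ᶠ ρ in upperInfinity, p ρ) ↔ ∃ R : ℝ, ∀ ρ : ℂ, 0 < ρ.im → R ≤ ‖ρ‖ → p ρ := by
  rw [upperInfinity, eventually_inf_principal, eventually_comap]
  constructor
  · intro h
    obtain ⟨R, hR⟩ := eventually_atTop.1 h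
    exact ⟨R, fun ρ h1 h2 => hR _ h2 ρ rfl h1⟩
  · rintro ⟨R, hR⟩
    filter_upwards [eventually_ge_atTop R] with r hr ρ hρ h0
    exact hR ρ h0 (by rw [hρ]; exact hr)

lemma eventually_im_pos : ∀ᶠ ρ in upperInfinity, 0 < ρ.im :=
  eventually_upperInfinity.2 ⟨0, fun _ h _ => h⟩

lemma eventually_le_norm (R : ℝ) : ∀ᶠ ρ in upperInfinity, R ≤ ‖ρ‖ :=
  eventually_upperInfinity.2 ⟨R, fun _ _ h => h⟩

lemma tendsto_norm_upperInfinity : Tendsto (fun ρ : ℂ => ‖ρ‖) upperInfinity atTop :=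
  tendsto_comap.mono_left inf_le_left

lemma tendsto_const_div_upperInfinity (C : ℝ) :
    Tendsto (fun ρ : ℂ => C / ‖ρ‖) upperInfinity (𝓝 0) :=
  tendsto_norm_upperInfinity.const_div_atTop C

lemma tendsto_inv_upperInfinity : Tendsto (fun ρ : ℂ => (Complex.I * ρ)⁻¹) upperInfinity (𝓝 0) := by
  rw [tendsto_zero_iff_norm_tendsto_zero]
  refine (tendsto_const_div_upperInfinity 1).congr fun ρ => ?_
  simp

lemma Ring.inverse_eq_of_mul_eq_one' {R : Type*} [Ring R] {a b : R} (ha : IsUnit a)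
    (h : a * b = 1) : Ring.inverse a = b :=
  ha.mul_left_cancel ((Ring.mul_inverse_cancel _ ha).trans h.symm)

lemma tendsto_ringInverse {α R : Type*} [NormedRing R] [CompleteSpace R] {l : Filter α} {f : α → R}
    {a : R} (ha : IsUnit a) (h : Tendsto f l (𝓝 a)) :
    Tendsto (fun x => Ring.inverse (f x)) l (𝓝 (Ring.inverse a)) := by
  obtain ⟨u, rfl⟩ := ha
  exact (NormedRing.inverse_continuousAt u).tendsto.comp h

namespace QuadraticPencil

variable {m : ℕ} {L : QuadraticPencil m}

/-- The inverse of `jostLimit L.Q₁`. -/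
def jostLimitInv (L : QuadraticPencil m) (x : ℝ) : Matrix (Fin m) (Fin m) ℂ :=
  (jostLimit L.transpose.reflect.Q₁ x).transpose

/-- The solution `P` of `P' = -Q₁ P`, `P(0) = 1`. -/
def propagator (L : QuadraticPencil m) (x : ℝ) : Matrix (Fin m) (Fin m) ℂ :=
  jostLimit L.Q₁ x * L.jostLimitInv 0

/-- The inverse of `propagator L`. -/
def propagatorInv (L : QuadraticPencil m) (x : ℝ) : Matrix (Fin m) (Fin m) ℂ :=
  jostLimit L.Q₁ 0 * L.jostLimitInv x

/-- The leading coefficient `P(x) (1 + h₁)⁻¹` of the Weyl solution at infinity. -/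
def weylLimit (L : QuadraticPencil m) (x : ℝ) : Matrix (Fin m) (Fin m) ℂ :=
  L.propagator x * Ring.inverse (1 + L.h₁)

namespace Admissible

variable (hL : L.Admissible)

include hL

lemma isPrimitive_jostLimitInv :
    IsPrimitive L.jostLimitInv (fun x => L.jostLimitInv x * L.Q₁ x) := by
  have h := hL.transpose.reflect.coeffs.isPrimitive_jostLimit.clm_comp
    ((transposeCLM m).restrictScalars ℝ)
  refine h.congr (fun _ _ => rfl) fun x _ => ?_
  change _ = (-(-(L.Q₁ x).transpose * jostLimit L.transpose.reflect.Q₁ x)).transpose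
  rw [neg_mul, neg_neg, Matrix.transpose_mul, Matrix.transpose_transpose, jostLimitInv]

lemma jostLimitInv_mul {x : ℝ} (hx : 0 ≤ x) : L.jostLimitInv x * jostLimit L.Q₁ x = 1 := by
  have h1 := (hL.isPrimitive_jostLimitInv.mul hL.coeffs.isPrimitive_jostLimit).congr
    (g₁ := fun _ => 0) (fun _ _ => rfl) fun x _ => by noncomm_ring
  have h2 : ∀ y, 0 ≤ y → L.jostLimitInv y * jostLimit L.Q₁ y =
      L.jostLimitInv 0 * jostLimit L.Q₁ 0 := fun y hy => by
    have := h1.eq_add y hy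
    simpa using this
  have h3 : Tendsto L.jostLimitInv atTop (𝓝 1) :=
    (((transposeCLM m).continuous.tendsto 1).comp
      hL.transpose.reflect.coeffs.tendsto_jostLimit).mono_right (by simp)
  have h4 := h3.mul hL.coeffs.tendsto_jostLimit
  rw [one_mul] at h4
  rw [h2 x hx]
  refine tendsto_nhds_unique (tendsto_const_nhds.congr' ?_) h4
  filter_upwards [eventually_ge_atTop 0] with y hy using (h2 y hy).symm

lemma jostLimit_mul {x : ℝ} (hx : 0 ≤ x) : jostLimit L.Q₁ x * L.jostLimitInv x = 1 :=
  mul_eq_one_comm.1 (hL.jostLimitInv_mul hx)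

lemma propagator_zero : L.propagator 0 = 1 := hL.jostLimit_mul le_rfl

lemma propagatorInv_zero : L.propagatorInv 0 = 1 := hL.jostLimit_mul le_rfl

lemma isPrimitive_propagator : IsPrimitive L.propagator (fun x => -(L.Q₁ x * L.propagator x)) :=
  (hL.coeffs.isPrimitive_jostLimit.mul_const _).congr (fun _ _ => rfl) fun _ _ => by
    rw [propagator]; noncomm_ring

lemma isPrimitive_propagatorInv :
    IsPrimitive L.propagatorInv (fun x => L.propagatorInv x * L.Q₁ x) :=
  (hL.isPrimitive_jostLimitInv.const_mul _).congr (fun _ _ => rfl) fun _ _ => by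
    rw [propagatorInv]; noncomm_ring

lemma propagatorInv_mul {x : ℝ} (hx : 0 ≤ x) : L.propagatorInv x * L.propagator x = 1 := by
  have h1 := (hL.isPrimitive_propagatorInv.mul hL.isPrimitive_propagator).congr
    (g₁ := fun _ => 0) (fun _ _ => rfl) fun x _ => by noncomm_ring
  have := h1.eq_add x hx
  simpa [hL.propagator_zero, hL.propagatorInv_zero] using this

lemma isUnit_one_add : IsUnit (1 + L.h₁) := by
  rw [Matrix.isUnit_iff_isUnit_det, isUnit_iff_ne_zero]
  exact hL.det_add_ne_zero

lemma isUnit_jostLimit {x : ℝ} (hx : 0 ≤ x) : IsUnit (jostLimit L.Q₁ x) :=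
  IsUnit.of_mul_eq_one _ (hL.jostLimit_mul hx)

lemma tendsto_jostU_jostLimit {x : ℝ} (hx : 0 ≤ x) :
    Tendsto (fun ρ => jostU L.Q₀ L.Q₁ ρ x) upperInfinity (𝓝 (jostLimit L.Q₁ x)) := by
  obtain ⟨C, -, hC⟩ := hL.coeffs.jost_asymptotics
  refine tendsto_iff_norm_sub_tendsto_zero.2 ?_
  refine squeeze_zero' (Eventually.of_forall fun _ => norm_nonneg _) ?_
    (tendsto_const_div_upperInfinity C)
  filter_upwards [eventually_im_pos, eventually_le_norm 1] with ρ h1 h2 using (hC ρ h1 h2 x hx).2.2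

lemma tendsto_jostV_zero {x : ℝ} (hx : 0 ≤ x) :
    Tendsto (fun ρ => jostV L.Q₀ L.Q₁ ρ x) upperInfinity (𝓝 0) := by
  obtain ⟨C, -, hC⟩ := hL.coeffs.jost_asymptotics
  refine squeeze_zero_norm' ?_ (tendsto_const_div_upperInfinity C)
  filter_upwards [eventually_im_pos, eventually_le_norm 1] with ρ h1 h2 using (hC ρ h1 h2 x hx).2.1

lemma tendsto_jostBdry : Tendsto (fun ρ => (Complex.I * ρ)⁻¹ • L.jostBdry ρ) upperInfinity
    (𝓝 ((1 + L.h₁) * jostLimit L.Q₁ 0)) := by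
  have hU := hL.tendsto_jostU_jostLimit le_rfl
  have hV := hL.tendsto_jostV_zero le_rfl
  have h1 := (hU.sub hV).add (((tendsto_inv_upperInfinity.smul_const L.h₀).const_add L.h₁).mul
    (hU.add hV))
  rw [sub_zero, add_zero, zero_smul, add_zero] at h1
  rw [add_mul, one_mul]
  refine h1.congr' ?_
  filter_upwards [eventually_im_pos] with ρ hρ
  have hρ0 : Complex.I * ρ ≠ 0 := mul_ne_zero Complex.I_ne_zero (by rintro rfl; simp at hρ)
  rw [jostBdry, bdry, jostDeriv, jost, hL.coeffs.jostY_eq hρ le_rfl, smul_add, smul_smul,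
    ← smul_mul_assoc (Complex.I * ρ)⁻¹, smul_add, smul_smul, inv_mul_cancel₀ hρ0, one_smul]
  congr 1
  · rw [Complex.ofReal_zero, mul_zero, Complex.exp_zero, mul_one, inv_mul_cancel₀ hρ0, one_smul]
  · simp

lemma isUnit_limit : IsUnit ((1 + L.h₁) * jostLimit L.Q₁ 0) :=
  hL.isUnit_one_add.mul (hL.isUnit_jostLimit le_rfl)

lemma ringInverse_limit : Ring.inverse ((1 + L.h₁) * jostLimit L.Q₁ 0) =
    L.jostLimitInv 0 * Ring.inverse (1 + L.h₁) := by
  refine Ring.inverse_eq_of_mul_eq_one' hL.isUnit_limit ?_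
  rw [mul_assoc, ← mul_assoc (jostLimit L.Q₁ 0), hL.jostLimit_mul le_rfl, one_mul,
    Ring.mul_inverse_cancel _ hL.isUnit_one_add]

lemma eventually_isUnit_jostBdry : ∀ᶠ ρ in upperInfinity, IsUnit (L.jostBdry ρ) ∧
    Ring.inverse (L.jostBdry ρ) =
      (Complex.I * ρ)⁻¹ • Ring.inverse ((Complex.I * ρ)⁻¹ • L.jostBdry ρ) := by
  obtain ⟨u, hu⟩ := hL.isUnit_limit
  have h1 := hL.tendsto_jostBdry.eventually (by rw [← hu]; exact Units.nhds u)
  filter_upwards [h1, eventually_im_pos] with ρ h hρ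
  have hρ0 : Complex.I * ρ ≠ 0 := mul_ne_zero Complex.I_ne_zero (by rintro rfl; simp at hρ)
  have h2 : L.jostBdry ρ * ((Complex.I * ρ)⁻¹ • Ring.inverse ((Complex.I * ρ)⁻¹ • L.jostBdry ρ)) =
      1 := by
    rw [mul_smul_comm, ← smul_mul_assoc]
    exact Ring.mul_inverse_cancel _ h
  have h3 : IsUnit (L.jostBdry ρ) := IsUnit.of_mul_eq_one _ h2
  exact ⟨h3, Ring.inverse_eq_of_mul_eq_one' h3 h2⟩

/-- Asymptotics of the Weyl solution in the upper half-plane. -/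
lemma tendsto_weylPhi {x : ℝ} (hx : 0 ≤ x) :
    Tendsto (fun ρ : ℂ => (Complex.I * ρ * Complex.exp (-(Complex.I * ρ) * x)) • L.weylPhi x ρ)
      upperInfinity (𝓝 (L.weylLimit x)) ∧
    Tendsto (fun ρ : ℂ => Complex.exp (-(Complex.I * ρ) * x) • L.weylPhiDeriv x ρ)
      upperInfinity (𝓝 (L.weylLimit x)) := by
  have hU := hL.tendsto_jostU_jostLimit hx
  have hV := hL.tendsto_jostV_zero hx
  have hI := tendsto_ringInverse hL.isUnit_limit hL.tendsto_jostBdry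
  rw [hL.ringInverse_limit] at hI
  have e : jostLimit L.Q₁ x * (L.jostLimitInv 0 * Ring.inverse (1 + L.h₁)) = L.weylLimit x := by
    rw [weylLimit, propagator, mul_assoc]
  have hexp : ∀ ρ : ℂ, Complex.exp (-(Complex.I * ρ) * x) * Complex.exp (Complex.I * ρ * x) = 1 :=
    fun ρ => by rw [← Complex.exp_add]; simp
  constructor
  · have h1 := (hU.add hV).mul hI
    rw [add_zero, e] at h1
    refine h1.congr' ?_
    filter_upwards [hL.eventually_isUnit_jostBdry, eventually_im_pos] with ρ hu hρ
    have hρ0 : Complex.I * ρ ≠ 0 := mul_ne_zero Complex.I_ne_zero (by rintro rfl; simp at hρ)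
    rw [(hL.weylPhi_eq hρ ((hL.hasWeylSolution_iff hρ).2 hu.1) hx).1, hu.2, jost,
      hL.coeffs.jostY_eq hρ hx, smul_mul_smul_comm, smul_smul]
    rw [show Complex.I * ρ * Complex.exp (-(Complex.I * ρ) * x) *
      (Complex.exp (Complex.I * ρ * x) * (Complex.I * ρ)⁻¹) = (Complex.I * ρ * (Complex.I * ρ)⁻¹) *
        (Complex.exp (-(Complex.I * ρ) * x) * Complex.exp (Complex.I * ρ * x)) by ring, hexp,
      mul_inv_cancel₀ hρ0, one_mul, one_smul]
  · have h1 := (hU.sub hV).mul hI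
    rw [sub_zero, e] at h1
    refine h1.congr' ?_
    filter_upwards [hL.eventually_isUnit_jostBdry, eventually_im_pos] with ρ hu hρ
    have hρ0 : Complex.I * ρ ≠ 0 := mul_ne_zero Complex.I_ne_zero (by rintro rfl; simp at hρ)
    rw [(hL.weylPhi_eq hρ ((hL.hasWeylSolution_iff hρ).2 hu.1) hx).2, hu.2, jostDeriv,
      smul_mul_smul_comm, smul_smul]
    rw [show Complex.exp (-(Complex.I * ρ) * x) *
      (Complex.I * ρ * Complex.exp (Complex.I * ρ * x) * (Complex.I * ρ)⁻¹) =
        (Complex.I * ρ * (Complex.I * ρ)⁻¹) *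
        (Complex.exp (-(Complex.I * ρ) * x) * Complex.exp (Complex.I * ρ * x)) by ring, hexp,
      mul_inv_cancel₀ hρ0, one_mul, one_smul]

lemma tendsto_weylMatrix : Tendsto (fun ρ : ℂ => (Complex.I * ρ) • L.weylMatrix ρ)
    upperInfinity (𝓝 (Ring.inverse (1 + L.h₁))) := by
  have h := (hL.tendsto_weylPhi le_rfl).1
  rw [weylLimit, hL.propagator_zero, one_mul] at h
  refine h.congr fun ρ => ?_
  simp [weylPhi, hL.sine_zero, hL.phi_zero]

lemma exists_norm_weylPhi_le_of_im_pos {x : ℝ} (hx : 0 ≤ x) : ∃ R C, 0 ≤ C ∧ ∀ ρ : ℂ, 0 < ρ.im →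
    R ≤ ‖ρ‖ → ‖L.weylPhi x ρ‖ ≤ C * Real.exp (-(|ρ.im| * x)) / ‖ρ‖ ∧
      ‖L.weylPhiDeriv x ρ‖ ≤ C * Real.exp (-(|ρ.im| * x)) := by
  obtain ⟨h1, h2⟩ := hL.tendsto_weylPhi hx
  have e1 := h1.norm.eventually_le_const (lt_add_one _)
  have e2 := h2.norm.eventually_le_const (lt_add_one _)
  obtain ⟨R, hR⟩ := eventually_upperInfinity.1 (e1.and e2)
  refine ⟨max R 1, ‖L.weylLimit x‖ + 1, by positivity, fun ρ hρ hρR => ?_⟩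
  obtain ⟨h3, h4⟩ := hR ρ hρ ((le_max_left _ _).trans hρR)
  have hρ1 : 0 < ‖ρ‖ := one_pos.trans_le ((le_max_right _ _).trans hρR)
  rw [norm_smul, norm_exp_I_mul] at h4
  rw [norm_smul, norm_mul, norm_mul, Complex.norm_I, one_mul, norm_exp_I_mul] at h3
  rw [abs_of_pos hρ, Real.exp_neg, ← div_eq_mul_inv]
  have hE := Real.exp_pos (ρ.im * x)
  constructor
  · rw [div_div, le_div_iff₀ (by positivity)]
    linarith
  · rw [le_div_iff₀ hE]
    linarith

/-- Bounds for the Weyl solution, uniform for large nonreal `ρ`. -/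
lemma exists_norm_weylPhi_le {x : ℝ} (hx : 0 ≤ x) : ∃ R C, 1 ≤ R ∧ 0 ≤ C ∧ ∀ ρ : ℂ, ρ.im ≠ 0 →
    R ≤ ‖ρ‖ → ‖L.weylPhi x ρ‖ ≤ C * Real.exp (-(|ρ.im| * x)) / ‖ρ‖ ∧
      ‖L.weylPhiDeriv x ρ‖ ≤ C * Real.exp (-(|ρ.im| * x)) := by
  obtain ⟨R₁, C₁, hC₁, h₁⟩ := hL.exists_norm_weylPhi_le_of_im_pos hx
  obtain ⟨R₂, C₂, hC₂, h₂⟩ := hL.reflect.exists_norm_weylPhi_le_of_im_pos hx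
  refine ⟨max 1 (max R₁ R₂), max C₁ C₂, le_max_left _ _, le_max_of_le_left hC₁, fun ρ hρ hR => ?_⟩
  have hρ1 : 0 < ‖ρ‖ := one_pos.trans_le ((le_max_left _ _).trans hR)
  have hR' := (le_max_right _ _).trans hR
  rcases hρ.lt_or_gt with h | h
  · have h3 := h₂ (-ρ) (by simpa using h) (by rw [norm_neg]; exact (le_max_right _ _).trans hR')
    rw [(hL.reflect_weylPhi hx _).1, (hL.reflect_weylPhi hx _).2, neg_neg, norm_neg,
      Complex.neg_im, abs_neg] at h3
    refine ⟨h3.1.trans ?_, h3.2.trans ?_⟩ <;> gcongr <;> exact le_max_right _ _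
  · have h3 := h₁ ρ h ((le_max_left _ _).trans hR')
    refine ⟨h3.1.trans ?_, h3.2.trans ?_⟩ <;> gcongr <;> exact le_max_left _ _

/-! ### Regularity of the Weyl matrix -/

lemma differentiableOn_jostBdry : DifferentiableOn ℂ L.jostBdry {ρ | 0 < ρ.im} :=
  hL.coeffs.differentiableOn_jostDeriv_zero.add
    ((differentiable_bdry L).differentiableOn.mul hL.coeffs.differentiableOn_jost_zero)

lemma differentiableAt_weylMatrix_of_im_pos {ρ : ℂ} (hρ : 0 < ρ.im) (h : L.HasWeylSolution ρ) :
    DifferentiableAt ℂ L.weylMatrix ρ := by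
  have hU : {ρ : ℂ | 0 < ρ.im} ∈ 𝓝 ρ :=
    (isOpen_lt continuous_const Complex.continuous_im).mem_nhds hρ
  have hu := (hL.hasWeylSolution_iff hρ).1 h
  have hd := hL.differentiableOn_jostBdry.differentiableAt hU
  have h1 : DifferentiableAt ℂ (fun ρ => jost L.Q₀ L.Q₁ ρ 0 * Ring.inverse (L.jostBdry ρ)) ρ :=
    (hL.coeffs.differentiableOn_jost_zero.differentiableAt hU).mul
      ((differentiableAt_inverse hu).comp ρ hd)
  refine h1.congr_of_eventuallyEq ?_
  obtain ⟨u, hu⟩ := hu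
  have h2 := hd.continuousAt.eventually (by rw [← hu]; exact Units.nhds u)
  filter_upwards [h2, hU] with w hw hw0
  exact hL.weylMatrix_eq hw0 ((hL.hasWeylSolution_iff hw0).2 hw)

lemma differentiableAt_weylMatrix {ρ : ℂ} (h : L.HasWeylSolution ρ) :
    DifferentiableAt ℂ L.weylMatrix ρ := by
  rcases lt_trichotomy ρ.im 0 with h0 | h0 | h0
  · have h1 := hL.reflect.differentiableAt_weylMatrix_of_im_pos (ρ := -ρ) (by simpa using h0)
      ((hasWeylSolution_reflect L _).2 (by rwa [neg_neg]))
    have h2 : L.weylMatrix = fun ρ => L.reflect.weylMatrix (-ρ) := by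
      funext w; rw [weylMatrix_reflect, neg_neg]
    rw [h2]
    exact h1.comp ρ differentiableAt_id.neg
  · exact absurd h (not_hasWeylSolution_of_im_eq_zero h0)
  · exact hL.differentiableAt_weylMatrix_of_im_pos h0 h

end Admissible

end QuadraticPencil

/-! ### Cauchy's theorem in a cut annulus -/

section CutAnnulus

variable {E : Type*} [NormedAddCommGroup E] [NormedSpace ℂ E] [CompleteSpace E]

/-- Cauchy's theorem in the half-annulus `R < |θ| < N`, `Im θ > 0`; the half-annulus is the image
of a rectangle under the exponential function. -/
lemma integral_halfAnnulus_eq_zero {G : ℂ → E} {R N : ℝ} (hR : 0 < R) (hN : R ≤ N)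
    (hc : ContinuousOn G {θ | 0 ≤ θ.im ∧ R ≤ ‖θ‖})
    (hd : ∀ θ : ℂ, 0 < θ.im → R < ‖θ‖ → DifferentiableAt ℂ G θ) :
    (∫ t in R..N, G t) + (∫ t in R..N, G (-t : ℝ)) +
      (∫ y in (0 : ℝ)..Real.pi, deriv (circleMap 0 N) y • G (circleMap 0 N y)) -
      (∫ y in (0 : ℝ)..Real.pi, deriv (circleMap 0 R) y • G (circleMap 0 R y)) = 0 := by
  have hN0 : 0 < N := hR.trans_le hN
  have hlog : Real.log R ≤ Real.log N := Real.log_le_log hR hN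
  set f : ℂ → E := fun w => Complex.exp w • G (Complex.exp w) with hf
  have hnorm : ∀ w : ℂ, ‖Complex.exp w‖ = Real.exp w.re := Complex.norm_exp
  have hRle : ∀ w : ℂ, Real.log R ≤ w.re → R ≤ ‖Complex.exp w‖ := fun w hw => by
    rw [hnorm, ← Real.log_le_iff_le_exp hR]; exact hw
  have hzre : ((Real.log R : ℝ) : ℂ).re = Real.log R := Complex.ofReal_re _
  have hzim : ((Real.log R : ℝ) : ℂ).im = 0 := Complex.ofReal_im _
  have hwre : ((Real.log N : ℝ) + Real.pi * Complex.I : ℂ).re = Real.log N := by simp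
  have hwim : ((Real.log N : ℝ) + Real.pi * Complex.I : ℂ).im = Real.pi := by simp
  have key := Complex.integral_boundary_rect_eq_zero_of_continuousOn_of_differentiableOn f
    ((Real.log R : ℝ) : ℂ) ((Real.log N : ℝ) + Real.pi * Complex.I : ℂ) ?_ ?_
  · rw [hzre, hzim, hwre, hwim] at key
    have hexpR : ∀ s ∈ uIcc (Real.log R) (Real.log N), HasDerivAt Real.exp (Real.exp s) s :=
      fun s _ => Real.hasDerivAt_exp s
    have himg : Real.exp '' uIcc (Real.log R) (Real.log N) ⊆ Ici R := by
      rintro _ ⟨s, hs, rfl⟩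
      rw [uIcc_of_le hlog] at hs
      rw [mem_Ici, ← Real.log_le_iff_le_exp hR]
      exact hs.1
    have e1 : ∫ s in Real.log R..Real.log N, f (s + ((0 : ℝ) : ℂ) * Complex.I) =
        ∫ t in R..N, G t := by
      have h1 := intervalIntegral.integral_deriv_smul_comp' (g := fun t : ℝ => G t) hexpR
        Real.continuous_exp.continuousOn ?_
      · rw [Real.exp_log hR, Real.exp_log hN0] at h1
        rw [← h1]
        refine intervalIntegral.integral_congr fun s _ => ?_
        simp only [hf, Complex.ofReal_zero, zero_mul, add_zero, Function.comp_apply,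
          ← Complex.ofReal_exp, Complex.coe_smul]
      · refine hc.comp (by fun_prop) fun t ht => ?_
        have : R ≤ t := himg ht
        exact ⟨by simp, by rw [Complex.norm_real]; exact this.trans (le_abs_self t)⟩
    have e2 : ∫ s in Real.log R..Real.log N, f (s + (Real.pi : ℂ) * Complex.I) =
        -∫ t in R..N, G (-t : ℝ) := by
      have h1 := intervalIntegral.integral_deriv_smul_comp' (g := fun t : ℝ => G (-t : ℝ)) hexpR
        Real.continuous_exp.continuousOn ?_
      · rw [Real.exp_log hR, Real.exp_log hN0] at h1
        rw [← h1, ← intervalIntegral.integral_neg]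
        refine intervalIntegral.integral_congr fun s _ => ?_
        simp only [hf, Complex.exp_add, Complex.exp_pi_mul_I, Function.comp_apply, mul_neg, mul_one,
          ← Complex.ofReal_exp, Complex.coe_smul, neg_smul, Complex.ofReal_neg]
      · refine hc.comp (by fun_prop) fun t ht => ?_
        have : R ≤ t := himg ht
        refine ⟨by simp, ?_⟩
        rw [Complex.norm_real, norm_neg]
        exact this.trans (le_abs_self t)
    have e3 : ∀ K : ℝ, 0 < K → Complex.I • ∫ y in (0 : ℝ)..Real.pi,
        f ((Real.log K : ℝ) + y * Complex.I) =
        ∫ y in (0 : ℝ)..Real.pi, deriv (circleMap 0 K) y • G (circleMap 0 K y) := fun K hK => by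
      rw [← intervalIntegral.integral_smul]
      refine intervalIntegral.integral_congr fun y _ => ?_
      have h2 : Complex.exp ((Real.log K : ℝ) + y * Complex.I) = circleMap 0 K y := by
        rw [Complex.exp_add, ← Complex.ofReal_exp, Real.exp_log hK, circleMap, zero_add]
      simp only [hf]
      rw [h2, deriv_circleMap, smul_smul, mul_comm]
    rw [e1, e2, e3 N hN0, e3 R hR] at key
    rw [← key]
    abel
  · rw [hzre, hzim, hwre, hwim, uIcc_of_le hlog, uIcc_of_le Real.pi_pos.le]
    refine Complex.continuous_exp.continuousOn.smul
      (hc.comp Complex.continuous_exp.continuousOn fun w hw => ⟨?_, hRle w hw.1.1⟩)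
    rw [Complex.exp_im]
    exact mul_nonneg (Real.exp_pos _).le (Real.sin_nonneg_of_nonneg_of_le_pi hw.2.1 hw.2.2)
  · rw [hzre, hzim, hwre, hwim, min_eq_left hlog, max_eq_right hlog, min_eq_left Real.pi_pos.le,
      max_eq_right Real.pi_pos.le]
    intro w hw
    have h1 : DifferentiableAt ℂ G (Complex.exp w) := by
      refine hd _ ?_ ?_
      · rw [Complex.exp_im]
        exact mul_pos (Real.exp_pos _) (Real.sin_pos_of_pos_of_lt_pi hw.2.1 hw.2.2)
      · rw [hnorm, ← Real.log_lt_iff_lt_exp hR]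
        exact hw.1.1
    exact (Complex.differentiable_exp.differentiableAt.smul
      (h1.comp w Complex.differentiable_exp.differentiableAt)).differentiableWithinAt

lemma circleMap_im (N y : ℝ) : (circleMap 0 N y).im = N * Real.sin y := by
  simp [circleMap, Complex.exp_im]

lemma norm_circleMap (N y : ℝ) : ‖circleMap 0 N y‖ = |N| := norm_circleMap_zero N y

lemma circleMap_add_pi (N y : ℝ) : circleMap 0 N (y + Real.pi) = -circleMap 0 N y := by
  simp [circleMap, add_mul, Complex.exp_add, Complex.exp_pi_mul_I]

/-- A function that is holomorphic outside the disc `|θ| < R` and off the real axis, with different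
continuous extensions `Fp`, `Fm` to the real axis from above and from below. -/
structure CutHolomorphic (R : ℝ) (Fp Fm : ℂ → E) : Prop where
  continuousOn_upper : ContinuousOn Fp {θ | 0 ≤ θ.im ∧ R ≤ ‖θ‖}
  continuousOn_lower : ContinuousOn Fm {θ | θ.im ≤ 0 ∧ R ≤ ‖θ‖}
  differentiableAt_upper : ∀ θ : ℂ, 0 < θ.im → R < ‖θ‖ → DifferentiableAt ℂ Fp θ
  differentiableAt_lower : ∀ θ : ℂ, θ.im < 0 → R < ‖θ‖ → DifferentiableAt ℂ Fm θ

namespace CutHolomorphic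

variable {R : ℝ} {Fp Fm F : ℂ → E}

/-- The integral over a circle, split into the upper and the lower half. -/
lemma circleIntegral_eq (h : CutHolomorphic R Fp Fm) (hR : 0 < R) {N : ℝ} (hN : R ≤ N)
    (hp : ∀ θ, 0 < θ.im → ‖θ‖ = N → F θ = Fp θ) (hm : ∀ θ, θ.im < 0 → ‖θ‖ = N → F θ = Fm θ) :
    CircleIntegrable F 0 N ∧ circleIntegral F 0 N =
      (∫ y in (0 : ℝ)..Real.pi, deriv (circleMap 0 N) y • Fp (circleMap 0 N y)) -
      (∫ y in (0 : ℝ)..Real.pi, deriv (circleMap 0 N) y • Fm (-circleMap 0 N y)) := by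
  have hN0 : 0 < N := hR.trans_le hN
  have hπ := Real.pi_pos
  have hn : ∀ y, ‖circleMap 0 N y‖ = N := fun y => by rw [norm_circleMap, abs_of_pos hN0]
  have hcont : ContinuousOn (fun y => Fp (circleMap 0 N y)) (uIcc 0 Real.pi) := by
    refine h.continuousOn_upper.comp (continuous_circleMap 0 N).continuousOn fun y hy => ?_
    rw [uIcc_of_le hπ.le] at hy
    refine ⟨?_, by rw [hn]; exact hN⟩
    rw [circleMap_im]
    exact mul_nonneg hN0.le (Real.sin_nonneg_of_nonneg_of_le_pi hy.1 hy.2)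
  have hcont' : ContinuousOn (fun y => Fm (circleMap 0 N y)) (uIcc Real.pi (2 * Real.pi)) := by
    refine h.continuousOn_lower.comp (continuous_circleMap 0 N).continuousOn fun y hy => ?_
    rw [uIcc_of_le (by linarith)] at hy
    refine ⟨?_, by rw [hn]; exact hN⟩
    rw [circleMap_im]
    have := Real.sin_nonneg_of_nonneg_of_le_pi (x := y - Real.pi) (by linarith [hy.1])
      (by linarith [hy.2])
    rw [Real.sin_sub_pi] at this
    nlinarith
  have hdc : Continuous (deriv (circleMap 0 N)) := by
    have : deriv (circleMap 0 N) = fun y => circleMap 0 N y * Complex.I :=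
      funext fun y => deriv_circleMap 0 N y
    rw [this]
    exact (continuous_circleMap 0 N).mul continuous_const
  have ae1 : ∀ y ∈ Ioo 0 Real.pi, F (circleMap 0 N y) = Fp (circleMap 0 N y) := fun y hy =>
    hp _ (by rw [circleMap_im]; exact mul_pos hN0 (Real.sin_pos_of_pos_of_lt_pi hy.1 hy.2)) (hn y)
  have ae2 : ∀ y ∈ Ioo Real.pi (2 * Real.pi), F (circleMap 0 N y) = Fm (circleMap 0 N y) :=
    fun y hy => hm _ (by
      rw [circleMap_im]
      have := Real.sin_pos_of_pos_of_lt_pi (x := y - Real.pi) (by linarith [hy.1])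
        (by linarith [hy.2])
      rw [Real.sin_sub_pi] at this
      nlinarith) (hn y)
  have i1 : IntervalIntegrable (fun y => F (circleMap 0 N y)) volume 0 Real.pi := by
    refine hcont.intervalIntegrable.congr_uIoo fun y hy => ?_
    rw [uIoo_of_le hπ.le] at hy
    exact (ae1 y hy).symm
  have i2 : IntervalIntegrable (fun y => F (circleMap 0 N y)) volume Real.pi (2 * Real.pi) := by
    refine hcont'.intervalIntegrable.congr_uIoo fun y hy => ?_
    rw [uIoo_of_le (by linarith)] at hy
    exact (ae2 y hy).symm
  refine ⟨i1.trans i2, ?_⟩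
  have j1 := i1.continuousOn_smul (f := deriv (circleMap 0 N)) hdc.continuousOn
  have j2 := i2.continuousOn_smul (f := deriv (circleMap 0 N)) hdc.continuousOn
  rw [circleIntegral, ← intervalIntegral.integral_add_adjacent_intervals j1 j2, sub_eq_add_neg]
  congr 1
  · refine intervalIntegral.integral_congr_uIoo fun y hy => ?_
    rw [uIoo_of_le hπ.le] at hy
    simp only [ae1 y hy]
  · have h3 : ∫ y in Real.pi..(2 * Real.pi), deriv (circleMap 0 N) y • F (circleMap 0 N y) =
        ∫ y in Real.pi..(2 * Real.pi), deriv (circleMap 0 N) y • Fm (circleMap 0 N y) := by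
      refine intervalIntegral.integral_congr_uIoo fun y hy => ?_
      rw [uIoo_of_le (by linarith)] at hy
      simp only [ae2 y hy]
    have h4 := intervalIntegral.integral_comp_add_right (a := 0) (b := Real.pi)
      (fun y => deriv (circleMap 0 N) y • Fm (circleMap 0 N y)) Real.pi
    rw [zero_add, ← two_mul] at h4
    rw [h3, ← h4, ← intervalIntegral.integral_neg]
    refine intervalIntegral.integral_congr fun y _ => ?_
    rw [deriv_circleMap, deriv_circleMap, circleMap_add_pi, neg_mul, neg_smul]

/-- Cauchy's theorem in the cut annulus `R < |θ| < N`. -/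
lemma integral_annulus_eq_zero (h : CutHolomorphic R Fp Fm) (hR : 0 < R) {N : ℝ} (hN : R ≤ N)
    (hp : ∀ θ, 0 < θ.im → ‖θ‖ = R ∨ ‖θ‖ = N → F θ = Fp θ)
    (hm : ∀ θ, θ.im < 0 → ‖θ‖ = R ∨ ‖θ‖ = N → F θ = Fm θ) :
    circleIntegral F 0 N - circleIntegral F 0 R +
      ((∫ t in R..N, (Fp t - Fm t)) + ∫ t in R..N, (Fp (-t : ℝ) - Fm (-t : ℝ))) = 0 := by
  have k1 := integral_halfAnnulus_eq_zero hR hN h.continuousOn_upper h.differentiableAt_upper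
  have k2 := integral_halfAnnulus_eq_zero (G := fun θ => Fm (-θ)) hR hN
    (h.continuousOn_lower.comp continuous_neg.continuousOn fun θ hθ => ⟨by simpa using hθ.1,
      by rw [norm_neg]; exact hθ.2⟩)
    (fun θ h1 h2 => (h.differentiableAt_lower (-θ) (by simpa using h1)
      (by rwa [norm_neg])).comp θ differentiableAt_id.neg)
  rw [(h.circleIntegral_eq hR hN (fun θ h1 h2 => hp θ h1 (Or.inr h2))
      (fun θ h1 h2 => hm θ h1 (Or.inr h2))).2,
    (h.circleIntegral_eq hR le_rfl (fun θ h1 h2 => hp θ h1 (Or.inl h2))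
      (fun θ h1 h2 => hm θ h1 (Or.inl h2))).2]
  have hsub : ∀ t ∈ uIcc R N, R ≤ ‖(t : ℂ)‖ := fun t ht => by
    rw [uIcc_of_le hN] at ht
    rw [Complex.norm_real]
    exact ht.1.trans (le_abs_self t)
  have c1 : IntervalIntegrable (fun t : ℝ => Fp t) volume R N :=
    (h.continuousOn_upper.comp (by fun_prop) fun t ht =>
      ⟨by simp, hsub t ht⟩).intervalIntegrable
  have c2 : IntervalIntegrable (fun t : ℝ => Fm t) volume R N :=
    (h.continuousOn_lower.comp (by fun_prop) fun t ht =>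
      ⟨by simp, hsub t ht⟩).intervalIntegrable
  have c3 : IntervalIntegrable (fun t : ℝ => Fp (-t : ℝ)) volume R N :=
    (h.continuousOn_upper.comp (by fun_prop) fun t ht =>
      ⟨by simp, by simpa using hsub t ht⟩).intervalIntegrable
  have c4 : IntervalIntegrable (fun t : ℝ => Fm (-t : ℝ)) volume R N :=
    (h.continuousOn_lower.comp (by fun_prop) fun t ht =>
      ⟨by simp, by simpa using hsub t ht⟩).intervalIntegrable
  rw [intervalIntegral.integral_sub c1 c2, intervalIntegral.integral_sub c3 c4]
  simp only [Complex.ofReal_neg, neg_neg] at k1 k2 ⊢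
  have e : ∀ a b c d e1 f g k : E, c - d - (e1 - f) + (a - b + (g - k)) =
      (a + g + c - e1) - (k + b + d - f) := fun a b c d e1 f g k => by abel
  rw [e, k1, k2, sub_zero]

/-- Cauchy's formula in the cut annulus `R < |θ| < N`, from a pair of functions that agree with
`(F(θ) - F(ρ)) / (θ - ρ)` on the boundary. -/
lemma cauchy_formula_aux (h : CutHolomorphic R Fp Fm) (hR : 0 < R) {N : ℝ}
    (hp : ∀ θ, 0 < θ.im → F θ = Fp θ) (hm : ∀ θ, θ.im < 0 → F θ = Fm θ)
    {ρ : ℂ} (hρR : R < ‖ρ‖) (hρN : ‖ρ‖ < N) {u : E} {Kp Km : ℂ → E} (hK : CutHolomorphic R Kp Km)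
    (hKp : ∀ θ, 0 ≤ θ.im → θ ≠ ρ → Kp θ = (θ - ρ)⁻¹ • (Fp θ - u))
    (hKm : ∀ θ, θ.im ≤ 0 → θ ≠ ρ → Km θ = (θ - ρ)⁻¹ • (Fm θ - u)) (hρ : ρ.im ≠ 0) :
    (2 * Real.pi * Complex.I : ℂ) • u =
      circleIntegral (fun θ => (θ - ρ)⁻¹ • F θ) 0 N -
        circleIntegral (fun θ => (θ - ρ)⁻¹ • F θ) 0 R +
      ((∫ t in R..N, ((t : ℂ) - ρ)⁻¹ • (Fp t - Fm t)) +
        ∫ t in R..N, (((-t : ℝ) : ℂ) - ρ)⁻¹ • (Fp (-t : ℝ) - Fm (-t : ℝ))) := by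
  have hRN : R ≤ N := (hρR.trans hρN).le
  have hN0 : 0 < N := hR.trans_le hRN
  have hne : ∀ θ, ‖θ‖ = R ∨ ‖θ‖ = N → θ ≠ ρ := by
    rintro θ (h1 | h1) rfl
    · exact hρR.ne' h1
    · exact hρN.ne h1
  have hreal : ∀ t : ℝ, (t : ℂ) ≠ ρ := by rintro t rfl; simp at hρ
  have h0 := hK.integral_annulus_eq_zero (F := fun θ => (θ - ρ)⁻¹ • (F θ - u)) hR hRN
    (fun θ h1 h2 => by rw [hKp θ h1.le (hne θ h2), hp θ h1])
    (fun θ h1 h2 => by rw [hKm θ h1.le (hne θ h2), hm θ h1])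
  have hci : ∀ K, 0 < K → K ≠ ‖ρ‖ → ContinuousOn (fun θ : ℂ => (θ - ρ)⁻¹) (Metric.sphere 0 K) :=
    fun K hK hKρ => ContinuousOn.inv₀ (by fun_prop) fun θ hθ => by
      rw [sub_ne_zero]
      rintro rfl
      exact hKρ (by simpa using hθ.symm)
  have hsplit : ∀ K, R ≤ K → K ≠ ‖ρ‖ → circleIntegral (fun θ => (θ - ρ)⁻¹ • (F θ - u)) 0 K =
      circleIntegral (fun θ => (θ - ρ)⁻¹ • F θ) 0 K -
        (circleIntegral (fun θ => (θ - ρ)⁻¹) 0 K) • u := fun K hRK hKρ => by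
    have hK0 : 0 < K := hR.trans_le hRK
    have hF := (h.circleIntegral_eq (F := F) hR hRK (fun θ h1 _ => hp θ h1)
      (fun θ h1 _ => hm θ h1)).1
    have i1 : CircleIntegrable (fun θ => (θ - ρ)⁻¹ • F θ) 0 K := by
      refine IntervalIntegrable.continuousOn_smul (f := fun y => (circleMap 0 K y - ρ)⁻¹) hF ?_
      exact (hci K hK0 hKρ).comp (continuous_circleMap 0 K).continuousOn fun y _ =>
        circleMap_mem_sphere 0 hK0.le y
    have i2 : CircleIntegrable (fun θ => (θ - ρ)⁻¹ • u) 0 K :=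
      ((hci K hK0 hKρ).smul continuousOn_const).circleIntegrable hK0.le
    rw [← circleIntegral.integral_smul_const, ← circleIntegral.integral_sub i1 i2]
    simp only [smul_sub]
  rw [hsplit N hRN hρN.ne', hsplit R le_rfl hρR.ne,
    circleIntegral.integral_sub_inv_of_mem_ball (by simpa using hρN)] at h0
  have hz : circleIntegral (fun θ => (θ - ρ)⁻¹) 0 R = 0 := by
    have hne' : ∀ θ ∈ Metric.closedBall (0 : ℂ) R, θ - ρ ≠ 0 := fun θ hθ => by
      rw [sub_ne_zero]
      rintro rfl
      rw [mem_closedBall_zero_iff] at hθ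
      exact hρR.not_ge hθ
    refine Complex.circleIntegral_eq_zero_of_differentiable_on_off_countable hR.le
      Set.countable_empty (ContinuousOn.inv₀ (by fun_prop) hne') fun θ hθ => ?_
    exact DifferentiableAt.inv (by fun_prop) (hne' θ (Metric.ball_subset_closedBall hθ.1))
  rw [hz, zero_smul, sub_zero] at h0
  have e1 : ∀ t : ℝ, Kp t - Km t = ((t : ℂ) - ρ)⁻¹ • (Fp t - Fm t) := fun t => by
    rw [hKp t (by simp) (hreal t), hKm t (by simp) (hreal t), ← smul_sub, sub_sub_sub_cancel_right]
  simp only [e1] at h0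
  rw [sub_sub, add_comm ((2 * Real.pi * Complex.I : ℂ) • u), ← sub_sub, sub_add_eq_add_sub,
    sub_eq_zero] at h0
  exact h0.symm

/-- Cauchy's formula in the cut annulus `R < |θ| < N`. -/
lemma cauchy_formula (h : CutHolomorphic R Fp Fm) (hR : 0 < R) {N : ℝ}
    (hp : ∀ θ, 0 < θ.im → F θ = Fp θ) (hm : ∀ θ, θ.im < 0 → F θ = Fm θ)
    {ρ : ℂ} (hρ : ρ.im ≠ 0) (hρR : R < ‖ρ‖) (hρN : ‖ρ‖ < N) :
    (2 * Real.pi * Complex.I : ℂ) • F ρ =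
      circleIntegral (fun θ => (θ - ρ)⁻¹ • F θ) 0 N -
        circleIntegral (fun θ => (θ - ρ)⁻¹ • F θ) 0 R +
      ((∫ t in R..N, ((t : ℂ) - ρ)⁻¹ • (Fp t - Fm t)) +
        ∫ t in R..N, (((-t : ℝ) : ℂ) - ρ)⁻¹ • (Fp (-t : ℝ) - Fm (-t : ℝ))) := by
  have hnorm : IsOpen {θ : ℂ | R < ‖θ‖} := isOpen_lt continuous_const continuous_norm
  rcases hρ.lt_or_gt with h0 | h0
  · have hop : IsOpen {θ : ℂ | θ.im < 0 ∧ R < ‖θ‖} :=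
      (isOpen_lt Complex.continuous_im continuous_const).inter hnorm
    have hmem : {θ : ℂ | θ.im < 0 ∧ R < ‖θ‖} ∈ 𝓝 ρ := hop.mem_nhds ⟨h0, hρR⟩
    have hne : ∀ θ : ℂ, 0 ≤ θ.im → θ - ρ ≠ 0 := fun θ hθ => by
      rw [sub_ne_zero]; rintro rfl; exact hθ.not_gt h0
    refine h.cauchy_formula_aux hR hp hm hρR hρN (u := F ρ)
      (Kp := fun θ => (θ - ρ)⁻¹ • (Fp θ - F ρ)) (Km := dslope Fm ρ) ⟨?_, ?_, ?_, ?_⟩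
      (fun _ _ _ => rfl) (fun θ _ hne => by
        rw [dslope_of_ne _ hne, slope_def_module, hm ρ h0]) hρ
    · exact ContinuousOn.smul (ContinuousOn.inv₀ (by fun_prop) fun θ hθ => hne θ hθ.1)
        (h.continuousOn_upper.sub continuousOn_const)
    · exact (continuousOn_dslope (Filter.mem_of_superset hmem (y := {θ : ℂ | θ.im ≤ 0 ∧ R ≤ ‖θ‖})
        fun θ hθ => ⟨le_of_lt hθ.1, le_of_lt hθ.2⟩)).2
        ⟨h.continuousOn_lower, h.differentiableAt_lower ρ h0 hρR⟩
    · exact fun θ h1 h2 => DifferentiableAt.smul (DifferentiableAt.inv (by fun_prop) (hne θ h1.le))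
        ((h.differentiableAt_upper θ h1 h2).sub_const _)
    · intro θ h1 h2
      exact ((Complex.differentiableOn_dslope hmem).2 fun w hw =>
        (h.differentiableAt_lower w hw.1 hw.2).differentiableWithinAt).differentiableAt
          (hop.mem_nhds ⟨h1, h2⟩)
  · have hop : IsOpen {θ : ℂ | 0 < θ.im ∧ R < ‖θ‖} :=
      (isOpen_lt continuous_const Complex.continuous_im).inter hnorm
    have hmem : {θ : ℂ | 0 < θ.im ∧ R < ‖θ‖} ∈ 𝓝 ρ := hop.mem_nhds ⟨h0, hρR⟩
    have hne : ∀ θ : ℂ, θ.im ≤ 0 → θ - ρ ≠ 0 := fun θ hθ => by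
      rw [sub_ne_zero]; rintro rfl; exact hθ.not_gt h0
    refine h.cauchy_formula_aux hR hp hm hρR hρN (u := F ρ)
      (Km := fun θ => (θ - ρ)⁻¹ • (Fm θ - F ρ)) (Kp := dslope Fp ρ) ⟨?_, ?_, ?_, ?_⟩
      (fun θ _ hne => by
        rw [dslope_of_ne _ hne, slope_def_module, hp ρ h0]) (fun _ _ _ => rfl) hρ
    · exact (continuousOn_dslope (Filter.mem_of_superset hmem (y := {θ : ℂ | 0 ≤ θ.im ∧ R ≤ ‖θ‖})
        fun θ hθ => ⟨le_of_lt hθ.1, le_of_lt hθ.2⟩)).2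
        ⟨h.continuousOn_upper, h.differentiableAt_upper ρ h0 hρR⟩
    · exact ContinuousOn.smul (ContinuousOn.inv₀ (by fun_prop) fun θ hθ => hne θ hθ.1)
        (h.continuousOn_lower.sub continuousOn_const)
    · intro θ h1 h2
      exact ((Complex.differentiableOn_dslope hmem).2 fun w hw =>
        (h.differentiableAt_upper w hw.1 hw.2).differentiableWithinAt).differentiableAt
          (hop.mem_nhds ⟨h1, h2⟩)
    · exact fun θ h1 h2 => DifferentiableAt.smul (DifferentiableAt.inv (by fun_prop) (hne θ h1.le))
        ((h.differentiableAt_lower θ h1 h2).sub_const _)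

end CutHolomorphic

lemma setIntegral_abs_gt {g : ℝ → E} {R : ℝ} (hR : 0 ≤ R)
    (hg : IntegrableOn g {t : ℝ | R < |t|}) :
    IntegrableOn g (Ioi R) ∧ IntegrableOn (fun t => g (-t)) (Ioi R) ∧
    ∫ t in {t : ℝ | R < |t|}, g t = (∫ t in Ioi R, g t) + ∫ t in Ioi R, g (-t) := by
  have hs : {t : ℝ | R < |t|} = Ioi R ∪ Iio (-R) := by
    ext t
    simp only [mem_ofPred_eq, mem_union, mem_Ioi, mem_Iio, lt_abs]
    exact or_congr Iff.rfl ⟨fun h => by linarith, fun h => by linarith⟩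
  rw [hs] at hg ⊢
  have h1 := hg.left_of_union
  have h2 := hg.right_of_union
  refine ⟨h1, ?_, ?_⟩
  · have hp : (fun t : ℝ => -t) ⁻¹' Iio (-R) = Ioi R := by
      ext t
      simp
    rw [← hp]
    exact ((Measure.measurePreserving_neg volume).integrableOn_comp_preimage
      (Homeomorph.neg ℝ).measurableEmbedding).2 h2
  · rw [setIntegral_union (by
      rw [Set.disjoint_left]
      intro t h3 h4
      simp only [mem_Ioi, mem_Iio] at h3 h4
      linarith) measurableSet_Iio h1 h2, integral_comp_neg_Ioi, integral_Iic_eq_integral_Iio]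

/-- The Cauchy integral over the circle of radius `N` and over the rays outside of it. -/
def cauchyTail (F : ℂ → E) (d : ℝ → E) (N : ℝ) (ρ : ℂ) : E :=
  circleIntegral (fun θ => (θ - ρ)⁻¹ • F θ) 0 N + ∫ t in {t : ℝ | N < |t|}, ((t : ℂ) - ρ)⁻¹ • d t

lemma measurableSet_abs_gt (N : ℝ) : MeasurableSet {t : ℝ | N < |t|} :=
  (isOpen_lt continuous_const continuous_abs).measurableSet

lemma differentiableOn_cauchyTail {F : ℂ → E} {d : ℝ → E} {N : ℝ} (hN : 0 < N)
    (hF : CircleIntegrable F 0 N) (hd : IntegrableOn d {t : ℝ | N < |t|}) :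
    DifferentiableOn ℂ (cauchyTail F d N) (Metric.ball 0 N) := by
  have h1 : DifferentiableOn ℂ (fun ρ => circleIntegral (fun θ => (θ - ρ)⁻¹ • F θ) 0 N)
      (Metric.ball 0 N) := by
    lift N to NNReal using hN.le
    have h2 := (hasFPowerSeriesOn_cauchy_integral hF (by exact_mod_cast hN)).differentiableOn
    rw [Metric.eball_coe] at h2
    have h3 := h2.const_smul (2 * Real.pi * Complex.I : ℂ)
    refine h3.congr fun ρ _ => ?_
    rw [Pi.smul_apply, smul_smul, mul_inv_cancel₀ Complex.two_pi_I_ne_zero, one_smul]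
  refine h1.add fun ρ hρ => DifferentiableAt.differentiableWithinAt ?_
  rw [mem_ball_zero_iff] at hρ
  have hpos : 0 < (N - ‖ρ‖) / 2 := by linarith
  have hlow : ∀ w ∈ Metric.ball (0 : ℂ) ((‖ρ‖ + N) / 2), ∀ t : ℝ, N < |t| →
      (N - ‖ρ‖) / 2 ≤ ‖(t : ℂ) - w‖ := fun w hw t ht => by
    rw [mem_ball_zero_iff] at hw
    have := norm_sub_norm_le (t : ℂ) w
    rw [Complex.norm_real, Real.norm_eq_abs] at this
    linarith
  have key := differentiableOn_integral_of_dominated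
    (μ := volume.restrict {t : ℝ | N < |t|}) (F := fun ρ t => ((t : ℂ) - ρ)⁻¹ • d t)
    (U := Metric.ball 0 ((‖ρ‖ + N) / 2)) (b := fun t => ((N - ‖ρ‖) / 2)⁻¹ * ‖d t‖)
    Metric.isOpen_ball (fun w _ => ?_) ?_ ?_ (hd.norm.const_mul _)
  · exact key.differentiableAt (Metric.isOpen_ball.mem_nhds (by
      rw [mem_ball_zero_iff]; linarith))
  · exact AEStronglyMeasurable.smul
      (by fun_prop : Measurable fun t : ℝ => ((t : ℂ) - w)⁻¹).aestronglyMeasurable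
      hd.aestronglyMeasurable
  · filter_upwards [ae_restrict_mem (measurableSet_abs_gt N)] with t ht
    intro w hw
    refine (DifferentiableAt.smul_const (DifferentiableAt.inv (by fun_prop) ?_)
      _).differentiableWithinAt
    exact norm_pos_iff.1 (hpos.trans_le (hlow w hw t ht))
  · filter_upwards [ae_restrict_mem (measurableSet_abs_gt N)] with t ht w hw
    rw [norm_smul, norm_inv]
    gcongr
    exact hlow w hw t ht

/-- Outside the disc `|ρ| ≤ R` a cut function `F` becomes entire when the Cauchy integral of its values on
the circle and of its jumps on the rays is added: by Cauchy's formula the sum is, for each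
`N > |ρ|`, the Cauchy integral over the circle of radius `N` and the rays outside of it. -/
lemma CutHolomorphic.exists_entire_extension {R : ℝ} {Fp Fm F : ℂ → E}
    (h : CutHolomorphic R Fp Fm) (hR : 0 < R)
    (hp : ∀ θ, 0 < θ.im → F θ = Fp θ) (hm : ∀ θ, θ.im < 0 → F θ = Fm θ)
    (hd : IntegrableOn (fun t : ℝ => Fm t - Fp t) {t : ℝ | R < |t|}) :
    ∃ e : ℂ → E, Differentiable ℂ e ∧ ∀ ρ : ℂ, ρ.im ≠ 0 → R < ‖ρ‖ →
      e ρ = F ρ + (2 * Real.pi * Complex.I : ℂ)⁻¹ •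
        cauchyTail F (fun t => Fm t - Fp t) R ρ := by
  set d : ℝ → E := fun t => Fm t - Fp t with hd_def
  set W : ℂ → E := fun ρ => (2 * Real.pi * Complex.I : ℂ) • F ρ + cauchyTail F d R ρ with hW
  have hsub : ∀ N, R ≤ N → IntegrableOn d {t : ℝ | N < |t|} := fun N hN =>
    hd.mono_set fun t ht => lt_of_le_of_lt hN ht
  have hE : ∀ N, R < N → ∀ ρ : ℂ, ρ.im ≠ 0 → R < ‖ρ‖ → ‖ρ‖ < N →
      cauchyTail F d N ρ = W ρ := fun N hN ρ hρ hρR hρN => by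
    have hg : IntegrableOn (fun t : ℝ => ((t : ℂ) - ρ)⁻¹ • d t) {t : ℝ | R < |t|} := by
      refine (hd.norm.const_mul |ρ.im|⁻¹).mono'
        (AEStronglyMeasurable.smul
          (by fun_prop : Measurable fun t : ℝ => ((t : ℂ) - ρ)⁻¹).aestronglyMeasurable
          hd.aestronglyMeasurable) (Filter.Eventually.of_forall fun t => ?_)
      rw [norm_smul, norm_inv]
      have h1 : |ρ.im| ≤ ‖(t : ℂ) - ρ‖ := by
        have := Complex.abs_im_le_norm ((t : ℂ) - ρ)
        simpa using this
      have h2 : 0 < |ρ.im| := abs_pos.2 hρ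
      gcongr
    obtain ⟨a1, a2, a3⟩ := setIntegral_abs_gt hR.le hg
    obtain ⟨b1, b2, b3⟩ := setIntegral_abs_gt (hR.trans hN).le
      (hg.mono_set fun t (ht : N < |t|) => hN.trans ht)
    have c1 := intervalIntegral.integral_interval_add_Ioi a1 b1
    have c2 := intervalIntegral.integral_interval_add_Ioi a2 b2
    have c3 := h.cauchy_formula hR hp hm hρ hρR hρN
    have e1 : ∀ t : ℝ, Fp t - Fm t = -d t := fun t => by simp [hd_def]
    simp only [e1, smul_neg, intervalIntegral.integral_neg] at c3
    simp only [hW, cauchyTail]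
    rw [c3, a3, b3, ← c1, ← c2]
    abel
  have hED : ∀ N, R < N → DifferentiableOn ℂ (cauchyTail F d N) (Metric.ball 0 N) :=
    fun N hN => differentiableOn_cauchyTail (hR.trans hN)
      (h.circleIntegral_eq hR hN.le (fun θ h1 _ => hp θ h1) (fun θ h1 _ => hm θ h1)).1
      (hsub N hN.le)
  have hEE : ∀ N N', R < N → N ≤ N' → EqOn (cauchyTail F d N) (cauchyTail F d N')
      (Metric.ball 0 N) := fun N N' hN hNN => by
    have hop : IsOpen {ρ : ℂ | 0 < ρ.im ∧ R < ‖ρ‖ ∧ ‖ρ‖ < N} :=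
      (isOpen_lt continuous_const Complex.continuous_im).inter
        ((isOpen_lt continuous_const continuous_norm).inter
          (isOpen_lt continuous_norm continuous_const))
    have hz : ((R + N) / 2 * Complex.I : ℂ) ∈ {ρ : ℂ | 0 < ρ.im ∧ R < ‖ρ‖ ∧ ‖ρ‖ < N} := by
      have e1 : ((R + N) / 2 * Complex.I : ℂ) = (((R + N) / 2 : ℝ) : ℂ) * Complex.I := by
        push_cast; ring
      have e2 : ‖((R + N) / 2 * Complex.I : ℂ)‖ = (R + N) / 2 := by
        rw [e1, norm_mul, Complex.norm_I, mul_one, Complex.norm_real, Real.norm_eq_abs,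
          abs_of_pos (by linarith)]
      refine ⟨?_, ?_, ?_⟩
      · rw [e1, Complex.im_ofReal_mul, Complex.I_im, mul_one]
        linarith
      · rw [e2]; linarith
      · rw [e2]; linarith
    refine AnalyticOnNhd.eqOn_of_preconnected_of_eventuallyEq
      ((hED N hN).analyticOnNhd Metric.isOpen_ball)
      (((hED N' (hN.trans_le hNN)).mono (Metric.ball_subset_ball hNN)).analyticOnNhd
        Metric.isOpen_ball) (convex_ball 0 N).isPreconnected
      (mem_ball_zero_iff.2 hz.2.2) ?_
    filter_upwards [hop.mem_nhds hz] with ρ hρ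
    rw [hE N hN ρ hρ.1.ne' hρ.2.1 hρ.2.2,
      hE N' (hN.trans_le hNN) ρ hρ.1.ne' hρ.2.1 (hρ.2.2.trans_le hNN)]
  refine ⟨fun ρ => (2 * Real.pi * Complex.I : ℂ)⁻¹ • cauchyTail F d (‖ρ‖ + R + 1) ρ, ?_, ?_⟩
  · refine Differentiable.const_smul (fun ρ => ?_) _
    have hN : R < ‖ρ‖ + R + 1 := by linarith [norm_nonneg ρ]
    have hmem : Metric.ball (0 : ℂ) (‖ρ‖ + R + 1) ∈ 𝓝 ρ :=
      Metric.isOpen_ball.mem_nhds (by rw [mem_ball_zero_iff]; linarith)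
    refine ((hED _ hN).differentiableAt hmem).congr_of_eventuallyEq ?_
    filter_upwards [hmem] with w hw
    rw [mem_ball_zero_iff] at hw
    have hw' : R < ‖w‖ + R + 1 := by linarith [norm_nonneg w]
    rcases le_total (‖ρ‖ + R + 1) (‖w‖ + R + 1) with h1 | h1
    · exact (hEE _ _ hN h1 (mem_ball_zero_iff.2 hw)).symm
    · exact hEE _ _ hw' h1 (mem_ball_zero_iff.2 (by linarith))
  · intro ρ hρ hρR
    simp only
    rw [hE _ (by linarith [norm_nonneg ρ]) ρ hρ hρR (by linarith), hW]
    simp only [smul_add, smul_smul]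
    rw [inv_mul_cancel₀ Complex.two_pi_I_ne_zero, one_smul]

end CutAnnulus

/-! ### A form of Liouville's theorem -/

section Liouville

variable {E : Type*} [NormedAddCommGroup E] [NormedSpace ℂ E]

/-- An estimate that degenerates at the real axis still bounds an entire function: the maximum
principle applies to `(ρ² - N²) f(ρ)`, since `|w² - N²| = 2 N |Im w|` on the circle `|w| = N`. -/
lemma norm_le_of_norm_mul_im_le {f : ℂ → E} (hf : Differentiable ℂ f) {C ρ₀ : ℝ} {k : ℕ}
    (hρ₀ : 0 < ρ₀) (hb : ∀ ρ : ℂ, ρ.im ≠ 0 → ρ₀ ≤ ‖ρ‖ → ‖f ρ‖ * |ρ.im| ≤ C * ‖ρ‖ ^ k) {N : ℝ}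
    (hN : ρ₀ ≤ N) {ρ : ℂ} (hρ : ‖ρ‖ ≤ N / 2) : ‖f ρ‖ * (3 * N) ≤ 8 * (C * N ^ k) := by
  have hN0 : 0 < N := hρ₀.trans_le hN
  have hC : 0 ≤ C * N ^ k := by
    have h1 := hb (N * Complex.I) (by simpa using hN0.ne') (by simpa [abs_of_pos hN0] using hN)
    rw [norm_mul, Complex.norm_I, mul_one, Complex.norm_real, Real.norm_eq_abs,
      abs_of_pos hN0] at h1
    exact (by positivity : (0 : ℝ) ≤ ‖f (N * Complex.I)‖ * |(N * Complex.I : ℂ).im|).trans h1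
  have hg : Differentiable ℂ fun w : ℂ => (w ^ 2 - N ^ 2) • f w :=
    Differentiable.smul (by fun_prop) hf
  have hfr : ∀ w ∈ frontier (Metric.ball (0 : ℂ) N),
      ‖(w ^ 2 - (N : ℂ) ^ 2) • f w‖ ≤ 2 * N * (C * N ^ k) := fun w hw => by
    rw [frontier_ball 0 hN0.ne', mem_sphere_zero_iff_norm] at hw
    have h1 : ‖w ^ 2 - (N : ℂ) ^ 2‖ = 2 * N * |w.im| := by
      have h2 : (N : ℂ) ^ 2 = w * (starRingEnd ℂ) w := by
        rw [Complex.mul_conj, Complex.normSq_eq_norm_sq, hw]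
        push_cast; rfl
      rw [h2, sq, ← mul_sub, norm_mul, hw, Complex.sub_conj, norm_mul, Complex.norm_I, mul_one,
        Complex.norm_real, Real.norm_eq_abs, abs_mul, abs_two]
      ring
    rw [norm_smul, h1]
    by_cases him : w.im = 0
    · rw [him, abs_zero, mul_zero, zero_mul]
      positivity
    · have := hb w him (hw ▸ hN)
      rw [hw] at this
      calc 2 * N * |w.im| * ‖f w‖ = 2 * N * (‖f w‖ * |w.im|) := by ring
        _ ≤ _ := by gcongr
  have h3 := Complex.norm_le_of_forall_mem_frontier_norm_le Metric.isBounded_ball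
    hg.diffContOnCl hfr (subset_closure (mem_ball_zero_iff.2 (by linarith : ‖ρ‖ < N)))
  rw [norm_smul] at h3
  have h4 : 3 / 4 * N ^ 2 ≤ ‖ρ ^ 2 - (N : ℂ) ^ 2‖ := by
    have h5 := norm_sub_norm_le ((N : ℂ) ^ 2) (ρ ^ 2)
    rw [norm_pow, norm_pow, Complex.norm_real, Real.norm_eq_abs, abs_of_pos hN0] at h5
    rw [norm_sub_rev]
    nlinarith [norm_nonneg ρ]
  have h6 := (mul_le_mul_of_nonneg_right h4 (norm_nonneg (f ρ))).trans h3
  have h7 : N * (‖f ρ‖ * (3 * N)) ≤ N * (8 * (C * N ^ k)) := by nlinarith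
  exact le_of_mul_le_mul_left h7 hN0

/-- An entire function that is `O(|ρ| / |Im ρ|)` is constant. -/
lemma apply_eq_apply_of_norm_mul_im_le {f : ℂ → E} (hf : Differentiable ℂ f) {C ρ₀ : ℝ}
    (hb : ∀ ρ : ℂ, ρ.im ≠ 0 → ρ₀ ≤ ‖ρ‖ → ‖f ρ‖ * |ρ.im| ≤ C * ‖ρ‖) (z w : ℂ) : f z = f w := by
  refine hf.apply_eq_apply_of_bounded ?_ z w
  rw [isBounded_iff_forall_norm_le]
  refine ⟨8 * C / 3, ?_⟩
  rintro _ ⟨ρ, rfl⟩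
  set N := max (max ρ₀ 1) (2 * ‖ρ‖) with hN
  have hN0 : 0 < N := one_pos.trans_le ((le_max_right _ _).trans (le_max_left _ _))
  have h1 := norm_le_of_norm_mul_im_le hf (C := C) (ρ₀ := max ρ₀ 1) (k := 1)
    (one_pos.trans_le (le_max_right _ _))
    (fun ρ h1 h2 => by rw [pow_one]; exact hb ρ h1 ((le_max_left _ _).trans h2))
    (le_max_left _ _ : _ ≤ N) (ρ := ρ) (by linarith [le_max_right (max ρ₀ 1) (2 * ‖ρ‖)])
  rw [le_div_iff₀ three_pos]
  have h2 : N * (‖f ρ‖ * 3) ≤ N * (8 * C) := by nlinarith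
  exact le_of_mul_le_mul_left h2 hN0

/-- An entire function that is `O(1 / |Im ρ|)` vanishes. -/
lemma eq_zero_of_norm_mul_im_le {f : ℂ → E} (hf : Differentiable ℂ f) {C ρ₀ : ℝ}
    (hb : ∀ ρ : ℂ, ρ.im ≠ 0 → ρ₀ ≤ ‖ρ‖ → ‖f ρ‖ * |ρ.im| ≤ C) (ρ : ℂ) : f ρ = 0 := by
  by_contra hne
  have hpos : 0 < ‖f ρ‖ := norm_pos_iff.2 hne
  set N := max (max (max ρ₀ 1) (2 * ‖ρ‖)) ((8 * C + 1) / (3 * ‖f ρ‖)) with hN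
  have h1 := norm_le_of_norm_mul_im_le hf (C := C) (ρ₀ := max ρ₀ 1) (k := 0)
    (one_pos.trans_le (le_max_right _ _))
    (fun ρ h1 h2 => by rw [pow_zero, mul_one]; exact hb ρ h1 ((le_max_left _ _).trans h2))
    ((le_max_left _ _).trans (le_max_left _ _) : _ ≤ N) (ρ := ρ) (by
      have : 2 * ‖ρ‖ ≤ N := (le_max_right _ _).trans (le_max_left _ _)
      linarith)
  have h2 : (8 * C + 1) / (3 * ‖f ρ‖) ≤ N := le_max_right _ _
  rw [div_le_iff₀ (by positivity)] at h2
  rw [pow_zero, mul_one] at h1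
  linarith

end Liouville

/-! ### Cauchy transforms over the contour -/

section Contour

variable {𝔸 : Type*} [NormedRing 𝔸] [NormedAlgebra ℂ 𝔸] [CompleteSpace 𝔸]
variable {α : Type*} [MeasurableSpace α] {μ : Measure α} {p : α → ℂ} {R : ℝ}

/-- A parametrised contour `p : α → ℂ`, with a measure `μ` on the parameters, that looks like the
union of the circle `|θ| = R` and of two real rays outside of it. -/
structure IsCutContour (μ : Measure α) (p : α → ℂ) (R : ℝ) : Prop where
  pos : 0 < R
  measurable : Measurable p
  abs_im_le : ∀ a, |(p a).im| ≤ R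
  abs_im_le_dist : ∀ ρ : ℂ, 2 * R ≤ ‖ρ‖ → ∀ a, |ρ.im| ≤ 2 * ‖p a - ρ‖
  ae_ne : ∀ ρ, ∀ᵐ a ∂μ, p a ≠ ρ

/-- The Cauchy transform of the density `h` on the contour. -/
def cauchyTransform {E : Type*} [NormedAddCommGroup E] [NormedSpace ℂ E] (μ : Measure α)
    (p : α → ℂ) (h : α → E) (ρ : ℂ) : E :=
  (2 * Real.pi * Complex.I : ℂ)⁻¹ • ∫ a, (p a - ρ)⁻¹ • h a ∂μ

lemma norm_two_pi_I_inv_le : ‖(2 * Real.pi * Complex.I : ℂ)⁻¹‖ ≤ 1 / 2 := by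
  rw [norm_inv, norm_mul, norm_mul, Complex.norm_I, mul_one, Complex.norm_real, Complex.norm_ofNat,
    Real.norm_eq_abs, abs_of_pos Real.pi_pos, one_div]
  gcongr
  linarith [Real.pi_gt_three]

namespace IsCutContour

section
variable {E : Type*} [NormedAddCommGroup E] [NormedSpace ℂ E] {h : α → E}

lemma aestronglyMeasurable_kernel (hγ : IsCutContour μ p R) (hh : AEStronglyMeasurable h μ)
    (ρ : ℂ) : AEStronglyMeasurable (fun a => (p a - ρ)⁻¹ • h a) μ :=
  (hγ.measurable.sub_const ρ).inv.aestronglyMeasurable.smul hh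

lemma norm_inv_mul_abs_im_le (hγ : IsCutContour μ p R) {ρ : ℂ} (hρ : 2 * R ≤ ‖ρ‖) (a : α) :
    ‖(p a - ρ)⁻¹‖ * |ρ.im| ≤ 2 := by
  rw [norm_inv, inv_mul_eq_div]
  exact div_le_of_le_mul₀ (norm_nonneg _) two_pos.le (hγ.abs_im_le_dist ρ hρ a)

lemma integrable_kernel (hγ : IsCutContour μ p R) (hh : Integrable h μ) {ρ : ℂ}
    (hρ : 2 * R ≤ ‖ρ‖) (him : ρ.im ≠ 0) : Integrable (fun a => (p a - ρ)⁻¹ • h a) μ := by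
  refine (hh.norm.const_mul (2 / |ρ.im|)).mono'
    (hγ.aestronglyMeasurable_kernel hh.aestronglyMeasurable ρ) (Eventually.of_forall fun a => ?_)
  rw [norm_smul]
  gcongr
  rw [le_div_iff₀ (abs_pos.2 him)]
  exact hγ.norm_inv_mul_abs_im_le hρ a

lemma norm_cauchyTransform_mul_le (hγ : IsCutContour μ p R) (hh : Integrable h μ) {ρ : ℂ}
    (hρ : 2 * R ≤ ‖ρ‖) : ‖cauchyTransform μ p h ρ‖ * |ρ.im| ≤ ∫ a, ‖h a‖ ∂μ := by
  rcases eq_or_ne ρ.im 0 with him | him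
  · rw [him, abs_zero, mul_zero]
    exact integral_nonneg fun a => norm_nonneg _
  have h1 : ‖∫ a, (p a - ρ)⁻¹ • h a ∂μ‖ ≤ 2 / |ρ.im| * ∫ a, ‖h a‖ ∂μ := by
    rw [← integral_const_mul]
    refine norm_integral_le_of_norm_le (hh.norm.const_mul _) (Eventually.of_forall fun a => ?_)
    rw [norm_smul]
    gcongr
    rw [le_div_iff₀ (abs_pos.2 him)]
    exact hγ.norm_inv_mul_abs_im_le hρ a
  have h2 : 0 < |ρ.im| := abs_pos.2 him
  have h3 : (0 : ℝ) ≤ ∫ a, ‖h a‖ ∂μ := integral_nonneg fun a => norm_nonneg _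
  rw [cauchyTransform, norm_smul]
  calc _ ≤ 1 / 2 * (2 / |ρ.im| * ∫ a, ‖h a‖ ∂μ) * |ρ.im| := by
        gcongr
        exact norm_two_pi_I_inv_le
    _ = _ := by field_simp

/-- The behaviour of a Cauchy transform at `±i∞`; here `c = ±i`. -/
lemma tendsto_smul_cauchyTransform (hγ : IsCutContour μ p R) (hh : Integrable h μ) {c : ℂ}
    (hc : c * c = -1) (hre : c.re = 0) :
    Tendsto (fun τ : ℝ => (τ : ℂ) • cauchyTransform μ p h (c * τ)) atTop
      (𝓝 (c • (2 * Real.pi * Complex.I : ℂ)⁻¹ • ∫ a, h a ∂μ)) := by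
  have hc0 : c ≠ 0 := by rintro rfl; simp at hc
  have hn : ‖c‖ = 1 := by
    have h1 : ‖c‖ * ‖c‖ = 1 := by rw [← norm_mul, hc, norm_neg, norm_one]
    nlinarith [norm_nonneg c]
  have him : |c.im| = 1 := by
    rw [← hn, ← Complex.abs_im_eq_norm.2 hre]
  have key : Tendsto (fun τ : ℝ => ∫ a, (τ : ℂ) • (p a - c * τ)⁻¹ • h a ∂μ) atTop
      (𝓝 (∫ a, c • h a ∂μ)) := by
    refine tendsto_integral_filter_of_dominated_convergence (fun a => 2 * ‖h a‖)
      (Eventually.of_forall fun τ =>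
        (hγ.aestronglyMeasurable_kernel hh.aestronglyMeasurable _).const_smul _) ?_
      (hh.norm.const_mul 2) (Eventually.of_forall fun a => ?_)
    · filter_upwards [eventually_ge_atTop (2 * R)] with τ hτ
      have hτ0 : 0 < τ := lt_of_lt_of_le (by linarith [hγ.pos]) hτ
      refine Eventually.of_forall fun a => ?_
      have h1 := hγ.norm_inv_mul_abs_im_le (ρ := c * τ) (by
        rw [norm_mul, hn, one_mul, Complex.norm_real, Real.norm_eq_abs, abs_of_pos hτ0]
        exact hτ) a
      have h2 : |(c * (τ : ℂ)).im| = τ := by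
        rw [Complex.im_mul_ofReal, abs_mul, him, one_mul, abs_of_pos hτ0]
      rw [h2] at h1
      rw [norm_smul, norm_smul, Complex.norm_real, Real.norm_eq_abs, abs_of_pos hτ0, ← mul_assoc,
        mul_comm τ]
      gcongr
    · have h1 : Tendsto (fun τ : ℝ => (p a * (τ : ℂ)⁻¹ - c)⁻¹) atTop (𝓝 c) := by
        have h2 : Tendsto (fun τ : ℝ => ((τ : ℂ))⁻¹) atTop (𝓝 0) := by
          have h3 := (Complex.continuous_ofReal.tendsto 0).comp tendsto_inv_atTop_zero
          simpa [Function.comp_def] using h3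
        have h4 := ((h2.const_mul (p a)).sub_const c).inv₀ (by simpa using hc0)
        rw [mul_zero, zero_sub] at h4
        have h5 : (-c)⁻¹ = c := inv_eq_of_mul_eq_one_left (by rw [mul_neg, hc, neg_neg])
        rwa [h5] at h4
      refine (h1.smul_const (h a)).congr' ?_
      filter_upwards [eventually_gt_atTop 0] with τ hτ
      have hτ' : (τ : ℂ) ≠ 0 := by exact_mod_cast hτ.ne'
      rw [smul_smul]
      congr 1
      have h6 : p a * (τ : ℂ)⁻¹ - c = (p a - c * τ) * (τ : ℂ)⁻¹ := by
        rw [sub_mul, mul_assoc, mul_inv_cancel₀ hτ', mul_one]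
      rw [h6, mul_inv, inv_inv, mul_comm]
  have := key.const_smul (2 * Real.pi * Complex.I : ℂ)⁻¹
  rw [integral_smul, smul_comm] at this
  refine this.congr fun τ => ?_
  rw [integral_smul, smul_comm, cauchyTransform]

lemma tendsto_cauchyTransform (hγ : IsCutContour μ p R) (hh : Integrable h μ) {c : ℂ}
    (hc : c * c = -1) (hre : c.re = 0) :
    Tendsto (fun τ : ℝ => cauchyTransform μ p h (c * τ)) atTop (𝓝 0) := by
  have h2 : Tendsto (fun τ : ℝ => ((τ : ℂ))⁻¹) atTop (𝓝 0) := by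
    have h3 := (Complex.continuous_ofReal.tendsto 0).comp tendsto_inv_atTop_zero
    simpa [Function.comp_def] using h3
  have h4 := h2.smul (hγ.tendsto_smul_cauchyTransform hh hc hre)
  rw [zero_smul] at h4
  refine h4.congr' ?_
  filter_upwards [eventually_gt_atTop 0] with τ hτ
  rw [smul_smul, inv_mul_cancel₀ (by exact_mod_cast hτ.ne'), one_smul]

end

end IsCutContour

end Contour

/-! ### The main equation for a pair of pencils at a fixed point -/

section MainEquation

variable {𝔸 : Type*} [NormedRing 𝔸] [NormedAlgebra ℂ 𝔸] [CompleteSpace 𝔸]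

/-- The values at a fixed point, as functions of the spectral parameter, of the solution `φ`, of the
solution `S` with `S(0) = 0`, `S'(0) = 1`, of their analogues `φs`, `Ss` for the adjoint equation,
and of the derivatives of all four; the Weyl matrix `M`; and the limits `G`, `Gm` of the
renormalised Weyl solution at `i∞` and at `-i∞`. The laws that connect these data are collected in
`WeylSystem.IsRegular`. -/
structure WeylSystem (𝔸 : Type*) where
  (φ φ' S S' φs φs' Ss Ss' M : ℂ → 𝔸)
  (G Gm : 𝔸)

namespace WeylSystem

/-- The Weyl solution. -/
def Φ (w : WeylSystem 𝔸) (ρ : ℂ) : 𝔸 := w.S ρ + w.φ ρ * w.M ρ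

/-- The derivative of the Weyl solution. -/
def Φ' (w : WeylSystem 𝔸) (ρ : ℂ) : 𝔸 := w.S' ρ + w.φ' ρ * w.M ρ

/-- The Weyl solution of the adjoint equation. -/
def Φs (w : WeylSystem 𝔸) (ρ : ℂ) : 𝔸 := w.Ss ρ + w.M ρ * w.φs ρ

/-- The derivative of the Weyl solution of the adjoint equation. -/
def Φs' (w : WeylSystem 𝔸) (ρ : ℂ) : 𝔸 := w.Ss' ρ + w.M ρ * w.φs' ρ

/-- The properties of the values at the point `x` of the solutions of a pencil that the main
equation depends on: the solutions are entire in the spectral parameter, their Wronskians are constant, and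
they and the Weyl solutions have the exponential behaviour at infinity that belongs to `x`. -/
structure IsRegular (w : WeylSystem 𝔸) (x : ℝ) : Prop where
  nonneg : 0 ≤ x
  diff_φ : Differentiable ℂ w.φ
  diff_φ' : Differentiable ℂ w.φ'
  diff_S : Differentiable ℂ w.S
  diff_S' : Differentiable ℂ w.S'
  diff_φs : Differentiable ℂ w.φs
  diff_φs' : Differentiable ℂ w.φs'
  diff_Ss : Differentiable ℂ w.Ss
  diff_Ss' : Differentiable ℂ w.Ss'
  wronskian_φs_φ : ∀ ρ, w.φs' ρ * w.φ ρ - w.φs ρ * w.φ' ρ = 0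
  wronskian_φs_S : ∀ ρ, w.φs' ρ * w.S ρ - w.φs ρ * w.S' ρ = -1
  wronskian_Ss_φ : ∀ ρ, w.Ss' ρ * w.φ ρ - w.Ss ρ * w.φ' ρ = 1
  wronskian_Ss_S : ∀ ρ, w.Ss' ρ * w.S ρ - w.Ss ρ * w.S' ρ = 0
  bound_φ : ∃ C, 0 ≤ C ∧ ∀ ρ : ℂ, 1 ≤ ‖ρ‖ → ‖w.φ ρ‖ ≤ C * Real.exp (|ρ.im| * x) ∧
    ‖w.φ' ρ‖ ≤ C * ‖ρ‖ * Real.exp (|ρ.im| * x)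
  bound_φs : ∃ C, 0 ≤ C ∧ ∀ ρ : ℂ, 1 ≤ ‖ρ‖ → ‖w.φs ρ‖ ≤ C * Real.exp (|ρ.im| * x) ∧
    ‖w.φs' ρ‖ ≤ C * ‖ρ‖ * Real.exp (|ρ.im| * x)
  bound_Φ : ∃ ρ₀ C, 1 ≤ ρ₀ ∧ 0 ≤ C ∧ ∀ ρ : ℂ, ρ.im ≠ 0 → ρ₀ ≤ ‖ρ‖ →
    ‖w.Φ ρ‖ ≤ C * Real.exp (-(|ρ.im| * x)) / ‖ρ‖ ∧ ‖w.Φ' ρ‖ ≤ C * Real.exp (-(|ρ.im| * x))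
  bound_Φs : ∃ ρ₀ C, 1 ≤ ρ₀ ∧ 0 ≤ C ∧ ∀ ρ : ℂ, ρ.im ≠ 0 → ρ₀ ≤ ‖ρ‖ →
    ‖w.Φs ρ‖ ≤ C * Real.exp (-(|ρ.im| * x)) / ‖ρ‖ ∧ ‖w.Φs' ρ‖ ≤ C * Real.exp (-(|ρ.im| * x))
  tendsto_Φ : Tendsto (fun τ : ℝ => ((τ * Real.exp (τ * x) : ℝ) : ℂ) • w.Φ (Complex.I * τ)) atTop
    (𝓝 (-w.G))
  tendsto_Φ' : Tendsto (fun τ : ℝ => ((Real.exp (τ * x) : ℝ) : ℂ) • w.Φ' (Complex.I * τ)) atTop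
    (𝓝 w.G)
  tendsto_Φ_down : Tendsto (fun τ : ℝ => ((τ * Real.exp (τ * x) : ℝ) : ℂ) • w.Φ (-Complex.I * τ))
    atTop (𝓝 (-w.Gm))
  tendsto_Φ'_down : Tendsto (fun τ : ℝ => ((Real.exp (τ * x) : ℝ) : ℂ) • w.Φ' (-Complex.I * τ))
    atTop (𝓝 w.Gm)

variable {w wt : WeylSystem 𝔸} {x : ℝ}

namespace IsRegular

lemma wronskian_Φs_φ (h : w.IsRegular x) (ρ : ℂ) : w.Φs' ρ * w.φ ρ - w.Φs ρ * w.φ' ρ = 1 := by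
  have : w.Φs' ρ * w.φ ρ - w.Φs ρ * w.φ' ρ = (w.Ss' ρ * w.φ ρ - w.Ss ρ * w.φ' ρ) +
      w.M ρ * (w.φs' ρ * w.φ ρ - w.φs ρ * w.φ' ρ) := by
    simp only [Φs, Φs']; noncomm_ring
  rw [this, h.wronskian_Ss_φ, h.wronskian_φs_φ, mul_zero, add_zero]

lemma wronskian_φs_Φ (h : w.IsRegular x) (ρ : ℂ) : w.φs' ρ * w.Φ ρ - w.φs ρ * w.Φ' ρ = -1 := by
  have : w.φs' ρ * w.Φ ρ - w.φs ρ * w.Φ' ρ = (w.φs' ρ * w.S ρ - w.φs ρ * w.S' ρ) +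
      (w.φs' ρ * w.φ ρ - w.φs ρ * w.φ' ρ) * w.M ρ := by
    simp only [Φ, Φ']; noncomm_ring
  rw [this, h.wronskian_φs_S, h.wronskian_φs_φ, zero_mul, add_zero]

lemma wronskian_Φs_Φ (h : w.IsRegular x) (ρ : ℂ) : w.Φs' ρ * w.Φ ρ - w.Φs ρ * w.Φ' ρ = 0 := by
  have : w.Φs' ρ * w.Φ ρ - w.Φs ρ * w.Φ' ρ = (w.Ss' ρ * w.S ρ - w.Ss ρ * w.S' ρ) +
      (w.Ss' ρ * w.φ ρ - w.Ss ρ * w.φ' ρ) * w.M ρ +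
      w.M ρ * (w.φs' ρ * w.S ρ - w.φs ρ * w.S' ρ) +
      w.M ρ * (w.φs' ρ * w.φ ρ - w.φs ρ * w.φ' ρ) * w.M ρ := by
    simp only [Φ, Φ', Φs, Φs']; noncomm_ring
  rw [this, h.wronskian_Ss_S, h.wronskian_Ss_φ, h.wronskian_φs_S, h.wronskian_φs_φ]
  simp

/-- Bounds on the contour, which lies in a strip. -/
lemma exists_strip_bound {f f' : ℂ → 𝔸} (hf : Continuous f) (hf' : Continuous f') (hx : 0 ≤ x)
    (hb : ∃ C, 0 ≤ C ∧ ∀ ρ : ℂ, 1 ≤ ‖ρ‖ → ‖f ρ‖ ≤ C * Real.exp (|ρ.im| * x) ∧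
      ‖f' ρ‖ ≤ C * ‖ρ‖ * Real.exp (|ρ.im| * x)) (R : ℝ) :
    ∃ C, 0 ≤ C ∧ ∀ θ : ℂ, |θ.im| ≤ R → ‖f θ‖ ≤ C ∧ ‖f' θ‖ ≤ C * (1 + ‖θ‖) := by
  obtain ⟨C, hC0, hC⟩ := hb
  obtain ⟨C1, h1⟩ := (isCompact_closedBall (0 : ℂ) 1).exists_bound_of_continuousOn hf.continuousOn
  obtain ⟨C2, h2⟩ := (isCompact_closedBall (0 : ℂ) 1).exists_bound_of_continuousOn hf'.continuousOn
  set K := max (C * Real.exp (R * x)) (max C1 C2) with hK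
  have hK1 : C * Real.exp (R * x) ≤ K := le_max_left _ _
  have hK2 : C1 ≤ K := (le_max_left _ _).trans (le_max_right _ _)
  have hK3 : C2 ≤ K := (le_max_right _ _).trans (le_max_right _ _)
  have hK0 : 0 ≤ K := le_trans (by positivity) hK1
  refine ⟨K, hK0, fun θ hθ => ?_⟩
  rcases le_total 1 ‖θ‖ with h | h
  · obtain ⟨h3, h4⟩ := hC θ h
    have h5 : Real.exp (|θ.im| * x) ≤ Real.exp (R * x) := by gcongr
    have h6 : C * Real.exp (|θ.im| * x) ≤ K := le_trans (by gcongr) hK1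
    refine ⟨h3.trans h6, h4.trans ?_⟩
    calc C * ‖θ‖ * Real.exp (|θ.im| * x) = C * Real.exp (|θ.im| * x) * ‖θ‖ := by ring
      _ ≤ K * (1 + ‖θ‖) := by gcongr; linarith
  · have hm : θ ∈ Metric.closedBall (0 : ℂ) 1 := mem_closedBall_zero_iff.2 h
    refine ⟨(h1 θ hm).trans hK2, ((h2 θ hm).trans hK3).trans ?_⟩
    nlinarith [norm_nonneg θ]

end IsRegular

/-- The kernel `⟨φs(θ), φ(ρ)⟩ / (ρ - θ)`, off the diagonal. -/
def kernel (w : WeylSystem 𝔸) (ρ θ : ℂ) : 𝔸 :=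
  (ρ - θ)⁻¹ • (w.φs' θ * w.φ ρ - w.φs θ * w.φ' ρ)

/-- The kernel is locally bounded in `ρ` and of linear growth in `θ`, also near the diagonal, where
its singularity is removable. -/
lemma IsRegular.exists_norm_dslope_le (h : w.IsRegular x) (R N : ℝ) :
    ∃ C, 0 ≤ C ∧ ∀ θ : ℂ, |θ.im| ≤ R → ∀ ρ ∈ Metric.ball (0 : ℂ) N,
      ‖dslope (fun ρ => w.φs' θ * w.φ ρ - w.φs θ * w.φ' ρ) θ ρ‖ ≤ C * (1 + ‖θ‖) := by
  obtain ⟨C, hC0, hC⟩ := IsRegular.exists_strip_bound h.diff_φs.continuous h.diff_φs'.continuous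
    h.nonneg h.bound_φs R
  obtain ⟨C1, h1⟩ := (isCompact_closedBall (0 : ℂ) (N + 3)).exists_bound_of_continuousOn
    h.diff_φ.continuous.continuousOn
  obtain ⟨C2, h2⟩ := (isCompact_closedBall (0 : ℂ) (N + 3)).exists_bound_of_continuousOn
    h.diff_φ'.continuous.continuousOn
  have hb : ∀ θ : ℂ, |θ.im| ≤ R → ∀ ρ ∈ Metric.closedBall (0 : ℂ) (N + 3),
      ‖w.φs' θ * w.φ ρ - w.φs θ * w.φ' ρ‖ ≤ (C * (|C1| + |C2|)) * (1 + ‖θ‖) := by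
    intro θ hθ ρ hρ
    obtain ⟨h3, h4⟩ := hC θ hθ
    have h5 := (h1 ρ hρ).trans (le_abs_self _)
    have h6 := (h2 ρ hρ).trans (le_abs_self _)
    calc _ ≤ ‖w.φs' θ‖ * ‖w.φ ρ‖ + ‖w.φs θ‖ * ‖w.φ' ρ‖ :=
          (norm_sub_le _ _).trans (add_le_add (norm_mul_le _ _) (norm_mul_le _ _))
      _ ≤ C * (1 + ‖θ‖) * |C1| + C * (1 + ‖θ‖) * |C2| := by
          gcongr
          exact h3.trans (le_mul_of_one_le_right hC0 (by linarith [norm_nonneg θ]))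
      _ = _ := by ring
  refine ⟨C * (|C1| + |C2|), by positivity, fun θ hθ ρ hρ => ?_⟩
  rw [mem_ball_zero_iff] at hρ
  have hz : w.φs' θ * w.φ θ - w.φs θ * w.φ' θ = 0 := h.wronskian_φs_φ θ
  have hpos : 0 ≤ C * (|C1| + |C2|) * (1 + ‖θ‖) := by positivity
  rcases le_or_gt 1 ‖ρ - θ‖ with h3 | h3
  · have hne : ρ ≠ θ := by
      rintro rfl
      rw [sub_self, norm_zero] at h3
      exact absurd h3 (by norm_num)
    rw [dslope_of_ne _ hne, slope_def_module, hz, sub_zero, norm_smul, norm_inv]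
    refine (mul_le_of_le_one_left (norm_nonneg _) (inv_le_one_of_one_le₀ h3)).trans
      (hb θ hθ ρ ?_)
    rw [mem_closedBall_zero_iff]
    linarith
  · have h4 : ‖θ‖ < N + 1 := by
      have := norm_sub_norm_le θ ρ
      rw [norm_sub_rev] at this
      linarith
    have h5 : MapsTo (fun ρ => w.φs' θ * w.φ ρ - w.φs θ * w.φ' ρ) (Metric.ball θ 2)
        (Metric.closedBall (w.φs' θ * w.φ θ - w.φs θ * w.φ' θ)
          (C * (|C1| + |C2|) * (1 + ‖θ‖))) := fun ζ hζ => by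
      rw [hz, mem_closedBall_zero_iff]
      refine hb θ hθ ζ ?_
      rw [mem_closedBall_zero_iff]
      rw [mem_ball_iff_norm] at hζ
      have := norm_sub_norm_le ζ θ
      linarith
    refine (Complex.norm_dslope_le_div_of_mapsTo_ball (Differentiable.differentiableOn
      ((h.diff_φ.const_mul _).sub (h.diff_φ'.const_mul _))) h5
      (mem_ball_iff_norm.2 (by linarith))).trans ?_
    linarith

end WeylSystem

end MainEquation

section MainEquation

variable {𝔸 : Type*} [NormedRing 𝔸] [NormedAlgebra ℂ 𝔸] [CompleteSpace 𝔸]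
variable {α : Type*} [MeasurableSpace α] {μ : Measure α} {p : α → ℂ} {k : α → 𝔸} {R : ℝ}

/-- `k` is the density of `M̂(θ) dθ` on the contour, for a matrix function `M̂` that is holomorphic
off the contour: it is sufficiently small at infinity, and Cauchy's theorem holds for it in the form
of `CutHolomorphic.exists_entire_extension`. -/
structure IsCutDensity (μ : Measure α) (p : α → ℂ) (k : α → 𝔸) (R : ℝ) (Mh : ℂ → 𝔸) : Prop where
  contour : IsCutContour μ p R
  aestronglyMeasurable : AEStronglyMeasurable k μ
  integrable : Integrable (fun a => (1 + ‖p a‖) * ‖k a‖) μ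
  exists_entire_extension : ∀ A B : ℂ → 𝔸, Differentiable ℂ A → Differentiable ℂ B →
    Integrable (fun a => A (p a) * k a * B (p a)) μ → ∃ e : ℂ → 𝔸, Differentiable ℂ e ∧
      ∀ ρ : ℂ, ρ.im ≠ 0 → R < ‖ρ‖ →
        e ρ = A ρ * Mh ρ * B ρ + cauchyTransform μ p (fun a => A (p a) * k a * B (p a)) ρ

/-- An entire function that vanishes far from the origin and off the real axis is zero. -/
lemma Differentiable.eq_zero_of_nonreal {f : ℂ → 𝔸} (hf : Differentiable ℂ f) {ρ₀ : ℝ}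
    (h : ∀ ρ : ℂ, ρ.im ≠ 0 → ρ₀ ≤ ‖ρ‖ → f ρ = 0) (ρ : ℂ) : f ρ = 0 :=
  eq_zero_of_norm_mul_im_le hf (C := 0) (fun ρ h1 h2 => by rw [h ρ h1 h2, norm_zero, zero_mul]) ρ

namespace WeylSystem

variable {w wt : WeylSystem 𝔸} {x : ℝ}

/-- The integral operator of the main equation, for the model `w`; `h` stands for the function
`a ↦ z (p a)`. -/
def mainOp (w : WeylSystem 𝔸) (μ : Measure α) (p : α → ℂ) (k h : α → 𝔸) (ρ : ℂ) : 𝔸 :=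
  (2 * Real.pi * Complex.I : ℂ)⁻¹ • ∫ a, h a * k a * w.kernel ρ (p a) ∂μ

section

variable {Mh : ℂ → 𝔸} {h : α → 𝔸}

lemma integrable_mul_density (hk : IsCutDensity μ p k R Mh) {f : ℂ → 𝔸} (hf : Continuous f)
    {K C : ℝ} (hC : ∀ θ : ℂ, |θ.im| ≤ R → ‖f θ‖ ≤ C * (1 + ‖θ‖))
    (hm : AEStronglyMeasurable h μ) (hb : ∀ᵐ a ∂μ, ‖h a‖ ≤ K) :
    Integrable (fun a => h a * k a * f (p a)) μ := by
  refine (hk.integrable.const_mul (K * C)).mono'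
    ((hm.mul hk.aestronglyMeasurable).mul
      (hf.comp_aestronglyMeasurable hk.contour.measurable.aestronglyMeasurable)) ?_
  filter_upwards [hb] with a ha
  calc _ ≤ ‖h a‖ * ‖k a‖ * ‖f (p a)‖ := (norm_mul_le _ _).trans (by gcongr; exact norm_mul_le _ _)
    _ ≤ K * ‖k a‖ * (C * (1 + ‖p a‖)) := by
        have := (norm_nonneg _).trans ha
        gcongr
        exact hC _ (hk.contour.abs_im_le a)
    _ = _ := by ring

lemma IsRegular.integrable_densities (hw : w.IsRegular x) (hk : IsCutDensity μ p k R Mh) {K : ℝ}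
    (hm : AEStronglyMeasurable h μ) (hb : ∀ᵐ a ∂μ, ‖h a‖ ≤ K) :
    Integrable (fun a => h a * k a * w.φs (p a)) μ ∧
      Integrable (fun a => h a * k a * w.φs' (p a)) μ := by
  obtain ⟨C, hC0, hC⟩ := IsRegular.exists_strip_bound hw.diff_φs.continuous hw.diff_φs'.continuous
    hw.nonneg hw.bound_φs R
  exact ⟨integrable_mul_density hk hw.diff_φs.continuous (fun θ hθ => (hC θ hθ).1.trans
      (le_mul_of_one_le_right hC0 (by linarith [norm_nonneg θ]))) hm hb,
    integrable_mul_density hk hw.diff_φs'.continuous (fun θ hθ => (hC θ hθ).2) hm hb⟩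

/-- Off the contour the operator is a combination of two Cauchy transforms. -/
lemma IsRegular.mainOp_eq (hw : w.IsRegular x) (hk : IsCutDensity μ p k R Mh) {K : ℝ}
    (hm : AEStronglyMeasurable h μ) (hb : ∀ᵐ a ∂μ, ‖h a‖ ≤ K) {ρ : ℂ} (hρ : 2 * R ≤ ‖ρ‖)
    (him : ρ.im ≠ 0) :
    w.mainOp μ p k h ρ =
      cauchyTransform μ p (fun a => h a * k a * w.φs (p a)) ρ * w.φ' ρ -
        cauchyTransform μ p (fun a => h a * k a * w.φs' (p a)) ρ * w.φ ρ := by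
  obtain ⟨i1, i2⟩ := hw.integrable_densities hk hm hb
  have j1 := hk.contour.integrable_kernel i1 hρ him
  have j2 := hk.contour.integrable_kernel i2 hρ him
  rw [mainOp, cauchyTransform, cauchyTransform, smul_mul_assoc, smul_mul_assoc, ← smul_sub,
    ← integral_mul_const_of_integrable j1, ← integral_mul_const_of_integrable j2,
    ← integral_sub (j1.mul_const _) (j2.mul_const _)]
  congr 1
  refine integral_congr_ae (Eventually.of_forall fun a => ?_)
  have e : (ρ - p a)⁻¹ = -(p a - ρ)⁻¹ := by rw [← neg_sub (p a) ρ, inv_neg]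
  simp only [kernel, e, smul_mul_assoc, mul_smul_comm, neg_smul, mul_neg, mul_sub, smul_sub,
    mul_assoc]
  abel

/-- Off the diagonal the kernel is a difference quotient. -/
lemma IsRegular.kernel_eq_dslope (hw : w.IsRegular x) {ρ θ : ℂ} (hne : θ ≠ ρ) :
    w.kernel ρ θ = dslope (fun ρ => w.φs' θ * w.φ ρ - w.φs θ * w.φ' ρ) θ ρ := by
  rw [dslope_of_ne _ hne.symm, slope_def_module, hw.wronskian_φs_φ, sub_zero, kernel]

lemma IsRegular.aestronglyMeasurable_mul_kernel (hw : w.IsRegular x)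
    (hk : IsCutDensity μ p k R Mh) (hm : AEStronglyMeasurable h μ) (ρ : ℂ) :
    AEStronglyMeasurable (fun a => h a * k a * w.kernel ρ (p a)) μ := by
  refine (hm.mul hk.aestronglyMeasurable).mul (AEStronglyMeasurable.smul
    (hk.contour.measurable.const_sub ρ).inv.aestronglyMeasurable ?_)
  have hp := hk.contour.measurable.aestronglyMeasurable (μ := μ)
  exact ((hw.diff_φs'.continuous.comp_aestronglyMeasurable hp).mul
    aestronglyMeasurable_const).sub
    ((hw.diff_φs.continuous.comp_aestronglyMeasurable hp).mul aestronglyMeasurable_const)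

/-- A majorant of the integrand of the main equation, uniform for bounded `ρ`. -/
lemma IsRegular.exists_majorant (hw : w.IsRegular x) (hk : IsCutDensity μ p k R Mh) {K : ℝ}
    (hb : ∀ᵐ a ∂μ, ‖h a‖ ≤ K) (N : ℝ) : ∃ b : α → ℝ, Integrable b μ ∧
      ∀ᵐ a ∂μ, ∀ ρ ∈ Metric.ball (0 : ℂ) N, ‖h a * k a *
        dslope (fun ρ => w.φs' (p a) * w.φ ρ - w.φs (p a) * w.φ' ρ) (p a) ρ‖ ≤ b a := by
  obtain ⟨C, hC0, hC⟩ := hw.exists_norm_dslope_le R N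
  refine ⟨fun a => (K * C) * ((1 + ‖p a‖) * ‖k a‖), hk.integrable.const_mul (K * C), ?_⟩
  filter_upwards [hb] with a ha ζ hζ
  calc _ ≤ ‖h a‖ * ‖k a‖ * _ := (norm_mul_le _ _).trans (by gcongr; exact norm_mul_le _ _)
    _ ≤ K * ‖k a‖ * (C * (1 + ‖p a‖)) := by
        have := (norm_nonneg _).trans ha
        gcongr
        exact hC _ (hk.contour.abs_im_le a) ζ hζ
    _ = _ := by ring

lemma IsRegular.integrable_mul_kernel (hw : w.IsRegular x) (hk : IsCutDensity μ p k R Mh) {K : ℝ}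
    (hm : AEStronglyMeasurable h μ) (hb : ∀ᵐ a ∂μ, ‖h a‖ ≤ K) (ρ : ℂ) :
    Integrable (fun a => h a * k a * w.kernel ρ (p a)) μ := by
  obtain ⟨b, hbi, hbb⟩ := hw.exists_majorant hk hb (‖ρ‖ + 1)
  refine hbi.mono' (hw.aestronglyMeasurable_mul_kernel hk hm ρ) ?_
  filter_upwards [hbb, hk.contour.ae_ne ρ] with a h1 h2
  rw [hw.kernel_eq_dslope h2]
  exact h1 ρ (by rw [mem_ball_zero_iff]; linarith)

lemma IsRegular.differentiable_mainOp (hw : w.IsRegular x) (hk : IsCutDensity μ p k R Mh) {K : ℝ}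
    (hm : AEStronglyMeasurable h μ) (hb : ∀ᵐ a ∂μ, ‖h a‖ ≤ K) :
    Differentiable ℂ (w.mainOp μ p k h) := by
  suffices H : Differentiable ℂ fun ρ => ∫ a, h a * k a * w.kernel ρ (p a) ∂μ from
    H.const_smul (2 * Real.pi * Complex.I : ℂ)⁻¹
  intro ρ
  obtain ⟨b, hbi, hbb⟩ := hw.exists_majorant hk hb (‖ρ‖ + 1)
  have hae : ∀ ρ, (fun a => h a * k a * w.kernel ρ (p a)) =ᵐ[μ] fun a => h a * k a *
      dslope (fun ρ => w.φs' (p a) * w.φ ρ - w.φs (p a) * w.φ' ρ) (p a) ρ := fun ρ => by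
    filter_upwards [hk.contour.ae_ne ρ] with a ha
    rw [hw.kernel_eq_dslope ha]
  simp only [fun ρ => integral_congr_ae (hae ρ)]
  have key := differentiableOn_integral_of_dominated (μ := μ) (U := Metric.ball 0 (‖ρ‖ + 1))
    (F := fun ρ a => h a * k a *
      dslope (fun ρ => w.φs' (p a) * w.φ ρ - w.φs (p a) * w.φ' ρ) (p a) ρ)
    (b := b) Metric.isOpen_ball
    (fun ζ _ => (hw.aestronglyMeasurable_mul_kernel hk hm ζ).congr (hae ζ))
    (Eventually.of_forall fun a => ?_) hbb hbi
  · exact key.differentiableAt (Metric.isOpen_ball.mem_nhds (by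
      rw [mem_ball_zero_iff]; linarith))
  · exact (((Complex.differentiableOn_dslope univ_mem).2 (Differentiable.differentiableOn
      ((hw.diff_φ.const_mul _).sub (hw.diff_φ'.const_mul _)))).const_mul _).mono (subset_univ _)

end

section Estimates

/-- Products of a growing and of a decaying factor. -/
lemma norm_mul_le_of_exp {a b : 𝔸} {A B s : ℝ} (ha : ‖a‖ ≤ A * Real.exp s)
    (hb : ‖b‖ ≤ B * Real.exp (-s)) : ‖a * b‖ ≤ A * B := by
  have hA : 0 ≤ A * Real.exp s := (norm_nonneg _).trans ha
  calc _ ≤ ‖a‖ * ‖b‖ := norm_mul_le _ _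
    _ ≤ (A * Real.exp s) * (B * Real.exp (-s)) := by gcongr
    _ = A * B * (Real.exp s * Real.exp (-s)) := by ring
    _ = A * B := by rw [← Real.exp_add, add_neg_cancel, Real.exp_zero, mul_one]

end Estimates

/-- The combinations `φ Φ̃s' - Φ φ̃s'` and `Φ φ̃s - φ Φ̃s` of the solutions of the pencil and of
its model differ from Cauchy transforms of `φ M̂ φ̃s'` and `φ M̂ φ̃s` by entire functions. By Liouville's
theorem these are a constant `q` and zero. Hence `φ` solves the main equation with `q φ̃` in place of
`φ̃`, and `q` is found from the limits of the Weyl solutions at `±i∞`. -/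
theorem IsRegular.exists_factor (hw : w.IsRegular x) (hwt : wt.IsRegular x)
    (hk : IsCutDensity μ p k R fun ρ => w.M ρ - wt.M ρ) (gi gmi : 𝔸) (hg : wt.G * gi = 1)
    (hgm : wt.Gm * gmi = 1) :
    ∃ q : 𝔸, (2 : ℂ) • q = w.G * gi + w.Gm * gmi ∧
      (∀ ρ, w.φ ρ + wt.mainOp μ p k (fun a => w.φ (p a)) ρ = q * wt.φ ρ) ∧
      ∀ ρ : ℂ, ρ.im ≠ 0 → 2 * R ≤ ‖ρ‖ → w.Φ ρ =
        (q + cauchyTransform μ p (fun a => w.φ (p a) * k a * wt.φs' (p a)) ρ) * wt.Φ ρ -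
          cauchyTransform μ p (fun a => w.φ (p a) * k a * wt.φs (p a)) ρ * wt.Φ' ρ := by
  obtain ⟨K, hK0, hK⟩ := IsRegular.exists_strip_bound hw.diff_φ.continuous hw.diff_φ'.continuous
    hw.nonneg hw.bound_φ R
  have hm : AEStronglyMeasurable (fun a => w.φ (p a)) μ :=
    hw.diff_φ.continuous.comp_aestronglyMeasurable hk.contour.measurable.aestronglyMeasurable
  have hb : ∀ᵐ a ∂μ, ‖w.φ (p a)‖ ≤ K :=
    Eventually.of_forall fun a => (hK _ (hk.contour.abs_im_le a)).1
  obtain ⟨i1, i2⟩ := hwt.integrable_densities hk hm hb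
  obtain ⟨e1, he1d, he1⟩ := hk.exists_entire_extension w.φ wt.φs' hw.diff_φ hwt.diff_φs' i2
  obtain ⟨e2, he2d, he2⟩ := hk.exists_entire_extension w.φ wt.φs hw.diff_φ hwt.diff_φs i1
  set a := cauchyTransform μ p (fun a => w.φ (p a) * k a * wt.φs' (p a)) with ha
  set b := cauchyTransform μ p (fun a => w.φ (p a) * k a * wt.φs (p a)) with hbdef
  have hR := hk.contour.pos
  have hR2 : ∀ ρ : ℂ, 2 * R ≤ ‖ρ‖ → R < ‖ρ‖ := fun ρ hρ => by linarith
  -- the two combinations below are entire, since `M` and the model's `M̃` drop out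
  set f1 : ℂ → 𝔸 := fun ρ => w.φ ρ * wt.Ss' ρ - w.S ρ * wt.φs' ρ - e1 ρ with hf1
  set f2 : ℂ → 𝔸 := fun ρ => w.S ρ * wt.φs ρ - w.φ ρ * wt.Ss ρ + e2 ρ with hf2
  have hf1d : Differentiable ℂ f1 :=
    ((hw.diff_φ.mul hwt.diff_Ss').sub (hw.diff_S.mul hwt.diff_φs')).sub he1d
  have hf2d : Differentiable ℂ f2 :=
    ((hw.diff_S.mul hwt.diff_φs).sub (hw.diff_φ.mul hwt.diff_Ss)).add he2d
  have hf1e : ∀ ρ : ℂ, ρ.im ≠ 0 → 2 * R ≤ ‖ρ‖ →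
      f1 ρ = w.φ ρ * wt.Φs' ρ - w.Φ ρ * wt.φs' ρ - a ρ := fun ρ h1 h2 => by
    rw [hf1]
    simp only [he1 ρ h1 (hR2 ρ h2), Φ, Φs']
    noncomm_ring
  have hf2e : ∀ ρ : ℂ, ρ.im ≠ 0 → 2 * R ≤ ‖ρ‖ →
      f2 ρ = w.Φ ρ * wt.φs ρ - w.φ ρ * wt.Φs ρ + b ρ := fun ρ h1 h2 => by
    rw [hf2]
    simp only [he2 ρ h1 (hR2 ρ h2), Φ, Φs]
    noncomm_ring
  obtain ⟨C1, hC1, b1⟩ := hw.bound_φ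
  obtain ⟨C2, hC2, b2⟩ := hwt.bound_φs
  obtain ⟨r3, C3, hr3, hC3, b3⟩ := hw.bound_Φ
  obtain ⟨r4, C4, hr4, hC4, b4⟩ := hwt.bound_Φs
  have hconst := apply_eq_apply_of_norm_mul_im_le hf1d
    (C := C1 * C4 + C3 * C2 + ∫ a, ‖w.φ (p a) * k a * wt.φs' (p a)‖ ∂μ)
    (ρ₀ := max (2 * R) (max r3 r4)) (fun ρ him hρ => ?_)
  swap
  · have h2R : 2 * R ≤ ‖ρ‖ := (le_max_left _ _).trans hρ
    have hρ3 : r3 ≤ ‖ρ‖ := ((le_max_left _ _).trans (le_max_right _ _)).trans hρ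
    have hρ4 : r4 ≤ ‖ρ‖ := ((le_max_right _ _).trans (le_max_right _ _)).trans hρ
    have hρ1 : 1 ≤ ‖ρ‖ := hr3.trans hρ3
    have hρ0 : 0 < ‖ρ‖ := one_pos.trans_le hρ1
    have t1 := norm_mul_le_of_exp (b1 ρ hρ1).1 (b4 ρ him hρ4).2
    have t2 : ‖w.Φ ρ * wt.φs' ρ‖ ≤ C3 * C2 := by
      have u1 := (b3 ρ him hρ3).1
      have u2 := (b2 ρ hρ1).2
      calc _ ≤ ‖w.Φ ρ‖ * ‖wt.φs' ρ‖ := norm_mul_le _ _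
        _ ≤ (C3 * Real.exp (-(|ρ.im| * x)) / ‖ρ‖) * (C2 * ‖ρ‖ * Real.exp (|ρ.im| * x)) := by
            gcongr
        _ = C3 * C2 * (Real.exp (-(|ρ.im| * x)) * Real.exp (|ρ.im| * x)) := by field_simp
        _ = _ := by rw [← Real.exp_add, neg_add_cancel, Real.exp_zero, mul_one]
    have t3 := hk.contour.norm_cauchyTransform_mul_le i2 h2R
    have t4 : (0 : ℝ) ≤ ∫ a, ‖w.φ (p a) * k a * wt.φs' (p a)‖ ∂μ :=
      integral_nonneg fun a => norm_nonneg _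
    have t5 := Complex.abs_im_le_norm ρ
    rw [hf1e ρ him h2R]
    calc _ ≤ (‖w.φ ρ * wt.Φs' ρ‖ + ‖w.Φ ρ * wt.φs' ρ‖ + ‖a ρ‖) * |ρ.im| := by
          gcongr
          exact (norm_sub_le _ _).trans (by gcongr; exact norm_sub_le _ _)
      _ = (‖w.φ ρ * wt.Φs' ρ‖ + ‖w.Φ ρ * wt.φs' ρ‖) * |ρ.im| + ‖a ρ‖ * |ρ.im| := by ring
      _ ≤ (C1 * C4 + C3 * C2) * ‖ρ‖ + (∫ a, ‖w.φ (p a) * k a * wt.φs' (p a)‖ ∂μ) * ‖ρ‖ := by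
          refine add_le_add ?_ (t3.trans (le_mul_of_one_le_right t4 hρ1))
          gcongr
      _ = _ := by ring
  have hzero : ∀ ρ, f2 ρ = 0 := by
    refine eq_zero_of_norm_mul_im_le hf2d
      (C := C3 * C2 + C1 * C4 + ∫ a, ‖w.φ (p a) * k a * wt.φs (p a)‖ ∂μ)
      (ρ₀ := max (2 * R) (max r3 r4)) (fun ρ him hρ => ?_)
    have h2R : 2 * R ≤ ‖ρ‖ := (le_max_left _ _).trans hρ
    have hρ3 : r3 ≤ ‖ρ‖ := ((le_max_left _ _).trans (le_max_right _ _)).trans hρ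
    have hρ4 : r4 ≤ ‖ρ‖ := ((le_max_right _ _).trans (le_max_right _ _)).trans hρ
    have hρ1 : 1 ≤ ‖ρ‖ := hr3.trans hρ3
    have hρ0 : 0 < ‖ρ‖ := one_pos.trans_le hρ1
    have t5 := Complex.abs_im_le_norm ρ
    have t1 : ‖w.φ ρ * wt.Φs ρ‖ * ‖ρ‖ ≤ C1 * C4 := by
      have u1 := (b4 ρ him hρ4).1
      rw [le_div_iff₀ hρ0] at u1
      calc _ ≤ ‖w.φ ρ‖ * ‖wt.Φs ρ‖ * ‖ρ‖ := by gcongr; exact norm_mul_le _ _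
        _ = ‖w.φ ρ‖ * (‖wt.Φs ρ‖ * ‖ρ‖) := by ring
        _ ≤ (C1 * Real.exp (|ρ.im| * x)) * (C4 * Real.exp (-(|ρ.im| * x))) := by
            gcongr
            exact (b1 ρ hρ1).1
        _ = C1 * C4 * (Real.exp (|ρ.im| * x) * Real.exp (-(|ρ.im| * x))) := by ring
        _ = _ := by rw [← Real.exp_add, add_neg_cancel, Real.exp_zero, mul_one]
    have t2 : ‖w.Φ ρ * wt.φs ρ‖ * ‖ρ‖ ≤ C3 * C2 := by
      have u1 := (b3 ρ him hρ3).1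
      rw [le_div_iff₀ hρ0] at u1
      calc _ ≤ ‖w.Φ ρ‖ * ‖wt.φs ρ‖ * ‖ρ‖ := by gcongr; exact norm_mul_le _ _
        _ = (‖w.Φ ρ‖ * ‖ρ‖) * ‖wt.φs ρ‖ := by ring
        _ ≤ (C3 * Real.exp (-(|ρ.im| * x))) * (C2 * Real.exp (|ρ.im| * x)) := by
            gcongr
            exact (b2 ρ hρ1).1
        _ = C3 * C2 * (Real.exp (-(|ρ.im| * x)) * Real.exp (|ρ.im| * x)) := by ring
        _ = _ := by rw [← Real.exp_add, neg_add_cancel, Real.exp_zero, mul_one]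
    have t3 := hk.contour.norm_cauchyTransform_mul_le i1 h2R
    rw [hf2e ρ him h2R]
    calc _ ≤ (‖w.Φ ρ * wt.φs ρ‖ + ‖w.φ ρ * wt.Φs ρ‖ + ‖b ρ‖) * |ρ.im| := by
          gcongr
          exact (norm_add_le _ _).trans (by gcongr; exact norm_sub_le _ _)
      _ = ‖w.Φ ρ * wt.φs ρ‖ * |ρ.im| + ‖w.φ ρ * wt.Φs ρ‖ * |ρ.im| + ‖b ρ‖ * |ρ.im| := by ring
      _ ≤ ‖w.Φ ρ * wt.φs ρ‖ * ‖ρ‖ + ‖w.φ ρ * wt.Φs ρ‖ * ‖ρ‖ + ‖b ρ‖ * |ρ.im| := by gcongr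
      _ ≤ _ := by gcongr
  -- the Wronskians of the model turn the two identities into formulas for `φ` and `Φ`
  set q := f1 0 with hq
  have hq1 : ∀ ρ : ℂ, ρ.im ≠ 0 → 2 * R ≤ ‖ρ‖ →
      w.φ ρ * wt.Φs' ρ - w.Φ ρ * wt.φs' ρ = q + a ρ := fun ρ h1 h2 => by
    rw [hconst 0 ρ] at hq
    rw [hq, hf1e ρ h1 h2, sub_add_cancel]
  have hq2 : ∀ ρ : ℂ, ρ.im ≠ 0 → 2 * R ≤ ‖ρ‖ →
      w.Φ ρ * wt.φs ρ - w.φ ρ * wt.Φs ρ = -b ρ := fun ρ h1 h2 => by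
    rw [eq_neg_iff_add_eq_zero, ← hf2e ρ h1 h2, hzero]
  have hφ : ∀ ρ : ℂ, ρ.im ≠ 0 → 2 * R ≤ ‖ρ‖ →
      w.φ ρ = (q + a ρ) * wt.φ ρ - b ρ * wt.φ' ρ := fun ρ h1 h2 => by
    have e : (q + a ρ) * wt.φ ρ - b ρ * wt.φ' ρ =
        w.φ ρ * (wt.Φs' ρ * wt.φ ρ - wt.Φs ρ * wt.φ' ρ) -
          w.Φ ρ * (wt.φs' ρ * wt.φ ρ - wt.φs ρ * wt.φ' ρ) := by
      rw [← hq1 ρ h1 h2, ← neg_eq_iff_eq_neg.2 (hq2 ρ h1 h2)]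
      noncomm_ring
    rw [e, hwt.wronskian_Φs_φ, hwt.wronskian_φs_φ, mul_one, mul_zero, sub_zero]
  have hΦ : ∀ ρ : ℂ, ρ.im ≠ 0 → 2 * R ≤ ‖ρ‖ →
      w.Φ ρ = (q + a ρ) * wt.Φ ρ - b ρ * wt.Φ' ρ := fun ρ h1 h2 => by
    have e : (q + a ρ) * wt.Φ ρ - b ρ * wt.Φ' ρ =
        w.φ ρ * (wt.Φs' ρ * wt.Φ ρ - wt.Φs ρ * wt.Φ' ρ) -
          w.Φ ρ * (wt.φs' ρ * wt.Φ ρ - wt.φs ρ * wt.Φ' ρ) := by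
      rw [← hq1 ρ h1 h2, ← neg_eq_iff_eq_neg.2 (hq2 ρ h1 h2)]
      noncomm_ring
    rw [e, hwt.wronskian_Φs_Φ, hwt.wronskian_φs_Φ, mul_neg_one, mul_zero, sub_neg_eq_add, zero_add]
  refine ⟨q, ?_, ?_, hΦ⟩
  · -- comparison of the asymptotics at `i∞` and `-i∞`
    set J : 𝔸 := (2 * Real.pi * Complex.I : ℂ)⁻¹ • ∫ a, w.φ (p a) * k a * wt.φs (p a) ∂μ with hJ
    have lim : ∀ c : ℂ, c * c = -1 → c.re = 0 → ∀ G Gt : 𝔸,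
        Tendsto (fun τ : ℝ => ((τ * Real.exp (τ * x) : ℝ) : ℂ) • w.Φ (c * τ)) atTop (𝓝 (-G)) →
        Tendsto (fun τ : ℝ => ((τ * Real.exp (τ * x) : ℝ) : ℂ) • wt.Φ (c * τ)) atTop (𝓝 (-Gt)) →
        Tendsto (fun τ : ℝ => ((Real.exp (τ * x) : ℝ) : ℂ) • wt.Φ' (c * τ)) atTop (𝓝 Gt) →
        G = (q + c • J) * Gt := fun c hc hre G Gt l1 l2 l3 => by
      have hc0 : c ≠ 0 := by rintro rfl; simp at hc
      have hn : ‖c‖ = 1 := by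
        have h1 : ‖c‖ * ‖c‖ = 1 := by rw [← norm_mul, hc, norm_neg, norm_one]
        nlinarith [norm_nonneg c]
      have hcim : c.im ≠ 0 := fun h0 => hc0 (Complex.ext hre h0)
      have l4 := ((tendsto_const_nhds (x := q)).add
        (hk.contour.tendsto_cauchyTransform i2 hc hre)).mul l2
      have l5 := (hk.contour.tendsto_smul_cauchyTransform i1 hc hre).mul l3
      have l6 := l4.sub l5
      have l7 : (fun τ : ℝ => (q + a (c * τ)) *
          ((τ * Real.exp (τ * x) : ℝ) : ℂ) • wt.Φ (c * τ) -
          (τ : ℂ) • b (c * τ) * ((Real.exp (τ * x) : ℝ) : ℂ) • wt.Φ' (c * τ)) =ᶠ[atTop]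
          fun τ : ℝ => ((τ * Real.exp (τ * x) : ℝ) : ℂ) • w.Φ (c * τ) := by
        filter_upwards [eventually_ge_atTop (2 * R)] with τ hτ
        have hτ0 : 0 < τ := lt_of_lt_of_le (by linarith [hR]) hτ
        rw [hΦ (c * τ) (by
            rw [Complex.im_mul_ofReal]
            exact mul_ne_zero hcim hτ0.ne') (by
            rw [norm_mul, hn, one_mul, Complex.norm_real, Real.norm_eq_abs, abs_of_pos hτ0]
            exact hτ)]
        simp only [smul_sub, mul_smul_comm, smul_mul_assoc, smul_smul, Complex.ofReal_mul]
        rw [mul_comm (τ : ℂ)]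
      have l8 := tendsto_nhds_unique (l6.congr' l7) l1
      rw [add_zero] at l8
      rw [← neg_inj, ← l8, add_mul]
      simp only [hJ]
      rw [mul_neg]
      abel
    have u1 := lim Complex.I Complex.I_mul_I Complex.I_re w.G wt.G hw.tendsto_Φ hwt.tendsto_Φ
      hwt.tendsto_Φ'
    have u2 := lim (-Complex.I) (by rw [neg_mul_neg, Complex.I_mul_I]) (by simp) w.Gm wt.Gm
      hw.tendsto_Φ_down hwt.tendsto_Φ_down hwt.tendsto_Φ'_down
    rw [u1, u2, mul_assoc, hg, mul_assoc, hgm, mul_one, mul_one, two_smul, neg_smul]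
    abel
  · intro ρ
    have hd : Differentiable ℂ fun ρ =>
        w.φ ρ + wt.mainOp μ p k (fun a => w.φ (p a)) ρ - q * wt.φ ρ :=
      (hw.diff_φ.add (hwt.differentiable_mainOp hk hm hb)).sub (hwt.diff_φ.const_mul q)
    refine sub_eq_zero.1 (hd.eq_zero_of_nonreal (ρ₀ := 2 * R) (fun ρ h1 h2 => ?_) ρ)
    rw [hwt.mainOp_eq hk hm hb h2 h1]
    nth_rewrite 1 [hφ ρ h1 h2]
    rw [← ha, ← hbdef]
    noncomm_ring

/-- An entire solution of the homogeneous main equation vanishes. With the companion `Z` of `z`, the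
pair `(z, Z)` is a constant multiple `c` of `(φ, Φ)` by Liouville's theorem, and the relation between
`Φ` and `Φ̃` gives `c q Φ̃ = 0`. -/
lemma IsRegular.eq_zero_of_homogeneous (hw : w.IsRegular x) (hwt : wt.IsRegular x)
    (hk : IsCutDensity μ p k R fun ρ => w.M ρ - wt.M ρ) {gi q : 𝔸} (hg : wt.G * gi = 1)
    (hq : IsUnit q)
    (hΦ : ∀ ρ : ℂ, ρ.im ≠ 0 → 2 * R ≤ ‖ρ‖ → w.Φ ρ =
        (q + cauchyTransform μ p (fun a => w.φ (p a) * k a * wt.φs' (p a)) ρ) * wt.Φ ρ -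
          cauchyTransform μ p (fun a => w.φ (p a) * k a * wt.φs (p a)) ρ * wt.Φ' ρ)
    {z : ℂ → 𝔸} (hzd : Differentiable ℂ z) {K : ℝ} (hb : ∀ᵐ a ∂μ, ‖z (p a)‖ ≤ K)
    (hz : ∀ ρ, z ρ = -wt.mainOp μ p k (fun a => z (p a)) ρ) (ρ : ℂ) : z ρ = 0 := by
  have hm : AEStronglyMeasurable (fun a => z (p a)) μ :=
    hzd.continuous.comp_aestronglyMeasurable hk.contour.measurable.aestronglyMeasurable
  obtain ⟨i1, i2⟩ := hwt.integrable_densities hk hm hb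
  obtain ⟨e1, he1d, he1⟩ := hk.exists_entire_extension z wt.φs' hzd hwt.diff_φs' i2
  obtain ⟨e2, he2d, he2⟩ := hk.exists_entire_extension z wt.φs hzd hwt.diff_φs i1
  set A := cauchyTransform μ p (fun a => z (p a) * k a * wt.φs' (p a)) with hA
  set B := cauchyTransform μ p (fun a => z (p a) * k a * wt.φs (p a)) with hB
  set I1 := ∫ a, ‖z (p a) * k a * wt.φs' (p a)‖ ∂μ with hI1
  set I2 := ∫ a, ‖z (p a) * k a * wt.φs (p a)‖ ∂μ with hI2
  have hI10 : 0 ≤ I1 := integral_nonneg fun a => norm_nonneg _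
  have hI20 : 0 ≤ I2 := integral_nonneg fun a => norm_nonneg _
  have hR := hk.contour.pos
  have hR2 : ∀ ρ : ℂ, 2 * R ≤ ‖ρ‖ → R < ‖ρ‖ := fun ρ hρ => by linarith
  have hzA : ∀ ρ : ℂ, ρ.im ≠ 0 → 2 * R ≤ ‖ρ‖ → z ρ = A ρ * wt.φ ρ - B ρ * wt.φ' ρ :=
    fun ρ h1 h2 => by rw [hz ρ, hwt.mainOp_eq hk hm hb h2 h1, neg_sub]
  -- `Z` accompanies `z` as the Weyl solution accompanies `φ`
  set Z : ℂ → 𝔸 := fun ρ => A ρ * wt.Φ ρ - B ρ * wt.Φ' ρ with hZ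
  set Y : ℂ → 𝔸 := fun ρ => e1 ρ * wt.S ρ - e2 ρ * wt.S' ρ with hY
  have hYd : Differentiable ℂ Y := (he1d.mul hwt.diff_S).sub (he2d.mul hwt.diff_S')
  have hZY : ∀ ρ : ℂ, ρ.im ≠ 0 → 2 * R ≤ ‖ρ‖ → Z ρ = Y ρ + z ρ * w.M ρ := fun ρ h1 h2 => by
    have t1 : Y ρ = A ρ * wt.S ρ - B ρ * wt.S' ρ +
        z ρ * (w.M ρ - wt.M ρ) * (wt.φs' ρ * wt.S ρ - wt.φs ρ * wt.S' ρ) := by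
      simp only [hY, he1 ρ h1 (hR2 ρ h2), he2 ρ h1 (hR2 ρ h2)]
      noncomm_ring
    have t2 : Z ρ = A ρ * wt.S ρ - B ρ * wt.S' ρ +
        (A ρ * wt.φ ρ - B ρ * wt.φ' ρ) * wt.M ρ := by
      simp only [hZ, Φ, Φ']
      noncomm_ring
    rw [t1, t2, ← hzA ρ h1 h2, hwt.wronskian_φs_S]
    noncomm_ring
  set f1 : ℂ → 𝔸 := fun ρ => z ρ * w.Ss' ρ - Y ρ * w.φs' ρ with hf1
  set f2 : ℂ → 𝔸 := fun ρ => Y ρ * w.φs ρ - z ρ * w.Ss ρ with hf2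
  have hf1e : ∀ ρ : ℂ, ρ.im ≠ 0 → 2 * R ≤ ‖ρ‖ → f1 ρ = z ρ * w.Φs' ρ - Z ρ * w.φs' ρ :=
    fun ρ h1 h2 => by
      rw [hZY ρ h1 h2, hf1]
      simp only [Φs']
      noncomm_ring
  have hf2e : ∀ ρ : ℂ, ρ.im ≠ 0 → 2 * R ≤ ‖ρ‖ → f2 ρ = Z ρ * w.φs ρ - z ρ * w.Φs ρ :=
    fun ρ h1 h2 => by
      rw [hZY ρ h1 h2, hf2]
      simp only [Φs]
      noncomm_ring
  obtain ⟨C1, hC1, b1⟩ := hwt.bound_φ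
  obtain ⟨C2, hC2, b2⟩ := hw.bound_φs
  obtain ⟨r3, C3, hr3, hC3, b3⟩ := hwt.bound_Φ
  obtain ⟨r4, C4, hr4, hC4, b4⟩ := hw.bound_Φs
  set ρ₀ := max (2 * R) (max r3 r4) with hρ₀
  have hzb : ∀ ρ : ℂ, ρ.im ≠ 0 → ρ₀ ≤ ‖ρ‖ →
      ‖z ρ‖ * |ρ.im| ≤ (I1 + I2) * C1 * ‖ρ‖ * Real.exp (|ρ.im| * x) := fun ρ him hρ => by
    have h2R : 2 * R ≤ ‖ρ‖ := (le_max_left _ _).trans hρ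
    have hρ1 : 1 ≤ ‖ρ‖ := hr3.trans (((le_max_left _ _).trans (le_max_right _ _)).trans hρ)
    have tA := hk.contour.norm_cauchyTransform_mul_le i2 h2R
    have tB := hk.contour.norm_cauchyTransform_mul_le i1 h2R
    rw [hzA ρ him h2R]
    calc _ ≤ (‖A ρ‖ * ‖wt.φ ρ‖ + ‖B ρ‖ * ‖wt.φ' ρ‖) * |ρ.im| := by
          gcongr
          exact (norm_sub_le _ _).trans (add_le_add (norm_mul_le _ _) (norm_mul_le _ _))
      _ = (‖A ρ‖ * |ρ.im|) * ‖wt.φ ρ‖ + (‖B ρ‖ * |ρ.im|) * ‖wt.φ' ρ‖ := by ring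
      _ ≤ I1 * (C1 * ‖ρ‖ * Real.exp (|ρ.im| * x)) +
            I2 * (C1 * ‖ρ‖ * Real.exp (|ρ.im| * x)) := by
          refine add_le_add (mul_le_mul tA ((b1 ρ hρ1).1.trans ?_) (norm_nonneg _) hI10)
            (mul_le_mul tB (b1 ρ hρ1).2 (norm_nonneg _) hI20)
          gcongr
          exact le_mul_of_one_le_right hC1 hρ1
      _ = _ := by ring
  have hZb : ∀ ρ : ℂ, ρ.im ≠ 0 → ρ₀ ≤ ‖ρ‖ →
      ‖Z ρ‖ * |ρ.im| ≤ (I1 + I2) * C3 * Real.exp (-(|ρ.im| * x)) := fun ρ him hρ => by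
    have h2R : 2 * R ≤ ‖ρ‖ := (le_max_left _ _).trans hρ
    have hρ3 : r3 ≤ ‖ρ‖ := ((le_max_left _ _).trans (le_max_right _ _)).trans hρ
    have hρ1 : 1 ≤ ‖ρ‖ := hr3.trans hρ3
    have tA := hk.contour.norm_cauchyTransform_mul_le i2 h2R
    have tB := hk.contour.norm_cauchyTransform_mul_le i1 h2R
    calc _ ≤ (‖A ρ‖ * ‖wt.Φ ρ‖ + ‖B ρ‖ * ‖wt.Φ' ρ‖) * |ρ.im| := by
          gcongr
          exact (norm_sub_le _ _).trans (add_le_add (norm_mul_le _ _) (norm_mul_le _ _))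
      _ = (‖A ρ‖ * |ρ.im|) * ‖wt.Φ ρ‖ + (‖B ρ‖ * |ρ.im|) * ‖wt.Φ' ρ‖ := by ring
      _ ≤ I1 * (C3 * Real.exp (-(|ρ.im| * x))) + I2 * (C3 * Real.exp (-(|ρ.im| * x))) := by
          refine add_le_add (mul_le_mul tA ((b3 ρ him hρ3).1.trans ?_) (norm_nonneg _) hI10)
            (mul_le_mul tB (b3 ρ him hρ3).2 (norm_nonneg _) hI20)
          exact div_le_self (by positivity) hρ1
      _ = _ := by ring
  have hexp : ∀ s : ℝ, Real.exp s * Real.exp (-s) = 1 := fun s => by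
    rw [← Real.exp_add, add_neg_cancel, Real.exp_zero]
  have hf1d : Differentiable ℂ f1 := (hzd.mul hw.diff_Ss').sub (hYd.mul hw.diff_φs')
  have hf2d : Differentiable ℂ f2 := (hYd.mul hw.diff_φs).sub (hzd.mul hw.diff_Ss)
  have hconst := apply_eq_apply_of_norm_mul_im_le hf1d
    (C := (I1 + I2) * C1 * C4 + (I1 + I2) * C3 * C2) (ρ₀ := ρ₀) (fun ρ him hρ => ?_)
  swap
  · have h2R : 2 * R ≤ ‖ρ‖ := (le_max_left _ _).trans hρ
    have hρ4 : r4 ≤ ‖ρ‖ := ((le_max_right _ _).trans (le_max_right _ _)).trans hρ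
    have hρ1 : 1 ≤ ‖ρ‖ := hr4.trans hρ4
    rw [hf1e ρ him h2R]
    calc _ ≤ (‖z ρ‖ * ‖w.Φs' ρ‖ + ‖Z ρ‖ * ‖w.φs' ρ‖) * |ρ.im| := by
          gcongr
          exact (norm_sub_le _ _).trans (add_le_add (norm_mul_le _ _) (norm_mul_le _ _))
      _ = (‖z ρ‖ * |ρ.im|) * ‖w.Φs' ρ‖ + (‖Z ρ‖ * |ρ.im|) * ‖w.φs' ρ‖ := by ring
      _ ≤ ((I1 + I2) * C1 * ‖ρ‖ * Real.exp (|ρ.im| * x)) * (C4 * Real.exp (-(|ρ.im| * x))) +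
            ((I1 + I2) * C3 * Real.exp (-(|ρ.im| * x))) *
              (C2 * ‖ρ‖ * Real.exp (|ρ.im| * x)) := by
          exact add_le_add
            (mul_le_mul (hzb ρ him hρ) (b4 ρ him hρ4).2 (norm_nonneg _) (by positivity))
            (mul_le_mul (hZb ρ him hρ) (b2 ρ hρ1).2 (norm_nonneg _) (by positivity))
      _ = ((I1 + I2) * C1 * C4 + (I1 + I2) * C3 * C2) * ‖ρ‖ *
            (Real.exp (|ρ.im| * x) * Real.exp (-(|ρ.im| * x))) := by ring
      _ = _ := by rw [hexp, mul_one]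
  have hzero := eq_zero_of_norm_mul_im_le hf2d
    (C := (I1 + I2) * C3 * C2 + (I1 + I2) * C1 * C4) (ρ₀ := ρ₀) (fun ρ him hρ => ?_)
  swap
  · have h2R : 2 * R ≤ ‖ρ‖ := (le_max_left _ _).trans hρ
    have hρ4 : r4 ≤ ‖ρ‖ := ((le_max_right _ _).trans (le_max_right _ _)).trans hρ
    have hρ1 : 1 ≤ ‖ρ‖ := hr4.trans hρ4
    have hρ0 : 0 < ‖ρ‖ := one_pos.trans_le hρ1
    rw [hf2e ρ him h2R]
    calc _ ≤ (‖Z ρ‖ * ‖w.φs ρ‖ + ‖z ρ‖ * ‖w.Φs ρ‖) * |ρ.im| := by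
          gcongr
          exact (norm_sub_le _ _).trans (add_le_add (norm_mul_le _ _) (norm_mul_le _ _))
      _ = (‖Z ρ‖ * |ρ.im|) * ‖w.φs ρ‖ + (‖z ρ‖ * |ρ.im|) * ‖w.Φs ρ‖ := by ring
      _ ≤ ((I1 + I2) * C3 * Real.exp (-(|ρ.im| * x))) * (C2 * Real.exp (|ρ.im| * x)) +
            ((I1 + I2) * C1 * ‖ρ‖ * Real.exp (|ρ.im| * x)) *
              (C4 * Real.exp (-(|ρ.im| * x)) / ‖ρ‖) := by
          exact add_le_add
            (mul_le_mul (hZb ρ him hρ) (b2 ρ hρ1).1 (norm_nonneg _) (by positivity))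
            (mul_le_mul (hzb ρ him hρ) (b4 ρ him hρ4).1 (norm_nonneg _) (by positivity))
      _ = ((I1 + I2) * C3 * C2 + (I1 + I2) * C1 * C4) *
            (Real.exp (|ρ.im| * x) * Real.exp (-(|ρ.im| * x))) := by field_simp
      _ = _ := by rw [hexp, mul_one]
  -- the Wronskians of the pencil give `z = c φ` and `Z = c Φ`
  set c := f1 0 with hc
  have hc1 : ∀ ρ : ℂ, ρ.im ≠ 0 → 2 * R ≤ ‖ρ‖ → z ρ * w.Φs' ρ - Z ρ * w.φs' ρ = c :=
    fun ρ h1 h2 => by rw [hc, hconst 0 ρ, hf1e ρ h1 h2]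
  have hc2 : ∀ ρ : ℂ, ρ.im ≠ 0 → 2 * R ≤ ‖ρ‖ → Z ρ * w.φs ρ - z ρ * w.Φs ρ = 0 :=
    fun ρ h1 h2 => by rw [← hf2e ρ h1 h2, hzero]
  have hzc : ∀ ρ, z ρ = c * w.φ ρ := fun ρ => by
    refine sub_eq_zero.1 ((hzd.sub (hw.diff_φ.const_mul c)).eq_zero_of_nonreal (ρ₀ := 2 * R)
      (fun ρ h1 h2 => ?_) ρ)
    have e : c * w.φ ρ = z ρ * (w.Φs' ρ * w.φ ρ - w.Φs ρ * w.φ' ρ) -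
        Z ρ * (w.φs' ρ * w.φ ρ - w.φs ρ * w.φ' ρ) -
        (Z ρ * w.φs ρ - z ρ * w.Φs ρ) * w.φ' ρ := by
      rw [← hc1 ρ h1 h2]
      noncomm_ring
    rw [Pi.sub_apply, e, hw.wronskian_Φs_φ, hw.wronskian_φs_φ, hc2 ρ h1 h2]
    simp
  have hZc : ∀ ρ : ℂ, ρ.im ≠ 0 → 2 * R ≤ ‖ρ‖ → Z ρ = c * w.Φ ρ := fun ρ h1 h2 => by
    have e : c * w.Φ ρ = z ρ * (w.Φs' ρ * w.Φ ρ - w.Φs ρ * w.Φ' ρ) -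
        Z ρ * (w.φs' ρ * w.Φ ρ - w.φs ρ * w.Φ' ρ) -
        (Z ρ * w.φs ρ - z ρ * w.Φs ρ) * w.Φ' ρ := by
      rw [← hc1 ρ h1 h2]
      noncomm_ring
    rw [e, hw.wronskian_Φs_Φ, hw.wronskian_φs_Φ, hc2 ρ h1 h2]
    simp
  -- hence the transforms of `z` are `c` times those of `φ`, and the relation for `Φ` applies
  have hm' : AEStronglyMeasurable (fun a => w.φ (p a)) μ :=
    hw.diff_φ.continuous.comp_aestronglyMeasurable hk.contour.measurable.aestronglyMeasurable
  obtain ⟨K', -, hK'⟩ := IsRegular.exists_strip_bound hw.diff_φ.continuous hw.diff_φ'.continuous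
    hw.nonneg hw.bound_φ R
  obtain ⟨j1, j2⟩ := hwt.integrable_densities hk hm'
    (Eventually.of_forall fun a => (hK' _ (hk.contour.abs_im_le a)).1)
  have hcq : ∀ ρ : ℂ, ρ.im ≠ 0 → 2 * R ≤ ‖ρ‖ → c * q * wt.Φ ρ = 0 := fun ρ h1 h2 => by
    have eA : A ρ = c * cauchyTransform μ p (fun a => w.φ (p a) * k a * wt.φs' (p a)) ρ := by
      rw [hA, cauchyTransform, cauchyTransform, mul_smul_comm,
        ← integral_const_mul_of_integrable (hk.contour.integrable_kernel j2 h2 h1)]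
      simp only [hzc, mul_smul_comm, mul_assoc]
    have eB : B ρ = c * cauchyTransform μ p (fun a => w.φ (p a) * k a * wt.φs (p a)) ρ := by
      rw [hB, cauchyTransform, cauchyTransform, mul_smul_comm,
        ← integral_const_mul_of_integrable (hk.contour.integrable_kernel j1 h2 h1)]
      simp only [hzc, mul_smul_comm, mul_assoc]
    have e := hZc ρ h1 h2
    rw [hΦ ρ h1 h2, hZ] at e
    simp only [eA, eB] at e
    rw [← sub_eq_zero.2 e.symm]
    noncomm_ring
  have hcG : c * q * wt.G = 0 := by
    have l2 := (hwt.tendsto_Φ.const_mul (c * q))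
    have l3 : (fun τ : ℝ => c * q * ((τ * Real.exp (τ * x) : ℝ) : ℂ) • wt.Φ (Complex.I * τ))
        =ᶠ[atTop] fun _ => 0 := by
      filter_upwards [eventually_ge_atTop (2 * R)] with τ hτ
      have hτ0 : 0 < τ := lt_of_lt_of_le (by linarith [hR]) hτ
      rw [mul_smul_comm, hcq _ (by simpa using hτ0.ne') (by simpa [abs_of_pos hτ0] using hτ),
        smul_zero]
    have l4 := tendsto_nhds_unique (l2.congr' l3) tendsto_const_nhds
    rwa [mul_neg, neg_eq_zero] at l4
  have hc0 : c = 0 := by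
    have h1 : c * q = 0 := by
      rw [← mul_one (c * q), ← hg, ← mul_assoc, hcG, zero_mul]
    obtain ⟨u, rfl⟩ := hq
    rw [← mul_one c, ← u.mul_inv, ← mul_assoc, h1, zero_mul]
  rw [hzc ρ, hc0, zero_mul]

/-- Uniqueness for the main equation: a bounded solution of the homogeneous equation on the contour
vanishes. -/
theorem IsRegular.mainOp_eq_zero (hw : w.IsRegular x) (hwt : wt.IsRegular x)
    (hk : IsCutDensity μ p k R fun ρ => w.M ρ - wt.M ρ) {gi q : 𝔸} (hg : wt.G * gi = 1)
    (hq : IsUnit q)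
    (hΦ : ∀ ρ : ℂ, ρ.im ≠ 0 → 2 * R ≤ ‖ρ‖ → w.Φ ρ =
        (q + cauchyTransform μ p (fun a => w.φ (p a) * k a * wt.φs' (p a)) ρ) * wt.Φ ρ -
          cauchyTransform μ p (fun a => w.φ (p a) * k a * wt.φs (p a)) ρ * wt.Φ' ρ)
    {h : α → 𝔸} {K : ℝ} (hm : AEStronglyMeasurable h μ) (hb : ∀ᵐ a ∂μ, ‖h a‖ ≤ K)
    (hh : ∀ᵐ a ∂μ, h a = -wt.mainOp μ p k h (p a)) (ρ : ℂ) : wt.mainOp μ p k h ρ = 0 := by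
  have hd := hwt.differentiable_mainOp hk hm hb
  have e : ∀ ρ, wt.mainOp μ p k (fun a => -wt.mainOp μ p k h (p a)) ρ = wt.mainOp μ p k h ρ :=
    fun ρ => by
      rw [mainOp, mainOp]
      congr 1
      refine integral_congr_ae ?_
      filter_upwards [hh] with a ha
      exact congrArg (· * k a * wt.kernel ρ (p a)) ha.symm
  refine neg_eq_zero.1 (hw.eq_zero_of_homogeneous hwt hk hg hq hΦ
    (z := fun ρ => -wt.mainOp μ p k h ρ) hd.neg (K := K) ?_ (fun ρ => ?_) ρ)
  · filter_upwards [hb, hh] with a h1 h2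
    rwa [← h2]
  · rw [e]

end WeylSystem

end MainEquation

/-! ### The solutions of a pencil at a fixed point -/

namespace QuadraticPencil

variable {m : ℕ} {L : QuadraticPencil m}

/-- The values of the solutions of the pencil at the point `x`. The solutions of the adjoint
equation are the transposes of those of the transposed pencil. -/
def system (L : QuadraticPencil m) (x : ℝ) : WeylSystem (Matrix (Fin m) (Fin m) ℂ) where
  φ := L.phi x
  φ' := L.phiDeriv x
  S := L.sine x
  S' := L.sineDeriv x
  φs ρ := (L.transpose.phi x ρ).transpose
  φs' ρ := (L.transpose.phiDeriv x ρ).transpose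
  Ss ρ := (L.transpose.sine x ρ).transpose
  Ss' ρ := (L.transpose.sineDeriv x ρ).transpose
  M := L.weylMatrix
  G := L.weylLimit x
  Gm := L.reflect.weylLimit x

lemma system_Φ (L : QuadraticPencil m) (x : ℝ) (ρ : ℂ) : (L.system x).Φ ρ = L.weylPhi x ρ := rfl

lemma system_Φ' (L : QuadraticPencil m) (x : ℝ) (ρ : ℂ) : (L.system x).Φ' ρ = L.weylPhiDeriv x ρ :=
  rfl

lemma tendsto_I_mul_upperInfinity :
    Tendsto (fun τ : ℝ => Complex.I * τ) atTop upperInfinity := by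
  rw [upperInfinity, tendsto_inf, tendsto_comap_iff, tendsto_principal]
  constructor
  · refine tendsto_abs_atTop_atTop.congr fun τ => ?_
    simp
  · filter_upwards [eventually_gt_atTop 0] with τ hτ
    simpa using hτ

namespace Admissible

variable (hL : L.Admissible)

include hL

lemma system_Φs (x : ℝ) (ρ : ℂ) : (L.system x).Φs ρ = (L.transpose.weylPhi x ρ).transpose := by
  rw [weylPhi, Matrix.transpose_add, Matrix.transpose_mul, hL.weylMatrix_transpose,
    Matrix.transpose_transpose]
  rfl

lemma system_Φs' (x : ℝ) (ρ : ℂ) :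
    (L.system x).Φs' ρ = (L.transpose.weylPhiDeriv x ρ).transpose := by
  rw [weylPhiDeriv, Matrix.transpose_add, Matrix.transpose_mul, hL.weylMatrix_transpose,
    Matrix.transpose_transpose]
  rfl

/-- The asymptotics of the Weyl solution along the imaginary half-axis. -/
lemma tendsto_weylPhi_I_mul {x : ℝ} (hx : 0 ≤ x) :
    Tendsto (fun τ : ℝ => ((τ * Real.exp (τ * x) : ℝ) : ℂ) • L.weylPhi x (Complex.I * τ)) atTop
      (𝓝 (-L.weylLimit x)) ∧
    Tendsto (fun τ : ℝ => ((Real.exp (τ * x) : ℝ) : ℂ) • L.weylPhiDeriv x (Complex.I * τ)) atTop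
      (𝓝 (L.weylLimit x)) := by
  obtain ⟨h1, h2⟩ := hL.tendsto_weylPhi hx
  have e : ∀ τ : ℝ, -(Complex.I * (Complex.I * τ)) = τ := fun τ => by
    rw [← mul_assoc, Complex.I_mul_I, neg_one_mul, neg_neg]
  have e' : ∀ τ : ℝ, Complex.I * (Complex.I * τ) = -τ := fun τ => neg_eq_iff_eq_neg.1 (e τ)
  constructor
  · refine (h1.comp tendsto_I_mul_upperInfinity).neg.congr fun τ => ?_
    simp only [Function.comp_apply]
    rw [e, e', ← neg_smul]
    push_cast
    rw [neg_mul, neg_neg]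
  · refine (h2.comp tendsto_I_mul_upperInfinity).congr fun τ => ?_
    simp only [Function.comp_apply]
    rw [e]
    push_cast
    rfl

lemma differentiable_transpose {f : ℂ → Matrix (Fin m) (Fin m) ℂ} (hf : Differentiable ℂ f) :
    Differentiable ℂ fun ρ => (f ρ).transpose :=
  (transposeCLM m).differentiable.comp hf

lemma isRegular_system {x : ℝ} (hx : 0 ≤ x) : (L.system x).IsRegular x where
  nonneg := hx
  diff_φ := hL.differentiable_phi hx
  diff_φ' := hL.differentiable_phiDeriv hx
  diff_S := hL.differentiable_sine hx
  diff_S' := hL.differentiable_sineDeriv hx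
  diff_φs := hL.differentiable_transpose (hL.transpose.differentiable_phi hx)
  diff_φs' := hL.differentiable_transpose (hL.transpose.differentiable_phiDeriv hx)
  diff_Ss := hL.differentiable_transpose (hL.transpose.differentiable_sine hx)
  diff_Ss' := hL.differentiable_transpose (hL.transpose.differentiable_sineDeriv hx)
  wronskian_φs_φ ρ := by
    refine ((hL.isSol_phi ρ).wronskian_eq (hL.isSolStar_phiStar ρ) hx).trans ?_
    simp only [hL.phi_zero, hL.phiDeriv_zero, hL.transpose.phi_zero, hL.transpose.phiDeriv_zero,
      Matrix.transpose_one, Matrix.transpose_neg, transpose_bdry, Matrix.transpose_transpose,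
      mul_one, one_mul, sub_self]
  wronskian_φs_S ρ := by
    refine ((hL.isSol_sine ρ).wronskian_eq (hL.isSolStar_phiStar ρ) hx).trans ?_
    simp only [hL.sine_zero, hL.sineDeriv_zero, hL.transpose.phi_zero,
      Matrix.transpose_one, mul_one, mul_zero, zero_sub]
  wronskian_Ss_φ ρ := by
    refine ((hL.isSol_phi ρ).wronskian_eq (hL.isSolStar_sineStar ρ) hx).trans ?_
    simp only [hL.phi_zero, hL.transpose.sine_zero, hL.transpose.sineDeriv_zero,
      Matrix.transpose_one, Matrix.transpose_zero, mul_one, zero_mul, sub_zero]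
  wronskian_Ss_S ρ := by
    refine ((hL.isSol_sine ρ).wronskian_eq (hL.isSolStar_sineStar ρ) hx).trans ?_
    simp only [hL.sine_zero, hL.transpose.sine_zero, Matrix.transpose_zero, mul_zero, zero_mul,
      sub_zero]
  bound_φ := hL.norm_phi_le hx
  bound_φs := by
    obtain ⟨C, hC0, hC⟩ := hL.transpose.norm_phi_le hx
    refine ⟨m * C, by positivity, fun ρ hρ => ⟨?_, ?_⟩⟩
    · refine (norm_transpose_le _).trans ?_
      rw [mul_assoc]
      gcongr
      exact (hC ρ hρ).1
    · refine (norm_transpose_le _).trans ?_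
      rw [mul_assoc, mul_assoc]
      gcongr
      rw [← mul_assoc]
      exact (hC ρ hρ).2
  bound_Φ := hL.exists_norm_weylPhi_le hx
  bound_Φs := by
    obtain ⟨r, C, hr, hC0, hC⟩ := hL.transpose.exists_norm_weylPhi_le hx
    refine ⟨r, m * C, hr, by positivity, fun ρ h1 h2 => ⟨?_, ?_⟩⟩
    · rw [hL.system_Φs]
      refine (norm_transpose_le _).trans ?_
      rw [mul_assoc, mul_div_assoc]
      gcongr
      exact (hC ρ h1 h2).1
    · rw [hL.system_Φs']
      refine (norm_transpose_le _).trans ?_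
      rw [mul_assoc]
      gcongr
      exact (hC ρ h1 h2).2
  tendsto_Φ := (hL.tendsto_weylPhi_I_mul hx).1
  tendsto_Φ' := (hL.tendsto_weylPhi_I_mul hx).2
  tendsto_Φ_down := by
    refine (hL.reflect.tendsto_weylPhi_I_mul hx).1.congr fun τ => ?_
    rw [(hL.reflect_weylPhi hx _).1, system_Φ, neg_mul]
  tendsto_Φ'_down := by
    refine (hL.reflect.tendsto_weylPhi_I_mul hx).2.congr fun τ => ?_
    rw [(hL.reflect_weylPhi hx _).2, system_Φ', neg_mul]

end Admissible

end QuadraticPencil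

/-! ### The circle with two rays as a measure space -/

section CutCircle

lemma measurableEmbedding_inl {α β : Type*} [MeasurableSpace α] [MeasurableSpace β] :
    MeasurableEmbedding (Sum.inl : α → α ⊕ β) :=
  ⟨Sum.inl_injective, measurable_inl, fun _ hs => measurableSet_inl_image.2 hs⟩

lemma measurableEmbedding_inr {α β : Type*} [MeasurableSpace α] [MeasurableSpace β] :
    MeasurableEmbedding (Sum.inr : β → α ⊕ β) :=
  ⟨Sum.inr_injective, measurable_inr, fun _ hs => measurableSet_inr_image.2 hs⟩

/-- The parameters of the circle `|θ| = R`, in the first summand, and of the rays `|t| > R`, in the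
second summand. -/
def cutCircleMeasure (R : ℝ) : Measure (ℝ ⊕ ℝ) :=
  (volume.restrict (Ioc 0 (2 * Real.pi))).map Sum.inl +
    (volume.restrict {t : ℝ | R < |t|}).map Sum.inr

/-- The points of the circle and of the rays. -/
def cutCirclePoint (R : ℝ) : ℝ ⊕ ℝ → ℂ := Sum.elim (circleMap 0 R) (fun t => (t : ℂ))

variable {R : ℝ} {E : Type*} [NormedAddCommGroup E]

lemma ae_cutCircle_iff {q : ℝ ⊕ ℝ → Prop} : (∀ᵐ a ∂cutCircleMeasure R, q a) ↔
    (∀ᵐ y ∂volume.restrict (Ioc 0 (2 * Real.pi)), q (Sum.inl y)) ∧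
      ∀ᵐ t ∂volume.restrict {t : ℝ | R < |t|}, q (Sum.inr t) := by
  rw [cutCircleMeasure, ae_add_measure_iff, measurableEmbedding_inl.ae_map_iff,
    measurableEmbedding_inr.ae_map_iff]

lemma aestronglyMeasurable_cutCircle_iff {f : ℝ ⊕ ℝ → E} :
    AEStronglyMeasurable f (cutCircleMeasure R) ↔
      AEStronglyMeasurable (fun y => f (Sum.inl y)) (volume.restrict (Ioc 0 (2 * Real.pi))) ∧
      AEStronglyMeasurable (fun t => f (Sum.inr t)) (volume.restrict {t : ℝ | R < |t|}) := by
  rw [cutCircleMeasure, aestronglyMeasurable_add_measure_iff,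
    measurableEmbedding_inl.aestronglyMeasurable_map_iff,
    measurableEmbedding_inr.aestronglyMeasurable_map_iff]
  rfl

lemma integrable_cutCircle_iff {f : ℝ ⊕ ℝ → E} : Integrable f (cutCircleMeasure R) ↔
    IntegrableOn (fun y => f (Sum.inl y)) (Ioc 0 (2 * Real.pi)) ∧
      IntegrableOn (fun t => f (Sum.inr t)) {t : ℝ | R < |t|} := by
  rw [cutCircleMeasure, integrable_add_measure, measurableEmbedding_inl.integrable_map_iff,
    measurableEmbedding_inr.integrable_map_iff]
  rfl

lemma integral_cutCircle [NormedSpace ℝ E] {f : ℝ ⊕ ℝ → E}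
    (hf : Integrable f (cutCircleMeasure R)) : ∫ a, f a ∂cutCircleMeasure R =
      (∫ y in (0 : ℝ)..(2 * Real.pi), f (Sum.inl y)) + ∫ t in {t : ℝ | R < |t|}, f (Sum.inr t) := by
  rw [cutCircleMeasure] at hf ⊢
  rw [integral_add_measure hf.left_of_add_measure hf.right_of_add_measure,
    measurableEmbedding_inl.integral_map, measurableEmbedding_inr.integral_map,
    intervalIntegral.integral_of_le Real.two_pi_pos.le]

lemma isCutContour_cutCircle (hR : 0 < R) :
    IsCutContour (cutCircleMeasure R) (cutCirclePoint R) R where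
  pos := hR
  measurable := Measurable.sumElim (continuous_circleMap 0 R).measurable
    Complex.measurable_ofReal
  abs_im_le := by
    rintro (y | t)
    · refine (Complex.abs_im_le_norm _).trans ?_
      simp [cutCirclePoint, abs_of_pos hR]
    · simpa [cutCirclePoint] using hR.le
  abs_im_le_dist := by
    rintro ρ hρ (y | t)
    · have h1 := norm_sub_norm_le ρ (circleMap 0 R y)
      rw [norm_circleMap, abs_of_pos hR, norm_sub_rev] at h1
      have h2 := Complex.abs_im_le_norm ρ
      simp only [cutCirclePoint, Sum.elim_inl]
      linarith
    · have h1 := Complex.abs_im_le_norm ((t : ℂ) - ρ)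
      rw [Complex.sub_im, Complex.ofReal_im, zero_sub, abs_neg] at h1
      simp only [cutCirclePoint, Sum.elim_inr]
      linarith [norm_nonneg ((t : ℂ) - ρ)]
  ae_ne := by
    intro ρ
    rw [ae_cutCircle_iff]
    constructor
    · refine measure_mono_null (fun y hy => hy) (?_ : (volume.restrict (Ioc 0 (2 * Real.pi)))
        {y : ℝ | ¬ circleMap 0 R y ≠ ρ} = 0)
      rw [Measure.restrict_apply' measurableSet_Ioc]
      refine Set.Subsingleton.measure_zero (fun y hy y' hy' => ?_) _
      rw [← uIoc_of_le Real.two_pi_pos.le] at hy hy'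
      exact injOn_circleMap_of_abs_sub_le hR.ne' (by simp [abs_of_pos Real.pi_pos]) hy.2 hy'.2
        ((not_not.1 hy.1).trans (not_not.1 hy'.1).symm)
    · refine ae_restrict_of_ae ?_
      refine (Set.Subsingleton.measure_zero (fun t ht t' ht' => ?_) _ :
        volume {t : ℝ | ¬ (t : ℂ) ≠ ρ} = 0)
      exact Complex.ofReal_injective ((not_not.1 ht).trans (not_not.1 ht').symm)

/-- The density of `M̂(θ) dθ`; `J` is the jump of `M̂` across the rays. -/
def cutCircleDensity {𝔸 : Type*} [NormedRing 𝔸] [NormedAlgebra ℂ 𝔸] (R : ℝ) (Mh : ℂ → 𝔸)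
    (J : ℝ → 𝔸) : ℝ ⊕ ℝ → 𝔸 :=
  Sum.elim (fun y => deriv (circleMap 0 R) y • Mh (circleMap 0 R y)) J

variable {𝔸 : Type*} [NormedRing 𝔸] [NormedAlgebra ℂ 𝔸] [CompleteSpace 𝔸]

lemma CutHolomorphic.isCutDensity {Mp Mm Mh : ℂ → 𝔸} (h : CutHolomorphic R Mp Mm) (hR : 0 < R)
    (hp : ∀ θ, 0 < θ.im → Mh θ = Mp θ) (hm : ∀ θ, θ.im < 0 → Mh θ = Mm θ)
    (hint : IntegrableOn (fun t : ℝ => (1 + |t|) * ‖Mm t - Mp t‖) {t : ℝ | R < |t|}) :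
    IsCutDensity (cutCircleMeasure R) (cutCirclePoint R)
      (cutCircleDensity R Mh fun t => Mm t - Mp t) R Mh := by
  have hγ := isCutContour_cutCircle hR
  have hdc : Continuous (deriv (circleMap 0 R)) := by
    have : deriv (circleMap 0 R) = fun y => circleMap 0 R y * Complex.I :=
      funext fun y => deriv_circleMap 0 R y
    rw [this]
    exact (continuous_circleMap 0 R).mul continuous_const
  have hcirc : IntegrableOn (fun y => deriv (circleMap 0 R) y • Mh (circleMap 0 R y))
      (Ioc 0 (2 * Real.pi)) := by
    have h1 := (h.circleIntegral_eq (F := Mh) hR le_rfl (fun θ h1 _ => hp θ h1)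
      (fun θ h1 _ => hm θ h1)).1
    have h2 := IntervalIntegrable.continuousOn_smul (f := deriv (circleMap 0 R)) h1 hdc.continuousOn
    exact (intervalIntegrable_iff_integrableOn_Ioc_of_le Real.two_pi_pos.le).1 h2
  have hJ : AEStronglyMeasurable (fun t : ℝ => Mm t - Mp t)
      (volume.restrict {t : ℝ | R < |t|}) := by
    refine ContinuousOn.aestronglyMeasurable ?_ (measurableSet_abs_gt R)
    have hn : ∀ t ∈ {t : ℝ | R < |t|}, R ≤ ‖(t : ℂ)‖ := fun t ht => by
      rw [Complex.norm_real]; exact le_of_lt ht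
    exact (h.continuousOn_lower.comp (by fun_prop) fun t ht => ⟨by simp, hn t ht⟩).sub
      (h.continuousOn_upper.comp (by fun_prop) fun t ht => ⟨by simp, hn t ht⟩)
  refine ⟨hγ, aestronglyMeasurable_cutCircle_iff.2 ⟨hcirc.aestronglyMeasurable, hJ⟩,
    integrable_cutCircle_iff.2 ⟨?_, ?_⟩, ?_⟩
  · refine (hcirc.norm.const_mul (1 + R)).congr (Eventually.of_forall fun y => ?_)
    simp [cutCirclePoint, cutCircleDensity, abs_of_pos hR]
  · refine hint.congr (Eventually.of_forall fun t => ?_)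
    simp [cutCirclePoint, cutCircleDensity]
  · intro A B hA hB hAB
    have hcut : CutHolomorphic R (fun θ => A θ * Mp θ * B θ) (fun θ => A θ * Mm θ * B θ) :=
      ⟨(hA.continuous.continuousOn.mul h.continuousOn_upper).mul hB.continuous.continuousOn,
        (hA.continuous.continuousOn.mul h.continuousOn_lower).mul hB.continuous.continuousOn,
        fun θ h1 h2 => ((hA θ).mul (h.differentiableAt_upper θ h1 h2)).mul (hB θ),
        fun θ h1 h2 => ((hA θ).mul (h.differentiableAt_lower θ h1 h2)).mul (hB θ)⟩
    have hjump : ∀ t : ℝ, A t * Mm t * B t - A t * Mp t * B t = A t * (Mm t - Mp t) * B t :=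
      fun t => by noncomm_ring
    obtain ⟨e, hed, he⟩ := hcut.exists_entire_extension (F := fun θ => A θ * Mh θ * B θ) hR
      (fun θ h1 => by rw [hp θ h1]) (fun θ h1 => by rw [hm θ h1])
      (by
        simp only [hjump]
        exact (integrable_cutCircle_iff.1 hAB).2)
    refine ⟨e, hed, fun ρ him hρ => ?_⟩
    rw [he ρ him hρ, cauchyTransform]
    congr 2
    -- on the contour the distance to `ρ` is bounded below
    have hpos : 0 < min (‖ρ‖ - R) |ρ.im| := lt_min (by linarith) (abs_pos.2 him)
    have hint' : Integrable (fun a => (cutCirclePoint R a - ρ)⁻¹ • (A (cutCirclePoint R a) *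
        cutCircleDensity R Mh (fun t => Mm t - Mp t) a * B (cutCirclePoint R a)))
        (cutCircleMeasure R) := by
      refine (hAB.norm.const_mul (min (‖ρ‖ - R) |ρ.im|)⁻¹).mono'
        (hγ.aestronglyMeasurable_kernel hAB.aestronglyMeasurable ρ)
        (Eventually.of_forall fun a => ?_)
      rw [norm_smul, norm_inv]
      have : min (‖ρ‖ - R) |ρ.im| ≤ ‖cutCirclePoint R a - ρ‖ := by
        rcases a with y | t
        · refine (min_le_left _ _).trans ?_
          have h1 := norm_sub_norm_le ρ (circleMap 0 R y)
          rw [norm_circleMap, abs_of_pos hR, norm_sub_rev] at h1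
          exact h1
        · refine (min_le_right _ _).trans ?_
          have h1 := Complex.abs_im_le_norm ((t : ℂ) - ρ)
          rw [Complex.sub_im, Complex.ofReal_im, zero_sub, abs_neg] at h1
          exact h1
      gcongr
    rw [integral_cutCircle hint', cauchyTail, circleIntegral]
    congr 1
    · refine intervalIntegral.integral_congr fun y _ => ?_
      simp only [cutCirclePoint, cutCircleDensity, Sum.elim_inl]
      rw [mul_smul_comm, smul_mul_assoc, smul_comm]
    · refine integral_congr_ae (Eventually.of_forall fun t => ?_)
      simp only [cutCirclePoint, cutCircleDensity, Sum.elim_inr, hjump]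

end CutCircle

/-! ### Boundary values on the cuts -/

section Boundary

variable {E : Type*} [NormedAddCommGroup E] [NormedSpace ℂ E]

/-- The extension of `M` from the upper half-plane to the real axis. -/
def upperExtension (M : ℂ → E) (θ : ℂ) : E :=
  if 0 < θ.im then M θ else extendFrom {ρ | 0 < ρ.im} M θ

/-- The extension of `M` from the lower half-plane to the real axis. -/
def lowerExtension (M : ℂ → E) (θ : ℂ) : E :=
  if θ.im < 0 then M θ else extendFrom {ρ | ρ.im < 0} M θ

lemma mem_closure_im_pos {θ : ℂ} (h : 0 ≤ θ.im) : θ ∈ closure {ρ : ℂ | 0 < ρ.im} := by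
  rw [Complex.closure_setOfPred_lt_im]
  exact h

lemma mem_closure_im_neg {θ : ℂ} (h : θ.im ≤ 0) : θ ∈ closure {ρ : ℂ | ρ.im < 0} := by
  rw [Complex.closure_setOfPred_im_lt]
  exact h

lemma upperExtension_ofReal {M : ℂ → E} {t : ℝ} {l : E}
    (h : Tendsto M (𝓝[{ρ : ℂ | 0 < ρ.im}] t) (𝓝 l)) : upperExtension M t = l := by
  rw [upperExtension, if_neg (by simp)]
  exact extendFrom_eq (mem_closure_im_pos (by simp)) h

lemma lowerExtension_ofReal {M : ℂ → E} {t : ℝ} {l : E}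
    (h : Tendsto M (𝓝[{ρ : ℂ | ρ.im < 0}] t) (𝓝 l)) : lowerExtension M t = l := by
  rw [lowerExtension, if_neg (by simp)]
  exact extendFrom_eq (mem_closure_im_neg (by simp)) h

lemma cutHolomorphic_extension {M : ℂ → E} {R : ℝ}
    (hd : ∀ ρ : ℂ, ρ.im ≠ 0 → R ≤ ‖ρ‖ → DifferentiableAt ℂ M ρ)
    (hp : ∀ t : ℝ, R ≤ |t| → ∃ l, Tendsto M (𝓝[{ρ : ℂ | 0 < ρ.im}] t) (𝓝 l))
    (hm : ∀ t : ℝ, R ≤ |t| → ∃ l, Tendsto M (𝓝[{ρ : ℂ | ρ.im < 0}] t) (𝓝 l)) :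
    CutHolomorphic R (upperExtension M) (lowerExtension M) := by
  have hreal : ∀ θ : ℂ, θ.im = 0 → R ≤ ‖θ‖ → ∃ t : ℝ, R ≤ |t| ∧ θ = t := fun θ h1 h2 => by
    have h3 : θ = (θ.re : ℂ) := Complex.ext rfl (by simpa using h1)
    refine ⟨θ.re, ?_, h3⟩
    rwa [h3, Complex.norm_real] at h2
  refine ⟨?_, ?_, fun θ h1 h2 => ?_, fun θ h1 h2 => ?_⟩
  · have hlim : ∀ θ ∈ {θ : ℂ | 0 ≤ θ.im ∧ R ≤ ‖θ‖}, ∃ l,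
        Tendsto M (𝓝[{ρ : ℂ | 0 < ρ.im}] θ) (𝓝 l) := by
      rintro θ ⟨h1, h2⟩
      rcases h1.eq_or_lt with h | h
      · obtain ⟨t, ht, rfl⟩ := hreal θ h.symm h2
        exact hp t ht
      · exact ⟨M θ, (hd θ h.ne' h2).continuousAt.mono_left nhdsWithin_le_nhds⟩
    refine (continuousOn_extendFrom (fun θ hθ => mem_closure_im_pos hθ.1) hlim).congr
      fun θ hθ => ?_
    rw [upperExtension]
    split_ifs with h
    · exact (extendFrom_eq (mem_closure_im_pos hθ.1)
        ((hd θ h.ne' hθ.2).continuousAt.mono_left nhdsWithin_le_nhds)).symm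
    · rfl
  · have hlim : ∀ θ ∈ {θ : ℂ | θ.im ≤ 0 ∧ R ≤ ‖θ‖}, ∃ l,
        Tendsto M (𝓝[{ρ : ℂ | ρ.im < 0}] θ) (𝓝 l) := by
      rintro θ ⟨h1, h2⟩
      rcases h1.eq_or_lt with h | h
      · obtain ⟨t, ht, rfl⟩ := hreal θ h h2
        exact hm t ht
      · exact ⟨M θ, (hd θ h.ne h2).continuousAt.mono_left nhdsWithin_le_nhds⟩
    refine (continuousOn_extendFrom (fun θ hθ => mem_closure_im_neg hθ.1) hlim).congr
      fun θ hθ => ?_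
    rw [lowerExtension]
    split_ifs with h
    · exact (extendFrom_eq (mem_closure_im_neg hθ.1)
        ((hd θ h.ne hθ.2).continuousAt.mono_left nhdsWithin_le_nhds)).symm
    · rfl
  · refine (hd θ h1.ne' h2.le).congr_of_eventuallyEq ?_
    filter_upwards [(isOpen_lt continuous_const Complex.continuous_im).mem_nhds h1] with w hw
    exact if_pos hw
  · refine (hd θ h1.ne h2.le).congr_of_eventuallyEq ?_
    filter_upwards [(isOpen_lt Complex.continuous_im continuous_const).mem_nhds h1] with w hw
    exact if_pos hw

/-- A weighted square-integrable function, continuous on a closed set, is integrable with a smaller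
weight. -/
lemma integrableOn_of_sq {g : ℝ → E} {R : ℝ} (hc : ContinuousOn g {t : ℝ | R ≤ |t|}) {r : ℝ}
    (h : IntegrableOn (fun t => ‖g t‖ ^ 2 * t ^ 4) {t : ℝ | r < |t|}) :
    IntegrableOn (fun t => (1 + |t|) * ‖g t‖) {t : ℝ | R < |t|} := by
  set N := max (max R r) 1 with hN
  have hcont : ContinuousOn (fun t : ℝ => (1 + |t|) * ‖g t‖) {t : ℝ | R ≤ |t|} :=
    ContinuousOn.mul (by fun_prop) hc.norm
  have hcl : IsClosed {t : ℝ | R ≤ |t|} := isClosed_le continuous_const continuous_abs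
  have h1 : IntegrableOn (fun t => (1 + |t|) * ‖g t‖) (Icc (-N) N ∩ {t : ℝ | R ≤ |t|}) :=
    (hcont.mono inter_subset_right).integrableOn_compact (isCompact_Icc.inter_right hcl)
  have hsub : {t : ℝ | N < |t|} ⊆ {t : ℝ | r < |t|} := fun t (ht : N < |t|) =>
    show r < |t| from ((le_max_right R r).trans (le_max_left _ 1)).trans_lt ht
  have h2 : IntegrableOn (fun t => (1 + |t|) * ‖g t‖) {t : ℝ | N < |t|} := by
    refine (((h.mono_set hsub).const_mul 8).add integrable_inv_one_add_sq.integrableOn).mono'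
      ((hcont.mono fun t ht => ?_).aestronglyMeasurable (measurableSet_abs_gt N)) ?_
    · exact ((le_max_left R r).trans (le_max_left _ _)).trans (le_of_lt ht)
    · filter_upwards [ae_restrict_mem (measurableSet_abs_gt N)] with t ht
      have ht1 : 1 ≤ |t| := (le_max_right _ _).trans (le_of_lt ht)
      rw [Real.norm_of_nonneg (by positivity), Pi.add_apply]
      have h3 : 1 ≤ t ^ 2 := by rw [← sq_abs]; nlinarith
      have h4 : (1 + |t|) ^ 2 ≤ 4 * t ^ 2 := by rw [← sq_abs t]; nlinarith
      have h5 : (0 : ℝ) < 1 + t ^ 2 := by positivity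
      set s := (1 + |t|) * ‖g t‖ with hs
      have h6 : s ≤ s ^ 2 * (1 + t ^ 2) + (1 + t ^ 2)⁻¹ := by
        have h7 : 0 ≤ (s * (1 + t ^ 2) - 1 / 2) ^ 2 * (1 + t ^ 2)⁻¹ := by positivity
        have h8 : (s * (1 + t ^ 2) - 1 / 2) ^ 2 * (1 + t ^ 2)⁻¹ =
            s ^ 2 * (1 + t ^ 2) - s + 1 / 4 * (1 + t ^ 2)⁻¹ := by field_simp; ring
        have h9 : 0 < (1 + t ^ 2)⁻¹ := by positivity
        linarith
      refine h6.trans (add_le_add ?_ le_rfl)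
      calc s ^ 2 * (1 + t ^ 2) = ‖g t‖ ^ 2 * ((1 + |t|) ^ 2 * (1 + t ^ 2)) := by rw [hs]; ring
        _ ≤ ‖g t‖ ^ 2 * ((4 * t ^ 2) * (2 * t ^ 2)) := by
            gcongr
            linarith
        _ = _ := by ring
  refine (h1.union h2).mono_set fun t (ht : R < |t|) => ?_
  by_cases h3 : N < |t|
  · exact Or.inr h3
  · exact Or.inl ⟨abs_le.1 (not_lt.1 h3), ht.le⟩

end Boundary

namespace QuadraticPencil

variable {m : ℕ} {L Lt : QuadraticPencil m} {R : ℝ}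

lemma halfPlane_one : halfPlane 1 = {ρ : ℂ | 0 < ρ.im} := by
  ext ρ; simp [halfPlane]

lemma halfPlane_neg_one : halfPlane (-1) = {ρ : ℂ | ρ.im < 0} := by
  ext ρ; simp [halfPlane]

lemma hasWeylSolution_of_singularSet_subset (h : L.singularSet ⊆ Metric.ball 0 R) {ρ : ℂ}
    (him : ρ.im ≠ 0) (hρ : R ≤ ‖ρ‖) : L.HasWeylSolution ρ := by
  by_contra hn
  have := h (Or.inl ⟨him, hn⟩)
  rw [mem_ball_zero_iff] at this
  exact hρ.not_gt this

lemma tendsto_weylBoundary (h : L.singularSet ⊆ Metric.ball 0 R) (σ : ℤˣ) {t : ℝ} (ht : R ≤ |t|) :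
    Tendsto L.weylMatrix (𝓝[halfPlane σ] (t : ℂ)) (𝓝 (L.weylBoundary σ t)) := by
  refine tendsto_nhds_limUnder ?_
  by_contra hn
  have := h (Or.inr ⟨t, rfl, σ, hn⟩)
  rw [mem_ball_zero_iff, Complex.norm_real] at this
  exact ht.not_gt this

lemma tendsto_weylBoundary_sub (h : Encloses L Lt R) (σ : ℤˣ) {t : ℝ} (ht : R ≤ |t|) :
    Tendsto (fun ρ => L.weylMatrix ρ - Lt.weylMatrix ρ) (𝓝[halfPlane σ] (t : ℂ))
      (𝓝 (L.weylBoundary σ t - Lt.weylBoundary σ t)) :=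
  (tendsto_weylBoundary h.2.1 σ ht).sub (tendsto_weylBoundary h.2.2 σ ht)

lemma upperExtension_eq (h : Encloses L Lt R) {t : ℝ} (ht : R ≤ |t|) :
    upperExtension (fun ρ => L.weylMatrix ρ - Lt.weylMatrix ρ) t =
      L.weylBoundary 1 t - Lt.weylBoundary 1 t :=
  upperExtension_ofReal (by rw [← halfPlane_one]; exact tendsto_weylBoundary_sub h 1 ht)

lemma lowerExtension_eq (h : Encloses L Lt R) {t : ℝ} (ht : R ≤ |t|) :
    lowerExtension (fun ρ => L.weylMatrix ρ - Lt.weylMatrix ρ) t =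
      L.weylBoundary (-1) t - Lt.weylBoundary (-1) t :=
  lowerExtension_ofReal (by rw [← halfPlane_neg_one]; exact tendsto_weylBoundary_sub h (-1) ht)

lemma cutHolomorphic_weylMatrix_sub (hL : L.Admissible) (hLt : Lt.Admissible)
    (h : Encloses L Lt R) :
    CutHolomorphic R (upperExtension fun ρ => L.weylMatrix ρ - Lt.weylMatrix ρ)
      (lowerExtension fun ρ => L.weylMatrix ρ - Lt.weylMatrix ρ) :=
  cutHolomorphic_extension
    (fun ρ h1 h2 => (hL.differentiableAt_weylMatrix
      (hasWeylSolution_of_singularSet_subset h.2.1 h1 h2)).sub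
      (hLt.differentiableAt_weylMatrix (hasWeylSolution_of_singularSet_subset h.2.2 h1 h2)))
    (fun t ht => ⟨_, by rw [← halfPlane_one]; exact tendsto_weylBoundary_sub h 1 ht⟩)
    (fun t ht => ⟨_, by rw [← halfPlane_neg_one]; exact tendsto_weylBoundary_sub h (-1) ht⟩)

lemma continuousOn_weylBoundary_sub (hL : L.Admissible) (hLt : Lt.Admissible)
    (h : Encloses L Lt R) (σ : ℤˣ) :
    ContinuousOn (fun t => L.weylBoundary σ t - Lt.weylBoundary σ t) {t : ℝ | R ≤ |t|} := by
  have hc := cutHolomorphic_weylMatrix_sub hL hLt h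
  have hn : ∀ t ∈ {t : ℝ | R ≤ |t|}, R ≤ ‖(t : ℂ)‖ := fun t ht => by
    rw [Complex.norm_real]; exact ht
  rcases Int.units_eq_one_or σ with rfl | rfl
  · exact (hc.continuousOn_upper.comp Complex.continuous_ofReal.continuousOn fun t ht =>
      ⟨by simp, hn t ht⟩).congr fun t ht => (upperExtension_eq h ht).symm
  · exact (hc.continuousOn_lower.comp Complex.continuous_ofReal.continuousOn fun t ht =>
      ⟨by simp, hn t ht⟩).congr fun t ht => (lowerExtension_eq h ht).symm

/-- The difference of the Weyl matrices is small enough on the cuts for the integrals in the main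
equations to converge. -/
def IntegrableJump (L Lt : QuadraticPencil m) (R : ℝ) : Prop :=
  ∀ σ : ℤˣ, IntegrableOn (fun t : ℝ => (1 + |t|) * ‖L.weylBoundary σ t - Lt.weylBoundary σ t‖)
    {t : ℝ | R < |t|}

lemma integrableJump (hL : L.Admissible) (hLt : Lt.Admissible) (h : Encloses L Lt R)
    (hc : CloseWeylMatrices L Lt) : IntegrableJump L Lt R := fun σ => by
  obtain ⟨r, -, hr⟩ := hc
  exact integrableOn_of_sq (continuousOn_weylBoundary_sub hL hLt h σ) (hr σ)

end QuadraticPencil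

/-! ### Solvability of the main equation at a point -/

section

variable {E : Type*} [NormedAddCommGroup E] [NormedSpace ℝ E] [CompleteSpace E] {R : ℝ}

lemma clm_integral_cutCircle (T : E →L[ℝ] ℂ) {f : ℝ ⊕ ℝ → E}
    (hf : Integrable f (cutCircleMeasure R)) : T (∫ a, f a ∂cutCircleMeasure R) =
      (∫ y in (0 : ℝ)..(2 * Real.pi), T (f (Sum.inl y))) +
        ∫ t in {t : ℝ | R < |t|}, T (f (Sum.inr t)) := by
  rw [← T.integral_comp_comm hf, integral_cutCircle (T.integrable_comp hf)]

lemma aestronglyMeasurable_comp_cutCirclePoint (hR : 0 < R) {z : ℂ → E}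
    (hz : ContinuousOn z (QuadraticPencil.contour R)) :
    AEStronglyMeasurable (fun a => z (cutCirclePoint R a)) (cutCircleMeasure R) := by
  rw [aestronglyMeasurable_cutCircle_iff]
  constructor
  · refine Continuous.aestronglyMeasurable ?_
    exact hz.comp_continuous (continuous_circleMap 0 R) fun y =>
      Or.inl (circleMap_mem_sphere 0 hR.le y)
  · refine ContinuousOn.aestronglyMeasurable (hz.comp Complex.continuous_ofReal.continuousOn
      fun t (ht : R < |t|) => Or.inr ⟨Complex.ofReal_im t, ?_⟩)
      (measurableSet_abs_gt R)
    change R ≤ |((t : ℂ)).re|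
    rw [Complex.ofReal_re]
    exact ht.le

lemma ae_mem_contour (hR : 0 < R) :
    ∀ᵐ a ∂cutCircleMeasure R, cutCirclePoint R a ∈ QuadraticPencil.contour R := by
  rw [ae_cutCircle_iff]
  refine ⟨Eventually.of_forall fun y => Or.inl (circleMap_mem_sphere 0 hR.le y), ?_⟩
  filter_upwards [ae_restrict_mem (measurableSet_abs_gt R)] with t ht
  refine Or.inr ⟨by simp [cutCirclePoint], ?_⟩
  simpa [cutCirclePoint] using le_of_lt ht

lemma abs_im_le_of_mem_contour (hR : 0 < R) {θ : ℂ} (h : θ ∈ QuadraticPencil.contour R) :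
    |θ.im| ≤ R := by
  rcases h with h | h
  · rw [mem_sphere_zero_iff_norm] at h
    exact h ▸ Complex.abs_im_le_norm θ
  · rw [h.1, abs_zero]
    exact hR.le

end

namespace WeylSystem

variable {𝔸 : Type*} [NormedRing 𝔸] [NormedAlgebra ℂ 𝔸] [CompleteSpace 𝔸]
variable {α : Type*} [MeasurableSpace α] {μ : Measure α} {p : α → ℂ} {k : α → 𝔸} {R : ℝ}
variable {w : WeylSystem 𝔸} {x : ℝ} {Mh : ℂ → 𝔸}

lemma IsRegular.mainOp_const_mul (hw : w.IsRegular x) (hk : IsCutDensity μ p k R Mh) {h : α → 𝔸}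
    {K : ℝ} (hm : AEStronglyMeasurable h μ) (hb : ∀ᵐ a ∂μ, ‖h a‖ ≤ K) (c : 𝔸) (ρ : ℂ) :
    w.mainOp μ p k (fun a => c * h a) ρ = c * w.mainOp μ p k h ρ := by
  rw [mainOp, mainOp, mul_smul_comm,
    ← integral_const_mul_of_integrable (hw.integrable_mul_kernel hk hm hb ρ)]
  simp only [mul_assoc]

lemma IsRegular.mainOp_sub (hw : w.IsRegular x) (hk : IsCutDensity μ p k R Mh) {h h' : α → 𝔸}
    {K K' : ℝ} (hm : AEStronglyMeasurable h μ) (hb : ∀ᵐ a ∂μ, ‖h a‖ ≤ K)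
    (hm' : AEStronglyMeasurable h' μ) (hb' : ∀ᵐ a ∂μ, ‖h' a‖ ≤ K') (ρ : ℂ) :
    w.mainOp μ p k (fun a => h a - h' a) ρ = w.mainOp μ p k h ρ - w.mainOp μ p k h' ρ := by
  rw [mainOp, mainOp, mainOp, ← smul_sub, ← integral_sub (hw.integrable_mul_kernel hk hm hb ρ)
    (hw.integrable_mul_kernel hk hm' hb' ρ)]
  simp only [sub_mul]

end WeylSystem

namespace WeylSystem

variable {𝔸 : Type*} [NormedRing 𝔸] [NormedAlgebra ℂ 𝔸] [CompleteSpace 𝔸] {R : ℝ}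
variable {w wt : WeylSystem 𝔸} {x : ℝ} {k : ℝ ⊕ ℝ → 𝔸}

/-- `z` is a bounded continuous solution of the main equation for the model `w`. -/
def IsMainSolution (w : WeylSystem 𝔸) (R : ℝ) (k : ℝ ⊕ ℝ → 𝔸) (z : ℂ → 𝔸) : Prop :=
  (ContinuousOn z (QuadraticPencil.contour R) ∧ ∃ C, ∀ ρ ∈ QuadraticPencil.contour R, ‖z ρ‖ ≤ C) ∧
    ∀ ρ ∈ QuadraticPencil.contour R, w.φ ρ = z ρ +
      w.mainOp (cutCircleMeasure R) (cutCirclePoint R) k (fun a => z (cutCirclePoint R a)) ρ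

/-- The main equation is uniquely solvable if the limits of the renormalised Weyl solutions of the
pencil and of its model are close: then the matrix `q` of `WeylSystem.IsRegular.exists_factor` is
close to the identity, hence invertible, and `q⁻¹ φ` is the solution. -/
theorem IsRegular.uniquelySolvable (hw : w.IsRegular x) (hwt : wt.IsRegular x)
    (hk : IsCutDensity (cutCircleMeasure R) (cutCirclePoint R) k R fun ρ => w.M ρ - wt.M ρ)
    {gi gmi : 𝔸} (hg : wt.G * gi = 1) (hgm : wt.Gm * gmi = 1) (hq : ‖w.G * gi - 1‖ < 1)
    (hqm : ‖w.Gm * gmi - 1‖ < 1) :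
    (∃ z, wt.IsMainSolution R k z) ∧ ∀ z z', wt.IsMainSolution R k z → wt.IsMainSolution R k z' →
      EqOn z z' (QuadraticPencil.contour R) := by
  obtain ⟨q, hq2, hqφ, hqΦ⟩ := hw.exists_factor hwt hk gi gmi hg hgm
  have hR := hk.contour.pos
  have hunit : IsUnit q := by
    have h1 : q = 1 - (1 - q) := by abel
    rw [h1]
    refine isUnit_one_sub_of_norm_lt_one ?_
    have h2 : (2 : ℂ) • (q - 1) = (w.G * gi - 1) + (w.Gm * gmi - 1) := by
      rw [smul_sub, hq2, two_smul]
      abel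
    have h3 : 2 * ‖q - 1‖ < 2 := by
      calc 2 * ‖q - 1‖ = ‖(2 : ℂ) • (q - 1)‖ := by rw [norm_smul, Complex.norm_ofNat]
        _ ≤ ‖w.G * gi - 1‖ + ‖w.Gm * gmi - 1‖ := by rw [h2]; exact norm_add_le _ _
        _ < 2 := by linarith
    rw [norm_sub_rev]
    linarith
  constructor
  · obtain ⟨u, rfl⟩ := hunit
    obtain ⟨K, -, hK⟩ := IsRegular.exists_strip_bound hw.diff_φ.continuous hw.diff_φ'.continuous
      hw.nonneg hw.bound_φ R
    refine ⟨fun ρ => ↑u⁻¹ * w.φ ρ, ⟨(continuous_const.mul hw.diff_φ.continuous).continuousOn,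
      ‖(↑u⁻¹ : 𝔸)‖ * K, fun ρ hρ => (norm_mul_le _ _).trans ?_⟩, fun ρ _ => ?_⟩
    · gcongr
      exact (hK ρ (abs_im_le_of_mem_contour hR hρ)).1
    · rw [hwt.mainOp_const_mul hk (hw.diff_φ.continuous.comp_aestronglyMeasurable
          hk.contour.measurable.aestronglyMeasurable)
          (Eventually.of_forall fun a => (hK _ (hk.contour.abs_im_le a)).1), ← mul_add, hqφ,
        ← mul_assoc, u.inv_mul, one_mul]
  · rintro z z' ⟨⟨hz, C, hC⟩, hzs⟩ ⟨⟨hz', C', hC'⟩, hzs'⟩ ρ hρ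
    have hm := aestronglyMeasurable_comp_cutCirclePoint hR hz
    have hm' := aestronglyMeasurable_comp_cutCirclePoint hR hz'
    have hb : ∀ᵐ a ∂cutCircleMeasure R, ‖z (cutCirclePoint R a)‖ ≤ C := by
      filter_upwards [ae_mem_contour hR] with a ha using hC _ ha
    have hb' : ∀ᵐ a ∂cutCircleMeasure R, ‖z' (cutCirclePoint R a)‖ ≤ C' := by
      filter_upwards [ae_mem_contour hR] with a ha using hC' _ ha
    have hsub := hwt.mainOp_sub hk hm hb hm' hb'
    have hdiff : ∀ θ ∈ QuadraticPencil.contour R, z θ - z' θ =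
        -wt.mainOp (cutCircleMeasure R) (cutCirclePoint R) k
          (fun a => z (cutCirclePoint R a) - z' (cutCirclePoint R a)) θ := fun θ hθ => by
      have h1 := (hzs θ hθ).symm.trans (hzs' θ hθ)
      rw [hsub, neg_sub, sub_eq_sub_iff_add_eq_add, h1, add_comm]
    have h0 := hw.mainOp_eq_zero hwt hk hg hunit hqΦ (hm.sub hm') (K := C + C')
      (by filter_upwards [hb, hb'] with a h1 h2 using (norm_sub_le _ _).trans (add_le_add h1 h2))
      (by filter_upwards [ae_mem_contour hR] with a ha using hdiff _ ha) ρ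
    refine sub_eq_zero.1 ((hdiff ρ hρ).trans ?_)
    rw [neg_eq_zero]
    exact h0

end WeylSystem

namespace QuadraticPencil

variable {m : ℕ} {L Lt : QuadraticPencil m} {R : ℝ}

/-- The density of `(M(θ) - M̃(θ)) dθ` on the contour. -/
def jumpDensity (L Lt : QuadraticPencil m) (R : ℝ) : ℝ ⊕ ℝ → Matrix (Fin m) (Fin m) ℂ :=
  cutCircleDensity R (fun ρ => L.weylMatrix ρ - Lt.weylMatrix ρ) fun t =>
    lowerExtension (fun ρ => L.weylMatrix ρ - Lt.weylMatrix ρ) t -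
      upperExtension (fun ρ => L.weylMatrix ρ - Lt.weylMatrix ρ) t

lemma isCutDensity_jumpDensity (hL : L.Admissible) (hLt : Lt.Admissible) (h : Encloses L Lt R)
    (hj : IntegrableJump L Lt R) : IsCutDensity (cutCircleMeasure R) (cutCirclePoint R)
      (jumpDensity L Lt R) R fun ρ => L.weylMatrix ρ - Lt.weylMatrix ρ := by
  have hc := cutHolomorphic_weylMatrix_sub hL hLt h
  refine hc.isCutDensity h.1 (fun θ hθ => (if_pos hθ).symm) (fun θ hθ => (if_pos hθ).symm) ?_
  have hn : ∀ t ∈ {t : ℝ | R < |t|}, R ≤ ‖(t : ℂ)‖ := fun t ht => by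
    rw [Complex.norm_real]; exact le_of_lt ht
  have hcont := (hc.continuousOn_lower.comp Complex.continuous_ofReal.continuousOn fun t ht =>
    ⟨by simp, hn t ht⟩).sub (hc.continuousOn_upper.comp Complex.continuous_ofReal.continuousOn
      fun t ht => ⟨by simp, hn t ht⟩)
  refine ((hj (-1)).add (hj 1)).mono' (ContinuousOn.aestronglyMeasurable
    (ContinuousOn.mul (by fun_prop) hcont.norm) (measurableSet_abs_gt R)) ?_
  filter_upwards [ae_restrict_mem (measurableSet_abs_gt R)] with t ht
  rw [Real.norm_of_nonneg (by positivity), Pi.add_apply, ← mul_add,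
    lowerExtension_eq h (le_of_lt ht), upperExtension_eq h (le_of_lt ht)]
  gcongr
  exact norm_sub_le _ _

/-- The kernels agree off the diagonal, which is a null set of the contour integral. -/
lemma kernel_eq_D {x : ℝ} (hx : 0 ≤ x) (hLt : Lt.Admissible) {ρ θ : ℂ} (hne : θ ≠ ρ) :
    (Lt.system x).kernel ρ θ = Lt.D x ρ θ := by
  rw [D, if_neg hne.symm, WeylSystem.kernel, bracket]
  have h := hLt.phiStar_eq hx θ
  rw [phiStar, phiStarDeriv] at h
  rw [h.1, h.2]
  rfl

/-- The contour integral of the main equation as an integral of a matrix function. -/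
lemma contourIntegral_eq {x : ℝ} (hx : 0 ≤ x) (hL : L.Admissible) (hLt : Lt.Admissible)
    (h : Encloses L Lt R) (hj : IntegrableJump L Lt R) {z : ℂ → Matrix (Fin m) (Fin m) ℂ}
    (hz : BoundedContinuousOn R z) (ρ : ℂ) :
    (2 * (Real.pi : ℂ) * Complex.I)⁻¹ • contourIntegral L Lt R z (fun θ => Lt.D x ρ θ) =
      (Lt.system x).mainOp (cutCircleMeasure R) (cutCirclePoint R) (jumpDensity L Lt R)
        (fun a => z (cutCirclePoint R a)) ρ := by
  obtain ⟨hzc, C, hC⟩ := hz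
  have hk := isCutDensity_jumpDensity hL hLt h hj
  have hint := (hLt.isRegular_system hx).integrable_mul_kernel hk
    (aestronglyMeasurable_comp_cutCirclePoint h.1 hzc)
    (by filter_upwards [ae_mem_contour h.1] with a ha using hC _ ha) ρ
  have hae := ae_cutCircle_iff.1 (hk.contour.ae_ne ρ)
  rw [WeylSystem.mainOp]
  congr 1
  ext j k
  have key := clm_integral_cutCircle (entryCLM j k) hint
  refine Eq.trans ?_ key.symm
  rw [contourIntegral, Matrix.of_apply, circleIntegral]
  congr 1
  · refine intervalIntegral.integral_congr_ae ?_
    rw [uIoc_of_le Real.two_pi_pos.le]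
    filter_upwards [(ae_restrict_iff' measurableSet_Ioc).1 hae.1] with y hy hy'
    have hne := hy hy'
    change _ = (z (cutCirclePoint R (Sum.inl y)) * jumpDensity L Lt R (Sum.inl y) *
      (Lt.system x).kernel ρ (cutCirclePoint R (Sum.inl y))) j k
    rw [kernel_eq_D hx hLt hne]
    simp only [jumpDensity, cutCircleDensity, cutCirclePoint, Sum.elim_inl, mul_smul_comm,
      smul_mul_assoc, Matrix.smul_apply]
  · refine integral_congr_ae ?_
    filter_upwards [hae.2, ae_restrict_mem (measurableSet_abs_gt R)] with t ht ht'
    change _ = (z (cutCirclePoint R (Sum.inr t)) * jumpDensity L Lt R (Sum.inr t) *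
      (Lt.system x).kernel ρ (cutCirclePoint R (Sum.inr t))) j k
    rw [kernel_eq_D hx hLt ht]
    simp only [jumpDensity, cutCircleDensity, cutCirclePoint, Sum.elim_inr,
      lowerExtension_eq h (le_of_lt ht'), upperExtension_eq h (le_of_lt ht')]

lemma solvesMain_iff {x : ℝ} (hx : 0 ≤ x) (hL : L.Admissible) (hLt : Lt.Admissible)
    (h : Encloses L Lt R) (hj : IntegrableJump L Lt R) {z : ℂ → Matrix (Fin m) (Fin m) ℂ} :
    SolvesMain L Lt R x z ↔ (Lt.system x).IsMainSolution R (jumpDensity L Lt R) z := by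
  refine and_congr_right fun hz => forall₂_congr fun ρ _ => ?_
  rw [contourIntegral_eq hx hL hLt h hj hz]
  rfl

/-- The leading coefficients of the two boundary conditions agree, since otherwise the difference of
the Weyl matrices would be of exact order `1 / t` on the cuts. -/
lemma h₁_eq (hL : L.Admissible) (hLt : Lt.Admissible) (h : Encloses L Lt R)
    (hj : IntegrableJump L Lt R) : L.h₁ = Lt.h₁ := by
  have hlim := (hL.tendsto_weylMatrix.sub hLt.tendsto_weylMatrix)
  set Δ := Ring.inverse (1 + L.h₁) - Ring.inverse (1 + Lt.h₁) with hΔ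
  have hzero : Δ = 0 := by
    by_contra hne
    have hpos : 0 < ‖Δ‖ := norm_pos_iff.2 hne
    obtain ⟨N, hN⟩ := eventually_upperInfinity.1
      (hlim.norm.eventually (lt_mem_nhds (half_lt_self hpos)))
    have hlow : ∀ t ∈ Ioi (max N R), ‖Δ‖ / 2 ≤
        (1 + |t|) * ‖L.weylBoundary 1 t - Lt.weylBoundary 1 t‖ := fun t ht => by
      have ht1 : N < |t| := (le_max_left _ _).trans_lt (lt_of_lt_of_le ht (le_abs_self t))
      have ht2 : R < |t| := (le_max_right _ _).trans_lt (lt_of_lt_of_le ht (le_abs_self t))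
      have h1 := tendsto_weylBoundary_sub h 1 ht2.le
      have h2 : Tendsto (fun ρ : ℂ => ‖ρ‖) (𝓝[halfPlane 1] (t : ℂ)) (𝓝 ‖(t : ℂ)‖) :=
        (continuous_norm.tendsto _).mono_left nhdsWithin_le_nhds
      rw [Complex.norm_real, Real.norm_eq_abs] at h2
      have hb : (𝓝[halfPlane 1] (t : ℂ)).NeBot := by
        rw [halfPlane_one]
        exact mem_closure_iff_nhdsWithin_neBot.1 (mem_closure_im_pos (by simp))
      have h3 : ‖Δ‖ / 2 ≤ |t| * ‖L.weylBoundary 1 t - Lt.weylBoundary 1 t‖ := by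
        refine ge_of_tendsto (h2.mul h1.norm) ?_
        filter_upwards [h2.eventually (lt_mem_nhds ht1), self_mem_nhdsWithin] with ρ h3 h4
        rw [halfPlane_one] at h4
        have h5 := (hN ρ h4 h3.le).le
        rw [← smul_sub, norm_smul, norm_mul, Complex.norm_I, one_mul] at h5
        exact h5
      refine h3.trans ?_
      gcongr
      linarith
    have hi : IntegrableOn (fun _ : ℝ => ‖Δ‖ / 2) (Ioi (max N R)) := by
      refine ((hj 1).mono_set fun t ht => ?_).mono' aestronglyMeasurable_const ?_
      · exact (le_max_right _ _).trans_lt (lt_of_lt_of_le ht (le_abs_self t))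
      · filter_upwards [ae_restrict_mem measurableSet_Ioi] with t ht
        rw [Real.norm_of_nonneg (by positivity)]
        exact hlow t ht
    rw [integrableOn_const_iff] at hi
    rcases hi with h0 | h0
    · exact (half_pos hpos).ne' (enorm_eq_zero.1 h0)
    · rw [Real.volume_Ioi] at h0
      exact absurd h0 (lt_irrefl _)
  have h1 := sub_eq_zero.1 hzero
  have h2 : (1 + L.h₁) = (1 + Lt.h₁) :=
    calc 1 + L.h₁ = (1 + L.h₁) * (Ring.inverse (1 + Lt.h₁) * (1 + Lt.h₁)) := by
          rw [Ring.inverse_mul_cancel _ hLt.isUnit_one_add, mul_one]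
      _ = 1 + Lt.h₁ := by
          rw [← h1, ← mul_assoc, Ring.mul_inverse_cancel _ hL.isUnit_one_add, one_mul]
  exact add_left_cancel h2

end QuadraticPencil

/-! ### Solvability for close models -/

section

variable {𝔸 : Type*} [NormedRing 𝔸] [NormedAlgebra ℝ 𝔸] [CompleteSpace 𝔸]

lemma intervalIntegrable_norm_add {A B : ℝ → 𝔸} {a b : ℝ} (hA : IntervalIntegrable A volume a b)
    (hB : IntervalIntegrable B volume a b) :
    IntervalIntegrable (fun t => ‖A t‖ + ‖B t‖) volume a b := hA.norm.add hB.norm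

lemma intervalIntegrable_norm_sub {A B : ℝ → 𝔸} {a b : ℝ} (hA : IntervalIntegrable A volume a b)
    (hB : IntervalIntegrable B volume a b) :
    IntervalIntegrable (fun t => ‖A t - B t‖) volume a b := (hA.sub hB).norm

/-- If `A` and `B` are close in the mean, the solution of `F' = -A F + F B`, `F(0) = 1`, is close
to `1`. -/
lemma IsPrimitive.norm_sub_one_le {F A B : ℝ → 𝔸}
    (hF : IsPrimitive F (fun x => -(A x * F x) + F x * B x)) (h0 : F 0 = 1)
    (hA : ∀ x, 0 ≤ x → IntervalIntegrable A volume 0 x)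
    (hB : ∀ x, 0 ≤ x → IntervalIntegrable B volume 0 x) {x : ℝ} (hx : 0 ≤ x) :
    ‖F x - 1‖ ≤ (∫ t in (0 : ℝ)..x, ‖B t - A t‖) *
      Real.exp (∫ t in (0 : ℝ)..x, (‖A t‖ + ‖B t‖)) := by
  have hg : ∀ y, 0 ≤ y → IntervalIntegrable (fun t => ‖A t‖ + ‖B t‖) volume 0 y :=
    fun y hy => intervalIntegrable_norm_add (hA y hy) (hB y hy)
  have hd : ∀ y, 0 ≤ y → IntervalIntegrable (fun t => ‖B t - A t‖) volume 0 y :=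
    fun y hy => intervalIntegrable_norm_sub (hB y hy) (hA y hy)
  have hmaj := volterraMajorant_forward (X := x) (g := fun t => ‖A t‖ + ‖B t‖)
    (fun t => by positivity) hg
  have hE := hF.sub (IsPrimitive.const 1)
  obtain ⟨K, -, hK⟩ := hE.exists_bound x
  refine hmaj.gronwall (y := fun t => ‖F t - 1‖) (M := K)
    (intervalIntegral.integral_nonneg hx fun t _ => norm_nonneg _) (fun _ _ => norm_nonneg _)
    (fun t ht => hK t ht) (fun y hy => ?_) ⟨hx, le_rfl⟩
  have hgy : IntervalIntegrable (fun t => (‖A t‖ + ‖B t‖) * ‖F t - 1‖) volume 0 y := by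
    refine (hg y hy.1).mul_continuousOn ?_
    rw [uIcc_of_le hy.1]
    exact (hE.continuousOn.mono Icc_subset_Ici_self).norm
  rw [← intervalIntegral.integral_of_le hy.1]
  calc ‖F y - 1‖ = ‖∫ t in (0 : ℝ)..y, (-(A t * F t) + F t * B t)‖ := by
        rw [hF.eq_add y hy.1, h0, add_sub_cancel_left]
    _ ≤ ∫ t in (0 : ℝ)..y, (‖B t - A t‖ + (‖A t‖ + ‖B t‖) * ‖F t - 1‖) := by
        refine intervalIntegral.norm_integral_le_of_norm_le hy.1
          (Eventually.of_forall fun t _ => ?_) ((hd y hy.1).add hgy)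
        have : -(A t * F t) + F t * B t = (B t - A t) + (-(A t * (F t - 1)) + (F t - 1) * B t) := by
          noncomm_ring
        rw [this]
        refine (norm_add_le _ _).trans ?_
        gcongr
        refine (norm_add_le _ _).trans ?_
        rw [norm_neg, add_mul]
        gcongr
        · exact norm_mul_le _ _
        · rw [mul_comm ‖B t‖]
          exact norm_mul_le _ _
    _ = (∫ t in (0 : ℝ)..y, ‖B t - A t‖) + ∫ t in (0 : ℝ)..y, (‖A t‖ + ‖B t‖) * ‖F t - 1‖ :=
        intervalIntegral.integral_add (hd y hy.1) hgy
    _ ≤ _ := by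
        gcongr
        exact intervalIntegral.integral_mono_interval le_rfl hy.1 hy.2
          (Eventually.of_forall fun t => norm_nonneg _) (hd x hx)

end

namespace QuadraticPencil

variable {m : ℕ} {L Lt : QuadraticPencil m} {R x : ℝ}

lemma Admissible.propagator_mul (hL : L.Admissible) (hx : 0 ≤ x) :
    L.propagator x * L.propagatorInv x = 1 :=
  mul_eq_one_comm.1 (hL.propagatorInv_mul hx)

/-- A measure of the distance between the coefficients `Q₁` of two pencils on `[0, x]`. -/
def coeffDistance (L Lt : QuadraticPencil m) (x : ℝ) : ℝ :=
  (∫ t in (0 : ℝ)..x, ‖Lt.Q₁ t - L.Q₁ t‖) *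
    Real.exp (∫ t in (0 : ℝ)..x, (‖L.Q₁ t‖ + ‖Lt.Q₁ t‖))

lemma coeffDistance_reflect (L Lt : QuadraticPencil m) (x : ℝ) :
    coeffDistance L.reflect Lt.reflect x = coeffDistance L Lt x := by
  simp only [coeffDistance, reflect, norm_neg, neg_sub_neg]
  simp only [norm_sub_rev]

lemma norm_propagator_mul_sub_one_le (hL : L.Admissible) (hLt : Lt.Admissible) (hx : 0 ≤ x) :
    ‖L.propagator x * Lt.propagatorInv x - 1‖ ≤ coeffDistance L Lt x := by
  have h1 := (hL.isPrimitive_propagator.mul hLt.isPrimitive_propagatorInv).congr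
    (g₁ := fun t => -(L.Q₁ t * (L.propagator t * Lt.propagatorInv t)) +
      L.propagator t * Lt.propagatorInv t * Lt.Q₁ t) (fun _ _ => rfl) fun t _ => by noncomm_ring
  exact h1.norm_sub_one_le (by rw [hL.propagator_zero, hLt.propagatorInv_zero, one_mul])
    hL.coeffs.intervalIntegrable_one hLt.coeffs.intervalIntegrable_one hx

lemma weylLimit_mul (hLt : Lt.Admissible) (hx : 0 ≤ x) :
    Lt.weylLimit x * ((1 + Lt.h₁) * Lt.propagatorInv x) = 1 := by
  rw [weylLimit, ← mul_assoc, mul_assoc _ _ (1 + Lt.h₁),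
    Ring.inverse_mul_cancel _ hLt.isUnit_one_add, mul_one, hLt.propagator_mul hx]

lemma norm_weylLimit_mul_sub_one_le (hL : L.Admissible) (hLt : Lt.Admissible) (hx : 0 ≤ x)
    (h₁ : L.h₁ = Lt.h₁) :
    ‖L.weylLimit x * ((1 + Lt.h₁) * Lt.propagatorInv x) - 1‖ ≤ coeffDistance L Lt x := by
  rw [weylLimit, h₁, ← mul_assoc, mul_assoc _ _ (1 + Lt.h₁),
    Ring.inverse_mul_cancel _ hLt.isUnit_one_add, mul_one]
  exact norm_propagator_mul_sub_one_le hL hLt hx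

/-- The main equation has exactly one solution if the coefficients `Q₁` of the pencil and of its
model are close on `[0, x]`. -/
theorem solvesMain_existsUnique (hL : L.Admissible) (hLt : Lt.Admissible) (h : Encloses L Lt R)
    (hj : IntegrableJump L Lt R) (hx : 0 ≤ x) (hd : coeffDistance L Lt x < 1) :
    (∃ z, SolvesMain L Lt R x z) ∧
      ∀ z w, SolvesMain L Lt R x z → SolvesMain L Lt R x w → EqOn z w (contour R) := by
  have h₁ := h₁_eq hL hLt h hj
  simp only [solvesMain_iff hx hL hLt h hj]
  refine (hL.isRegular_system hx).uniquelySolvable (hLt.isRegular_system hx)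
    (isCutDensity_jumpDensity hL hLt h hj) (weylLimit_mul hLt hx) (weylLimit_mul hLt.reflect hx)
    ((norm_weylLimit_mul_sub_one_le hL hLt hx h₁).trans_lt hd)
    ((norm_weylLimit_mul_sub_one_le hL.reflect hLt.reflect hx ?_).trans_lt ?_)
  · simp [reflect, h₁]
  · rwa [coeffDistance_reflect]

end QuadraticPencil

/-! ### The adjoint main equation -/

namespace QuadraticPencil

variable {m : ℕ} {L Lt : QuadraticPencil m} {R x : ℝ}

lemma tendsto_transpose {α : Type*} {l : Filter α} {f : α → Matrix (Fin m) (Fin m) ℂ}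
    {A : Matrix (Fin m) (Fin m) ℂ} (h : Tendsto f l (𝓝 A)) :
    Tendsto (fun a => (f a).transpose) l (𝓝 A.transpose) :=
  ((transposeCLM m).continuous.tendsto A).comp h

namespace Admissible

variable (hL : L.Admissible)

include hL

lemma tendsto_weylMatrix_transpose {l : Filter ℂ} {A : Matrix (Fin m) (Fin m) ℂ}
    (h : Tendsto L.weylMatrix l (𝓝 A)) : Tendsto L.transpose.weylMatrix l (𝓝 A.transpose) :=
  (tendsto_transpose h).congr fun ρ => (hL.weylMatrix_transpose ρ).symm

lemma singularSet_transpose_subset : L.transpose.singularSet ⊆ L.singularSet := by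
  rintro ρ (⟨h1, h2⟩ | ⟨t, rfl, σ, h⟩)
  · exact Or.inl ⟨h1, (hL.hasWeylSolution_transpose_iff ρ).not.1 h2⟩
  · exact Or.inr ⟨t, rfl, σ, fun ⟨l, hl⟩ => h ⟨_, hL.tendsto_weylMatrix_transpose hl⟩⟩

lemma weylBoundary_transpose (h : L.singularSet ⊆ Metric.ball 0 R) (σ : ℤˣ) {t : ℝ}
    (ht : R ≤ |t|) : L.transpose.weylBoundary σ t = (L.weylBoundary σ t).transpose := by
  have hb : (𝓝[halfPlane σ] (t : ℂ)).NeBot := by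
    rcases Int.units_eq_one_or σ with rfl | rfl
    · rw [halfPlane_one]
      exact mem_closure_iff_nhdsWithin_neBot.1 (mem_closure_im_pos (by simp))
    · rw [halfPlane_neg_one]
      exact mem_closure_iff_nhdsWithin_neBot.1 (mem_closure_im_neg (by simp))
  exact (hL.tendsto_weylMatrix_transpose (tendsto_weylBoundary h σ ht)).limUnder_eq

/-- The kernel `D*` is the transposed kernel `D` of the transposed pencil. -/
lemma transpose_D (hx : 0 ≤ x) (ρ θ : ℂ) :
    L.transpose.D x ρ θ = (L.DStar x ρ θ).transpose := by
  have key : ∀ s, 0 ≤ s → ∀ ρ, L.transpose.phi s ρ = (L.phiStar s ρ).transpose := fun s hs ρ => by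
    rw [(hL.phiStar_eq hs ρ).1, Matrix.transpose_transpose]
  have key' : L.transpose.phiDeriv x ρ = (L.phiStarDeriv x ρ).transpose := by
    rw [(hL.phiStar_eq hx ρ).2, Matrix.transpose_transpose]
  rw [DStar]
  by_cases h : ρ = θ
  · subst h
    rw [D, if_pos rfl, D, if_pos rfl, Matrix.transpose_add, Matrix.transpose_smul]
    congr 1
    ext j k
    rw [Matrix.of_apply, Matrix.transpose_apply, Matrix.of_apply]
    refine intervalIntegral.integral_congr fun s hs => ?_
    rw [uIcc_of_le hx] at hs
    change _ = (L.phiStar s ρ * ((ρ + ρ) • (1 : Matrix (Fin m) (Fin m) ℂ) +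
      (2 * Complex.I) • L.Q₁ s) * L.phi s ρ).transpose j k
    have e1 : L.transpose.Q₁ s = (L.Q₁ s).transpose := rfl
    simp only [(hL.transpose_phiStar hs.1 ρ).1, key s hs.1, Matrix.transpose_mul, e1,
      Matrix.transpose_add, Matrix.transpose_smul, Matrix.transpose_one, mul_assoc]
  · rw [D, if_neg h, D, if_neg (Ne.symm h), Matrix.transpose_smul]
    have e1 : L.transpose.bracket x ρ θ = -(L.bracket x θ ρ).transpose := by
      have a1 := (hL.transpose_phiStar hx θ).1
      have a2 := (hL.transpose_phiStar hx θ).2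
      have a3 := key x hx ρ
      unfold phiStar phiStarDeriv phi phiDeriv at *
      rw [bracket, bracket, a1, a2, a3, key', Matrix.transpose_sub, Matrix.transpose_mul,
        Matrix.transpose_mul, neg_sub]
    rw [e1, smul_neg, ← neg_smul, ← inv_neg, neg_sub]

end Admissible

lemma Encloses.transpose (hL : L.Admissible) (hLt : Lt.Admissible) (h : Encloses L Lt R) :
    Encloses L.transpose Lt.transpose R :=
  ⟨h.1, hL.singularSet_transpose_subset.trans h.2.1, hLt.singularSet_transpose_subset.trans h.2.2⟩

lemma weylBoundary_sub_transpose (hL : L.Admissible) (hLt : Lt.Admissible) (h : Encloses L Lt R)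
    (σ : ℤˣ) {t : ℝ} (ht : R ≤ |t|) :
    L.transpose.weylBoundary σ t - Lt.transpose.weylBoundary σ t =
      (L.weylBoundary σ t - Lt.weylBoundary σ t).transpose := by
  rw [hL.weylBoundary_transpose h.2.1 σ ht, hLt.weylBoundary_transpose h.2.2 σ ht,
    Matrix.transpose_sub]

lemma IntegrableJump.transpose (hL : L.Admissible) (hLt : Lt.Admissible) (h : Encloses L Lt R)
    (hj : IntegrableJump L Lt R) : IntegrableJump L.transpose Lt.transpose R := fun σ => by
  have hc := (continuousOn_weylBoundary_sub hL.transpose hLt.transpose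
    (h.transpose hL hLt) σ).mono (s := {t : ℝ | R ≤ |t|}) (t := {t : ℝ | R < |t|})
      fun t (ht : R < |t|) => ht.le
  refine ((hj σ).const_mul m).mono' (ContinuousOn.aestronglyMeasurable
    (ContinuousOn.mul (by fun_prop) hc.norm) (measurableSet_abs_gt R)) ?_
  filter_upwards [ae_restrict_mem (measurableSet_abs_gt R)] with t ht
  rw [Real.norm_of_nonneg (by positivity), weylBoundary_sub_transpose hL hLt h σ (le_of_lt ht),
    mul_left_comm]
  gcongr
  exact norm_transpose_le _

lemma contourIntegral_transpose (hL : L.Admissible) (hLt : Lt.Admissible) (h : Encloses L Lt R)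
    (hx : 0 ≤ x) (z : ℂ → Matrix (Fin m) (Fin m) ℂ) (ρ : ℂ) :
    contourIntegral L.transpose Lt.transpose R (fun θ => (z θ).transpose)
      (fun θ => Lt.transpose.D x ρ θ) =
      (contourIntegral L Lt R (fun θ => Lt.DStar x ρ θ) z).transpose := by
  ext j k
  rw [contourIntegral, Matrix.of_apply, Matrix.transpose_apply, contourIntegral, Matrix.of_apply]
  congr 1
  · congr 1
    funext θ
    rw [hLt.transpose_D hx, hL.weylMatrix_transpose, hLt.weylMatrix_transpose,
      ← Matrix.transpose_sub, ← Matrix.transpose_mul, ← Matrix.transpose_mul,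
      Matrix.transpose_apply, mul_assoc]
  · refine setIntegral_congr_fun (measurableSet_abs_gt R) fun t (ht : R < |t|) => ?_
    rw [weylBoundary_sub_transpose hL hLt h _ ht.le, weylBoundary_sub_transpose hL hLt h _ ht.le,
      hLt.transpose_D hx, ← Matrix.transpose_sub, ← Matrix.transpose_mul, ← Matrix.transpose_mul,
      Matrix.transpose_apply, mul_assoc]

lemma boundedContinuousOn_transpose {z : ℂ → Matrix (Fin m) (Fin m) ℂ}
    (hz : BoundedContinuousOn R z) : BoundedContinuousOn R fun ρ => (z ρ).transpose := by
  obtain ⟨h1, C, hC⟩ := hz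
  refine ⟨(transposeCLM m).continuous.comp_continuousOn h1, m * C, fun ρ hρ => ?_⟩
  exact (norm_transpose_le _).trans (by gcongr; exact hC ρ hρ)

/-- The adjoint main equation is the transposed main equation of the transposed pencils. -/
lemma solvesMainStar_iff (hL : L.Admissible) (hLt : Lt.Admissible) (h : Encloses L Lt R)
    (hx : 0 ≤ x) {z : ℂ → Matrix (Fin m) (Fin m) ℂ} : SolvesMainStar L Lt R x z ↔
      SolvesMain L.transpose Lt.transpose R x fun ρ => (z ρ).transpose := by
  refine and_congr ⟨boundedContinuousOn_transpose, fun hz => ?_⟩ (forall₂_congr fun ρ _ => ?_)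
  · exact boundedContinuousOn_transpose hz
  · rw [contourIntegral_transpose hL hLt h hx, ← Matrix.transpose_smul, ← Matrix.transpose_add,
      (hLt.phiStar_eq hx ρ).1]
    constructor
    · intro e
      rw [← e, Matrix.transpose_transpose]
    · intro e
      rw [e, Matrix.transpose_transpose]

lemma coeffDistance_transpose_le (hL : L.Admissible) (hLt : Lt.Admissible) (hx : 0 ≤ x) :
    coeffDistance L.transpose Lt.transpose x ≤ (m * ∫ t in (0 : ℝ)..x, ‖Lt.Q₁ t - L.Q₁ t‖) *
      Real.exp (m * ∫ t in (0 : ℝ)..x, (‖L.Q₁ t‖ + ‖Lt.Q₁ t‖)) := by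
  have i1 := hL.coeffs.intervalIntegrable_one x hx
  have i2 := hLt.coeffs.intervalIntegrable_one x hx
  have j1 := hL.transpose.coeffs.intervalIntegrable_one x hx
  have j2 := hLt.transpose.coeffs.intervalIntegrable_one x hx
  have hnn : 0 ≤ ∫ t in (0 : ℝ)..x, ‖Lt.Q₁ t - L.Q₁ t‖ :=
    intervalIntegral.integral_nonneg hx fun t _ => norm_nonneg _
  rw [coeffDistance, ← intervalIntegral.integral_const_mul, ← intervalIntegral.integral_const_mul]
  gcongr
  · exact intervalIntegral.integral_nonneg hx fun t _ => by positivity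
  · refine intervalIntegral.integral_mono_on hx (intervalIntegrable_norm_sub j2 j1)
      ((intervalIntegrable_norm_sub i2 i1).const_mul _) fun t _ => ?_
    exact norm_transpose_le (Lt.Q₁ t - L.Q₁ t)
  · refine intervalIntegral.integral_mono_on hx (intervalIntegrable_norm_add j1 j2)
      ((intervalIntegrable_norm_add i1 i2).const_mul _) fun t _ => ?_
    rw [mul_add]
    exact add_le_add (norm_transpose_le _) (norm_transpose_le _)

/-- Both main equations are uniquely solvable if the coefficients `Q₁` of the pencil and of its
model are close on `[0, x]`. -/
theorem uniquelySolvable_of_close (hL : L.Admissible) (hLt : Lt.Admissible) (h : Encloses L Lt R)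
    (hj : IntegrableJump L Lt R) (hx : 0 ≤ x)
    (hd : ((m + 1) * ∫ t in (0 : ℝ)..x, ‖Lt.Q₁ t - L.Q₁ t‖) *
      Real.exp ((m + 1) * ∫ t in (0 : ℝ)..x, (‖L.Q₁ t‖ + ‖Lt.Q₁ t‖)) < 1) :
    UniquelySolvable L Lt R x := by
  have hI : 0 ≤ ∫ t in (0 : ℝ)..x, ‖Lt.Q₁ t - L.Q₁ t‖ :=
    intervalIntegral.integral_nonneg hx fun t _ => norm_nonneg _
  have hJ : 0 ≤ ∫ t in (0 : ℝ)..x, (‖L.Q₁ t‖ + ‖Lt.Q₁ t‖) :=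
    intervalIntegral.integral_nonneg hx fun t _ => by positivity
  have hm : (0 : ℝ) ≤ m := Nat.cast_nonneg m
  refine ⟨solvesMain_existsUnique hL hLt h hj hx (lt_of_le_of_lt ?_ hd), ?_⟩
  · rw [coeffDistance]
    gcongr <;> nlinarith
  · obtain ⟨⟨z, hz⟩, hu⟩ := solvesMain_existsUnique hL.transpose hLt.transpose
      (h.transpose hL hLt) (hj.transpose hL hLt h) hx
      ((coeffDistance_transpose_le hL hLt hx).trans_lt (lt_of_le_of_lt (by gcongr <;> linarith) hd))
    refine ⟨⟨fun ρ => (z ρ).transpose, ?_⟩, fun z w hz hw ρ hρ => ?_⟩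
    · rw [solvesMainStar_iff hL hLt h hx]
      exact hz
    · exact Matrix.transpose_injective (hu _ _ ((solvesMainStar_iff hL hLt h hx).1 hz)
        ((solvesMainStar_iff hL hLt h hx).1 hw) hρ)

end QuadraticPencil

/-! ### Termination of the algorithm -/

section

variable {E : Type*} [NormedAddCommGroup E] [NormedSpace ℝ E] [CompleteSpace E]

/-- An integrable function with an integrable derivative tends to zero at infinity. -/
lemma IsPrimitive.tendsto_zero {f g : ℝ → E} (h : IsPrimitive f g) (hf : IntegrableOn f (Ioi 0))
    (hg : IntegrableOn g (Ioi 0)) : Tendsto f atTop (𝓝 0) := by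
  have h1 : Tendsto f atTop (𝓝 (f 0 + ∫ t in Ioi 0, g t)) := by
    refine ((intervalIntegral_tendsto_integral_Ioi 0 hg tendsto_id).const_add (f 0)).congr' ?_
    filter_upwards [eventually_ge_atTop 0] with x hx using (h.eq_add x hx).symm
  have h2 : f 0 + ∫ t in Ioi 0, g t = 0 := by
    refine IntegrableAtFilter.eq_zero_of_tendsto (μ := volume) ⟨Ioi 0, Ioi_mem_atTop 0, hf⟩
      (fun s hs => ?_) h1
    obtain ⟨b, hb⟩ := mem_atTop_sets.1 hs
    exact measure_mono_top (fun x (hx : b < x) => hb x hx.le) Real.volume_Ioi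
  rwa [h2] at h1

variable {p q : ℝ → E} {d x : ℝ}

/-- The distance of two functions that agree up to the point `d` is determined by their values
beyond this point. -/
lemma integral_norm_sub_le_of_eqOn (hp : IntegrableOn p (Ioi 0)) (hq : IntegrableOn q (Ioi 0))
    (hd : 0 ≤ d) (hdx : d ≤ x) (he : ∀ t ∈ Icc 0 d, p t = q t) :
    (∫ t in (0 : ℝ)..x, ‖p t - q t‖) ≤ ∫ t in d..x, (‖q t‖ + ‖p t‖) := by
  have hx := hd.trans hdx
  have hi : ∀ y, 0 ≤ y → IntervalIntegrable (fun t => ‖p t - q t‖) volume 0 y := fun y hy =>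
    ((hp.intervalIntegrable_zero y hy).sub (hq.intervalIntegrable_zero y hy)).norm
  have hs : ∀ y, 0 ≤ y → IntervalIntegrable (fun t => ‖q t‖ + ‖p t‖) volume 0 y := fun y hy =>
    (hq.intervalIntegrable_zero y hy).norm.add (hp.intervalIntegrable_zero y hy).norm
  have hi' := (hi d hd).symm.trans (hi x hx)
  have h0 : ∫ t in (0 : ℝ)..d, ‖p t - q t‖ = 0 := by
    refine (intervalIntegral.integral_congr (g := fun _ => (0 : ℝ)) fun t ht => ?_).trans
      intervalIntegral.integral_zero
    rw [uIcc_of_le hd] at ht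
    simp [he t ht]
  rw [← intervalIntegral.integral_add_adjacent_intervals (hi d hd) hi', h0, zero_add]
  refine intervalIntegral.integral_mono_on hdx hi' ((hs d hd).symm.trans (hs x hx)) fun t _ => ?_
  rw [add_comm]
  exact norm_sub_le _ _

lemma integral_norm_add_le_of_eqOn (hp : IntegrableOn p (Ioi 0)) (hq : IntegrableOn q (Ioi 0))
    (hd : 0 ≤ d) (hdx : d ≤ x) (he : ∀ t ∈ Icc 0 d, p t = q t) :
    (∫ t in (0 : ℝ)..x, (‖q t‖ + ‖p t‖)) ≤
      2 * (∫ t in Ioi 0, ‖q t‖) + ∫ t in d..x, (‖q t‖ + ‖p t‖) := by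
  have hx := hd.trans hdx
  have hs : ∀ y, 0 ≤ y → IntervalIntegrable (fun t => ‖q t‖ + ‖p t‖) volume 0 y := fun y hy =>
    (hq.intervalIntegrable_zero y hy).norm.add (hp.intervalIntegrable_zero y hy).norm
  have h0 : ∫ t in (0 : ℝ)..d, (‖q t‖ + ‖p t‖) ≤ 2 * ∫ t in Ioi 0, ‖q t‖ := by
    have h1 : ∫ t in (0 : ℝ)..d, (‖q t‖ + ‖p t‖) = 2 * ∫ t in (0 : ℝ)..d, ‖q t‖ := by
      rw [← intervalIntegral.integral_const_mul]
      refine intervalIntegral.integral_congr fun t ht => ?_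
      rw [uIcc_of_le hd] at ht
      simp only [he t ht, two_mul]
    rw [h1, intervalIntegral.integral_of_le hd]
    gcongr
    · exact Eventually.of_forall fun _ => norm_nonneg _
    · exact hq.norm
    · exact Ioc_subset_Ioi_self
  rw [← intervalIntegral.integral_add_adjacent_intervals (hs d hd) ((hs d hd).symm.trans (hs x hx))]
  gcongr

end

namespace QuadraticPencil

variable {m : ℕ} {L : QuadraticPencil m}

/-- There is a number `η`, depending only on the pencil, such that both main equations are uniquely
solvable at `x` for each model that has been chosen at a point `d` with
`∫_d^x (‖Q₁‖ + ‖Q̃₁‖) ≤ η`. -/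
lemma exists_solvability_threshold (hL : L.Admissible) : ∃ η : ℝ, 0 < η ∧
    ∀ (d : ℝ) (Lt : QuadraticPencil m) (R x : ℝ), 0 ≤ d → L.IsModel d Lt → Encloses L Lt R →
      d ≤ x → (∫ t in d..x, (‖L.Q₁ t‖ + ‖Lt.Q₁ t‖)) ≤ η → UniquelySolvable L Lt R x := by
  set N := ∫ t in Ioi 0, ‖L.Q₁ t‖ with hN
  set K := ((m : ℝ) + 1) * Real.exp ((m + 1) * (2 * N + 1)) with hK
  have hN0 : 0 ≤ N := integral_nonneg fun _ => norm_nonneg _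
  have hm : (0 : ℝ) ≤ m := Nat.cast_nonneg m
  have hK1 : 1 ≤ K := by
    have h1 : 1 ≤ Real.exp ((m + 1) * (2 * N + 1)) := Real.one_le_exp (by positivity)
    nlinarith
  have hK0 : 0 < K := by linarith
  refine ⟨(2 * K)⁻¹, by positivity, fun d Lt R x hd hM hR hdx hη => ?_⟩
  have hη1 : (2 * K)⁻¹ ≤ 1 := inv_le_one_of_one_le₀ (by linarith)
  have hI := integral_norm_sub_le_of_eqOn hM.admissible.coeffs.int₁ hL.coeffs.int₁ hd hdx
    hM.classQ.eq_on
  have hJ := integral_norm_add_le_of_eqOn hM.admissible.coeffs.int₁ hL.coeffs.int₁ hd hdx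
    hM.classQ.eq_on
  refine uniquelySolvable_of_close hL hM.admissible hR (integrableJump hL hM.admissible hR hM.close)
    (hd.trans hdx) ?_
  have hI' := hI.trans hη
  have hJ' : (∫ t in (0 : ℝ)..x, (‖L.Q₁ t‖ + ‖Lt.Q₁ t‖)) ≤ 2 * N + 1 := by linarith
  calc _ ≤ (((m : ℝ) + 1) * (2 * K)⁻¹) * Real.exp ((m + 1) * (2 * N + 1)) := by gcongr
    _ = K * (2 * K)⁻¹ := by rw [hK]; ring
    _ = 1 / 2 := by field_simp
    _ < 1 := by norm_num

/-- Each step of the algorithm has at least a certain length `ε`, and from a certain point `T` on a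
single step suffices. -/
lemma exists_uniform_step (hL : L.Admissible) : ∃ ε : ℝ, 0 < ε ∧ ∃ T : ℝ,
    ∀ (d : ℝ) (Lt : QuadraticPencil m) (R x : ℝ), 0 ≤ d → L.IsModel d Lt → Encloses L Lt R →
      d ≤ x → (x ≤ d + ε ∨ T ≤ d) → UniquelySolvable L Lt R x := by
  obtain ⟨η, hη, hsol⟩ := exists_solvability_threshold hL
  set B := ‖L.Q₁ 0‖ + ∫ t in Ioi 0, ‖L.dQ₁ t‖ with hB
  have hB0 : 0 ≤ B := add_nonneg (norm_nonneg _) (integral_nonneg fun _ => norm_nonneg _)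
  have hQB : ∀ x, 0 ≤ x → ‖L.Q₁ x‖ ≤ B := fun x hx =>
    hL.coeffs.prim.norm_le_of_integrableOn hL.coeffs.intd hx
  have hQ0 := (hL.coeffs.prim.tendsto_zero hL.coeffs.int₁ hL.coeffs.intd).norm
  have hI0 := tendsto_integral_Ioi_zero hL.coeffs.int₁.norm
  rw [norm_zero] at hQ0
  obtain ⟨T, hT⟩ := eventually_atTop.1 ((hQ0.eventually (ge_mem_nhds (half_pos hη))).and
    (hI0.eventually (ge_mem_nhds (half_pos hη))))
  refine ⟨η / (2 * B + 1), by positivity, T, fun d Lt R x hd hM hR hdx h => ?_⟩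
  refine hsol d Lt R x hd hM hR hdx ?_
  have hx := hd.trans hdx
  have hLi : IntegrableOn (fun t => ‖L.Q₁ t‖) (Ioi 0) := hL.coeffs.int₁.norm
  have hMi : IntegrableOn (fun t => ‖Lt.Q₁ t‖) (Ioi 0) := hM.admissible.coeffs.int₁.norm
  have hi : IntervalIntegrable (fun t => ‖L.Q₁ t‖) volume d x :=
    (hLi.intervalIntegrable_zero d hd).symm.trans (hLi.intervalIntegrable_zero x hx)
  have hi' : IntervalIntegrable (fun t => ‖Lt.Q₁ t‖) volume d x :=
    (hMi.intervalIntegrable_zero d hd).symm.trans (hMi.intervalIntegrable_zero x hx)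
  rcases h with h | h
  · have h1 : (∫ t in d..x, (‖L.Q₁ t‖ + ‖Lt.Q₁ t‖)) ≤ ∫ _ in d..x, 2 * B := by
      refine intervalIntegral.integral_mono_on_of_le_Ioo hdx (hi.add hi')
        intervalIntegrable_const fun t ht => ?_
      rw [two_mul]
      exact add_le_add (hQB t (hd.trans ht.1.le)) ((hM.classQ.norm_le t ht.1).trans (hQB d hd))
    refine h1.trans ?_
    rw [intervalIntegral.integral_const, smul_eq_mul]
    calc (x - d) * (2 * B) ≤ η / (2 * B + 1) * (2 * B + 1) := by
          gcongr <;> linarith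
      _ = η := div_mul_cancel₀ _ (by positivity)
  · obtain ⟨h1, h2⟩ := hT d h
    have hmono : ∀ {f : ℝ → ℝ}, IntegrableOn f (Ioi 0) → (∀ t, 0 ≤ f t) →
        ∫ t in d..x, f t ≤ ∫ t in Ioi d, f t := fun hf h0 => by
      rw [intervalIntegral.integral_of_le hdx]
      exact setIntegral_mono_set (hf.mono_set (Ioi_subset_Ioi hd)) (Eventually.of_forall h0)
        (LE.le.eventuallyLE Ioc_subset_Ioi_self)
    rw [intervalIntegral.integral_add hi hi']
    have h3 := hmono hLi fun _ => norm_nonneg _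
    have h4 := (hmono hMi fun _ => norm_nonneg _).trans (hM.classQ.integral_le.trans h1)
    linarith

/-- The admissible end points of a step have a largest element if there is one at all. -/
lemma existsUnique_isNextPoint {d e₀ : ℝ} {Lt : QuadraticPencil m} {R : ℝ} (h : d < e₀)
    (hs : ∀ x : ℝ, d < x → x < e₀ → UniquelySolvable L Lt R x) :
    ∃! e : EReal, L.IsNextPoint d Lt R e := by
  set S := {e : EReal | (d : EReal) < e ∧
    ∀ x : ℝ, (d : EReal) < (x : EReal) → (x : EReal) < e → UniquelySolvable L Lt R x} with hS
  have h0 : (e₀ : EReal) ∈ S := ⟨EReal.coe_lt_coe_iff.2 h, fun x h1 h2 =>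
    hs x (EReal.coe_lt_coe_iff.1 h1) (EReal.coe_lt_coe_iff.1 h2)⟩
  refine ⟨sSup S, ⟨⟨h0.1.trans_le (le_sSup h0), fun x h1 h2 => ?_⟩, fun e he => le_sSup he⟩,
    fun e he => he.isLUB.sSup_eq.symm⟩
  obtain ⟨e, he, hxe⟩ := lt_sSup_iff.1 h2
  exact he.2 x h1 hxe

end QuadraticPencil

end

theorem mainTheorem5 {m : ℕ} (L : QuadraticPencil m) (hL : L.Admissible) :
    (∀ (d : ℝ) (Lt : QuadraticPencil m) (R : ℝ), 0 ≤ d → L.IsModel d Lt →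
        QuadraticPencil.Encloses L Lt R → ∃! e : EReal, L.IsStep d Lt R e) ∧
    ∃ (s : ℕ) (x : ℕ → EReal), x 0 = 0 ∧ x s = ⊤ ∧ (∀ k < s, x k < x (k + 1)) ∧
      ∀ (n : ℕ) (δ : ℕ → EReal) (Lt : ℕ → QuadraticPencil m) (R : ℕ → ℝ),
        L.IsRun n δ Lt R → n ≤ s ∧ ∀ k ≤ n, x k ≤ δ k := by
  obtain ⟨ε, hε, T, hstep⟩ := QuadraticPencil.exists_uniform_step hL
  refine ⟨fun d Lt R hd hM hR => ?_, ?_⟩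
  · obtain ⟨e, he, hu⟩ := QuadraticPencil.existsUnique_isNextPoint (L := L) (Lt := Lt) (R := R)
      (lt_add_of_pos_right d hε) fun x h1 h2 => hstep d Lt R x hd hM hR h1.le (Or.inl h2.le)
    exact ⟨e, ⟨hM, hR, he⟩, fun e' he' => hu e' he'.next⟩
  -- the points `0, ε, …, N ε, ∞` with `N ε ≥ T` form the partition
  obtain ⟨N, hN⟩ := exists_nat_ge (T / ε)
  have hNT : T ≤ N * ε := (div_le_iff₀ hε).1 hN
  set x : ℕ → EReal := fun k => if k ≤ N then ((k * ε : ℝ) : EReal) else ⊤ with hx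
  have hxN : x (N + 1) = ⊤ := if_neg (by omega)
  refine ⟨N + 1, x, by simp [hx], hxN, fun k hk => ?_, fun n δ Lt R hrun => ?_⟩
  · have h1 : x k = ((k * ε : ℝ) : EReal) := if_pos (by omega)
    rw [h1]
    rcases (Nat.lt_succ_iff.1 hk).lt_or_eq with h2 | rfl
    · have h3 : x (k + 1) = (((k + 1 : ℕ) * ε : ℝ) : EReal) := if_pos h2
      rw [h3, EReal.coe_lt_coe_iff]
      push_cast
      linarith
    · rw [hxN]
      exact EReal.coe_lt_top _
  · have key : ∀ k ≤ n, x k ≤ δ k := by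
      intro k
      induction k with
      | zero => intro _; rw [hrun.1]; simp [hx]
      | succ k ih =>
        intro hk
        obtain ⟨d, hd, hs⟩ := hrun.2 k (by omega)
        have h1 := ih (by omega)
        rw [hd] at h1
        have hkN : k ≤ N := by
          by_contra hn
          have h2 : x k = ⊤ := if_neg hn
          rw [h2] at h1
          exact (EReal.coe_lt_top d).not_ge h1
        have h2 : x k = ((k * ε : ℝ) : EReal) := if_pos hkN
        rw [h2, EReal.coe_le_coe_iff] at h1
        have hd0 : 0 ≤ d := le_trans (by positivity) h1
        have hsol := fun y hy => hstep d (Lt k) (R k) y hd0 hs.model hs.encloses hy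
        rcases hkN.lt_or_eq with h3 | rfl
        · have h4 : x (k + 1) = (((k + 1 : ℕ) * ε : ℝ) : EReal) := if_pos h3
          rw [h4]
          have h5 : (((k + 1 : ℕ) * ε : ℝ) : EReal) ≤ ((d + ε : ℝ) : EReal) :=
            EReal.coe_le_coe_iff.2 (by push_cast; linarith)
          refine h5.trans (hs.next.2 ⟨EReal.coe_lt_coe_iff.2 (by linarith), fun y h5 h6 => ?_⟩)
          exact hsol y (EReal.coe_lt_coe_iff.1 h5).le (Or.inl (EReal.coe_lt_coe_iff.1 h6).le)
        · refine le_top.trans (hs.next.2 ⟨EReal.coe_lt_top d, fun y h5 _ => ?_⟩)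
          exact hsol y (EReal.coe_lt_coe_iff.1 h5).le (Or.inr (hNT.trans h1))
    refine ⟨?_, key⟩
    by_contra hn
    obtain ⟨d, hd, -⟩ := hrun.2 (N + 1) (by omega)
    have h1 := key (N + 1) (by omega)
    rw [hxN, hd] at h1
    exact (EReal.coe_lt_top d).not_ge h1
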